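/- **Setting.** Let $k=\bigoplus_{l\in\mathbb Z}k_l$ be a graded commutative ring ($ab=(-1)^{|a||b|}ba$) and let $\eta\in k_1$ satisfy $2\eta=0$. Let $\Gamma=k[s]/(s^2=\eta s)$ with $|s|=1$, free over $k$ on $1,s$ with $as=(-1)^{|a|}sa$ for $a\in k$, be the graded Hopf algebra over $k$ in which $s$ is primitive: $s\mapsto s\otimes1+1\otimes s$, counit $s\mapsto0$, antipode $s\mapsto-s$. "$\Gamma$-module" means graded right $\Gamma$-module; right $k$-modules are bimodules by $ax=(-1)^{|a||x|}xa$; $\otimes$ and $\operatorname{Hom}$ are over $k$. In a chain complex an element of homological degree $n$ and internal degree $l=|x|$ has total degree $\|x\|=n+l$, and signs use the total degree. $X\otimes Y$ has boundary $\partial x\otimes y+(-1)^{\|x\|}x\otimes\partial y$ and diagonal action $(x\otimes y)s=x\otimes ys+(-1)^{\|y\|}xs\otimes y$. $\operatorname{Hom}(X,Y)$ consists of the right $k$-linear maps (finite sums of homogeneous ones), with $(fa)(x)=f(ax)$ for $a\in k$, boundary $f\mapsto\partial f-(-1)^{\|f\|}f\partial$ and conjugate action $(fs)(x)=(-1)^{\|x\|}\bigl(f(x)s-f(xs)\bigr)$.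 Chain maps are $\Gamma$-linear and preserve both degrees. Let $\epsilon\colon P\to k$ be a projective $\Gamma$-resolution of the trivial module $k$ and let $\widetilde P$ be the mapping cone of $\epsilon$ (so $\widetilde P_0=k$ and $\widetilde P_n=P_{n-1}$ for $n\ge1$). For a $\Gamma$-module $M$ put $\operatorname{hm}(M)=\widetilde P\otimes\operatorname{Hom}(P,M)$ and $$\widehat{\operatorname{Ext}}{}^{c}_\Gamma(k,M)=H_{-c}\bigl(\operatorname{Hom}_\Gamma(k,\operatorname{hm}(M))\bigr),\qquad c\in\mathbb Z,$$ where $\operatorname{Hom}_\Gamma(k,X)$ is identified by $f\mapsto f(1)$ with the invariants of $X$. Given chain maps $\Psi\colon P\to P\otimes P$ covering $\mathrm{id}\colon k\to k\otimes k$ and $\Phi\colon\widetilde P\otimes\widetilde P\to\widetilde P$ extending the fold map ($\Phi(1\otimes x)=x=\Phi(x\otimes1)$ for $1\in k=\widetilde P_0$), the cup product $\widehat{\operatorname{Ext}}{}^{c_1}_\Gamma(k,M)\otimes\widehat{\operatorname{Ext}}{}^{c_2}_\Gamma(k,N)\to\widehat{\operatorname{Ext}}{}^{c_1+c_2}_\Gamma(k,M\otimes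 N)$ is induced by $(\Phi\otimes\Psi^*)\circ(1\otimes1\otimes\alpha)\circ(1\otimes\tau\otimes1)\colon\operatorname{hm}(M)\otimes\operatorname{hm}(N)\to\operatorname{hm}(M\otimes N)$, where $\tau(y\otimes z)=(-1)^{\|y\|\|z\|}z\otimes y$ and $\alpha(f\otimes g)(x\otimes x')=(-1)^{\|g\|\|x\|}f(x)\otimes g(x')$. **Theorem.** Projective resolutions $P$ as above exist. For every such $P$, maps $\Psi$ and $\Phi$ exist, and there are isomorphisms of right $k$-modules, for all $\Gamma$-modules $M$ and all $c\in\mathbb Z$ and natural in $M$, $$\widehat{\operatorname{Ext}}{}^{c}_\Gamma(k,M)\cong\begin{cases}t^{c}\cdot\ker(s)/\operatorname{im}(s+\eta)&c\text{ even},\\ t^{c}\cdot\ker(s+\eta)/\operatorname{im}(s)&c\text{ odd,}\end{cases}$$ where $s$ and $s+\eta$ act on $M$ by right multiplication and $t^c\cdot m$ denotes the class that corresponds to the class of $m$; if $m$ is homogeneous, then $t^c\cdot m$ has homological degree $-c$ and internal degree $|m|-c$. For every choice of $\Psi$ and $\Phi$, the cup product is $$(t^{c_1}\cdot m)\smile(t^{c_2}\cdot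 n)=t^{c_1+c_2}\cdot(m\otimes n).$$ Equivalently, the answer is the homology of $M[t,t^{-1}]=\bigoplus_{c}t^cM$, where $t$ has homological and internal degree $-1$, with the differential determined by $d(m)=tms$ and $d(t)=t^2\eta$, that is, $d(t^cm)=t^{c+1}(ms+c\,m\eta)$: there are right $k$-linear isomorphisms from its homology in homological degree $-c$ to $\widehat{\operatorname{Ext}}{}^{c}_\Gamma(k,M)$ that send the homology class of a cycle $t^cm$ to $t^c\cdot m$. For every pairing $\mu\colon M\otimes N\to L$ of $\Gamma$-modules (a $\Gamma$-linear map of degree $0$) and every choice of $\Psi$ and $\Phi$, the cup product followed by the map $\widehat{\operatorname{Ext}}{}^{c_1+c_2}_\Gamma(k,M\otimes N)\to\widehat{\operatorname{Ext}}{}^{c_1+c_2}_\Gamma(k,L)$ induced by $\mu$ corresponds to the pairing on homology induced by $t^{a}m\otimes t^{b}n\mapsto t^{a+b}\mu(m\otimes n)$. -/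

import Mathlib

open MulOpposite DirectSum

universe u

namespace HopfTate

noncomputable section

/-! ## Signs and homogeneous elements -/

/-- The sign `(-1)^n`. -/
def sg (n : ℤ) : ℤ := (n.negOnePow : ℤˣ)

lemma sg_add (m n : ℤ) : sg (m + n) = sg m * sg n := by simp [sg, Int.negOnePow_add]

lemma sg_neg (n : ℤ) : sg (-n) = sg n := by simp [sg]

lemma sg_sub (m n : ℤ) : sg (m - n) = sg m * sg n := by simp [sg, Int.negOnePow_sub]

@[simp] lemma sg_zero : sg 0 = 1 := by simp [sg]

@[simp] lemma sg_one : sg 1 = -1 := by simp [sg]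

@[simp] lemma sg_sq (n : ℤ) : sg n * sg n = 1 := by
  rw [← sg_add, sg, Int.negOnePow_even _ ⟨n, rfl⟩]; simp

@[simp] lemma sg_mul_self (n : ℤ) : sg (n * n) = sg n := by simp [sg]

lemma sg_smul_smul {X : Type*} [AddCommGroup X] (n : ℤ) (x : X) : sg n • sg n • x = x := by
  rw [smul_smul, sg_sq, one_smul]

section graded

variable {ι X Z : Type*} [DecidableEq ι] [AddCommGroup X] [AddCommGroup Z]
  (gr : ι → AddSubgroup X) [Decomposition gr]

/-- The additive map given by `φ i` on the homogeneous elements of degree `i`. -/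
def glift (φ : ∀ i, gr i →+ Z) : X →+ Z :=
  (DirectSum.toAddMonoid φ).comp (decomposeAddEquiv gr).toAddMonoidHom

lemma glift_of_mem (φ : ∀ i, gr i →+ Z) {i : ι} {x : X} (hx : x ∈ gr i) :
    glift gr φ x = φ i ⟨x, hx⟩ := by
  simp [glift, decompose_of_mem gr hx]

lemma gr_induction {p : X → Prop} (h0 : p 0) (hom : ∀ i, ∀ x ∈ gr i, p x)
    (hadd : ∀ x y, p x → p y → p (x + y)) (x : X) : p x :=
  Decomposition.inductionOn gr h0 (fun {i} m => hom i m m.2) hadd x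

lemma gr_ext {f g : X →+ Z} (h : ∀ i, ∀ x ∈ gr i, f x = g x) : f = g := by
  ext x
  induction x using gr_induction gr with
  | h0 => simp
  | hom i x hx => exact h i x hx
  | hadd x y hx hy => simp [hx, hy]

/-- The projection to the homogeneous part of degree `i`. -/
def gproj (i : ι) : X →+ X := glift gr (fun j => if j = i then (gr j).subtype else 0)

lemma gproj_same {i : ι} {x : X} (hx : x ∈ gr i) : gproj gr i x = x := by
  simp [gproj, glift_of_mem gr _ hx]

lemma gproj_ne {i j : ι} {x : X} (hx : x ∈ gr j) (h : j ≠ i) : gproj gr i x = 0 := by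
  simp [gproj, glift_of_mem gr _ hx, h]

end graded

lemma isInternal_of_detect {ι X : Type*} [DecidableEq ι] [AddCommGroup X]
    {gr : ι → AddSubgroup X} {W : ι → Type*} [∀ i, AddCommGroup (W i)] (htop : iSup gr = ⊤)
    (q : ∀ i, X →+ W i) (hne : ∀ i j, i ≠ j → ∀ x ∈ gr j, q i x = 0)
    (heq : ∀ i, ∀ x ∈ gr i, q i x = 0 → x = 0) : IsInternal gr := by
  constructor
  · rw [injective_iff_map_eq_zero]
    intro a ha
    ext i
    have h1 : ∀ b : ⨁ i, gr i, q i (DirectSum.coeAddMonoidHom gr b) = q i (b i) := by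
      intro b
      induction b using DirectSum.induction_on with
      | zero => simp
      | of j x =>
        rw [DirectSum.coeAddMonoidHom_of]
        by_cases h : j = i
        · subst h; simp
        · rw [hne i j (Ne.symm h) x x.2, DirectSum.of_eq_of_ne _ _ _ (Ne.symm h)]; simp
      | add x y hx hy => simp [hx, hy]
    have h2 := h1 a
    rw [ha, map_zero] at h2
    simpa using heq i _ (a i).2 h2.symm
  · intro x
    have hx : x ∈ iSup gr := by rw [htop]; trivial
    induction hx using AddSubgroup.iSup_induction' with
    | hp i x hx => exact ⟨DirectSum.of (fun i => gr i) i ⟨x, hx⟩, by simp⟩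
    | h1 => exact ⟨0, by simp⟩
    | hadd x y _ _ hx hy =>
      obtain ⟨a, rfl⟩ := hx
      obtain ⟨b, rfl⟩ := hy
      exact ⟨a + b, by simp⟩

/-! ## The base ring `k` and the algebra `Γ = k[s]/(s² = ηs)` -/

/-- A graded commutative ring `k` (commutative up to the Koszul sign) with an element `η` in
degree `1` such that `2η = 0`. -/
structure EtaRing : Type (u + 1) where
  k : Type u
  [ring : Ring k]
  gr : ℤ → AddSubgroup k
  [graded : GradedRing gr]
  graded_comm : ∀ i j : ℤ, ∀ a ∈ gr i, ∀ b ∈ gr j, a * b = sg (i * j) • (b * a)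
  eta : k
  eta_mem : eta ∈ gr 1
  two_eta : eta + eta = 0

attribute [instance] EtaRing.ring EtaRing.graded

namespace EtaRing

variable (B : EtaRing.{u})

/-- The grading involution `a ↦ (-1)^|a| a` of `k`. -/
def sig : B.k →+* B.k :=
  { glift B.gr (fun i => sg i • (B.gr i).subtype) with
    map_one' := by
      change glift B.gr _ 1 = 1
      rw [glift_of_mem B.gr _ SetLike.GradedOne.one_mem]; simp
    map_mul' := by
      intro x y
      change glift B.gr _ (x * y) = glift B.gr _ x * glift B.gr _ y
      induction x using gr_induction B.gr with
      | h0 => simp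
      | hadd x x' hx hx' => simp [add_mul, hx, hx']
      | hom i x hx =>
        induction y using gr_induction B.gr with
        | h0 => simp
        | hadd y y' hy hy' => simp [mul_add, hy, hy']
        | hom j y hy =>
          rw [glift_of_mem B.gr _ (SetLike.GradedMul.mul_mem hx hy), glift_of_mem B.gr _ hx,
            glift_of_mem B.gr _ hy]
          simp [sg_add, mul_smul, smul_comm (sg i), -zsmul_eq_mul] }

variable {B}

lemma sig_of_mem {i : ℤ} {a : B.k} (ha : a ∈ B.gr i) : B.sig a = sg i • a := by
  change glift B.gr _ a = _
  rw [glift_of_mem B.gr _ ha]; simp [-zsmul_eq_mul]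

lemma sig_mem {i : ℤ} {a : B.k} (ha : a ∈ B.gr i) : B.sig a ∈ B.gr i := by
  rw [sig_of_mem ha]; exact zsmul_mem ha _

@[simp] lemma sig_sig (a : B.k) : B.sig (B.sig a) = a := by
  induction a using gr_induction B.gr with
  | h0 => simp
  | hadd x y hx hy => simp [hx, hy]
  | hom i x hx => rw [sig_of_mem hx, map_zsmul, sig_of_mem hx, sg_smul_smul]

lemma neg_eta : -B.eta = B.eta := neg_eq_of_add_eq_zero_left B.two_eta

@[simp] lemma sig_eta : B.sig B.eta = B.eta := by
  rw [sig_of_mem B.eta_mem]; simp [neg_eta]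

lemma eta_mul (a : B.k) : B.eta * a = B.sig a * B.eta := by
  induction a using gr_induction B.gr with
  | h0 => simp
  | hadd x y hx hy => simp [hx, hy, mul_add, add_mul]
  | hom i x hx =>
    rw [B.graded_comm 1 i _ B.eta_mem _ hx, sig_of_mem hx, one_mul, smul_mul_assoc]

end EtaRing

open EtaRing

/-- The algebra `Γ = k[s]/(s² = ηs)` with `|s| = 1`. It is free over `k` on `1` and `s`; the pair
`⟨a, b⟩` stands for `a + s b`, and multiplication is determined by `a s = (-1)^|a| s a` and
`s² = η s`. -/
@[ext] structure Gam (B : EtaRing.{u}) : Type u where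
  a : B.k
  b : B.k

namespace Gam

variable {B : EtaRing.{u}}

/-- `Γ` as an additive group is `k × k`. -/
def equiv : Gam B ≃ B.k × B.k := ⟨fun x => (x.a, x.b), fun p => ⟨p.1, p.2⟩, fun _ => rfl, fun _ => rfl⟩

instance : AddCommGroup (Gam B) := equiv.addCommGroup

instance : Mul (Gam B) :=
  ⟨fun x y => ⟨x.a * y.a, B.sig x.a * y.b + x.b * y.a + B.eta * B.sig x.b * y.b⟩⟩

instance : One (Gam B) := ⟨⟨1, 0⟩⟩

@[simp] lemma mul_a (x y : Gam B) : (x * y).a = x.a * y.a := rfl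
@[simp] lemma mul_b (x y : Gam B) :
    (x * y).b = B.sig x.a * y.b + x.b * y.a + B.eta * B.sig x.b * y.b := rfl
@[simp] lemma one_a : (1 : Gam B).a = 1 := rfl
@[simp] lemma one_b : (1 : Gam B).b = 0 := rfl
@[simp] lemma zero_a : (0 : Gam B).a = 0 := rfl
@[simp] lemma zero_b : (0 : Gam B).b = 0 := rfl
@[simp] lemma add_a (x y : Gam B) : (x + y).a = x.a + y.a := rfl
@[simp] lemma add_b (x y : Gam B) : (x + y).b = x.b + y.b := rfl

instance : Ring (Gam B) :=
  { (inferInstance : AddCommGroup (Gam B)), (inferInstance : Mul (Gam B)),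
    (inferInstance : One (Gam B)) with
    left_distrib := fun x y z => by
      apply Gam.ext
      · simp [mul_add]
      · simp only [mul_b, add_a, add_b, mul_add]; abel
    right_distrib := fun x y z => by
      apply Gam.ext
      · simp [add_mul]
      · simp only [mul_b, add_a, add_b, mul_add, add_mul, map_add]; abel
    zero_mul := fun x => by apply Gam.ext <;> simp
    mul_zero := fun x => by apply Gam.ext <;> simp
    one_mul := fun x => by apply Gam.ext <;> simp
    mul_one := fun x => by apply Gam.ext <;> simp
    mul_assoc := fun x y z => by
      apply Gam.ext
      · simp [mul_assoc]
      · have h1 : B.eta * B.sig (B.eta * (B.sig x.b * y.b)) * z.2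
            = B.eta * (B.sig x.b * (B.eta * (B.sig y.b * z.2))) := by
          rw [map_mul, map_mul, sig_sig, sig_eta, ← mul_assoc (B.sig x.b), ← sig_sig (B.sig x.b),
            ← eta_mul, sig_sig]
          simp only [mul_assoc]
        have h2 : ∀ w : B.k, B.sig x.a * (B.eta * w) = B.eta * (x.a * w) := fun w => by
          rw [← mul_assoc, ← eta_mul, mul_assoc]
        simp only [mul_a, mul_b, mul_add, add_mul, map_add, map_mul, sig_sig, mul_assoc] at h1 ⊢
        rw [h1, h2]; abel }

/-- The unit `k → Γ`. -/
def ι : B.k →+* Gam B where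
  toFun a := ⟨a, 0⟩
  map_one' := rfl
  map_zero' := rfl
  map_mul' a b := Gam.ext rfl (by simp)
  map_add' a b := Gam.ext rfl (by simp)

@[simp] lemma ι_a (a : B.k) : (ι a : Gam B).a = a := rfl
@[simp] lemma ι_b (a : B.k) : (ι a : Gam B).b = 0 := rfl

/-- The counit `Γ → k`, sending `s` to `0`. -/
def ε : Gam B →+* B.k where
  toFun x := x.a
  map_one' := rfl
  map_zero' := rfl
  map_mul' _ _ := rfl
  map_add' _ _ := rfl

@[simp] lemma ε_apply (x : Gam B) : ε x = x.a := rfl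

/-- The generator `s` of `Γ`. -/
def s : Gam B := ⟨0, 1⟩

@[simp] lemma s_a : (s : Gam B).a = 0 := rfl
@[simp] lemma s_b : (s : Gam B).b = 1 := rfl

lemma s_mul_s : (s : Gam B) * s = ι B.eta * s := by
  apply Gam.ext <;> simp

lemma ι_mul_s (a : B.k) : ι a * (s : Gam B) = s * ι (B.sig a) := by
  apply Gam.ext <;> simp

lemma eq_add (x : Gam B) : x = ι x.a + s * ι x.b := by
  apply Gam.ext <;> simp

variable (B) in
/-- The elements of degree `j` of `Γ`: `|a + s b| = j` means `|a| = j` and `|b| = j - 1`. -/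
def gr (j : ℤ) : AddSubgroup (Gam B) where
  carrier := {x | x.a ∈ B.gr j ∧ x.b ∈ B.gr (j - 1)}
  zero_mem' := ⟨zero_mem _, zero_mem _⟩
  add_mem' hx hy := ⟨add_mem hx.1 hy.1, add_mem hx.2 hy.2⟩
  neg_mem' hx := ⟨neg_mem hx.1, neg_mem hx.2⟩

lemma ι_mem {j : ℤ} {a : B.k} (ha : a ∈ B.gr j) : ι a ∈ gr B j := ⟨ha, zero_mem _⟩

lemma s_mem : (s : Gam B) ∈ gr B 1 :=
  ⟨zero_mem _, by simpa using (SetLike.GradedOne.one_mem : (1 : B.k) ∈ B.gr 0)⟩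

end Gam

/-! ## Chain complexes of `Γ`-modules -/

/-- A chain complex of graded right `Γ`-modules, given as the direct sum over all homological
degrees `n` and internal degrees `l` of its homogeneous parts `gr (n, l)`. The boundary `d` is
`Γ`-linear, lowers the homological degree by one and preserves the internal degree. -/
structure Cx (B : EtaRing.{u}) : Type (u + 1) where
  X : Type u
  [grp : AddCommGroup X]
  [mod : Module (Gam B)ᵐᵒᵖ X]
  gr : ℤ × ℤ → AddSubgroup X
  internal : IsInternal gr
  smul_mem : ∀ (g : ℤ × ℤ) (j : ℤ) (x : X) (γ : Gam B),
    x ∈ gr g → γ ∈ Gam.gr B j → op γ • x ∈ gr (g + (0, j))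
  d : X →ₗ[(Gam B)ᵐᵒᵖ] X
  d_mem : ∀ (g : ℤ × ℤ) (x : X), x ∈ gr g → d x ∈ gr (g + (-1, 0))
  d_d : ∀ x : X, d (d x) = 0

attribute [instance] Cx.grp Cx.mod

/-- The total degree of an element of bidegree `(n, l)` is `n + l`. -/
def tot (g : ℤ × ℤ) : ℤ := g.1 + g.2

lemma tot_add (g h : ℤ × ℤ) : tot (g + h) = tot g + tot h := by
  simp only [tot, Prod.fst_add, Prod.snd_add]; ring

@[simp] lemma tot_mk (n l : ℤ) : tot (n, l) = n + l := rfl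

lemma tot_zero_mk (l : ℤ) : tot (0, l) = l := zero_add l

@[simp] lemma tot_zero : tot 0 = 0 := rfl

namespace Cx

variable {B : EtaRing.{u}} (X Y : Cx B)

instance : Decomposition X.gr := X.internal.chooseDecomposition

/-- Right `Γ`-modules are right `k`-modules along `k → Γ`. -/
instance : Module B.kᵐᵒᵖ X.X := Module.compHom X.X (RingHom.op (Gam.ι (B := B)))

/-- The right action of `k`: `ra a x = x a`. -/
def ra : B.k →+ X.X →+ X.X where
  toFun a := DistribSMul.toAddMonoidHom X.X (op (Gam.ι a))
  map_zero' := by ext; simp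
  map_add' a b := by ext; simp [add_smul]

/-- The right action of `s`: `sm x = x s`. -/
def sm : X.X →+ X.X := DistribSMul.toAddMonoidHom X.X (op (Gam.s : Gam B))

/-- The Koszul sign operator: multiplication by `(-1)^(e * ‖x‖)` on homogeneous `x`. -/
def kos (e : ℤ) : X.X →+ X.X := glift X.gr (fun g => sg (e * tot g) • (X.gr g).subtype)

variable {X Y}

lemma ra_def (a : B.k) (x : X.X) : X.ra a x = op (Gam.ι a) • x := rfl
lemma sm_def (x : X.X) : X.sm x = op (Gam.s : Gam B) • x := rfl
lemma op_smul_eq (a : B.k) (x : X.X) : op a • x = X.ra a x := rfl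

@[simp] lemma ra_one (x : X.X) : X.ra 1 x = x := by simp [ra_def]

lemma ra_ra (a b : B.k) (x : X.X) : X.ra b (X.ra a x) = X.ra (a * b) x := by
  simp [ra_def, smul_smul, ← op_mul]

lemma sm_ra (a : B.k) (x : X.X) : X.sm (X.ra a x) = X.ra (B.sig a) (X.sm x) := by
  simp [ra_def, sm_def, smul_smul, ← op_mul, Gam.ι_mul_s]

lemma sm_sm (x : X.X) : X.sm (X.sm x) = X.ra B.eta (X.sm x) := by
  rw [← sig_eta, ← sm_ra]
  simp [ra_def, sm_def, smul_smul, ← op_mul, Gam.s_mul_s]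

lemma smul_eq (γ : Gam B) (x : X.X) : op γ • x = X.ra γ.a x + X.ra γ.b (X.sm x) := by
  conv_lhs => rw [Gam.eq_add γ]
  simp [ra_def, sm_def, smul_smul, add_smul]

lemma ra_mem {g : ℤ × ℤ} {j : ℤ} {a : B.k} {x : X.X} (hx : x ∈ X.gr g) (ha : a ∈ B.gr j) :
    X.ra a x ∈ X.gr (g + (0, j)) := X.smul_mem g j x _ hx (Gam.ι_mem ha)

lemma sm_mem {g : ℤ × ℤ} {x : X.X} (hx : x ∈ X.gr g) : X.sm x ∈ X.gr (g + (0, 1)) :=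
  X.smul_mem g 1 x _ hx Gam.s_mem

lemma d_ra (a : B.k) (x : X.X) : X.d (X.ra a x) = X.ra a (X.d x) := X.d.map_smul _ _

lemma d_sm (x : X.X) : X.d (X.sm x) = X.sm (X.d x) := X.d.map_smul _ _

lemma kos_of_mem (e : ℤ) {g : ℤ × ℤ} {x : X.X} (hx : x ∈ X.gr g) :
    X.kos e x = sg (e * tot g) • x := by
  rw [kos, glift_of_mem X.gr _ hx]; simp [-zsmul_eq_mul]

lemma kos_mem (e : ℤ) {g : ℤ × ℤ} {x : X.X} (hx : x ∈ X.gr g) : X.kos e x ∈ X.gr g := by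
  rw [kos_of_mem e hx]; exact zsmul_mem hx _

lemma hom_ext {Z : Type*} [AddCommGroup Z] {f f' : X.X →+ Z}
    (h : ∀ g, ∀ x ∈ X.gr g, f x = f' x) : f = f' := gr_ext X.gr h

lemma iSup_gr (X : Cx B) : iSup X.gr = ⊤ := by
  rw [eq_top_iff]
  intro x _
  induction x using gr_induction X.gr with
  | h0 => exact zero_mem _
  | hom i x hx => exact AddSubgroup.mem_iSup_of_mem i hx
  | hadd x y hx hy => exact add_mem (hx trivial) (hy trivial)

/-- The right `Γ`-module structure given by a right `k`-action `r` and an operator `S`, the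
action of `s`. -/
@[reducible] def gamModule (X : Type u) [AddCommGroup X] (r : B.k →+ X →+ X) (S : X →+ X)
    (r_one : ∀ x, r 1 x = x) (r_r : ∀ a b x, r b (r a x) = r (a * b) x)
    (S_r : ∀ a x, S (r a x) = r (B.sig a) (S x)) (S_S : ∀ x, S (S x) = r B.eta (S x)) :
    Module (Gam B)ᵐᵒᵖ X where
  smul γ x := r (unop γ).a x + r (unop γ).b (S x)
  one_smul x := by
    change r 1 x + r 0 (S x) = x
    simp [r_one]
  mul_smul γ δ x := by
    change r ((unop δ) * (unop γ)).1 x + r ((unop δ) * (unop γ)).2 (S x)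
      = r (unop γ).a (r (unop δ).a x + r (unop δ).b (S x))
        + r (unop γ).b (S (r (unop δ).a x + r (unop δ).b (S x)))
    simp only [Gam.mul_a, Gam.mul_b, map_add, AddMonoidHom.add_apply, S_r, S_S, r_r, mul_assoc]
    abel
  smul_zero γ := by
    change r (unop γ).a 0 + r (unop γ).b (S 0) = 0
    simp
  smul_add γ x y := by
    change r (unop γ).a (x + y) + r (unop γ).b (S (x + y))
      = (r (unop γ).a x + r (unop γ).b (S x)) + (r (unop γ).a y + r (unop γ).b (S y))
    simp only [map_add]; abel
  add_smul γ δ x := by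
    change r ((unop γ).a + (unop δ).a) x + r ((unop γ).b + (unop δ).b) (S x)
      = (r (unop γ).a x + r (unop γ).b (S x)) + (r (unop δ).a x + r (unop δ).b (S x))
    simp only [map_add, AddMonoidHom.add_apply]; abel
  zero_smul x := by
    change r 0 x + r 0 (S x) = 0
    simp

/-- Constructor for complexes of `Γ`-modules from a right `k`-action `r`, the action `S` of `s`,
the bigrading and the boundary. -/
abbrev ofOps (X : Type u) [AddCommGroup X] (r : B.k →+ X →+ X) (S : X →+ X)
    (gr : ℤ × ℤ → AddSubgroup X) (dd : X →+ X) (internal : IsInternal gr)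
    (r_one : ∀ x, r 1 x = x) (r_r : ∀ a b x, r b (r a x) = r (a * b) x)
    (S_r : ∀ a x, S (r a x) = r (B.sig a) (S x)) (S_S : ∀ x, S (S x) = r B.eta (S x))
    (r_mem : ∀ g j x a, x ∈ gr g → a ∈ B.gr j → r a x ∈ gr (g + (0, j)))
    (S_mem : ∀ g x, x ∈ gr g → S x ∈ gr (g + (0, 1)))
    (d_r : ∀ a x, dd (r a x) = r a (dd x)) (d_S : ∀ x, dd (S x) = S (dd x))
    (d_mem : ∀ g x, x ∈ gr g → dd x ∈ gr (g + (-1, 0))) (d_d : ∀ x, dd (dd x) = 0) : Cx B :=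
  letI := gamModule X r S r_one r_r S_r S_S
  { X := X
    gr := gr
    internal := internal
    smul_mem := fun g j x γ hx hγ => by
      refine add_mem (r_mem g j x _ hx hγ.1) ?_
      have h := r_mem _ _ _ _ (S_mem g x hx) hγ.2
      have e : g + (0, 1) + (0, j - 1) = g + (0, j) := by ext <;> simp [add_assoc]
      rwa [e] at h
    d :=
      { dd with
        map_smul' := fun γ x => by
          change dd (r (unop γ).a x + r (unop γ).b (S x))
            = r (unop γ).a (dd x) + r (unop γ).b (S (dd x))
          rw [map_add, d_r, d_r, d_S] }
    d_mem := d_mem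
    d_d := d_d }

section ofOps

variable {X : Type u} [AddCommGroup X] {r : B.k →+ X →+ X} {S : X →+ X}
    {gr : ℤ × ℤ → AddSubgroup X} {dd : X →+ X} {h1 : IsInternal gr}
    {h2 : ∀ x, r 1 x = x} {h3 : ∀ a b x, r b (r a x) = r (a * b) x}
    {h4 : ∀ a x, S (r a x) = r (B.sig a) (S x)} {h5 : ∀ x, S (S x) = r B.eta (S x)}
    {h6 : ∀ g j x a, x ∈ gr g → a ∈ B.gr j → r a x ∈ gr (g + (0, j))}
    {h7 : ∀ g x, x ∈ gr g → S x ∈ gr (g + (0, 1))}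
    {h8 : ∀ a x, dd (r a x) = r a (dd x)} {h9 : ∀ x, dd (S x) = S (dd x)}
    {h10 : ∀ g x, x ∈ gr g → dd x ∈ gr (g + (-1, 0))} {h11 : ∀ x, dd (dd x) = 0}

lemma ofOps_ra (a : B.k) (x : X) :
    (ofOps X r S gr dd h1 h2 h3 h4 h5 h6 h7 h8 h9 h10 h11).ra a x = r a x := by
  change r a x + r 0 (S x) = r a x
  simp

lemma ofOps_sm (x : X) :
    (ofOps X r S gr dd h1 h2 h3 h4 h5 h6 h7 h8 h9 h10 h11).sm x = S x := by
  change r 0 x + r 1 (S x) = S x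
  simp [h2]

end ofOps

end Cx

namespace Cx

variable {B : EtaRing.{u}} {X Y : Cx B}

lemma kos_ra (e : ℤ) {j : ℤ} {a : B.k} (ha : a ∈ B.gr j) (x : X.X) :
    X.kos e (X.ra a x) = sg (e * j) • X.ra a (X.kos e x) := by
  induction x using gr_induction X.gr with
  | h0 => simp
  | hadd x y hx hy => simp [hx, hy]
  | hom g x hx =>
    rw [kos_of_mem e (ra_mem hx ha), kos_of_mem e hx, map_zsmul, smul_smul, tot_add, mul_add,
      sg_add, mul_comm]
    simp

lemma kos_sm (e : ℤ) (x : X.X) : X.kos e (X.sm x) = sg e • X.sm (X.kos e x) := by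
  induction x using gr_induction X.gr with
  | h0 => simp
  | hadd x y hx hy => simp [hx, hy]
  | hom g x hx =>
    rw [kos_of_mem e (sm_mem hx), kos_of_mem e hx, map_zsmul, smul_smul, tot_add, mul_add,
      sg_add, mul_comm]
    simp

lemma kos_d (e : ℤ) (x : X.X) : X.kos e (X.d x) = sg e • X.d (X.kos e x) := by
  induction x using gr_induction X.gr with
  | h0 => simp
  | hadd x y hx hy => simp [hx, hy]
  | hom g x hx =>
    rw [kos_of_mem e (X.d_mem _ _ hx), kos_of_mem e hx, map_zsmul, smul_smul, tot_add, mul_add,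
      sg_add, mul_comm]
    simp [sg_neg]

lemma kos_kos (e : ℤ) (x : X.X) : X.kos e (X.kos e x) = x := by
  induction x using gr_induction X.gr with
  | h0 => simp
  | hadd x y hx hy => simp [hx, hy]
  | hom g x hx => rw [kos_of_mem e hx, map_zsmul, kos_of_mem e hx, sg_smul_smul]

/-! ### Tensor products over `k` -/

section tensor

open TensorProduct

variable (X Y) in
/-- The relations `x a ⊗ y = x ⊗ a y`, where `a y = (-1)^(|a| ‖y‖) y a`, defining the tensor
product over `k` of graded right `k`-modules. -/
def relT : AddSubgroup (X.X ⊗[ℤ] Y.X) :=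
  AddSubgroup.closure {z | ∃ (g h : ℤ × ℤ) (j : ℤ), ∃ x ∈ X.gr g, ∃ a ∈ B.gr j, ∃ y ∈ Y.gr h,
    z = X.ra a x ⊗ₜ[ℤ] y - sg (j * tot h) • (x ⊗ₜ[ℤ] Y.ra a y)}

variable (X Y) in
/-- The underlying abelian group of the tensor product `X ⊗ Y` over `k`. -/
def TC : Type u := (X.X ⊗[ℤ] Y.X) ⧸ relT X Y

instance : AddCommGroup (TC X Y) := inferInstanceAs (AddCommGroup ((X.X ⊗[ℤ] Y.X) ⧸ relT X Y))

/-- The element `x ⊗ y`. -/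
def tm : X.X →+ Y.X →+ TC X Y where
  toFun x := (QuotientAddGroup.mk' (relT X Y)).comp (TensorProduct.mk ℤ X.X Y.X x).toAddMonoidHom
  map_zero' := by
    refine AddMonoidHom.ext fun y => ?_
    simp only [map_zero]
    rfl
  map_add' a b := by
    refine AddMonoidHom.ext fun y => ?_
    simp only [map_add]
    rfl

/-- A biadditive map compatible with the relations defining the tensor product over `k`. -/
abbrev Balanced {Z : Type*} [AddCommGroup Z] (b : X.X →+ Y.X →+ Z) : Prop :=
  ∀ (g h : ℤ × ℤ) (j : ℤ), ∀ x ∈ X.gr g, ∀ a ∈ B.gr j, ∀ y ∈ Y.gr h,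
    b (X.ra a x) y = sg (j * tot h) • b x (Y.ra a y)

/-- The map out of the tensor product induced by a balanced biadditive map. -/
def tlift {Z : Type*} [AddCommGroup Z] (b : X.X →+ Y.X →+ Z) (hb : Balanced b) : TC X Y →+ Z :=
  QuotientAddGroup.lift (relT X Y) (TensorProduct.liftAddHom b (by simp)) (by
    rw [relT, AddSubgroup.closure_le]
    rintro _ ⟨g, h, j, x, hx, a, ha, y, hy, rfl⟩
    change TensorProduct.liftAddHom b _ _ = 0
    simp [hb g h j x hx a ha y hy, -zsmul_eq_mul])

@[simp] lemma tlift_tm {Z : Type*} [AddCommGroup Z] (b : X.X →+ Y.X →+ Z) (hb : Balanced b)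
    (x : X.X) (y : Y.X) : tlift b hb (tm x y) = b x y := rfl

lemma tm_balanced : Balanced (tm (X := X) (Y := Y)) := by
  intro g h j x hx a ha y hy
  have h1 : (QuotientAddGroup.mk' (relT X Y))
      (X.ra a x ⊗ₜ[ℤ] y - sg (j * tot h) • (x ⊗ₜ[ℤ] Y.ra a y)) = 0 :=
    (QuotientAddGroup.eq_zero_iff _).2
      (AddSubgroup.subset_closure ⟨g, h, j, x, hx, a, ha, y, hy, rfl⟩)
  rw [map_sub, sub_eq_zero, map_zsmul] at h1
  exact h1

lemma T_induction {p : TC X Y → Prop}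
    (htm : ∀ g h, ∀ x ∈ X.gr g, ∀ y ∈ Y.gr h, p (tm x y))
    (hadd : ∀ z w, p z → p w → p (z + w)) (z : TC X Y) : p z := by
  have h0 : p 0 := by simpa using htm 0 0 0 (zero_mem _) 0 (zero_mem _)
  obtain ⟨z, rfl⟩ := QuotientAddGroup.mk_surjective z
  induction z using TensorProduct.induction_on with
  | zero => exact h0
  | add z w hz hw => exact hadd _ _ hz hw
  | tmul x y =>
    change p (tm x y)
    induction x using gr_induction X.gr with
    | h0 => simpa using h0
    | hadd x x' hx hx' => rw [map_add]; exact hadd _ _ hx hx'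
    | hom g x hx =>
      induction y using gr_induction Y.gr with
      | h0 => simpa using h0
      | hadd y y' hy hy' => rw [map_add]; exact hadd _ _ hy hy'
      | hom h y hy => exact htm g h x hx y hy

lemma T_ext {Z : Type*} [AddCommGroup Z] {f f' : TC X Y →+ Z}
    (h : ∀ i j, ∀ x ∈ X.gr i, ∀ y ∈ Y.gr j, f (tm x y) = f' (tm x y)) : f = f' := by
  refine AddMonoidHom.ext fun z => ?_
  induction z using T_induction with
  | htm i j x hx y hy => exact h i j x hx y hy
  | hadd z w hz hw => rw [map_add, map_add, hz, hw]

lemma tm_ra {j : ℤ} {a : B.k} (ha : a ∈ B.gr j) (x : X.X) (y : Y.X) :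
    tm (X.ra a x) y = tm x (Y.ra a (Y.kos j y)) := by
  induction x using gr_induction X.gr with
  | h0 => simp
  | hadd x x' hx hx' => simp [hx, hx']
  | hom g x hx =>
    induction y using gr_induction Y.gr with
    | h0 => simp
    | hadd y y' hy hy' => simp [hy, hy']
    | hom h y hy =>
      rw [tm_balanced g h j x hx a ha y hy, kos_of_mem j hy, map_zsmul, map_zsmul]

variable (X Y) in
/-- The part of bidegree `g` of the tensor product. -/
def grT (g : ℤ × ℤ) : AddSubgroup (TC X Y) :=
  AddSubgroup.closure {z | ∃ h h' : ℤ × ℤ, h + h' = g ∧ ∃ x ∈ X.gr h, ∃ y ∈ Y.gr h', z = tm x y}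

lemma tm_mem {g h : ℤ × ℤ} {x : X.X} {y : Y.X} (hx : x ∈ X.gr g) (hy : y ∈ Y.gr h) :
    tm x y ∈ grT X Y (g + h) :=
  AddSubgroup.subset_closure ⟨g, h, rfl, x, hx, y, hy, rfl⟩

lemma grT_le {g : ℤ × ℤ} {Z : Type*} [AddCommGroup Z] {f : TC X Y →+ Z} {S : AddSubgroup Z}
    (h : ∀ h h' : ℤ × ℤ, h + h' = g → ∀ x ∈ X.gr h, ∀ y ∈ Y.gr h', f (tm x y) ∈ S) :
    ∀ z ∈ grT X Y g, f z ∈ S := by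
  have : grT X Y g ≤ S.comap f := by
    rw [grT, AddSubgroup.closure_le]
    rintro _ ⟨i, i', hi, x, hx, y, hy, rfl⟩
    exact h i i' hi x hx y hy
  exact this

/-- The projection of the tensor product to its part of bidegree `g`. -/
def qT (g : ℤ × ℤ) : TC X Y →+ TC X Y :=
  tlift (glift X.gr (fun h => (tm.compl₂ (gproj Y.gr (g - h))).comp (X.gr h).subtype)) (by
    intro h h' j x hx a ha y hy
    rw [glift_of_mem X.gr _ hx, glift_of_mem X.gr _ (ra_mem hx ha)]
    simp only [AddMonoidHom.comp_apply, AddMonoidHom.compl₂_apply, AddSubgroup.coe_subtype]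
    by_cases e : h' = g - (h + (0, j))
    · have e' : h' + (0, j) = g - h := by rw [e]; abel
      rw [gproj_same Y.gr (e ▸ hy), gproj_same Y.gr (e' ▸ ra_mem hy ha)]
      exact tm_balanced h h' j x hx a ha y hy
    · have e' : h' + (0, j) ≠ g - h := fun e' => e (by rw [← sub_sub, ← e']; abel)
      rw [gproj_ne Y.gr hy e, gproj_ne Y.gr (ra_mem hy ha) e']
      simp)

lemma qT_tm (g : ℤ × ℤ) {h h' : ℤ × ℤ} {x : X.X} {y : Y.X} (hx : x ∈ X.gr h) (hy : y ∈ Y.gr h') :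
    qT g (tm x y) = if h + h' = g then tm x y else 0 := by
  rw [qT, tlift_tm, glift_of_mem X.gr _ hx]
  simp only [AddMonoidHom.comp_apply, AddMonoidHom.compl₂_apply, AddSubgroup.coe_subtype]
  split_ifs with e
  · rw [gproj_same Y.gr]; rwa [← e, add_sub_cancel_left]
  · rw [gproj_ne Y.gr hy, map_zero]
    rintro rfl; exact e (by abel)

lemma grT_internal : IsInternal (grT X Y) := by
  refine isInternal_of_detect ?_ (fun g => qT g) ?_ ?_
  · rw [eq_top_iff]
    intro z _
    induction z using T_induction with
    | htm g h x hx y hy => exact AddSubgroup.mem_iSup_of_mem _ (tm_mem hx hy)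
    | hadd z w hz hw => exact add_mem (hz trivial) (hw trivial)
  · intro g h hgh z hz
    refine (AddSubgroup.mem_bot).1 (grT_le (f := qT g) (S := ⊥) ?_ z hz)
    intro i i' hi x hx y hy
    rw [qT_tm g hx hy, if_neg (by rw [hi]; exact hgh.symm)]
    exact zero_mem _
  · intro g z hz h0
    have : (qT g - AddMonoidHom.id (TC X Y) : TC X Y →+ TC X Y) z ∈ (⊥ : AddSubgroup (TC X Y)) := by
      refine grT_le ?_ z hz
      intro i i' hi x hx y hy
      rw [AddMonoidHom.sub_apply, qT_tm g hx hy, if_pos hi]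
      simp
    simpa [h0] using this

variable (X Y) in
/-- The right `k`-action on the tensor product: `(x ⊗ y) a = x ⊗ y a`. -/
def rT : B.k →+ TC X Y →+ TC X Y where
  toFun a := tlift (tm.compl₂ (Y.ra a)) (by
    intro g h j x hx b hb y hy
    simp only [AddMonoidHom.compl₂_apply]
    induction a using gr_induction B.gr with
    | h0 => simp
    | hadd a a' h h' => simp [h, h']
    | hom i a ha =>
      rw [tm_balanced _ _ j x hx b hb _ (ra_mem hy ha), ra_ra, ra_ra,
        B.graded_comm i j a ha b hb, map_zsmul, AddMonoidHom.zsmul_apply, map_zsmul, smul_smul,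
        tot_add, mul_add, sg_add, mul_assoc, tot_zero_mk, mul_comm i j,
        sg_sq, mul_one])
  map_zero' := T_ext fun g h x hx y hy => by simp
  map_add' a a' := T_ext fun g h x hx y hy => by
    simp only [AddMonoidHom.add_apply, tlift_tm, AddMonoidHom.compl₂_apply, map_add]

@[simp] lemma rT_tm (a : B.k) (x : X.X) (y : Y.X) : rT X Y a (tm x y) = tm x (Y.ra a y) := rfl

variable (X Y) in
/-- The action of `s` on the tensor product. As `s` is primitive, the diagonal action is
`(x ⊗ y) s = x ⊗ y s + (-1)^‖y‖ x s ⊗ y`. -/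
def sT : TC X Y →+ TC X Y :=
  tlift (tm.compl₂ Y.sm + (tm.comp X.sm).compl₂ (Y.kos 1)) (by
    intro g h j x hx a ha y hy
    simp only [AddMonoidHom.add_apply, AddMonoidHom.compl₂_apply, AddMonoidHom.comp_apply]
    rw [tm_ra ha, sm_ra, sig_of_mem ha, map_zsmul, AddMonoidHom.zsmul_apply, map_zsmul,
      AddMonoidHom.zsmul_apply, tm_ra ha, sm_ra, sig_of_mem ha, kos_ra _ ha, kos_sm,
      kos_of_mem j hy]
    simp only [map_zsmul, AddMonoidHom.zsmul_apply, smul_add, smul_smul, one_mul,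
      kos_of_mem 1 hy, kos_of_mem j hy]
    congr 1 <;> congr 1 <;> ring)

lemma sT_tm (x : X.X) (y : Y.X) :
    sT X Y (tm x y) = tm x (Y.sm y) + tm (X.sm x) (Y.kos 1 y) := rfl

variable (X Y) in
/-- The boundary `x ⊗ y ↦ d x ⊗ y + (-1)^‖x‖ x ⊗ d y` of the tensor product. -/
def dT : TC X Y →+ TC X Y :=
  tlift (tm.comp X.d.toAddMonoidHom + (tm.comp (X.kos 1)).compl₂ Y.d.toAddMonoidHom) (by
    intro g h j x hx a ha y hy
    simp only [AddMonoidHom.add_apply, AddMonoidHom.compl₂_apply, AddMonoidHom.comp_apply,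
      LinearMap.toAddMonoidHom_coe]
    rw [d_ra, d_ra, tm_ra ha, kos_ra _ ha, map_zsmul, AddMonoidHom.zsmul_apply, tm_ra ha,
      kos_d, kos_of_mem j hy]
    simp only [map_zsmul, smul_add, smul_smul, one_mul]
    congr 2
    rw [← mul_assoc, sg_sq, one_mul])

lemma dT_tm (x : X.X) (y : Y.X) :
    dT X Y (tm x y) = tm (X.d x) y + tm (X.kos 1 x) (Y.d y) := rfl

variable (X Y) in
/-- The tensor product `X ⊗ Y` over `k` of complexes of `Γ`-modules. -/
abbrev tensor : Cx B :=
  ofOps (TC X Y) (rT X Y) (sT X Y) (grT X Y) (dT X Y) grT_internal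
    (fun z => by
      induction z using T_induction with
      | htm g h x hx y hy => simp
      | hadd z w hz hw => rw [map_add, hz, hw])
    (fun a b z => by
      induction z using T_induction with
      | htm g h x hx y hy => simp [ra_ra]
      | hadd z w hz hw => simp only [map_add, hz, hw])
    (fun a z => by
      induction z using T_induction with
      | htm g h x hx y hy =>
        induction a using gr_induction B.gr with
        | h0 => simp
        | hadd a b h h' => simp only [map_add, AddMonoidHom.add_apply, h, h']
        | hom j a ha =>
          simp only [rT_tm, sT_tm, map_add, sm_ra, kos_ra 1 ha, sig_of_mem ha, map_zsmul,
            AddMonoidHom.zsmul_apply, one_mul]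
      | hadd z w hz hw => simp only [map_add, hz, hw])
    (fun z => by
      induction z using T_induction with
      | htm g h x hx y hy =>
        simp only [rT_tm, sT_tm, map_add, kos_sm, kos_kos, sm_sm,
          tm_ra B.eta_mem, sg_one, neg_smul, one_smul, map_neg]
        abel
      | hadd z w hz hw => simp only [map_add, hz, hw])
    (fun g j z a hz ha => grT_le (f := rT X Y a) (fun h h' e x hx y hy => by
      rw [← e, rT_tm, add_assoc]; exact tm_mem hx (ra_mem hy ha)) z hz)
    (fun g z hz => grT_le (f := sT X Y) (fun h h' e x hx y hy => by
      rw [← e, sT_tm]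
      refine add_mem ?_ ?_
      · rw [add_assoc]; exact tm_mem hx (sm_mem hy)
      · rw [add_right_comm]; exact tm_mem (sm_mem hx) (kos_mem 1 hy)) z hz)
    (fun a z => by
      induction z using T_induction with
      | htm g h x hx y hy => simp only [rT_tm, dT_tm, d_ra, map_add]
      | hadd z w hz hw => simp only [map_add, hz, hw])
    (fun z => by
      induction z using T_induction with
      | htm g h x hx y hy =>
        simp only [sT_tm, dT_tm, d_sm, map_add, kos_sm, kos_d, map_zsmul, AddMonoidHom.zsmul_apply]
        abel
      | hadd z w hz hw => simp only [map_add, hz, hw])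
    (fun g z hz => grT_le (f := dT X Y) (fun h h' e x hx y hy => by
      rw [← e, dT_tm]
      refine add_mem ?_ ?_
      · rw [add_right_comm]; exact tm_mem (X.d_mem _ _ hx) hy
      · rw [add_assoc]; exact tm_mem (kos_mem 1 hx) (Y.d_mem _ _ hy)) z hz)
    (fun z => by
      induction z using T_induction with
      | htm g h x hx y hy =>
        simp only [dT_tm, d_d, map_add, kos_d, map_zsmul, AddMonoidHom.zsmul_apply, map_zero,
          AddMonoidHom.zero_apply, sg_one]
        simp
      | hadd z w hz hw => simp only [map_add, hz, hw, add_zero])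

end tensor

end Cx

namespace Cx

variable {B : EtaRing.{u}} {X Y Z X' Y' : Cx B}

lemma tensor_ra (a : B.k) (z : TC X Y) : (tensor X Y).ra a z = rT X Y a z := ofOps_ra a z

lemma tensor_sm (z : TC X Y) : (tensor X Y).sm z = sT X Y z := ofOps_sm z

lemma tensor_d (z : TC X Y) : (tensor X Y).d z = dT X Y z := rfl

variable (X) in
/-- The left action of `k`: `la a x = a x = (-1)^(|a| ‖x‖) x a` for homogeneous `a` and `x`. -/
def la : B.k →+ X.X →+ X.X :=
  glift B.gr (fun j => ((AddMonoidHom.compHom.flip (X.kos j)).comp X.ra).comp (B.gr j).subtype)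

lemma la_of_mem {j : ℤ} {a : B.k} (ha : a ∈ B.gr j) (x : X.X) :
    X.la a x = X.ra a (X.kos j x) := by
  rw [la, glift_of_mem B.gr _ ha]; rfl

lemma la_one (x : X.X) : X.la 1 x = x := by
  rw [la_of_mem (SetLike.GradedOne.one_mem : (1 : B.k) ∈ B.gr 0), ra_one]
  induction x using gr_induction X.gr with
  | h0 => simp
  | hadd x y hx hy => simp [hx, hy]
  | hom g x hx => simp [kos_of_mem 0 hx]

lemma la_ra (a b : B.k) (x : X.X) : X.la a (X.ra b x) = X.ra b (X.la a x) := by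
  induction a using gr_induction B.gr with
  | h0 => simp
  | hadd x y hx hy => simp [hx, hy]
  | hom i a ha =>
    induction b using gr_induction B.gr with
    | h0 => simp
    | hadd x y hx hy => simp [hx, hy]
    | hom j b hb =>
      rw [la_of_mem ha, la_of_mem ha, kos_ra _ hb, map_zsmul, ra_ra, ra_ra,
        B.graded_comm i j a ha b hb, map_zsmul, AddMonoidHom.zsmul_apply]

lemma la_la (a b : B.k) (x : X.X) : X.la a (X.la b x) = X.la (a * b) x := by
  induction a using gr_induction B.gr with
  | h0 => simp
  | hadd x y hx hy => simp [hx, hy, add_mul]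
  | hom i a ha =>
    induction b using gr_induction B.gr with
    | h0 => simp
    | hadd x y hx hy => simp [hx, hy, mul_add]
    | hom j b hb =>
      induction x using gr_induction X.gr with
      | h0 => simp
      | hadd x y hx hy => simp only [map_add, hx, hy]
      | hom g x hx =>
        rw [la_of_mem ha, la_of_mem hb, la_of_mem (SetLike.GradedMul.mul_mem ha hb), kos_ra _ hb,
          map_zsmul, ra_ra, B.graded_comm i j a ha b hb]
        simp only [kos_of_mem _ hx, map_zsmul, AddMonoidHom.zsmul_apply, smul_smul]
        rw [add_mul, sg_add]
        congr 1; ring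

lemma kos_la (e : ℤ) {j : ℤ} {a : B.k} (ha : a ∈ B.gr j) (x : X.X) :
    X.kos e (X.la a x) = sg (e * j) • X.la a (X.kos e x) := by
  rw [la_of_mem ha, la_of_mem ha, kos_ra e ha]
  congr 2
  induction x using gr_induction X.gr with
  | h0 => simp
  | hadd x y hx hy => simp [hx, hy]
  | hom g x hx => simp only [kos_of_mem _ hx, map_zsmul, smul_smul, mul_comm]

lemma kos_la_sig (a : B.k) (x : X.X) :
    X.kos 1 (X.la (B.sig a) x) = X.la a (X.kos 1 x) := by
  induction a using gr_induction B.gr with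
  | h0 => simp
  | hadd x y hx hy => simp only [map_add, AddMonoidHom.add_apply, hx, hy]
  | hom j a ha =>
    rw [sig_of_mem ha, map_zsmul, AddMonoidHom.zsmul_apply, map_zsmul, kos_la 1 ha, one_mul,
      sg_smul_smul]

lemma sm_la (a : B.k) (x : X.X) : X.sm (X.la a x) = X.la a (X.sm x) := by
  induction a using gr_induction B.gr with
  | h0 => simp
  | hadd x y hx hy => simp [hx, hy]
  | hom j a ha =>
    rw [la_of_mem ha, la_of_mem ha, sm_ra, kos_sm, sig_of_mem ha, map_zsmul, map_zsmul,
      AddMonoidHom.zsmul_apply]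

lemma neg_ra_eta (x : X.X) : -(X.ra B.eta x) = X.ra B.eta x := by
  rw [← AddMonoidHom.neg_apply, ← map_neg, neg_eta]

lemma d_la (a : B.k) (x : X.X) : X.d (X.la a x) = X.la (B.sig a) (X.d x) := by
  induction a using gr_induction B.gr with
  | h0 => simp
  | hadd x y hx hy => simp [hx, hy]
  | hom j a ha =>
    rw [la_of_mem ha, sig_of_mem ha, map_zsmul, AddMonoidHom.zsmul_apply, la_of_mem ha, kos_d,
      d_ra, map_zsmul, sg_smul_smul]

/-! ### The internal `Hom` over `k` -/

section hom

variable (X Y) in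
/-- The right `k`-linear maps of bidegree `g`. -/
def homDeg (g : ℤ × ℤ) : AddSubgroup (X.X →+ Y.X) where
  carrier := {f | (∀ a x, f (X.ra a x) = Y.ra a (f x)) ∧ ∀ h, ∀ x ∈ X.gr h, f x ∈ Y.gr (g + h)}
  zero_mem' := ⟨fun a x => by simp, fun h x _ => zero_mem _⟩
  add_mem' hf hf' := ⟨fun a x => by simp [hf.1, hf'.1],
    fun h x hx => add_mem (hf.2 h x hx) (hf'.2 h x hx)⟩
  neg_mem' hf := ⟨fun a x => by simp [hf.1], fun h x hx => neg_mem (hf.2 h x hx)⟩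

variable (X Y) in
/-- The underlying group of the internal `Hom` over `k`: finite sums of homogeneous right
`k`-linear maps. -/
def homAll : AddSubgroup (X.X →+ Y.X) := ⨆ g, homDeg X Y g

lemma homDeg_le (g : ℤ × ℤ) : homDeg X Y g ≤ homAll X Y := le_iSup (homDeg X Y) g

lemma homAll_induction {p : (X.X →+ Y.X) → Prop} (hom : ∀ g, ∀ f ∈ homDeg X Y g, p f)
    (hadd : ∀ f f', p f → p f' → p (f + f')) {f : X.X →+ Y.X} (hf : f ∈ homAll X Y) : p f :=
  AddSubgroup.iSup_induction (homDeg X Y) (C := p) hf hom (hom 0 0 (zero_mem _)) hadd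

lemma map_ra {f : X.X →+ Y.X} (hf : f ∈ homAll X Y) (a : B.k) (x : X.X) :
    f (X.ra a x) = Y.ra a (f x) := by
  refine homAll_induction (p := fun f => f (X.ra a x) = Y.ra a (f x)) ?_ ?_ hf
  · exact fun g f hf => hf.1 a x
  · exact fun f f' hf hf' => by simp [hf, hf']

lemma H_ext {f f' : homAll X Y} (h : ∀ x, f.1 x = f'.1 x) : f = f' :=
  Subtype.ext (AddMonoidHom.ext h)

variable (X Y) in
/-- The part of bidegree `g` of the internal `Hom`. -/
def grH (g : ℤ × ℤ) : AddSubgroup (homAll X Y) := (homDeg X Y g).addSubgroupOf (homAll X Y)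

lemma H_induction {p : homAll X Y → Prop} (hom : ∀ g, ∀ f ∈ grH X Y g, p f)
    (hadd : ∀ f f', p f → p f' → p (f + f')) (f : homAll X Y) : p f := by
  obtain ⟨f, hf⟩ := f
  refine AddSubgroup.iSup_induction' (homDeg X Y) (C := fun f hf => p ⟨f, hf⟩) ?_ ?_ ?_ hf
  · exact fun g f hf => hom g _ hf
  · exact hom 0 _ (zero_mem _)
  · exact fun f f' hf hf' h h' => hadd _ _ h h'

lemma grH_internal : IsInternal (grH X Y) := by
  refine isInternal_of_detect (W := fun _ => (Σ h, X.gr h) → Y.X) ?_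
    (fun g => { toFun := fun f p => gproj Y.gr (g + p.1) (f.1 p.2)
                map_zero' := by ext; simp
                map_add' := by intros; ext; simp }) ?_ ?_
  · rw [eq_top_iff]
    intro f _
    induction f using H_induction with
    | hom g f hf => exact AddSubgroup.mem_iSup_of_mem g hf
    | hadd f f' h h' => exact add_mem (h trivial) (h' trivial)
  · intro g h hgh f hf
    funext p
    exact gproj_ne Y.gr (hf.2 p.1 p.2 p.2.2) fun e => hgh (add_right_cancel e).symm
  · intro g f hf h0
    refine Subtype.ext (hom_ext fun h x hx => ?_)
    have := congrFun h0 ⟨h, x, hx⟩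
    change gproj Y.gr (g + h) (f.1 x) = 0 at this
    exact (gproj_same Y.gr (hf.2 h x hx)).symm.trans this

/-- Restriction of an operator on additive maps to the internal `Hom`s. -/
def hres (T : (X.X →+ Y.X) →+ (X'.X →+ Y'.X))
    (hT : ∀ g, ∀ f ∈ homDeg X Y g, T f ∈ homAll X' Y') : homAll X Y →+ homAll X' Y' :=
  (T.comp (homAll X Y).subtype).codRestrict (homAll X' Y') (fun f => by
    obtain ⟨f, hf⟩ := f
    refine homAll_induction (p := fun f => T f ∈ homAll X' Y') hT (fun f f' h h' => ?_) hf
    rw [map_add]; exact add_mem h h')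

lemma kos_map_kos (e : ℤ) {g : ℤ × ℤ} {f : X.X →+ Y.X} (hf : f ∈ homDeg X Y g) (x : X.X) :
    Y.kos e (f (X.kos e x)) = sg (e * tot g) • f x := by
  induction x using gr_induction X.gr with
  | h0 => simp
  | hadd x y hx hy => simp [hx, hy]
  | hom h x hx =>
    rw [kos_of_mem e hx, map_zsmul, map_zsmul, kos_of_mem e (hf.2 h x hx), smul_smul, tot_add,
      mul_add, sg_add, mul_comm, mul_assoc, sg_sq, mul_one]

lemma map_la_mem {j : ℤ} {a : B.k} (ha : a ∈ B.gr j) {g : ℤ × ℤ} {f : X.X →+ Y.X}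
    (hf : f ∈ homDeg X Y g) : f.comp (X.la a) ∈ homDeg X Y (g + (0, j)) := by
  refine ⟨fun b x => ?_, fun h x hx => ?_⟩
  · simp [la_ra, hf.1]
  · have := hf.2 _ _ (ra_mem (kos_mem j hx) ha)
    rw [AddMonoidHom.comp_apply, la_of_mem ha]
    rwa [add_assoc, add_comm (0, j) h]

variable (X Y) in
/-- The right `k`-action on the internal `Hom`: `(f a)(x) = f(a x)`. -/
def rH : B.k →+ homAll X Y →+ homAll X Y where
  toFun a := hres (AddMonoidHom.compHom.flip (X.la a)) (fun g f hf => by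
    change f.comp (X.la a) ∈ _
    induction a using gr_induction B.gr with
    | h0 => simp
    | hadd a b h h' =>
      rw [map_add, show f.comp (X.la a + X.la b) = f.comp (X.la a) + f.comp (X.la b) by
        ext; simp]
      exact add_mem h h'
    | hom j a ha => exact homDeg_le _ (map_la_mem ha hf))
  map_zero' := by
    refine AddMonoidHom.ext fun f => H_ext fun x => ?_
    change f.1 (X.la 0 x) = 0
    simp
  map_add' a b := by
    refine AddMonoidHom.ext fun f => H_ext fun x => ?_
    change f.1 (X.la (a + b) x) = f.1 (X.la a x) + f.1 (X.la b x)
    simp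

@[simp] lemma rH_apply (a : B.k) (f : homAll X Y) (x : X.X) : (rH X Y a f).1 x = f.1 (X.la a x) :=
  rfl

lemma sH_mem {g : ℤ × ℤ} {f : X.X →+ Y.X} (hf : f ∈ homDeg X Y g) :
    (Y.sm.comp f - f.comp X.sm).comp (X.kos 1) ∈ homDeg X Y (g + (0, 1)) := by
  refine ⟨fun a x => ?_, fun h x hx => ?_⟩
  · induction a using gr_induction B.gr with
    | h0 => simp
    | hadd a b h h' => simp only [map_add, AddMonoidHom.add_apply, h, h']
    | hom j a ha =>
      simp only [AddMonoidHom.comp_apply, AddMonoidHom.sub_apply, kos_ra 1 ha, map_zsmul, hf.1,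
        sm_ra, one_mul, sig_of_mem ha, AddMonoidHom.zsmul_apply, smul_smul, map_sub, smul_sub]
      simp [-zsmul_eq_mul]
  · refine sub_mem ?_ ?_
    · rw [add_right_comm]; exact sm_mem (hf.2 _ _ (kos_mem 1 hx))
    · rw [add_assoc, add_comm (0, 1) h]; exact hf.2 _ _ (sm_mem (kos_mem 1 hx))

variable (X Y) in
/-- The action of `s` on the internal `Hom`. As `s` is primitive with antipode `-s`, the conjugate
action is `(f s)(x) = (-1)^‖x‖ (f(x) s - f(x s))`. -/
def sH : homAll X Y →+ homAll X Y :=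
  hres (AddMonoidHom.compHom.flip (X.kos 1) |>.comp
    (AddMonoidHom.compHom Y.sm - AddMonoidHom.compHom.flip X.sm))
    (fun _ _ hf => homDeg_le _ (sH_mem hf))

lemma sH_apply (f : homAll X Y) (x : X.X) :
    (sH X Y f).1 x = Y.sm (f.1 (X.kos 1 x)) - f.1 (X.sm (X.kos 1 x)) := rfl

lemma dH_mem {g : ℤ × ℤ} {f : X.X →+ Y.X} (hf : f ∈ homDeg X Y g) :
    Y.d.toAddMonoidHom.comp f
      - (((Y.kos 1).comp f).comp (X.kos 1)).comp X.d.toAddMonoidHom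
      ∈ homDeg X Y (g + (-1, 0)) := by
  refine ⟨fun a x => ?_, fun h x hx => ?_⟩
  · simp only [AddMonoidHom.comp_apply, AddMonoidHom.sub_apply, LinearMap.toAddMonoidHom_coe,
      hf.1, d_ra, kos_map_kos 1 hf, map_sub, map_zsmul]
  · refine sub_mem ?_ ?_
    · rw [add_right_comm]; exact Y.d_mem _ _ (hf.2 _ _ hx)
    · simp only [AddMonoidHom.comp_apply, kos_map_kos 1 hf]
      rw [add_assoc, add_comm (-1, 0) h]; exact zsmul_mem (hf.2 _ _ (X.d_mem _ _ hx)) _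

variable (X Y) in
/-- The boundary `(∂ f)(x) = d (f x) - (-1)^‖f‖ f (d x)` of the internal `Hom`; here the sign
`(-1)^‖f‖` is expressed as conjugation by the sign operators of `X` and `Y`. -/
def dH : homAll X Y →+ homAll X Y :=
  hres (AddMonoidHom.compHom Y.d.toAddMonoidHom
      - ((AddMonoidHom.compHom.flip X.d.toAddMonoidHom).comp
          (AddMonoidHom.compHom.flip (X.kos 1))).comp (AddMonoidHom.compHom (Y.kos 1)))
    (fun _ _ hf => homDeg_le _ (dH_mem hf))

lemma dH_apply (f : homAll X Y) (x : X.X) :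
    (dH X Y f).1 x = Y.d (f.1 x) - Y.kos 1 (f.1 (X.kos 1 (X.d x))) := rfl

variable (X Y) in
/-- The internal `Hom` over `k` of complexes of `Γ`-modules. -/
abbrev ihom : Cx B :=
  ofOps (homAll X Y) (rH X Y) (sH X Y) (grH X Y) (dH X Y) grH_internal
    (fun f => H_ext fun x => by simp [la_one])
    (fun a b f => H_ext fun x => by simp [la_la])
    (fun a f => H_ext fun x => by
      simp only [sH_apply, rH_apply, kos_la_sig, sm_la])
    (fun f => H_ext fun x => by
      simp only [sH_apply, rH_apply, map_sub, kos_sm, kos_kos, map_zsmul, sm_sm, map_ra f.2,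
        la_of_mem B.eta_mem, kos_ra 1 B.eta_mem, sm_ra, sig_eta]
      simp only [sg_one, mul_one, neg_smul, one_smul, sub_eq_add_neg, neg_neg, neg_add,
        neg_ra_eta]
      abel)
    (fun g j f a hf ha => map_la_mem ha hf)
    (fun g f hf => sH_mem hf)
    (fun a f => H_ext fun x => by
      simp only [dH_apply, rH_apply, d_la, kos_la_sig])
    (fun f => H_ext fun x => by
      simp only [dH_apply, sH_apply, map_sub, kos_sm, kos_d, kos_kos, map_zsmul, d_sm]
      simp only [sg_one, smul_neg, neg_smul, one_smul]
      abel)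
    (fun g f hf => dH_mem hf)
    (fun f => H_ext fun x => by
      simp only [dH_apply, map_sub, kos_d, map_zsmul, d_d, map_zero]
      simp)

lemma ihom_ra (a : B.k) (f : homAll X Y) : (ihom X Y).ra a f = rH X Y a f := ofOps_ra a f

lemma ihom_sm (f : homAll X Y) : (ihom X Y).sm f = sH X Y f := ofOps_sm f

lemma ihom_d (f : homAll X Y) : (ihom X Y).d f = dH X Y f := rfl

end hom

/-! ### The unit complex, morphisms and mapping cones -/

variable (B) in
/-- The trivial `Γ`-module `k`, on which `Γ` acts through the counit, in homological degree `0`. -/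
abbrev unit : Cx B where
  X := B.k
  mod := Module.compHom B.k (RingHom.op (Gam.ε (B := B)))
  gr g := if g.1 = 0 then B.gr g.2 else ⊥
  internal := by
    refine isInternal_of_detect (W := fun _ => B.k) ?_
      (fun g => if g.1 = 0 then gproj B.gr g.2 else 0) ?_ ?_
    · rw [eq_top_iff]
      intro a _
      induction a using gr_induction B.gr with
      | h0 => exact zero_mem _
      | hom j a ha => exact AddSubgroup.mem_iSup_of_mem (0, j) (by simpa using ha)
      | hadd a b h h' => exact add_mem (h trivial) (h' trivial)
    · intro g h hgh a ha
      by_cases h1 : g.1 = 0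
      · by_cases h2 : h.1 = 0
        · rw [if_pos h2] at ha
          rw [if_pos h1]
          exact gproj_ne B.gr ha fun e => hgh (Prod.ext (h1.trans h2.symm) e.symm)
        · rw [if_neg h2, AddSubgroup.mem_bot] at ha
          simp [ha]
      · rw [if_neg h1]; rfl
    · intro g a ha h0
      by_cases h1 : g.1 = 0
      · rw [if_pos h1] at ha h0
        rwa [gproj_same B.gr ha] at h0
      · rwa [if_neg h1, AddSubgroup.mem_bot] at ha
  smul_mem g j a γ ha hγ := by
    change a * γ.a ∈ _
    by_cases h1 : g.1 = 0
    · have h2 : (g + (0, j)).1 = 0 := by simpa using h1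
      rw [if_pos h1] at ha
      rw [if_pos h2]
      exact SetLike.GradedMul.mul_mem ha hγ.1
    · rw [if_neg h1, AddSubgroup.mem_bot] at ha
      rw [ha, zero_mul]; exact zero_mem _
  d := 0
  d_mem _ _ _ := zero_mem _
  d_d _ := rfl

/-- A morphism of bigraded `Γ`-modules: a `Γ`-linear map preserving the bidegree (not assumed to
commute with the boundaries). -/
structure GrMor (X Y : Cx B) where
  f : X.X →ₗ[(Gam B)ᵐᵒᵖ] Y.X
  map_gr : ∀ g, ∀ x ∈ X.gr g, f x ∈ Y.gr g

/-- A `Γ`-linear chain map. -/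
structure Mor (X Y : Cx B) extends GrMor X Y where
  map_d : ∀ x, f (X.d x) = Y.d (f x)

namespace GrMor

variable (φ : GrMor X Y)

lemma ra' (a : B.k) (x : X.X) : φ.f (X.ra a x) = Y.ra a (φ.f x) := φ.f.map_smul _ _

lemma sm' (x : X.X) : φ.f (X.sm x) = Y.sm (φ.f x) := φ.f.map_smul _ _

lemma kos' (e : ℤ) (x : X.X) : φ.f (X.kos e x) = Y.kos e (φ.f x) := by
  induction x using gr_induction X.gr with
  | h0 => simp
  | hadd x y hx hy => simp [hx, hy]
  | hom g x hx => rw [kos_of_mem e hx, kos_of_mem e (φ.map_gr g x hx), map_zsmul]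

lemma la' (a : B.k) (x : X.X) : φ.f (X.la a x) = Y.la a (φ.f x) := by
  induction a using gr_induction B.gr with
  | h0 => simp
  | hadd a b h h' => simp [h, h']
  | hom j a ha => rw [la_of_mem ha, la_of_mem ha, φ.ra', φ.kos']

end GrMor

namespace Mor

variable (X) in
/-- The identity. -/
def id : Mor X X where
  f := LinearMap.id
  map_gr _ _ h := h
  map_d _ := rfl

/-- Composition of chain maps. -/
def comp (ψ : Mor Y Z) (φ : Mor X Y) : Mor X Z where
  f := ψ.f.comp φ.f
  map_gr g x hx := ψ.map_gr g _ (φ.map_gr g x hx)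
  map_d x := by simp [φ.map_d, ψ.map_d]

/-- A chain map from an additive map commuting with all the structure. -/
def ofAdd (F : X.X →+ Y.X) (hr : ∀ a x, F (X.ra a x) = Y.ra a (F x))
    (hs : ∀ x, F (X.sm x) = Y.sm (F x)) (hg : ∀ g, ∀ x ∈ X.gr g, F x ∈ Y.gr g)
    (hd : ∀ x, F (X.d x) = Y.d (F x)) : Mor X Y where
  f := { F with
    map_smul' := fun γ x => by
      obtain ⟨γ, rfl⟩ := MulOpposite.op_surjective γ
      change F (op γ • x) = op γ • F x
      rw [smul_eq, smul_eq, map_add, hr, hr, hs] }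
  map_gr := hg
  map_d := hd

/-- The tensor product of two chain maps, on underlying groups. -/
def tmap (φ : Mor X X') (ψ : Mor Y Y') : TC X Y →+ TC X' Y' :=
  tlift ((tm.comp φ.f.toAddMonoidHom).compl₂ ψ.f.toAddMonoidHom)
    (fun g h j x hx a ha y hy => by
      simp only [AddMonoidHom.comp_apply, AddMonoidHom.compl₂_apply,
        LinearMap.toAddMonoidHom_coe, φ.ra', ψ.ra']
      exact tm_balanced g h j _ (φ.map_gr g x hx) a ha _ (ψ.map_gr h y hy))

lemma tmap_tm (φ : Mor X X') (ψ : Mor Y Y') (x : X.X) (y : Y.X) :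
    tmap φ ψ (tm x y) = tm (φ.f x) (ψ.f y) := rfl

/-- The tensor product of two chain maps. -/
def tensor (φ : Mor X X') (ψ : Mor Y Y') : Mor (X.tensor Y) (X'.tensor Y') :=
  ofAdd (X := X.tensor Y) (Y := X'.tensor Y') (tmap φ ψ)
    (fun a (z : TC X Y) => by
      rw [tensor_ra, tensor_ra]
      induction z using T_induction with
      | htm g h x hx y hy => simp only [rT_tm, tmap_tm, ψ.ra']
      | hadd z w hz hw => simp only [map_add, hz, hw])
    (fun (z : TC X Y) => by
      rw [tensor_sm, tensor_sm]
      induction z using T_induction with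
      | htm g h x hx y hy => simp only [sT_tm, map_add, tmap_tm, ψ.sm', φ.sm', ψ.kos']
      | hadd z w hz hw => simp only [map_add, hz, hw])
    (fun g z hz => grT_le (fun h h' e x hx y hy => by
      rw [← e]; exact tm_mem (φ.map_gr h x hx) (ψ.map_gr h' y hy)) z hz)
    (fun (z : TC X Y) => by
      rw [tensor_d, tensor_d]
      induction z using T_induction with
      | htm g h x hx y hy => simp only [dT_tm, map_add, tmap_tm, φ.map_d, ψ.map_d, φ.kos']
      | hadd z w hz hw => simp only [map_add, hz, hw])

/-- The map `f ↦ ψ ∘ f ∘ φ` between internal `Hom`s, on underlying groups. -/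
def hmap (φ : Mor X' X) (ψ : Mor Y Y') : homAll X Y →+ homAll X' Y' :=
  hres ((AddMonoidHom.compHom ψ.f.toAddMonoidHom).comp
      (AddMonoidHom.compHom.flip φ.f.toAddMonoidHom))
    (fun g _ hf => homDeg_le g
      ⟨fun a x => (congrArg (fun y => ψ.f y)
          ((congrArg _ (φ.ra' a x)).trans (hf.1 a _))).trans (ψ.ra' a _),
      fun _ _ hx => ψ.map_gr _ _ (hf.2 _ _ (φ.map_gr _ _ hx))⟩)

lemma hmap_apply (φ : Mor X' X) (ψ : Mor Y Y') (f : homAll X Y) (x : X'.X) :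
    (hmap φ ψ f).1 x = ψ.f (f.1 (φ.f x)) := rfl

/-- The chain map `f ↦ ψ ∘ f ∘ φ` between internal `Hom`s. -/
def ihom (φ : Mor X' X) (ψ : Mor Y Y') : Mor (X.ihom Y) (X'.ihom Y') :=
  ofAdd (X := X.ihom Y) (Y := X'.ihom Y') (hmap φ ψ)
    (fun a (f : homAll X Y) => by
      rw [ihom_ra, ihom_ra]
      exact H_ext fun x => by simp only [rH_apply, hmap_apply, φ.la'])
    (fun (f : homAll X Y) => by
      rw [ihom_sm, ihom_sm]
      exact H_ext fun x => by simp only [sH_apply, hmap_apply, map_sub, ψ.sm', φ.sm', φ.kos'])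
    (fun g f hf => ⟨fun a x => (congrArg (fun y => ψ.f y)
          ((congrArg _ (φ.ra' a x)).trans (hf.1 a _))).trans (ψ.ra' a _),
        fun h x hx => ψ.map_gr _ _ (hf.2 _ _ (φ.map_gr _ _ hx))⟩)
    (fun (f : homAll X Y) => by
      rw [ihom_d, ihom_d]
      exact H_ext fun x => by
        simp only [dH_apply, hmap_apply, map_sub, ψ.map_d, φ.kos', φ.map_d, ψ.kos'])

end Mor

/-- The mapping cone of a chain map: `X_{n-1} ⊕ Y_n` in homological degree `n`, with boundary
`(x, y) ↦ (-d x, d y + φ x)`. -/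
abbrev cone (φ : Mor X Y) : Cx B where
  X := X.X × Y.X
  gr g := (X.gr (g + (-1, 0))).prod (Y.gr g)
  internal := by
    refine isInternal_of_detect (W := fun _ => X.X × Y.X) ?_
      (fun g => (gproj X.gr (g + (-1, 0))).prodMap (gproj Y.gr g)) ?_ ?_
    · rw [eq_top_iff]
      rintro ⟨x, y⟩ -
      rw [← Prod.fst_add_snd (x, y)]
      refine add_mem ?_ ?_
      · induction x using gr_induction X.gr with
        | h0 => exact zero_mem _
        | hom g x hx =>
          refine AddSubgroup.mem_iSup_of_mem (g + (1, 0)) ⟨?_, zero_mem _⟩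
          have e : g + (1, 0) + (-1, 0) = g := by ext <;> simp
          rw [e]; exact hx
        | hadd x x' h h' => simpa using add_mem h h'
      · induction y using gr_induction Y.gr with
        | h0 => exact zero_mem _
        | hom g y hy => exact AddSubgroup.mem_iSup_of_mem g ⟨zero_mem _, hy⟩
        | hadd y y' h h' => simpa using add_mem h h'
    · rintro g h hgh ⟨x, y⟩ ⟨hx, hy⟩
      refine Prod.ext ?_ ?_
      · exact gproj_ne X.gr hx fun e => hgh (add_right_cancel e).symm
      · exact gproj_ne Y.gr hy (Ne.symm hgh)
    · rintro g ⟨x, y⟩ ⟨hx, hy⟩ h0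
      have h1 := congrArg Prod.fst h0
      have h2 := congrArg Prod.snd h0
      exact Prod.ext ((gproj_same X.gr hx).symm.trans h1) ((gproj_same Y.gr hy).symm.trans h2)
  smul_mem g j x γ hx hγ :=
    ⟨by rw [add_right_comm]; exact X.smul_mem _ _ _ _ hx.1 hγ, Y.smul_mem _ _ _ _ hx.2 hγ⟩
  d := (-(X.d.comp (LinearMap.fst _ _ _))).prod
    (Y.d.comp (LinearMap.snd _ _ _) + φ.f.comp (LinearMap.fst _ _ _))
  d_mem g x hx := by
    refine ⟨(X.gr _).neg_mem ?_, (Y.gr _).add_mem (Y.d_mem _ _ hx.2) (φ.map_gr _ _ hx.1)⟩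
    rw [add_right_comm]; exact X.d_mem _ _ hx.1
  d_d x := by simp [d_d, φ.map_d]

end Cx

namespace Cx

variable {B : EtaRing.{u}} {X Y X' Y' : Cx B}

lemma sg_cases (n : ℤ) : sg n = 1 ∨ sg n = -1 := by
  rcases Int.even_or_odd n with h | h
  · left; simp [sg, Int.negOnePow_even n h]
  · right; simp [sg, Int.negOnePow_odd n h]

/-! ### The pairing `α : Hom(X, Y) ⊗ Hom(X', Y') → Hom(X ⊗ X', Y ⊗ Y')` -/

section alpha

lemma grH_map {f : homAll X Y} {e h : ℤ × ℤ} (hf : f ∈ grH X Y e) {x : X.X} (hx : x ∈ X.gr h) :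
    f.1 x ∈ Y.gr (e + h) := hf.2 h x hx

lemma sH_grH {f : homAll X Y} {e : ℤ × ℤ} (hf : f ∈ grH X Y e) :
    sH X Y f ∈ grH X Y (e + (0, 1)) := sH_mem hf

lemma dH_grH {f : homAll X Y} {e : ℤ × ℤ} (hf : f ∈ grH X Y e) :
    dH X Y f ∈ grH X Y (e + (-1, 0)) := dH_mem hf

lemma rH_grH {f : homAll X Y} {e : ℤ × ℤ} {j : ℤ} {a : B.k} (hf : f ∈ grH X Y e)
    (ha : a ∈ B.gr j) : rH X Y a f ∈ grH X Y (e + (0, j)) := map_la_mem ha hf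

lemma kos_grH {f : homAll X Y} {e : ℤ × ℤ} (hf : f ∈ grH X Y e) (j : ℤ) (x : X.X) :
    Y.kos j (f.1 (X.kos j x)) = sg (j * tot e) • f.1 x := kos_map_kos j hf x

/-- The biadditive map `(x, x') ↦ (-1)^(‖g‖ ‖x‖) f x ⊗ g x'`. -/
def alB (f : homAll X Y) (g : homAll X' Y') : X.X →+ X'.X →+ TC Y Y' :=
  glift X.gr (fun h => (AddMonoidHom.compHom.flip ((ihom X' Y').kos (tot h) g).1).comp
    ((tm.comp f.1).comp (X.gr h).subtype))

lemma alB_of_mem (f : homAll X Y) {g : homAll X' Y'} {e h : ℤ × ℤ} (hg : g ∈ grH X' Y' e)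
    {x : X.X} (hx : x ∈ X.gr h) (x' : X'.X) :
    alB f g x x' = sg (tot h * tot e) • (tm (f.1 x) (g.1 x') : TC Y Y') := by
  rw [alB, glift_of_mem X.gr _ hx]
  change tm (f.1 x) (((ihom X' Y').kos (tot h) g).1 x') = _
  rw [kos_of_mem (X := ihom X' Y') (tot h) hg]
  exact map_zsmul _ _ _

lemma alB_add_left (f f' : homAll X Y) (g : homAll X' Y') :
    alB (f + f') g = alB f g + alB f' g := by
  refine gr_ext X.gr fun h x hx => AddMonoidHom.ext fun x' => ?_
  simp only [alB, AddMonoidHom.add_apply]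
  rw [glift_of_mem X.gr _ hx, glift_of_mem X.gr _ hx, glift_of_mem X.gr _ hx]
  change tm (f.1 x + f'.1 x) _ = tm (f.1 x) _ + tm (f'.1 x) _
  rw [map_add]; rfl

lemma alB_add_right (f : homAll X Y) (g g' : homAll X' Y') :
    alB f (g + g') = alB f g + alB f g' := by
  refine gr_ext X.gr fun h x hx => AddMonoidHom.ext fun x' => ?_
  simp only [alB, AddMonoidHom.add_apply]
  rw [glift_of_mem X.gr _ hx, glift_of_mem X.gr _ hx, glift_of_mem X.gr _ hx]
  change tm (f.1 x) (((ihom X' Y').kos (tot h) (g + g')).1 x') = _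
  rw [map_add]
  exact map_add (tm (f.1 x)) _ _

lemma alB_balanced (f : homAll X Y) (g : homAll X' Y') : Balanced (alB f g) := by
  induction g using H_induction with
  | hom e g hg =>
    intro h h' j x hx a ha x' hx'
    rw [alB_of_mem f hg (ra_mem hx ha), alB_of_mem f hg hx, map_ra f.2, tm_ra ha,
      kos_of_mem j (grH_map hg hx'), map_zsmul, map_zsmul, ← map_ra g.2, smul_smul, smul_smul]
    congr 1
    simp only [tot_add, tot_zero_mk, mul_add, add_mul, sg_add]
    linear_combination (sg (tot h * tot e) * sg (j * tot h')) * sg_sq (j * tot e)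
  | hadd g g' h1 h2 =>
    intro h h' j x hx a ha x' hx'
    rw [alB_add_right]
    simp only [AddMonoidHom.add_apply, smul_add]
    rw [h1 h h' j x hx a ha x' hx', h2 h h' j x hx a ha x' hx']

/-- The map `x ⊗ x' ↦ (-1)^(‖g‖ ‖x‖) f x ⊗ g x'`. -/
def alT (f : homAll X Y) (g : homAll X' Y') : TC X X' →+ TC Y Y' :=
  tlift (alB f g) (alB_balanced f g)

lemma alT_tm (f : homAll X Y) {g : homAll X' Y'} {e h : ℤ × ℤ} (hg : g ∈ grH X' Y' e)
    {x : X.X} (hx : x ∈ X.gr h) (x' : X'.X) :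
    alT f g (tm x x') = sg (tot h * tot e) • tm (f.1 x) (g.1 x') :=
  alB_of_mem f hg hx x'

lemma alT_add_left (f f' : homAll X Y) (g : homAll X' Y') :
    alT (f + f') g = alT f g + alT f' g :=
  T_ext fun _ _ x _ x' _ => by
    simp only [alT, tlift_tm, AddMonoidHom.add_apply, alB_add_left]

lemma alT_add_right (f : homAll X Y) (g g' : homAll X' Y') :
    alT f (g + g') = alT f g + alT f g' :=
  T_ext fun _ _ x _ x' _ => by
    simp only [alT, tlift_tm, AddMonoidHom.add_apply, alB_add_right]

lemma alT_homDeg {f : homAll X Y} {g : homAll X' Y'} {e e' : ℤ × ℤ} (hf : f ∈ grH X Y e)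
    (hg : g ∈ grH X' Y' e') : alT f g ∈ homDeg (tensor X X') (tensor Y Y') (e + e') := by
  refine ⟨fun a (z : TC X X') => ?_, fun i z hz => grT_le (fun h h' hi x hx x' hx' => ?_) z hz⟩
  · rw [tensor_ra, tensor_ra]
    induction z using T_induction with
    | htm h h' x hx x' hx' =>
      rw [rT_tm, alT_tm f hg hx, alT_tm f hg hx, map_ra g.2, map_zsmul, rT_tm]
    | hadd z w hz hw => simp only [map_add, hz, hw]
  · rw [alT_tm f hg hx, ← hi, add_add_add_comm]
    exact zsmul_mem (tm_mem (grH_map hf hx) (grH_map hg hx')) _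

lemma alT_mem (f : homAll X Y) (g : homAll X' Y') :
    alT f g ∈ homAll (tensor X X') (tensor Y Y') := by
  induction f using H_induction with
  | hom e f hf =>
    induction g using H_induction with
    | hom e' g hg => exact homDeg_le _ (alT_homDeg hf hg)
    | hadd g g' h h' => rw [alT_add_right]; exact add_mem h h'
  | hadd f f' h h' => rw [alT_add_left]; exact add_mem h h'

/-- `α` as a biadditive map. -/
def alH : homAll X Y →+ homAll X' Y' →+ homAll (tensor X X') (tensor Y Y') :=
  AddMonoidHom.mk' (fun f => AddMonoidHom.mk' (fun g => ⟨alT f g, alT_mem f g⟩)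
      (fun g g' => Subtype.ext (alT_add_right f g g')))
    (fun f f' => AddMonoidHom.ext fun g => Subtype.ext (alT_add_left f f' g))

lemma alH_tm (f : homAll X Y) {g : homAll X' Y'} {e h : ℤ × ℤ} (hg : g ∈ grH X' Y' e)
    {x : X.X} (hx : x ∈ X.gr h) (x' : X'.X) :
    (alH f g).1 (tm x x' : TC X X')
      = sg (tot h * tot e) • (tm (f.1 x) (g.1 x') : TC Y Y') :=
  alB_of_mem f hg hx x'

lemma alH_grH {f : homAll X Y} {g : homAll X' Y'} {e e' : ℤ × ℤ} (hf : f ∈ grH X Y e)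
    (hg : g ∈ grH X' Y' e') : alH f g ∈ grH (tensor X X') (tensor Y Y') (e + e') :=
  alT_homDeg hf hg

lemma HT_ext {F F' : homAll (tensor X X') (tensor Y Y')}
    (h : ∀ i i', ∀ x ∈ X.gr i, ∀ x' ∈ X'.gr i',
      F.1 (tm x x' : TC X X') = F'.1 (tm x x' : TC X X')) : F = F' :=
  Subtype.ext (T_ext h)

lemma alH_balanced : Balanced (X := ihom X Y) (Y := ihom X' Y') alH := by
  intro e e' j (f : homAll X Y) hf a ha (g : homAll X' Y') hg
  rw [ihom_ra, ihom_ra]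
  refine HT_ext fun h h' x hx x' hx' => ?_
  rw [alH_tm _ hg hx]
  change _ = sg _ • (alH f (rH X' Y' a g)).1 (tm x x' : TC X X')
  rw [alH_tm _ (rH_grH hg ha) hx, rH_apply, rH_apply, la_of_mem ha, la_of_mem ha,
    kos_of_mem j hx, kos_of_mem j hx', map_zsmul, map_zsmul, map_zsmul, map_zsmul, map_ra f.2,
    map_zsmul, map_ra g.2, AddMonoidHom.zsmul_apply, tm_ra ha, kos_of_mem j (grH_map hg hx'),
    map_zsmul, map_zsmul]
  simp only [map_zsmul, smul_smul]
  congr 1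
  simp only [tot_add, tot_zero_mk, mul_add, add_mul, sg_add, mul_comm j]
  ring

/-- The chain map `α : Hom(X, Y) ⊗ Hom(X', Y') → Hom(X ⊗ X', Y ⊗ Y')`, given by
`α(f ⊗ g)(x ⊗ x') = (-1)^(‖g‖ ‖x‖) f x ⊗ g x'`. -/
def alpha (X Y X' Y' : Cx B) :
    Mor (tensor (ihom X Y) (ihom X' Y')) (ihom (tensor X X') (tensor Y Y')) :=
  Mor.ofAdd (X := tensor (ihom X Y) (ihom X' Y')) (Y := ihom (tensor X X') (tensor Y Y'))
    (tlift (X := ihom X Y) (Y := ihom X' Y') alH alH_balanced)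
    (fun a (z : TC (ihom X Y) (ihom X' Y')) => by
      rw [tensor_ra, ihom_ra]
      induction z using T_induction with
      | hadd z w hz hw => simp only [map_add, hz, hw]
      | htm e e' f hf g hg =>
        rw [rT_tm, tlift_tm, tlift_tm, ihom_ra]
        refine HT_ext fun h h' x hx x' hx' => ?_
        rw [rH_apply]
        induction a using gr_induction B.gr with
        | h0 => simp
        | hadd a b h1 h2 =>
          simp only [map_add, AddMonoidHom.add_apply] at h1 h2 ⊢
          rw [← h1, ← h2]; rfl
        | hom j a ha =>
          rw [alH_tm _ (rH_grH hg ha) hx, la_of_mem (X := tensor X X') ha,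
            kos_of_mem (X := tensor X X') j (tm_mem hx hx'), map_zsmul, map_zsmul, tensor_ra,
            rT_tm, alH_tm _ hg hx, rH_apply, la_of_mem ha, kos_of_mem j hx', map_zsmul, map_zsmul,
            map_zsmul]
          simp only [smul_smul]
          congr 1
          simp only [tot_add, tot_zero_mk, mul_add, add_mul, sg_add, mul_comm j]
          ring)
    (fun (z : TC (ihom X Y) (ihom X' Y')) => by
      rw [tensor_sm, ihom_sm]
      induction z using T_induction with
      | hadd z w hz hw => simp only [map_add, hz, hw]
      | htm e e' f hf g hg =>
        rw [sT_tm, map_add, tlift_tm, tlift_tm, tlift_tm, ihom_sm, ihom_sm,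
          kos_of_mem (X := ihom X' Y') 1 hg, map_zsmul]
        refine HT_ext fun h h' x hx x' hx' => ?_
        change (alH f (sH X' Y' g)).1 (tm x x' : TC X X')
          + sg (1 * tot e') • (alH (sH X Y f) g).1 (tm x x' : TC X X') = _
        rw [alH_tm _ (sH_grH hg) hx, alH_tm _ hg hx, sH_apply, sH_apply, sH_apply,
          kos_of_mem (X := tensor X X') 1 (tm_mem hx hx'), map_zsmul, map_zsmul, map_zsmul,
          map_zsmul, tensor_sm, tensor_sm, sT_tm, map_add, alH_tm _ hg hx, map_zsmul, sT_tm,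
          kos_of_mem 1 (grH_map hg hx'), kos_of_mem 1 hx, kos_of_mem 1 hx', alH_tm _ hg hx,
          alH_tm _ hg (sm_mem hx)]
        simp only [map_zsmul, map_sub, AddMonoidHom.sub_apply, AddMonoidHom.zsmul_apply, tot_add,
          tot_zero_mk, mul_add, add_mul, sg_add, one_mul, mul_one]
        rcases sg_cases (tot h) with h1 | h1 <;> rcases sg_cases (tot h') with h2 | h2 <;>
        rcases sg_cases (tot e') with h3 | h3 <;> simp only [h1, h2, h3] <;> module)
    (fun g z hz => grT_le (X := ihom X Y) (Y := ihom X' Y') (S := grH (tensor X X') (tensor Y Y') g)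
      (fun e e' he f hf f' hf' => by rw [← he]; exact alT_homDeg hf hf') z hz)
    (fun (z : TC (ihom X Y) (ihom X' Y')) => by
      rw [tensor_d, ihom_d]
      induction z using T_induction with
      | hadd z w hz hw => simp only [map_add, hz, hw]
      | htm e e' f hf g hg =>
        rw [dT_tm, map_add, tlift_tm, tlift_tm, tlift_tm, ihom_d, ihom_d,
          kos_of_mem (X := ihom X Y) 1 hf, map_zsmul]
        refine HT_ext fun h h' x hx x' hx' => ?_
        change (alH (dH X Y f) g).1 (tm x x' : TC X X')
          + sg (1 * tot e) • (alH f (dH X' Y' g)).1 (tm x x' : TC X X') = _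
        have hd : (tensor X X').d (tm x x' : TC X X') ∈ (tensor X X').gr (h + h' + (-1, 0)) :=
          (tensor X X').d_mem _ _ (tm_mem hx hx')
        rw [alH_tm _ (dH_grH hg) hx, alH_tm _ hg hx, dH_apply, dH_apply, dH_apply,
          kos_grH hf 1, kos_grH hg 1, kos_grH (alH_grH hf hg) 1,
          tensor_d, tensor_d, dT_tm, map_add, alH_tm _ hg hx, alH_tm _ hg (X.d_mem _ _ hx),
          kos_of_mem 1 hx, alH_tm _ hg (zsmul_mem hx _), map_zsmul, dT_tm, kos_of_mem 1 (grH_map hf hx)]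
        simp only [map_zsmul, map_sub, AddMonoidHom.sub_apply, AddMonoidHom.zsmul_apply, tot_add,
          tot_mk, mul_add, add_mul, sg_add, one_mul, mul_one, sg_neg, mul_neg, neg_mul]
        rcases sg_cases (tot h) with h1 | h1 <;> rcases sg_cases (tot e) with h2 | h2 <;>
        rcases sg_cases (tot e') with h3 | h3 <;> simp only [h1, h2, h3] <;> simp <;> module)

end alpha

end Cx

namespace Cx

variable {B : EtaRing.{u}} {X Y Z W : Cx B}

/-! ### The interchange of the two middle factors -/

section mid

lemma kos_swap (e : ℤ) (x : X.X) (i : ℤ) : X.kos e (X.kos i x) = X.kos i (X.kos e x) := by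
  induction x using gr_induction X.gr with
  | h0 => simp
  | hadd x y hx hy => simp only [map_add, hx, hy]
  | hom g x hx =>
    simp only [kos_of_mem _ hx, map_zsmul, smul_smul]
    rw [mul_comm]

/-- The map `w ↦ (x ⊗ z) ⊗ (y ⊗ w)`, as a triadditive map of `y`, `z`, `w`, with the sign operator
of index `e` applied to `z`. -/
def md0 (x : X.X) (e : ℤ) : Y.X →+ Z.X →+ W.X →+ TC (tensor X Z) (tensor Y W) :=
  AddMonoidHom.mk' (fun y => AddMonoidHom.mk' (fun z =>
      (tm (X := tensor X Z) (Y := tensor Y W) (tm x (Z.kos e z))).comp (tm y))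
    (fun z z' => by simp only [map_add]; rfl))
    (fun y y' => by
      ext z w
      change tm (X := tensor X Z) (Y := tensor Y W) _ (tm (y + y') w)
        = tm (X := tensor X Z) (Y := tensor Y W) _ (tm y w)
          + tm (X := tensor X Z) (Y := tensor Y W) _ (tm y' w)
      rw [map_add, AddMonoidHom.add_apply]
      exact map_add _ _ _)

/-- The map `y ↦ z ↦ w ↦ (-1)^(‖y‖ ‖z‖) (x ⊗ z) ⊗ (y ⊗ w)`. -/
def md1 (x : X.X) : Y.X →+ Z.X →+ W.X →+ TC (tensor X Z) (tensor Y W) :=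
  glift Y.gr (fun h => (md0 x (tot h)).comp (Y.gr h).subtype)

/-- The element `(x ⊗ z) ⊗ (y ⊗ w)`. -/
abbrev tm4 (x : X.X) (z : Z.X) (y : Y.X) (w : W.X) : TC (tensor X Z) (tensor Y W) :=
  tm (X := tensor X Z) (Y := tensor Y W) (tm x z) (tm y w)

lemma md1_of_mem (x : X.X) {h i : ℤ × ℤ} {y : Y.X} (hy : y ∈ Y.gr h) {z : Z.X}
    (hz : z ∈ Z.gr i) (w : W.X) :
    md1 x y z w = sg (tot h * tot i) • tm4 x z y w := by
  rw [md1, glift_of_mem Y.gr _ hy]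
  change tm (X := tensor X Z) (Y := tensor Y W) (tm x (Z.kos (tot h) z)) (tm y w) = _
  rw [kos_of_mem _ hz, map_zsmul (tm x)]
  exact DFunLike.congr_fun (map_zsmul (tm (X := tensor X Z) (Y := tensor Y W)) _ _) _

lemma tm4_add_left (x x' : X.X) (z : Z.X) (y : Y.X) (w : W.X) :
    tm4 (x + x') z y w = tm4 x z y w + tm4 x' z y w := by
  simp only [tm4]
  rw [map_add, AddMonoidHom.add_apply]
  exact DFunLike.congr_fun (map_add (tm (X := tensor X Z) (Y := tensor Y W)) _ _) _

lemma tm4_zsmul₁ (n : ℤ) (x : X.X) (z : Z.X) (y : Y.X) (w : W.X) :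
    tm4 (n • x) z y w = n • tm4 x z y w := by
  simp only [tm4]
  rw [map_zsmul, AddMonoidHom.zsmul_apply]
  exact DFunLike.congr_fun (map_zsmul (tm (X := tensor X Z) (Y := tensor Y W)) _ _) _

lemma tm4_zsmul₂ (n : ℤ) (x : X.X) (z : Z.X) (y : Y.X) (w : W.X) :
    tm4 x (n • z) y w = n • tm4 x z y w := by
  simp only [tm4]
  rw [map_zsmul]
  exact DFunLike.congr_fun (map_zsmul (tm (X := tensor X Z) (Y := tensor Y W)) _ _) _

lemma tm4_zsmul₃ (n : ℤ) (x : X.X) (z : Z.X) (y : Y.X) (w : W.X) :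
    tm4 x z (n • y) w = n • tm4 x z y w := by
  simp only [tm4]
  rw [map_zsmul, AddMonoidHom.zsmul_apply]
  exact map_zsmul (tm (X := tensor X Z) (Y := tensor Y W) (tm x z)) _ _

lemma tm4_zsmul₄ (n : ℤ) (x : X.X) (z : Z.X) (y : Y.X) (w : W.X) :
    tm4 x z y (n • w) = n • tm4 x z y w := by
  simp only [tm4]
  rw [map_zsmul]
  exact map_zsmul (tm (X := tensor X Z) (Y := tensor Y W) (tm x z)) _ _

lemma tm4_ra₃ {i : ℤ × ℤ} {j : ℤ} {a : B.k} (ha : a ∈ B.gr j) (x : X.X) (z : Z.X) (y : Y.X)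
    {w : W.X} (hw : w ∈ W.gr i) :
    tm4 x z (Y.ra a y) w = sg (j * tot i) • tm4 x z y (W.ra a w) := by
  rw [tm4, tm_ra ha, kos_of_mem j hw, map_zsmul]
  exact tm4_zsmul₄ _ _ _ _ _

lemma tm4_ra₂ {h i : ℤ × ℤ} {j : ℤ} {a : B.k} (ha : a ∈ B.gr j) (x : X.X) (z : Z.X)
    {y : Y.X} (hy : y ∈ Y.gr h) {w : W.X} (hw : w ∈ W.gr i) :
    tm4 x (Z.ra a z) y w = sg (j * tot (h + i)) • tm4 x z y (W.ra a w) := by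
  have h1 := tm_ra (X := tensor X Z) (Y := tensor Y W) ha (tm x z) (tm y w)
  rw [tensor_ra, rT_tm, kos_of_mem (X := tensor Y W) j (tm_mem hy hw), map_zsmul,
    tensor_ra, rT_tm] at h1
  exact h1.trans (map_zsmul (tm (X := tensor X Z) (Y := tensor Y W) (tm x z)) _ _)

lemma tm4_ra₁ {h h' i : ℤ × ℤ} {j : ℤ} {a : B.k} (ha : a ∈ B.gr j) (x : X.X) {z : Z.X}
    (hz : z ∈ Z.gr h') {y : Y.X} (hy : y ∈ Y.gr h) {w : W.X} (hw : w ∈ W.gr i) :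
    tm4 (X.ra a x) z y w = sg (j * tot (h' + h + i)) • tm4 x z y (W.ra a w) := by
  rw [tm4, tm_ra ha, kos_of_mem j hz, map_zsmul]
  refine (tm4_zsmul₂ (sg (j * tot h')) x (Z.ra a z) y w).trans ?_
  rw [tm4_ra₂ ha x z hy hw, smul_smul, ← sg_add]
  congr 2
  simp only [tot_add]; ring

lemma md1_balanced (x : X.X) (y : Y.X) : Balanced (md1 (Z := Z) (W := W) x y) := by
  intro i i' j z hz a ha w hw
  induction y using gr_induction Y.gr with
  | h0 => simp
  | hadd y y' h h' => simp only [map_add, AddMonoidHom.add_apply, h, h', smul_add]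
  | hom h y hy =>
    rw [md1_of_mem x hy (ra_mem hz ha), md1_of_mem x hy hz, tm4_ra₂ ha x z hy hw, smul_smul,
      smul_smul]
    congr 1
    simp only [tot_add, tot_zero_mk, mul_add, add_mul, sg_add, mul_comm j]
    linear_combination (sg (tot h * tot i) * sg (tot i' * j)) * sg_sq (tot h * j)

/-- The map `(x, y) ↦ (z ⊗ w ↦ (-1)^(‖y‖ ‖z‖) (x ⊗ z) ⊗ (y ⊗ w))`. -/
def md2 : X.X →+ Y.X →+ TC Z W →+ TC (tensor X Z) (tensor Y W) :=
  AddMonoidHom.mk' (fun x => AddMonoidHom.mk' (fun y => tlift (md1 x y) (md1_balanced x y))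
      (fun y y' => T_ext fun _ _ z _ w _ => by
        simp only [tlift_tm, map_add, AddMonoidHom.add_apply]))
    (fun x x' => gr_ext Y.gr fun h y hy => T_ext fun i i' z hz w hw => by
      change md1 (x + x') y z w = md1 x y z w + md1 x' y z w
      rw [md1_of_mem _ hy hz, md1_of_mem _ hy hz, md1_of_mem _ hy hz, tm4_add_left, smul_add])

lemma md2_tm (x : X.X) {h i : ℤ × ℤ} {y : Y.X} (hy : y ∈ Y.gr h) {z : Z.X}
    (hz : z ∈ Z.gr i) (w : W.X) :
    md2 x y (tm z w) = sg (tot h * tot i) • tm4 x z y w := md1_of_mem x hy hz w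

lemma md2_balanced : Balanced (md2 (X := X) (Y := Y) (Z := Z) (W := W)) := by
  intro g h j x hx a ha y hy
  refine T_ext fun i i' z hz w hw => ?_
  rw [AddMonoidHom.zsmul_apply, md2_tm _ hy hz, md2_tm _ (ra_mem hy ha) hz,
    tm4_ra₁ ha x hz hy hw, tm4_ra₃ ha x z y hw]
  simp only [smul_smul]
  congr 1
  simp only [tot_add, tot_zero_mk, add_mul, sg_add, mul_comm j]
  ring

/-- The map `(x ⊗ y, z ⊗ w) ↦ (-1)^(‖y‖ ‖z‖) (x ⊗ z) ⊗ (y ⊗ w)`. -/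
def md3 : TC X Y →+ TC Z W →+ TC (tensor X Z) (tensor Y W) := tlift md2 md2_balanced

lemma md3_tm (x : X.X) {h i : ℤ × ℤ} {y : Y.X} (hy : y ∈ Y.gr h) {z : Z.X}
    (hz : z ∈ Z.gr i) (w : W.X) :
    md3 (tm x y) (tm z w) = sg (tot h * tot i) • tm4 x z y w := md1_of_mem x hy hz w

lemma tm_gr_induction {g : ℤ × ℤ} {p : TC X Y → Prop} (h0 : p 0)
    (htm : ∀ h h' : ℤ × ℤ, h + h' = g → ∀ x ∈ X.gr h, ∀ y ∈ Y.gr h', p (tm x y))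
    (hadd : ∀ z w, p z → p w → p (z + w)) (hneg : ∀ z, p z → p (-z)) {z : TC X Y}
    (hz : z ∈ grT X Y g) : p z := by
  refine AddSubgroup.closure_induction (p := fun z _ => p z) ?_ h0 (fun z w _ _ => hadd z w)
    (fun z _ => hneg z) hz
  rintro _ ⟨h, h', e, x, hx, y, hy, rfl⟩
  exact htm h h' e x hx y hy

lemma md3_balanced : Balanced (X := tensor X Y) (Y := tensor Z W) md3 := by
  intro g h j u hu a ha v hv
  rw [tensor_ra, tensor_ra]
  refine tm_gr_induction (p := fun u => md3 (rT X Y a u) v = sg (j * tot h) • md3 u (rT Z W a v))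
    (by simp) (fun g1 g2 hg x hx y hy => ?_) (fun u u' e e' => ?_) (fun u e => ?_) hu
  · refine tm_gr_induction (p := fun v => md3 (rT X Y a (tm x y)) v
      = sg (j * tot h) • md3 (tm x y) (rT Z W a v))
      (by simp) (fun h1 h2 hh z hz w hw => ?_) (fun u u' e e' => ?_) (fun u e => ?_) hv
    · rw [rT_tm, rT_tm, md3_tm _ (ra_mem hy ha) hz, md3_tm _ hy hz, tm4_ra₃ ha x z y hw, ← hh]
      simp only [smul_smul]
      congr 1
      simp only [tot_add, tot_zero_mk, add_mul, sg_add, mul_comm j]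
      ring
    · simp only [map_add, e, e', smul_add]
    · simp only [map_neg, e, smul_neg]
  · simp only [map_add, AddMonoidHom.add_apply, e, e', smul_add]
  · simp only [map_neg, AddMonoidHom.neg_apply, e, smul_neg]

/-- The underlying additive map of `mid`. -/
def midT : TC (tensor X Y) (tensor Z W) →+ TC (tensor X Z) (tensor Y W) :=
  tlift (X := tensor X Y) (Y := tensor Z W) md3 md3_balanced

lemma midT_tm4 (x : X.X) {h i : ℤ × ℤ} {y : Y.X} (hy : y ∈ Y.gr h) {z : Z.X}
    (hz : z ∈ Z.gr i) (w : W.X) :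
    midT (tm4 x y z w) = sg (tot h * tot i) • tm4 x z y w := md1_of_mem x hy hz w

lemma T4_induction {p : TC (tensor X Y) (tensor Z W) → Prop}
    (htm : ∀ e f g h, ∀ x ∈ X.gr e, ∀ y ∈ Y.gr f, ∀ z ∈ Z.gr g, ∀ w ∈ W.gr h, p (tm4 x y z w))
    (hadd : ∀ z w, p z → p w → p (z + w)) (u : TC (tensor X Y) (tensor Z W)) : p u := by
  induction u using T_induction with
  | hadd z w hz hw => exact hadd z w hz hw
  | htm _ _ u _ v _ =>
    refine T_induction (X := X) (Y := Y)
      (p := fun u => p (tm (X := tensor X Y) (Y := tensor Z W) u v)) ?_ ?_ u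
    · intro e f x hx y hy
      refine T_induction (X := Z) (Y := W)
        (p := fun v => p (tm (X := tensor X Y) (Y := tensor Z W) (tm x y) v)) ?_ ?_ v
      · intro g h z hz w hw
        exact htm e f g h x hx y hy z hz w hw
      · intro z w hz hw
        have e := map_add (tm (X := tensor X Y) (Y := tensor Z W) (tm x y)) z w
        exact e ▸ hadd _ _ hz hw
    · intro z w hz hw
      have e := DFunLike.congr_fun (map_add (tm (X := tensor X Y) (Y := tensor Z W)) z w) v
      exact e ▸ hadd _ _ hz hw

lemma T4_ra (a : B.k) (x : X.X) (y : Y.X) (z : Z.X) (w : W.X) :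
    rT (tensor X Y) (tensor Z W) a (tm4 x y z w) = tm4 x y z (W.ra a w) := by
  rw [rT_tm, tensor_ra, rT_tm]

lemma tm_lin_left (n : ℤ) (x x' : X.X) (y : Y.X) :
    tm (x + n • x') y = (tm x y + n • tm x' y : TC X Y) := by
  rw [map_add, map_zsmul]; rfl

lemma tm_lin_right (n : ℤ) (x : X.X) (y y' : Y.X) :
    tm x (y + n • y') = (tm x y + n • tm x y' : TC X Y) := by
  rw [map_add, map_zsmul]

lemma tm_zsmul_left (n : ℤ) (x : X.X) (y : Y.X) : tm (n • x) y = (n • tm x y : TC X Y) := by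
  rw [map_zsmul]; rfl

lemma T4_sm {f g h : ℤ × ℤ} {x : X.X} {y : Y.X} {z : Z.X} {w : W.X}
    (hy : y ∈ Y.gr f) (hz : z ∈ Z.gr g) (hw : w ∈ W.gr h) :
    sT (tensor X Y) (tensor Z W) (tm4 x y z w) = tm4 x y z (W.sm w)
      + sg (tot h) • tm4 x y (Z.sm z) w + sg (tot g + tot h) • tm4 x (Y.sm y) z w
      + sg (tot f + tot g + tot h) • tm4 (X.sm x) y z w := by
  rw [sT_tm, tensor_sm, tensor_sm, sT_tm, sT_tm, kos_of_mem (X := tensor Z W) 1 (tm_mem hz hw),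
    kos_of_mem 1 hw, kos_of_mem 1 hy, one_mul, one_mul, one_mul, map_zsmul (tm (Z.sm z)),
    map_zsmul (tm (X.sm x))]
  refine (congrArg₂ (· + ·) (tm_lin_right (X := tensor X Y) (Y := tensor Z W) _ _ _ _)
    ((map_zsmul (tm (X := tensor X Y) (Y := tensor Z W) _) _ _).trans (congrArg _
      (tm_lin_left (X := tensor X Y) (Y := tensor Z W) _ _ _ _)))).trans ?_
  change tm4 x y z (W.sm w) + sg (tot h) • tm4 x y (Z.sm z) w
    + sg (tot (g + h)) • (tm4 x (Y.sm y) z w + sg (tot f) • tm4 (X.sm x) y z w) = _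
  simp only [tot_add, sg_add]
  module

lemma T4_d {e f g : ℤ × ℤ} {x : X.X} {y : Y.X} {z : Z.X} {w : W.X} (hx : x ∈ X.gr e)
    (hy : y ∈ Y.gr f) (hz : z ∈ Z.gr g) :
    dT (tensor X Y) (tensor Z W) (tm4 x y z w) = tm4 (X.d x) y z w
      + sg (tot e) • tm4 x (Y.d y) z w + sg (tot e + tot f) • tm4 x y (Z.d z) w
      + sg (tot e + tot f + tot g) • tm4 x y z (W.d w) := by
  rw [dT_tm, tensor_d, tensor_d, dT_tm, dT_tm, kos_of_mem (X := tensor X Y) 1 (tm_mem hx hy),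
    kos_of_mem 1 hx, kos_of_mem 1 hz, one_mul, one_mul, one_mul, tm_zsmul_left (sg (tot e)) x (Y.d y),
    tm_zsmul_left (sg (tot g)) z (W.d w)]
  refine (congrArg₂ (· + ·) (tm_lin_left (X := tensor X Y) (Y := tensor Z W) _ _ _ _)
    ((tm_zsmul_left (X := tensor X Y) (Y := tensor Z W) _ _ _).trans
      (congrArg _ (tm_lin_right (X := tensor X Y) (Y := tensor Z W) _ _ _ _)))).trans ?_
  change tm4 (X.d x) y z w + sg (tot e) • tm4 x (Y.d y) z w
    + sg (tot (e + f)) • (tm4 x y (Z.d z) w + sg (tot g) • tm4 x y z (W.d w)) = _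
  simp only [tot_add, sg_add]
  module

/-- The chain map interchanging the two middle factors,
`(x ⊗ y) ⊗ (z ⊗ w) ↦ (-1)^(‖y‖ ‖z‖) (x ⊗ z) ⊗ (y ⊗ w)`. -/
def mid (X Y Z W : Cx B) :
    Mor (tensor (tensor X Y) (tensor Z W)) (tensor (tensor X Z) (tensor Y W)) :=
  Mor.ofAdd (X := tensor (tensor X Y) (tensor Z W)) (Y := tensor (tensor X Z) (tensor Y W)) midT
    (fun a (u : TC (tensor X Y) (tensor Z W)) => by
      rw [tensor_ra, tensor_ra]
      induction u using T4_induction with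
      | hadd z w hz hw => simp only [map_add, hz, hw]
      | htm e f g h x hx y hy z hz w hw =>
        rw [T4_ra, midT_tm4 _ hy hz, midT_tm4 _ hy hz, map_zsmul, T4_ra])
    (fun (u : TC (tensor X Y) (tensor Z W)) => by
      rw [tensor_sm, tensor_sm]
      induction u using T4_induction with
      | hadd z w hz hw => simp only [map_add, hz, hw]
      | htm e f g h x hx y hy z hz w hw =>
        rw [T4_sm hy hz hw, midT_tm4 _ hy hz, map_zsmul, T4_sm hz hy hw]
        simp only [map_add, map_zsmul]
        rw [midT_tm4 _ hy hz, midT_tm4 _ hy (sm_mem hz), midT_tm4 _ (sm_mem hy) hz,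
          midT_tm4 _ hy hz]
        simp only [tot_add, tot_zero_mk, mul_add, add_mul, sg_add, mul_one, one_mul]
        rcases sg_cases (tot f) with h1 | h1 <;> rcases sg_cases (tot g) with h2 | h2 <;>
        rcases sg_cases (tot h) with h3 | h3 <;> simp only [h1, h2, h3] <;> module)
    (fun i u hu => by
      refine grT_le (X := tensor X Y) (Y := tensor Z W) (f := midT)
        (S := grT (tensor X Z) (tensor Y W) i) (fun k l hkl u hu v hv => ?_) u hu
      refine tm_gr_induction (p := fun u => midT (tm (X := tensor X Y) (Y := tensor Z W) u v)
        ∈ grT (tensor X Z) (tensor Y W) i) (by simp)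
        (fun e f hef x hx y hy => ?_) (fun u u' h h' => ?_) (fun u h => ?_) hu
      · refine tm_gr_induction (p := fun v =>
          midT (tm (X := tensor X Y) (Y := tensor Z W) (tm x y) v)
          ∈ grT (tensor X Z) (tensor Y W) i) (by simp)
          (fun g h hgh z hz w hw => ?_) (fun u u' h h' => ?_) (fun u h => ?_) hv
        · change midT (tm4 x y z w) ∈ _
          rw [midT_tm4 _ hy hz, ← hkl, ← hef, ← hgh, add_add_add_comm]
          exact zsmul_mem (tm_mem (X := tensor X Z) (Y := tensor Y W) (tm_mem hx hz)
            (tm_mem hy hw)) _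
        · have := add_mem h h'
          rwa [← map_add, ← map_add] at this
        · have := neg_mem h
          rwa [← map_neg, ← map_neg] at this
      · have := add_mem h h'
        rwa [← map_add, ← AddMonoidHom.add_apply, ← map_add] at this
      · have := neg_mem h
        rwa [← map_neg, ← AddMonoidHom.neg_apply, ← map_neg] at this)
    (fun (u : TC (tensor X Y) (tensor Z W)) => by
      rw [tensor_d, tensor_d]
      induction u using T4_induction with
      | hadd z w hz hw => simp only [map_add, hz, hw]
      | htm e f g h x hx y hy z hz w hw =>
        rw [T4_d hx hy hz, midT_tm4 _ hy hz, map_zsmul, T4_d hx hz hy]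
        simp only [map_add, map_zsmul]
        rw [midT_tm4 _ hy hz, midT_tm4 _ hy (Z.d_mem _ _ hz), midT_tm4 _ (Y.d_mem _ _ hy) hz,
          midT_tm4 _ hy hz]
        simp only [tot_add, tot_mk, mul_add, add_mul, sg_add, mul_one, one_mul, mul_neg, neg_mul,
          sg_neg, add_zero]
        rcases sg_cases (tot f) with h1 | h1 <;> rcases sg_cases (tot g) with h2 | h2 <;>
        rcases sg_cases (tot e) with h3 | h3 <;> simp only [h1, h2, h3] <;> module)

end mid

end Cx

namespace Cx

variable {B : EtaRing.{u}} {X Y Z : Cx B}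

/-! ### Homology of invariants -/

lemma comm_smul (a : B.k) (γ : Gam B) (x : X.X) : op γ • op a • x = op (Gam.ι a * γ) • x := by
  rw [op_smul_eq, ra_def, smul_smul, ← op_mul]

variable (X) in
/-- The invariants `{x | x γ = x ε(γ) for all γ ∈ Γ}` of `X`, a right `k`-module. Evaluation at `1`
identifies `Hom_Γ(k, X)` with it, see `homEquivInv`. -/
def inv : Submodule B.kᵐᵒᵖ X.X where
  carrier := {x | ∀ γ : Gam B, op γ • x = op (Gam.ε γ) • x}
  zero_mem' := fun γ => by simp
  add_mem' hx hy := fun γ => by rw [smul_add, smul_add, hx γ, hy γ]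
  smul_mem' a x hx := fun γ => by
    obtain ⟨a, rfl⟩ := op_surjective a
    rw [comm_smul, hx, smul_smul, ← op_mul, map_mul]
    rfl

lemma mem_inv {x : X.X} : x ∈ X.inv ↔ X.sm x = 0 := by
  constructor
  · intro h
    have := h Gam.s
    rwa [← sm_def, Gam.ε_apply, Gam.s_a, op_zero, zero_smul] at this
  · intro h γ
    rw [smul_eq, h, map_zero, add_zero]; rfl

variable (X) in
/-- Evaluation at `1` identifies the group `Hom_Γ(k, X)` of additive maps `f : k → X` that satisfy
`f(a γ) = f(a) γ`, where `a γ = a ε(γ)`, with the group of invariants. -/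
def homEquivInv :
    {f : B.k →+ X.X // ∀ (a : B.k) (γ : Gam B), f (a * Gam.ε γ) = op γ • f a} ≃ X.inv where
  toFun f := ⟨f.1 1, fun γ => by
    rw [← f.2, op_smul_eq, ra_def, ← f.2]
    rfl⟩
  invFun x := ⟨X.ra.flip x.1, fun a γ => by
    change X.ra (a * γ.a) x.1 = op γ • X.ra a x.1
    rw [smul_eq, sm_ra, mem_inv.1 x.2]
    simp [ra_ra]⟩
  left_inv f := by
    refine Subtype.ext (AddMonoidHom.ext fun a => ?_)
    change op (Gam.ι a) • f.1 1 = f.1 a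
    rw [← f.2]
    exact congrArg f.1 (one_mul a)
  right_inv x := Subtype.ext (ra_one x.1)

variable (X) in
/-- The part of homological degree `n`, the sum over all internal degrees. -/
def deg (n : ℤ) : Submodule B.kᵐᵒᵖ X.X :=
  { (⨆ l : ℤ, X.gr (n, l) : AddSubgroup X.X) with
    smul_mem' := by
      intro a x hx
      obtain ⟨a, rfl⟩ := op_surjective a
      change X.ra a x ∈ (⨆ l : ℤ, X.gr (n, l) : AddSubgroup X.X)
      induction a using gr_induction B.gr with
      | h0 => simp
      | hadd a b h h' => rw [map_add]; exact add_mem h h'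
      | hom j a ha =>
        have hx' : x ∈ (⨆ l : ℤ, X.gr (n, l) : AddSubgroup X.X) := hx
        refine AddSubgroup.iSup_induction (fun l => X.gr (n, l))
          (C := fun x => X.ra a x ∈ (⨆ l : ℤ, X.gr (n, l) : AddSubgroup X.X)) hx' ?_ ?_ ?_
        · intro l x hx
          have := ra_mem hx ha
          rw [Prod.mk_add_mk, add_zero] at this
          exact AddSubgroup.mem_iSup_of_mem (S := fun l => X.gr (n, l)) (l + j) this
        · rw [map_zero]; exact zero_mem _
        · intro x y hx hy
          rw [map_add]; exact add_mem hx hy }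

lemma mem_deg {n l : ℤ} {x : X.X} (hx : x ∈ X.gr (n, l)) : x ∈ X.deg n :=
  AddSubgroup.mem_iSup_of_mem (S := fun l => X.gr (n, l)) l hx

lemma deg_induction {n : ℤ} {p : X.X → Prop} (hom : ∀ l, ∀ x ∈ X.gr (n, l), p x)
    (hadd : ∀ x y, p x → p y → p (x + y)) {x : X.X} (hx : x ∈ X.deg n) : p x :=
  AddSubgroup.iSup_induction (fun l => X.gr (n, l)) (C := p) hx hom
    (hom 0 0 (zero_mem _)) hadd

variable (X) in
/-- The boundary as a right `k`-linear map. -/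
def dk : X.X →ₗ[B.kᵐᵒᵖ] X.X :=
  { X.d with map_smul' := fun _ _ => X.d.map_smul _ _ }

variable (X) in
/-- The `n`-cycles of the complex `Hom_Γ(k, X)`. -/
def cyc (n : ℤ) : Submodule B.kᵐᵒᵖ X.X := X.inv ⊓ X.deg n ⊓ LinearMap.ker X.dk

variable (X) in
/-- The `n`-boundaries of the complex `Hom_Γ(k, X)`. -/
def bdry (n : ℤ) : Submodule B.kᵐᵒᵖ X.X := (X.inv ⊓ X.deg (n + 1)).map X.dk

variable (X) in
/-- The homology `H_n(Hom_Γ(k, X))`, a right `k`-module. -/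
abbrev Hinv (n : ℤ) : Type u := X.cyc n ⧸ (X.bdry n).submoduleOf (X.cyc n)

variable (X) in
/-- The class of a cycle. -/
def Hcls (n : ℤ) : X.cyc n →ₗ[B.kᵐᵒᵖ] X.Hinv n := Submodule.mkQ _

lemma Mor.map_deg (φ : Mor X Y) {n : ℤ} {x : X.X} (hx : x ∈ X.deg n) : φ.f x ∈ Y.deg n := by
  refine deg_induction (p := fun x => φ.f x ∈ Y.deg n) (fun l x hx => mem_deg (φ.map_gr _ x hx))
    (fun x y h h' => ?_) hx
  rw [map_add]; exact add_mem h h'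

lemma Mor.map_inv (φ : Mor X Y) {x : X.X} (hx : x ∈ X.inv) : φ.f x ∈ Y.inv := by
  rw [mem_inv] at hx ⊢
  rw [← φ.sm', hx, map_zero]

lemma mem_cyc {n : ℤ} {x : X.X} : x ∈ X.cyc n ↔ (X.sm x = 0 ∧ x ∈ X.deg n) ∧ X.d x = 0 := by
  rw [← mem_inv]; rfl

/-- The right `k`-linear map underlying a chain map. -/
def Mor.lin (φ : Mor X Y) : X.X →ₗ[B.kᵐᵒᵖ] Y.X :=
  { φ.f with map_smul' := fun _ _ => φ.f.map_smul _ _ }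

lemma Mor.map_cyc (φ : Mor X Y) (n : ℤ) : X.cyc n ≤ (Y.cyc n).comap φ.lin := by
  rintro x ⟨⟨h1, h2⟩, h3⟩
  refine ⟨⟨φ.map_inv h1, φ.map_deg h2⟩, ?_⟩
  have h4 : X.d x = 0 := h3
  change Y.d (φ.f x) = 0
  rw [← φ.map_d, h4, map_zero]

/-- The map on homology of invariants induced by a chain map. -/
def Hmap (φ : Mor X Y) (n : ℤ) : X.Hinv n →ₗ[B.kᵐᵒᵖ] Y.Hinv n :=
  Submodule.mapQ _ _ (φ.lin.restrict (φ.map_cyc n)) (by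
    rintro ⟨x, hx⟩ ⟨y, ⟨hy1, hy2⟩, hy⟩
    exact ⟨φ.f y, ⟨φ.map_inv hy1, φ.map_deg hy2⟩,
      (φ.map_d y).symm.trans (congrArg (fun z => φ.f z) hy)⟩)

lemma tm_deg {m n l : ℤ} (h : m + n = l) {x : X.X} {y : Y.X} (hx : x ∈ X.deg m)
    (hy : y ∈ Y.deg n) : (tm x y : TC X Y) ∈ (tensor X Y).deg l := by
  refine deg_induction (p := fun x => (tm x y : TC X Y) ∈ (tensor X Y).deg l)
    (fun i x hx => ?_) (fun x x' h h' => ?_) hx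
  · refine deg_induction (p := fun y => (tm x y : TC X Y) ∈ (tensor X Y).deg l)
      (fun j y hy => ?_) (fun y y' h h' => ?_) hy
    · refine mem_deg (X := tensor X Y) (l := i + j) ?_
      have h2 := tm_mem hx hy
      rwa [Prod.mk_add_mk, h] at h2
    · rw [map_add]; exact add_mem h h'
  · rw [map_add]; exact add_mem h h'

lemma tm_inv {x : X.X} {y : Y.X} (hx : X.sm x = 0) (hy : Y.sm y = 0) :
    (tm x y : TC X Y) ∈ (tensor X Y).inv := by
  rw [mem_inv, tensor_sm, sT_tm, hx, hy]
  simp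

lemma tm_cyc {m n l : ℤ} (h : m + n = l) {x : X.X} {y : Y.X} (hx : x ∈ X.cyc m)
    (hy : y ∈ Y.cyc n) : (tm x y : TC X Y) ∈ (tensor X Y).cyc l := by
  rw [mem_cyc] at hx hy
  refine ⟨⟨tm_inv hx.1.1 hy.1.1, tm_deg h hx.1.2 hy.1.2⟩, ?_⟩
  change dT X Y (tm x y) = 0
  rw [dT_tm, hx.2, hy.2]
  simp

lemma kos_inv {e : ℤ} {x : X.X} (hx : X.sm x = 0) : X.sm (X.kos e x) = 0 := by
  have := kos_sm e x
  rw [hx, map_zero] at this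
  rw [← sg_smul_smul e (X.sm _), ← this, smul_zero]

lemma kos_deg {e n : ℤ} {x : X.X} (hx : x ∈ X.deg n) : X.kos e x ∈ X.deg n := by
  refine deg_induction (p := fun x => X.kos e x ∈ X.deg n) (fun l x hx => mem_deg (kos_mem e hx))
    (fun x y h h' => ?_) hx
  rw [map_add]; exact add_mem h h'

/-- The external product on cycles. -/
def crossCyc {m n l : ℤ} (h : m + n = l) : X.cyc m →+ Y.cyc n →+ (tensor X Y).cyc l :=
  AddMonoidHom.mk' (fun x => AddMonoidHom.mk' (fun y => ⟨(tm x.1 y.1 : TC X Y), tm_cyc h x.2 y.2⟩)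
      (fun y y' => Subtype.ext (map_add (tm x.1) y.1 y'.1)))
    (fun x x' => AddMonoidHom.ext fun y => Subtype.ext
      (DFunLike.congr_fun (map_add tm x.1 x'.1) y.1))

/-- The external product `H_m(Hom_Γ(k, X)) ⊗ H_n(Hom_Γ(k, Y)) → H_{m+n}(Hom_Γ(k, X ⊗ Y))`,
`[x] ⊗ [y] ↦ [x ⊗ y]`. -/
def cross {m n l : ℤ} (h : m + n = l) : X.Hinv m →+ Y.Hinv n →+ (tensor X Y).Hinv l :=
  QuotientAddGroup.lift _
    (AddMonoidHom.mk' (fun x => QuotientAddGroup.lift _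
        ((((tensor X Y).Hcls l).toAddMonoidHom).comp (crossCyc h x)) (by
          rintro ⟨y, hy⟩ ⟨y', ⟨hy1, hy2⟩, rfl⟩
          have hx := mem_cyc.1 x.2
          refine (Submodule.Quotient.mk_eq_zero _).2
            ⟨(tm (X.kos 1 x.1) y' : TC X Y), ⟨tm_inv (kos_inv hx.1.1) (mem_inv.1 hy1),
              tm_deg (by rw [← h]; ring) (kos_deg hx.1.2) hy2⟩, ?_⟩
          change dT X Y (tm (X.kos 1 x.1) y') = tm x.1 (Y.d y')
          have h2 : X.d (X.kos 1 x.1) = 0 := by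
            have := kos_d 1 x.1
            rw [hx.2, map_zero] at this
            rw [← sg_smul_smul 1 (X.d _), ← this, smul_zero]
          rw [dT_tm, h2, kos_kos, map_zero, AddMonoidHom.zero_apply, zero_add]))
      (fun x x' => AddMonoidHom.ext fun y => by
        obtain ⟨y, rfl⟩ := QuotientAddGroup.mk_surjective y
        change (tensor X Y).Hcls l (crossCyc h (x + x') y)
          = (tensor X Y).Hcls l (crossCyc h x y) + (tensor X Y).Hcls l (crossCyc h x' y)
        rw [map_add, AddMonoidHom.add_apply, map_add]))
    (by
      rintro ⟨x, hx⟩ ⟨x', ⟨hx1, hx2⟩, rfl⟩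
      refine AddMonoidHom.ext fun y => ?_
      obtain ⟨y, rfl⟩ := QuotientAddGroup.mk_surjective y
      have hy := mem_cyc.1 y.2
      refine (Submodule.Quotient.mk_eq_zero _).2
        ⟨(tm x' y.1 : TC X Y), ⟨tm_inv (mem_inv.1 hx1) hy.1.1,
          tm_deg (by rw [← h]; ring) hx2 hy.1.2⟩, ?_⟩
      change dT X Y (tm x' y.1) = tm (X.d x') y.1
      rw [dT_tm, hy.2, map_zero, add_zero])

lemma cross_Hcls {m n l : ℤ} (h : m + n = l) (x : X.cyc m) (y : Y.cyc n) :
    cross h (X.Hcls m x) (Y.Hcls n y) = (tensor X Y).Hcls l (crossCyc h x y) := rfl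

end Cx

/-! ## Resolutions, the Tate complex and the cup product -/

open Cx

/-- A projective resolution `ε : P → k` of the trivial `Γ`-module `k`: a non-negative complex `P` of
graded `Γ`-modules that is projective in each homological degree (stated as the lifting property of
the bigraded module underlying `P`), with an augmentation that makes the augmented complex exact. -/
structure Resolution (B : EtaRing.{u}) where
  P : Cx.{u} B
  nonneg : ∀ n l : ℤ, n < 0 → P.gr (n, l) = ⊥
  proj : ∀ (A C : Cx.{u} B) (g : GrMor A C) (f : GrMor P C), Function.Surjective g.f →
    ∃ h : GrMor P A, ∀ x, g.f (h.f x) = f.f x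
  aug : Mor P (unit B)
  aug_surj : Function.Surjective aug.f
  exact : ∀ x : P.X, P.d x = 0 → aug.f x = 0 → ∃ y : P.X, P.d y = x

namespace Resolution

variable {B : EtaRing.{u}} (P : Resolution B)

/-- The mapping cone `P̃` of `ε : P → k`. -/
abbrev tilde : Cx B := cone P.aug

/-- The inclusion `i : k → P̃`. -/
def incl (a : B.k) : P.tilde.X := ((0 : P.P.X), a)

/-- A `Γ`-linear chain map `Ψ : P → P ⊗ P` covering the identity `k → k ⊗ k`, `a ↦ 1 ⊗ a`. -/
structure Diagonal where
  map : Mor P.P (tensor P.P P.P)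
  covers : ∀ x : P.P.X, (Mor.tensor P.aug P.aug).f (map.f x)
    = (tm (X := unit B) (Y := unit B) (1 : B.k) (P.aug.f x) : TC (unit B) (unit B))

/-- A `Γ`-linear chain map `Φ : P̃ ⊗ P̃ → P̃` extending the fold map. -/
structure FoldExt where
  map : Mor (tensor P.tilde P.tilde) P.tilde
  left : ∀ x : P.tilde.X,
    map.f (tm (X := P.tilde) (Y := P.tilde) (P.incl 1) x : TC P.tilde P.tilde) = x
  right : ∀ x : P.tilde.X,
    map.f (tm (X := P.tilde) (Y := P.tilde) x (P.incl 1) : TC P.tilde P.tilde) = x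

/-- The Tate complex `hm(M) = P̃ ⊗ Hom(P, M)`. -/
abbrev hm (M : Cx B) : Cx B := tensor P.tilde (ihom P.P M)

/-- The map of Tate complexes induced by a map of coefficients. -/
def hmMap {M L : Cx B} (μ : Mor M L) : Mor (P.hm M) (P.hm L) :=
  Mor.tensor (Mor.id P.tilde) (Mor.ihom (Mor.id P.P) μ)

variable {P} in
/-- The pairing `hm(M) ⊗ hm(N) → hm(M ⊗ N)`, the composite of `1 ⊗ τ ⊗ 1`, `1 ⊗ 1 ⊗ α` and
`Φ ⊗ Ψ^*`. -/
def pairing (Ψ : P.Diagonal) (Φ : P.FoldExt) (M N : Cx B) :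
    Mor (tensor (P.hm M) (P.hm N)) (P.hm (tensor M N)) :=
  ((Mor.tensor Φ.map (Mor.ihom Ψ.map (Mor.id (tensor M N)))).comp
    (Mor.tensor (Mor.id (tensor P.tilde P.tilde)) (alpha P.P M P.P N))).comp
    (mid P.tilde (ihom P.P M) P.tilde (ihom P.P N))

end Resolution

/-- A graded right `Γ`-module, regarded as a complex concentrated in homological degree `0`. -/
structure GMod (B : EtaRing.{u}) extends Cx.{u} B where
  conc : ∀ n l : ℤ, n ≠ 0 → gr (n, l) = ⊥

namespace GMod

variable {B : EtaRing.{u}}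

/-- The tensor product of two `Γ`-modules over `k`. -/
abbrev tensor (M N : GMod B) : GMod B where
  toCx := Cx.tensor M.toCx N.toCx
  conc := fun n l hn => by
    rw [eq_bot_iff]
    change grT M.toCx N.toCx (n, l) ≤ ⊥
    rw [grT, AddSubgroup.closure_le]
    rintro _ ⟨⟨a, b⟩, ⟨c, d⟩, h, x, hx, y, hy, rfl⟩
    by_cases ha : a = 0
    · by_cases hc : c = 0
      · exact absurd (congrArg Prod.fst h).symm (by simpa [ha, hc] using hn)
      · rw [N.conc c d hc, AddSubgroup.mem_bot] at hy
        simp [hy]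
    · rw [M.conc a b ha, AddSubgroup.mem_bot] at hx
      simp [hx]

/-- The `Γ`-linear maps of degree `0` between two `Γ`-modules. -/
abbrev Hom (M N : GMod B) : Type u := Mor M.toCx N.toCx

variable (M N L : GMod B)

/-- The element `m ⊗ n` of `M ⊗ N`. -/
def tmul (m : M.X) (n : N.X) : (M.tensor N).X := (tm m n : TC M.toCx N.toCx)

/-- The Tate cohomology group `Ext^^c_Γ(k, M) = H_{-c}(Hom_Γ(k, hm(M)))`, computed with the
projective resolution `P`. -/
abbrev tateExt (P : Resolution B) (c : ℤ) : Type u := (P.hm M.toCx).Hinv (-c)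

variable {M L} in
/-- The map on Tate cohomology induced by a map of `Γ`-modules. -/
def tateMap (P : Resolution B) (c : ℤ) (μ : M.Hom L) :
    M.tateExt P c →ₗ[B.kᵐᵒᵖ] L.tateExt P c := Hmap (P.hmMap μ) (-c)

/-- The cup product on Tate cohomology. -/
def cup {P : Resolution B} (Ψ : P.Diagonal) (Φ : P.FoldExt) (c₁ c₂ : ℤ) :
    M.tateExt P c₁ →+ N.tateExt P c₂ →+ (M.tensor N).tateExt P (c₁ + c₂) :=
  AddMonoidHom.compr₂ (cross (neg_add c₁ c₂).symm)
    (Hmap (Resolution.pairing Ψ Φ M.toCx N.toCx) (-(c₁ + c₂))).toAddMonoidHom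

/-! ### The groups `ker(s)/im(s + η)` and `ker(s + η)/im(s)` -/

/-- Right multiplication by `s + c η`: the map `m ↦ m s + c (m η)`. -/
def mulS (c : ℤ) : M.X →+ M.X := M.sm + c • M.ra B.eta

lemma mulS_apply (c : ℤ) (m : M.X) : M.mulS c m = M.sm m + c • M.ra B.eta m := rfl

/-- This map is semilinear with respect to the grading involution of `k`. -/
lemma mulS_ra (c : ℤ) (a : B.k) (m : M.X) :
    M.mulS c (M.ra a m) = M.ra (B.sig a) (M.mulS c m) := by
  have h : a * B.eta = B.eta * B.sig a := by rw [eta_mul, sig_sig]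
  rw [mulS_apply, mulS_apply, sm_ra, ra_ra, map_add, map_zsmul, ra_ra, h]

/-- The kernel of `s + c η`. -/
def kerS (c : ℤ) : Submodule B.kᵐᵒᵖ M.X :=
  { (M.mulS c).ker with
    smul_mem' := fun a m hm => by
      obtain ⟨a, rfl⟩ := op_surjective a
      have hm' : M.mulS c m = 0 := hm
      change M.mulS c (M.ra a m) = 0
      rw [mulS_ra, hm', map_zero] }

/-- The image of `s + c η`. -/
def imS (c : ℤ) : Submodule B.kᵐᵒᵖ M.X :=
  { (M.mulS c).range with
    smul_mem' := fun a m hm => by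
      obtain ⟨a, rfl⟩ := op_surjective a
      obtain ⟨m, rfl⟩ := hm
      refine ⟨M.ra (B.sig a) m, ?_⟩
      rw [mulS_ra, sig_sig]; rfl }

/-- `ker(s)` for `c` even and `ker(s + η)` for `c` odd. -/
def ansZ (c : ℤ) : Submodule B.kᵐᵒᵖ M.X := if Even c then M.kerS 0 else M.kerS 1

/-- `im(s + η)` for `c` even and `im(s)` for `c` odd. -/
def ansB (c : ℤ) : Submodule B.kᵐᵒᵖ M.X := if Even c then M.imS 1 else M.imS 0

/-- `ker(s)/im(s + η)` for `c` even and `ker(s + η)/im(s)` for `c` odd. -/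
abbrev ans (c : ℤ) : Type u := M.ansZ c ⧸ (M.ansB c).submoduleOf (M.ansZ c)

/-- The class of an element. -/
def ansCls (c : ℤ) : M.ansZ c →ₗ[B.kᵐᵒᵖ] M.ans c := Submodule.mkQ _

/-! ### The differential graded module `M[t, t⁻¹]` -/

/-- The module `M[t, t⁻¹]`; the element `t^c m` is `Finsupp.single c m`. -/
abbrev Laurent : Type u := ℤ →₀ M.X

/-- The differential of `M[t, t⁻¹]`, determined by `d(m) = t m s` and `d(t) = t² η`, that is,
`d(t^c m) = d(t^c) m + t^c d(m) = t^(c+1) (m s + c (m η))`. -/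
def lauD : M.Laurent →+ M.Laurent :=
  Finsupp.liftAddHom fun c => (Finsupp.singleAddHom (c + 1)).comp (M.mulS c)

@[simp] lemma lauD_single (c : ℤ) (m : M.X) :
    M.lauD (Finsupp.single c m) = Finsupp.single (c + 1) (M.mulS c m) := by
  simp [lauD]

/-- The cycles in `t^c M`, the part of homological degree `-c` of `M[t, t⁻¹]`. -/
def lauZ (c : ℤ) : Submodule B.kᵐᵒᵖ M.Laurent where
  carrier := {x | (∃ m, Finsupp.single c m = x) ∧ M.lauD x = 0}
  zero_mem' := ⟨⟨0, by simp⟩, map_zero _⟩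
  add_mem' := by
    rintro _ _ ⟨⟨m, rfl⟩, hm⟩ ⟨⟨n, rfl⟩, hn⟩
    exact ⟨⟨m + n, Finsupp.single_add _ _ _⟩, by rw [map_add, hm, hn, add_zero]⟩
  smul_mem' := by
    rintro a _ ⟨⟨m, rfl⟩, hm⟩
    obtain ⟨a, rfl⟩ := op_surjective a
    refine ⟨⟨op a • m, (Finsupp.smul_single _ _ _).symm⟩, ?_⟩
    rw [Finsupp.smul_single, op_smul_eq, lauD_single, mulS_ra]
    rw [lauD_single, Finsupp.single_eq_zero] at hm
    rw [hm, map_zero, Finsupp.single_zero]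

/-- The boundaries in `t^c M`. -/
def lauB (c : ℤ) : Submodule B.kᵐᵒᵖ M.Laurent where
  carrier := {x | ∃ m, M.lauD (Finsupp.single (c - 1) m) = x}
  zero_mem' := ⟨0, by simp⟩
  add_mem' := by
    rintro _ _ ⟨m, rfl⟩ ⟨n, rfl⟩
    exact ⟨m + n, by rw [Finsupp.single_add, map_add]⟩
  smul_mem' := by
    rintro a _ ⟨m, rfl⟩
    obtain ⟨a, rfl⟩ := op_surjective a
    refine ⟨M.ra (B.sig a) m, ?_⟩
    rw [lauD_single, lauD_single, Finsupp.smul_single, op_smul_eq, mulS_ra, sig_sig]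

/-- The homology of `M[t, t⁻¹]` in homological degree `-c`. -/
abbrev lauH (c : ℤ) : Type u := M.lauZ c ⧸ (M.lauB c).submoduleOf (M.lauZ c)

/-- The homology class of a cycle of `M[t, t⁻¹]`. -/
def lauCls (c : ℤ) : M.lauZ c →ₗ[B.kᵐᵒᵖ] M.lauH c := Submodule.mkQ _

variable {M N L} in
/-- The pairing `M[t, t⁻¹] ⊗ N[t, t⁻¹] → L[t, t⁻¹]`, `t^a m ⊗ t^b n ↦ t^(a+b) μ(m ⊗ n)`, induced by
a pairing `μ : M ⊗ N → L` of `Γ`-modules. -/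
def lauPair (μ : (M.tensor N).Hom L) : M.Laurent →+ N.Laurent →+ L.Laurent :=
  Finsupp.liftAddHom fun a => AddMonoidHom.mk'
    (fun m => Finsupp.liftAddHom fun b =>
      ((Finsupp.singleAddHom (a + b)).comp μ.f.toAddMonoidHom).comp (tm m))
    (fun m m' => by
      refine Finsupp.addHom_ext fun b n => ?_
      simp only [AddMonoidHom.add_apply, Finsupp.liftAddHom_apply_single]
      change Finsupp.single (a + b) (μ.f (tm (m + m') n : TC M.toCx N.toCx))
        = Finsupp.single (a + b) (μ.f (tm m n : TC M.toCx N.toCx))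
          + Finsupp.single (a + b) (μ.f (tm m' n : TC M.toCx N.toCx))
      rw [← Finsupp.single_add, map_add tm]
      exact congrArg _ (map_add μ.f _ _))

lemma lauPair_single (μ : (M.tensor N).Hom L) (a b : ℤ) (m : M.X) (n : N.X) :
    lauPair μ (Finsupp.single a m) (Finsupp.single b n)
      = Finsupp.single (a + b) (μ.f (M.tmul N m n)) := by
  simp [lauPair]; rfl

end GMod

end

end HopfTate

open HopfTate

/-! The trivial module has a periodic resolution, free on generators `p_n` (n ≥ 0) of bidegree (n,
n), with p_{n+1} ↦ p_n (s + nη). It is a complex because (s + nη)(s + (n+1)η) = 0 when 2η = 0, and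
`Std.bd_contr` gives a k-linear contraction. Since the total degree of p_n is even, the generators
create almost no signs.

For this resolution the Tate complex is compared with M[t, t⁻¹] by one map `Std.R`, x ⊗ f ↦ λ(x)
f(p_n), where f has homological degree -n and λ is the functional on the mapping cone with 1 ↦ 1,
p_n ↦ 0, p_n s ↦ -1. The identity `Std.R_d_of_mem` says that R(dz) is, up to sign, R(zs) minus (s +
cη) applied to R(z), for z of homological degree -c. On invariants R is therefore a chain map up to
sign, and it induces `Std.RH` on homology.

Surjectivity is by explicit chains (`Std.exists_chain`): for c ≥ 0 the chain 1 ⊗ f, with f the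
Γ-linear map p_c ↦ m; for c = -(n+1) the multiple by s + η of p_n ⊗ mε, up to signs. Injectivity
(`Std.exists_boundary`) writes a chain in the basis 1, p_n, p_n s of the mapping cone. In an
invariant chain the coordinates at p_n s determine those at p_n. The last coordinate at p_n s of a
cycle killed by R is a coboundary, hence can be removed by subtracting a boundary; when none is
left, the cycle is 1 ⊗ f with f Γ-linear and zero on its generator, so it vanishes.

An arbitrary P is handled by the comparison theorem (`Resolution.exists_lift`,
`Resolution.exists_htpy`), both halves of which come from `Resolution.null_homotopic` applied to an
acyclic mapping cone. Homotopies pass to mapping cones, tensor products and internal Homs, so Tate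
homology does not depend on P.

For the cup product, Ψ is transported to the standard resolution, where it is homotopic to p_n ↦ ∑
p_i ⊗ p_j because a tensor product of resolutions is a resolution (`Std.isRes_tensor`). With this
diagonal, evaluation at generators is multiplicative (`Std.ev_alH`). If c₁ ≥ 0, the first factor may
be taken to be 1 ⊗ f, and then only Φ(1 ⊗ y) matters, which after transport is homotopic to y.
Negative c₁ is reduced to this case by the shift p_n ↦ p_{n-2k} on the cochain factor, which alters
neither R nor R of a product (`Std.prodR_perHm`).

Existence of Ψ follows by transporting the standard diagonal. For Φ, an explicit product on the
standard mapping cone (`Std.foldMor`) is transported to P; it then restricts to the fold map only up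
to homotopy, and subtracting a suitable null-homotopic map makes the restriction exact
(`Resolution.nonempty_foldExt`). -/

namespace HopfTate
noncomputable section
open EtaRing Cx

namespace Cx

variable {B : EtaRing.{u}} {X Y Z X' Y' : Cx B}

/-! ## Homotopies -/

/-- A `Γ`-linear homotopy between two chain maps. -/
structure Htpy (F G : Mor X Y) where
  h : X.X →+ Y.X
  ra : ∀ a x, h (X.ra a x) = Y.ra a (h x)
  sm : ∀ x, h (X.sm x) = Y.sm (h x)
  mem : ∀ g, ∀ x ∈ X.gr g, h x ∈ Y.gr (g + (1, 0))
  eq : ∀ x, F.f x - G.f x = Y.d (h x) + h (X.d x)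

lemma Mor.ext_f {F G : Mor X Y} (h : ∀ x, F.f x = G.f x) : F = G := by
  obtain ⟨⟨f, _⟩, _⟩ := F
  obtain ⟨⟨g, _⟩, _⟩ := G
  have : f = g := LinearMap.ext h
  subst this; rfl

lemma Hmap_Hcls (F : Mor X Y) (n : ℤ) (x : X.cyc n) :
    Hmap F n (X.Hcls n x) = Y.Hcls n ⟨F.f x.1, F.map_cyc n x.2⟩ := rfl

lemma Hcls_surjective (n : ℤ) : Function.Surjective (X.Hcls n) := Submodule.mkQ_surjective _

lemma Hcls_eq {n : ℤ} {x y : X.cyc n} :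
    X.Hcls n x = X.Hcls n y ↔ x.1 - y.1 ∈ X.bdry n :=
  Submodule.Quotient.eq _

lemma mem_bdry {n : ℤ} {x : X.X} :
    x ∈ X.bdry n ↔ ∃ y, (X.sm y = 0 ∧ y ∈ X.deg (n + 1)) ∧ X.d y = x := by
  constructor
  · rintro ⟨y, ⟨h1, h2⟩, h3⟩
    exact ⟨y, ⟨mem_inv.1 h1, h2⟩, h3⟩
  · rintro ⟨y, ⟨h1, h2⟩, h3⟩
    exact ⟨y, ⟨mem_inv.2 h1, h2⟩, h3⟩

lemma Hmap_comp (G : Mor Y Z) (F : Mor X Y) (n : ℤ) (x : X.Hinv n) :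
    Hmap (G.comp F) n x = Hmap G n (Hmap F n x) := by
  obtain ⟨x, rfl⟩ := Hcls_surjective n x
  rfl

lemma Hmap_id (n : ℤ) (x : X.Hinv n) : Hmap (Mor.id X) n x = x := by
  obtain ⟨x, rfl⟩ := Hcls_surjective n x
  rfl

lemma map_deg_shift {h : X.X →+ Y.X} {m : ℤ}
    (hm : ∀ g, ∀ x ∈ X.gr g, ∃ l, h x ∈ Y.gr (g.1 + m, l)) {n : ℤ} {x : X.X}
    (hx : x ∈ X.deg n) : h x ∈ Y.deg (n + m) := by
  refine deg_induction (p := fun x => h x ∈ Y.deg (n + m)) (fun l x hx => ?_)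
    (fun x y h1 h2 => ?_) hx
  · obtain ⟨l', h'⟩ := hm _ x hx
    exact mem_deg h'
  · rw [map_add]; exact add_mem h1 h2

namespace Htpy

variable {F G : Mor X Y}

/-- On an invariant cycle x the two maps differ by the boundary of h x, and h x is again invariant
because the homotopy is Γ-linear. -/
lemma Hmap_eq (H : Htpy F G) (n : ℤ) : Hmap F n = Hmap G n := by
  refine LinearMap.ext fun x => ?_
  obtain ⟨x, rfl⟩ := Hcls_surjective n x
  rw [Hmap_Hcls, Hmap_Hcls, Hcls_eq, mem_bdry]
  obtain ⟨⟨h1, h2⟩, h3⟩ := mem_cyc.1 x.2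
  refine ⟨H.h x.1, ⟨by rw [← H.sm, h1, map_zero], ?_⟩, ?_⟩
  · exact map_deg_shift (m := 1) (fun g x hx => ⟨g.2, by simpa [Prod.add_def] using H.mem g x hx⟩) h2
  · change _ = F.f x.1 - G.f x.1
    rw [H.eq, h3, map_zero, add_zero]

lemma kos_h (H : Htpy F G) (e : ℤ) (x : X.X) :
    Y.kos e (H.h x) = sg e • H.h (X.kos e x) := by
  induction x using gr_induction X.gr with
  | h0 => simp
  | hadd x y hx hy => simp [hx, hy]
  | hom g x hx =>
    rw [kos_of_mem e hx, kos_of_mem e (H.mem g x hx), map_zsmul, smul_smul, tot_add, mul_add,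
      sg_add, mul_comm]
    simp

lemma h_la (H : Htpy F G) (a : B.k) (x : X.X) :
    H.h (X.la a x) = Y.la (B.sig a) (H.h x) := by
  induction a using gr_induction B.gr with
  | h0 => simp
  | hadd x y hx hy => simp [hx, hy]
  | hom j a ha =>
    rw [la_of_mem ha, sig_of_mem ha, map_zsmul, AddMonoidHom.zsmul_apply, la_of_mem ha, kos_h,
      H.ra, map_zsmul, sg_smul_smul]

/-- Homotopies are compatible with tensoring on the right. -/
def tensorRight (H : Htpy F G) (K : Mor X' Y') : Htpy (F.tensor K) (G.tensor K) where
  h := tlift ((tm.comp H.h).compl₂ K.f.toAddMonoidHom) (fun g h j x hx a ha y hy => by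
      simp only [AddMonoidHom.comp_apply, AddMonoidHom.compl₂_apply,
        LinearMap.toAddMonoidHom_coe, H.ra, K.ra']
      exact tm_balanced _ h j _ (H.mem g x hx) a ha _ (K.map_gr h y hy))
  ra a (z : TC X X') := by
    rw [tensor_ra, tensor_ra]
    induction z using T_induction with
    | htm g h x hx y hy =>
      simp only [rT_tm, tlift_tm, AddMonoidHom.comp_apply, AddMonoidHom.compl₂_apply,
        LinearMap.toAddMonoidHom_coe, K.ra']
    | hadd z w hz hw => simp only [map_add, hz, hw]
  sm (z : TC X X') := by
    rw [tensor_sm, tensor_sm]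
    induction z using T_induction with
    | htm g h x hx y hy =>
      simp only [sT_tm, map_add, tlift_tm, AddMonoidHom.comp_apply, AddMonoidHom.compl₂_apply,
        LinearMap.toAddMonoidHom_coe, K.sm', H.sm, K.kos']
    | hadd z w hz hw => simp only [map_add, hz, hw]
  mem g z hz := grT_le (fun h h' e x hx y hy => by
    rw [← e, add_right_comm]; exact tm_mem (H.mem h x hx) (K.map_gr h' y hy)) z hz
  eq (z : TC X X') := by
    rw [tensor_d, tensor_d]
    induction z using T_induction with
    | htm g h x hx y hy =>
      change tm (F.f x) (K.f y) - tm (G.f x) (K.f y) = _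
      have e := H.kos_h 1 x
      rw [sg_one, neg_smul, one_smul] at e
      rw [← AddMonoidHom.sub_apply, ← map_sub, H.eq, dT_tm, map_add]
      simp only [tlift_tm, AddMonoidHom.comp_apply, AddMonoidHom.compl₂_apply,
        LinearMap.toAddMonoidHom_coe, dT_tm, e, K.map_d, map_add, AddMonoidHom.add_apply, map_neg,
        AddMonoidHom.neg_apply]
      abel
    | hadd z w hz hw =>
      simp only [map_add] at hz hw ⊢
      rw [add_sub_add_comm, hz, hw]; abel

/-- Homotopies are compatible with tensoring on the left. -/
def tensorLeft (H : Htpy F G) (K : Mor X' Y') : Htpy (K.tensor F) (K.tensor G) where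
  -- The homotopy has total degree one and has to pass the left factor, whence x ⊗ y ↦ (-1)^‖x‖ K x
  -- ⊗ h y.
  h := tlift ((tm.comp (K.f.toAddMonoidHom.comp (X'.kos 1))).compl₂ H.h)
    (fun g h j x hx a ha y hy => by
      simp only [AddMonoidHom.comp_apply, AddMonoidHom.compl₂_apply,
        LinearMap.toAddMonoidHom_coe, H.ra, kos_ra 1 ha, map_zsmul, AddMonoidHom.zsmul_apply, K.ra']
      rw [tm_balanced _ _ j _ (K.map_gr g _ (kos_mem 1 hx)) a ha _ (H.mem h y hy), smul_smul,
        tot_add, mul_add, sg_add]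
      congr 1
      simp only [tot_mk, add_zero, mul_one, one_mul]
      linear_combination sg (j * tot h) * sg_sq j)
  ra a (z : TC X' X) := by
    rw [tensor_ra, tensor_ra]
    induction z using T_induction with
    | htm g h x hx y hy =>
      simp only [rT_tm, tlift_tm, AddMonoidHom.comp_apply, AddMonoidHom.compl₂_apply,
        LinearMap.toAddMonoidHom_coe, H.ra]
    | hadd z w hz hw => simp only [map_add, hz, hw]
  sm (z : TC X' X) := by
    rw [tensor_sm, tensor_sm]
    induction z using T_induction with
    | htm g h x hx y hy =>
      simp only [sT_tm, map_add, tlift_tm, AddMonoidHom.comp_apply, AddMonoidHom.compl₂_apply,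
        LinearMap.toAddMonoidHom_coe, K.sm', H.sm, kos_sm, kos_h, map_zsmul,
        AddMonoidHom.zsmul_apply]
    | hadd z w hz hw => simp only [map_add, hz, hw]
  mem g z hz := grT_le (fun h h' e x hx y hy => by
    rw [← e, add_assoc]; exact tm_mem (K.map_gr h _ (kos_mem 1 hx)) (H.mem h' y hy)) z hz
  eq (z : TC X' X) := by
    rw [tensor_d, tensor_d]
    induction z using T_induction with
    | htm g h x hx y hy =>
      change tm (K.f x) (F.f y) - tm (K.f x) (G.f y) = _
      rw [← map_sub, H.eq, dT_tm, map_add]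
      simp only [tlift_tm, AddMonoidHom.comp_apply, AddMonoidHom.compl₂_apply,
        LinearMap.toAddMonoidHom_coe, dT_tm, K.map_d, map_add,
        ← K.kos', kos_kos, kos_d, sg_one, neg_smul, one_smul, map_neg, AddMonoidHom.neg_apply]
      abel
    | hadd z w hz hw =>
      simp only [map_add] at hz hw ⊢
      rw [add_sub_add_comm, hz, hw]; abel

lemma comp_mem (H : Htpy F G) {g : ℤ × ℤ} {f : Y.X →+ Z.X} (hf : f ∈ homDeg Y Z g) :
    ((Z.kos 1).comp (f.comp (Y.kos 1))).comp H.h ∈ homDeg X Z (g + (1, 0)) := by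
  refine ⟨fun a x => ?_, fun h x hx => ?_⟩
  · simp only [AddMonoidHom.comp_apply, H.ra, kos_map_kos 1 hf, hf.1, map_zsmul]
  · simp only [AddMonoidHom.comp_apply, kos_map_kos 1 hf]
    rw [add_assoc, add_comm (1, 0) h]
    exact zsmul_mem (hf.2 _ _ (H.mem h x hx)) _

/-- The additive map `f ↦ (-1)^‖f‖ f h` between internal `Hom`s. -/
def ihomAdd (H : Htpy F G) (Z : Cx B) : homAll Y Z →+ homAll X Z :=
  hres ((AddMonoidHom.compHom.flip H.h).comp ((AddMonoidHom.compHom (Z.kos 1)).comp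
    (AddMonoidHom.compHom.flip (Y.kos 1)))) (fun _ _ hf => homDeg_le _ (H.comp_mem hf))

lemma ihomAdd_apply (H : Htpy F G) (f : homAll Y Z) (x : X.X) :
    (H.ihomAdd Z f).1 x = Z.kos 1 (f.1 (Y.kos 1 (H.h x))) := rfl

/-- Homotopies are compatible with the internal `Hom` in the first variable. -/
def ihom (H : Htpy F G) (Z : Cx B) : Htpy (F.ihom (Mor.id Z)) (G.ihom (Mor.id Z)) where
  h := H.ihomAdd Z
  ra a (f : homAll Y Z) := by
    rw [ihom_ra, ihom_ra]
    refine H_ext fun x => ?_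
    rw [ihomAdd_apply, rH_apply, rH_apply, ihomAdd_apply, h_la, kos_la_sig]
  sm (f : homAll Y Z) := by
    rw [ihom_sm, ihom_sm]
    refine H_ext fun x => ?_
    simp only [ihomAdd_apply, sH_apply, H.sm, kos_h, kos_kos, kos_sm, map_sub, sg_one,
      neg_smul, one_smul, map_neg]
    abel
  mem g f hf := H.comp_mem hf
  eq (f : homAll Y Z) := by
    rw [ihom_d, ihom_d]
    refine H_ext fun x => ?_
    change f.1 (F.f x) - f.1 (G.f x) = (dH X Z (H.ihomAdd Z f)).1 x + (H.ihomAdd Z (dH Y Z f)).1 x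
    rw [← map_sub, H.eq]
    simp only [ihomAdd_apply, dH_apply, kos_h, kos_kos, map_sub, map_add, kos_d, sg_one,
      neg_smul, one_smul, map_neg]
    abel

end Htpy

/-- The map of mapping cones induced by a chain map over `Z`. -/
def coneMap {p : Mor X Z} {q : Mor Y Z} (F : Mor X Y) (hF : ∀ x, q.f (F.f x) = p.f x) :
    Mor (cone p) (cone q) where
  f := LinearMap.prodMap F.f LinearMap.id
  map_gr g x hx := ⟨F.map_gr _ _ hx.1, hx.2⟩
  map_d x := Prod.ext (by simp [F.map_d]) (by simp [hF])

lemma cone_d {p : Mor X Z} (x : X.X) (z : Z.X) :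
    (cone p).d ((x, z) : X.X × Z.X) = ((-X.d x, Z.d z + p.f x) : X.X × Z.X) := rfl

/-- A homotopy over `Z` induces a homotopy of mapping cones. -/
def Htpy.cone {p : Mor X Z} {q : Mor Y Z} {F G : Mor X Y} (hF : ∀ x, q.f (F.f x) = p.f x)
    (hG : ∀ x, q.f (G.f x) = p.f x) (H : Htpy F G) (hH : ∀ x, q.f (H.h x) = 0) :
    Htpy (coneMap F hF) (coneMap G hG) where
  -- The sign matches the negated boundary in the first summand of a cone. With zero on the second
  -- summand the equation there reduces to `hH`.
  h := (-H.h).prodMap 0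
  ra a x := Prod.ext
    (show -H.h (X.ra a x.1) = Y.ra a (-H.h x.1) by rw [H.ra, map_neg])
    (show 0 = Z.ra a 0 by rw [map_zero])
  sm x := Prod.ext (show -H.h (X.sm x.1) = Y.sm (-H.h x.1) by rw [H.sm, map_neg])
    (show 0 = Z.sm 0 by rw [map_zero])
  mem g x hx := by
    refine ⟨(Y.gr _).neg_mem ?_, zero_mem _⟩
    rw [add_right_comm]
    exact H.mem _ _ hx.1
  eq x := by
    refine Prod.ext ?_ ?_
    · have := H.eq x.1
      change F.f x.1 - G.f x.1 = - Y.d (-H.h x.1) + -(H.h (-X.d x.1))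
      rw [this]; simp
    · change x.2 - x.2 = Z.d 0 + q.f (-H.h x.1) + 0
      simp [hH]

end Cx
end
end HopfTate

namespace HopfTate
noncomputable section
open EtaRing Cx

namespace Cx

variable {B : EtaRing.{u}} {X Y Z X' Y' : Cx B}

/-! ## Lifting through acyclic complexes -/

/-- A `Γ`-linear map from an additive map commuting with the actions of `k` and `s`. -/
def linOf (F : X.X →+ Y.X) (hr : ∀ a x, F (X.ra a x) = Y.ra a (F x))
    (hs : ∀ x, F (X.sm x) = Y.sm (F x)) : X.X →ₗ[(Gam B)ᵐᵒᵖ] Y.X :=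
  { F with
    map_smul' := fun γ x => by
      obtain ⟨γ, rfl⟩ := MulOpposite.op_surjective γ
      change F (op γ • x) = op γ • F x
      rw [smul_eq, smul_eq, map_add, hr, hr, hs] }

lemma lin_ra (f : X.X →ₗ[(Gam B)ᵐᵒᵖ] Y.X) (a : B.k) (x : X.X) :
    f (X.ra a x) = Y.ra a (f x) := f.map_smul _ _

lemma lin_sm (f : X.X →ₗ[(Gam B)ᵐᵒᵖ] Y.X) (x : X.X) : f (X.sm x) = Y.sm (f x) := f.map_smul _ _

/-- To define a `Γ`-linear map it suffices to give `Γ`-linear maps for each homological degree. -/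
def linGlue (f : ℤ → X.X →ₗ[(Gam B)ᵐᵒᵖ] Y.X) : X.X →ₗ[(Gam B)ᵐᵒᵖ] Y.X :=
  linOf (glift X.gr (fun g => (f g.1).toAddMonoidHom.comp (X.gr g).subtype))
    (fun a x => by
      induction a using gr_induction B.gr with
      | h0 => simp
      | hadd a b h h' => simp only [map_add, AddMonoidHom.add_apply, h, h']
      | hom j a ha =>
        induction x using gr_induction X.gr with
        | h0 => simp
        | hadd x y hx hy => simp only [map_add, hx, hy]
        | hom g x hx =>
          rw [glift_of_mem X.gr _ hx, glift_of_mem X.gr _ (ra_mem hx ha)]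
          change f (g.1 + 0) (X.ra a x) = Y.ra a (f g.1 x)
          rw [add_zero, lin_ra])
    (fun x => by
      induction x using gr_induction X.gr with
      | h0 => simp
      | hadd x y hx hy => simp only [map_add, hx, hy]
      | hom g x hx =>
        rw [glift_of_mem X.gr _ hx, glift_of_mem X.gr _ (sm_mem hx)]
        change f (g.1 + 0) (X.sm x) = Y.sm (f g.1 x)
        rw [add_zero, lin_sm])

lemma linGlue_of_mem (f : ℤ → X.X →ₗ[(Gam B)ᵐᵒᵖ] Y.X) {g : ℤ × ℤ} {x : X.X} (hx : x ∈ X.gr g) :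
    linGlue f x = f g.1 x := glift_of_mem X.gr _ hx

/-- The graded module underlying `X`, with bidegrees shifted by `g`. -/
abbrev shift (X : Cx B) (g : ℤ × ℤ) : Cx B where
  X := X.X
  gr i := X.gr (i + g)
  internal := by
    refine isInternal_of_detect (W := fun _ => X.X) ?_ (fun i => gproj X.gr (i + g)) ?_ ?_
    · rw [eq_top_iff]
      intro x _
      induction x using gr_induction X.gr with
      | h0 => exact zero_mem _
      | hom i x hx => exact AddSubgroup.mem_iSup_of_mem (i - g) (by simpa using hx)
      | hadd x y hx hy => exact add_mem (hx trivial) (hy trivial)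
    · exact fun i j hij x hx => gproj_ne X.gr hx fun e => hij (add_right_cancel e).symm
    · exact fun i x hx h0 => (gproj_same X.gr hx).symm.trans h0
  smul_mem i j x γ hx hγ := by
    rw [add_right_comm]; exact X.smul_mem _ _ _ _ hx hγ
  d := 0
  d_mem _ _ _ := zero_mem _
  d_d _ := rfl

/-- The graded module of cycles of an acyclic complex, with bidegrees shifted by `g`. -/
abbrev cycCx (X : Cx B) (hX : ∀ x : X.X, X.d x = 0 → ∃ y, X.d y = x) (g : ℤ × ℤ) : Cx B where
  X := LinearMap.ker X.d
  gr i := (X.gr (i + g)).comap (LinearMap.ker X.d).subtype.toAddMonoidHom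
  internal := by
    refine isInternal_of_detect (W := fun _ => X.X) ?_
      (fun i => (gproj X.gr (i + g)).comp (LinearMap.ker X.d).subtype.toAddMonoidHom) ?_ ?_
    · rw [eq_top_iff]
      rintro ⟨x, hx⟩ -
      -- Acyclicity is what makes the homogeneous cycles span: x is the boundary of some y, and the
      -- boundaries of the homogeneous parts of y are cycles.
      obtain ⟨y, rfl⟩ := hX x hx
      change (⟨X.d y, X.d_d y⟩ : LinearMap.ker X.d) ∈ _
      induction y using gr_induction X.gr with
      | h0 =>
        have : (⟨X.d 0, X.d_d 0⟩ : LinearMap.ker X.d) = 0 := Subtype.ext (map_zero _)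
        rw [this]; exact zero_mem _
      | hom i y hy =>
        refine AddSubgroup.mem_iSup_of_mem (i + (-1, 0) - g) ?_
        change X.d y ∈ X.gr (i + (-1, 0) - g + g)
        rw [sub_add_cancel]
        exact X.d_mem _ _ hy
      | hadd x y h1 h2 =>
        have : (⟨X.d (x + y), X.d_d _⟩ : LinearMap.ker X.d) = ⟨X.d x, X.d_d _⟩ + ⟨X.d y, X.d_d _⟩ :=
          Subtype.ext (map_add _ _ _)
        rw [this]; exact add_mem (h1 (X.d_d x)) (h2 (X.d_d y))
    · exact fun i j hij x hx => gproj_ne X.gr hx fun e => hij (add_right_cancel e).symm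
    · exact fun i x hx h0 => Subtype.ext ((gproj_same X.gr hx).symm.trans h0)
  smul_mem i j x γ hx hγ := by
    change op γ • x.1 ∈ X.gr (i + (0, j) + g)
    rw [add_right_comm]; exact X.smul_mem _ _ _ _ hx hγ
  d := 0
  d_mem _ _ _ := zero_mem _
  d_d _ := rfl

end Cx

namespace Resolution

variable {B : EtaRing.{u}} (P : Resolution B) {W : Cx B}

/-- Acyclicity makes d a surjection of graded modules from W, suitably shifted, onto its cycles;
projectivity of the resolution lifts a map into the cycles along it. -/
lemma lift_cycles (hW : ∀ x : W.X, W.d x = 0 → ∃ y, W.d y = x) (g : ℤ × ℤ)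
    (f : P.P.X →ₗ[(Gam B)ᵐᵒᵖ] W.X) (hf : ∀ i, ∀ x ∈ P.P.gr i, f x ∈ W.gr (i + g))
    (hd : ∀ x, W.d (f x) = 0) :
    ∃ h : P.P.X →ₗ[(Gam B)ᵐᵒᵖ] W.X, (∀ i, ∀ x ∈ P.P.gr i, h x ∈ W.gr (i + (g + (1, 0)))) ∧
      ∀ x, W.d (h x) = f x := by
  let p : GrMor (W.shift (g + (1, 0))) (W.cycCx hW g) :=
    { f := W.d.codRestrict (LinearMap.ker W.d) W.d_d
      map_gr := fun i x hx => by
        change W.d x ∈ W.gr (i + g)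
        have := W.d_mem _ _ hx
        have e : i + (g + (1, 0)) + (-1, 0) = i + g := by
              ext <;> simp only [Prod.fst_add, Prod.snd_add] <;> ring
        rwa [e] at this }
  let q : GrMor P.P (W.cycCx hW g) :=
    { f := f.codRestrict (LinearMap.ker W.d) hd
      map_gr := hf }
  have hp : Function.Surjective p.f := by
    rintro ⟨x, hx⟩
    obtain ⟨y, rfl⟩ := hW x hx
    exact ⟨y, rfl⟩
  obtain ⟨h, hh⟩ := P.proj _ _ p q hp
  exact ⟨h.f, h.map_gr, fun x => congrArg Subtype.val (hh x)⟩

/-- A homogeneous `Γ`-linear map from a projective resolution to an acyclic complex that commutes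
with the boundaries up to a sign is null-homotopic. -/
theorem null_homotopic (hW : ∀ x : W.X, W.d x = 0 → ∃ y, W.d y = x) (g : ℤ × ℤ) (σ : ℤ)
    (f : P.P.X →ₗ[(Gam B)ᵐᵒᵖ] W.X)
    (hf : ∀ i, ∀ x ∈ P.P.gr i, f x ∈ W.gr (i + g)) (hd : ∀ x, W.d (f x) = σ • f (P.P.d x)) :
    ∃ h : P.P.X →ₗ[(Gam B)ᵐᵒᵖ] W.X, (∀ i, ∀ x ∈ P.P.gr i, h x ∈ W.gr (i + (g + (1, 0)))) ∧
      ∀ x, W.d (h x) + σ • h (P.P.d x) = f x := by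
  -- The homotopy is built degree by degree: at stage n the equation holds in homological degrees
  -- below n. Each H is defined on all of P, since the lifting property concerns the whole bigraded
  -- module.
  let good (n : ℕ) (H : P.P.X →ₗ[(Gam B)ᵐᵒᵖ] W.X) : Prop :=
    (∀ i, ∀ x ∈ P.P.gr i, H x ∈ W.gr (i + (g + (1, 0)))) ∧
      ∀ i : ℤ × ℤ, i.1 < n → ∀ x ∈ P.P.gr i, W.d (H x) + σ • H (P.P.d x) = f x
  have hnn : ∀ i : ℤ × ℤ, i.1 < 0 → ∀ x ∈ P.P.gr i, x = 0 := fun i hi x hx => by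
    have := P.nonneg i.1 i.2 hi
    rwa [this, AddSubgroup.mem_bot] at hx
  have step : ∀ (n : ℕ) (H : P.P.X →ₗ[(Gam B)ᵐᵒᵖ] W.X), good n H → ∃ H', good (n + 1) H' ∧
      ∀ i : ℤ × ℤ, i.1 ≠ n → ∀ x ∈ P.P.gr i, H' x = H x := by
    intro n H hH
    -- The error of H in degree n, made zero in all other degrees so that it is cycle-valued
    -- everywhere.
    let E₀ : ℤ → P.P.X →ₗ[(Gam B)ᵐᵒᵖ] W.X := fun m =>
      if m = n then f - W.d.comp H - σ • H.comp P.P.d else 0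
    have hE : ∀ i, ∀ x ∈ P.P.gr i, linGlue E₀ x
        = if i.1 = n then f x - W.d (H x) - σ • H (P.P.d x) else 0 := fun i x hx => by
      rw [linGlue_of_mem _ hx]
      dsimp only [E₀]
      split_ifs <;> rfl
    obtain ⟨L, hL, hL'⟩ := P.lift_cycles hW g (linGlue E₀) (fun i x hx => by
        rw [hE i x hx]
        split_ifs
        · refine sub_mem (sub_mem (hf i x hx) ?_) (zsmul_mem ?_ _)
          · have := W.d_mem _ _ (hH.1 i x hx)
            have e : i + (g + (1, 0)) + (-1, 0) = i + g := by
              ext <;> simp only [Prod.fst_add, Prod.snd_add] <;> ring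
            rwa [e] at this
          · have := hH.1 _ _ (P.P.d_mem i x hx)
            have e : i + (-1, 0) + (g + (1, 0)) = i + g := by
              ext <;> simp only [Prod.fst_add, Prod.snd_add] <;> ring
            rwa [e] at this
        · exact zero_mem _)
      (fun x => by
        induction x using gr_induction P.P.gr with
        | h0 => simp
        | hadd x y hx hy => simp only [map_add, hx, hy, add_zero]
        | hom i x hx =>
          rw [hE i x hx]
          split_ifs with h
          -- The equation one degree lower, applied to dx, shows that the error takes values in
          -- cycles.
          · have h1 := hH.2 _ (by simp only [Prod.fst_add]; lia) _ (P.P.d_mem i x hx)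
            rw [d_d, map_zero, smul_zero, add_zero] at h1
            rw [map_sub, map_sub, d_d, map_zsmul, h1, hd]
            simp
          · simp)
    -- The lift is cut down to degree n, so that the correction leaves the equations already
    -- achieved untouched.
    let L₀ : ℤ → P.P.X →ₗ[(Gam B)ᵐᵒᵖ] W.X := fun m => if m = n then L else 0
    have hL0 : ∀ i, ∀ x ∈ P.P.gr i, linGlue L₀ x = if i.1 = n then L x else 0 := fun i x hx => by
      rw [linGlue_of_mem _ hx]
      dsimp only [L₀]
      split_ifs <;> rfl
    refine ⟨H + linGlue L₀, ⟨fun i x hx => ?_, fun i hi x hx => ?_⟩, fun i hi x hx => ?_⟩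
    · rw [LinearMap.add_apply, hL0 i x hx]
      refine add_mem (hH.1 i x hx) ?_
      split_ifs
      · exact hL i x hx
      · exact zero_mem _
    · rw [LinearMap.add_apply, LinearMap.add_apply, hL0 i x hx, hL0 _ _ (P.P.d_mem i x hx)]
      by_cases h : i.1 = n
      · have h2 : ¬ (i + (-1, 0)).1 = (n : ℤ) := by simp only [Prod.fst_add]; lia
        rw [if_pos h, if_neg h2, map_add, hL', hE i x hx, if_pos h, add_zero]
        abel
      · have h1 := hH.2 i (by push_cast at hi; lia) x hx
        rw [if_neg h, add_zero]
        split_ifs with h2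
        · simp only [Prod.fst_add] at h2
          push_cast at hi; lia
        · rw [add_zero, h1]
    · rw [LinearMap.add_apply, hL0 i x hx, if_neg hi, add_zero]
  let S : ∀ n : ℕ, {H // good n H} := fun n => Nat.rec
    ⟨0, fun _ _ _ => zero_mem _, fun i hi x hx => by
      rw [hnn i hi x hx]; simp⟩
    (fun n H => ⟨(step n H.1 H.2).choose, (step n H.1 H.2).choose_spec.1⟩) n
  have hS : ∀ (n : ℕ) (i : ℤ × ℤ), i.1 ≠ n → ∀ x ∈ P.P.gr i, (S (n + 1)).1 x = (S n).1 x :=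
    fun n => (step n (S n).1 (S n).2).choose_spec.2
  have hfix : ∀ i, ∀ x ∈ P.P.gr i, linGlue (fun m => (S (m.toNat + 1)).1) x
      = (S (i.1.toNat + 1)).1 x := fun i x hx => linGlue_of_mem _ hx
  -- Stage m + 1 is the first at which the equation holds in degree m, and later stages no longer
  -- change the values in that degree.
  refine ⟨linGlue (fun m => (S (m.toNat + 1)).1), fun i x hx => ?_, fun x => ?_⟩
  · rw [hfix i x hx]
    exact (S _).2.1 i x hx
  · induction x using gr_induction P.P.gr with
    | h0 => simp
    | hadd x y hx hy =>
      simp only [map_add, smul_add, ← hx, ← hy]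
      abel
    | hom i x hx =>
      by_cases h : i.1 < 0
      · rw [hnn i h x hx]; simp
      · have h1 := (S (i.1.toNat + 1)).2.2 i (by push_cast; lia) x hx
        have hdx := P.P.d_mem i x hx
        rw [hfix i x hx, hfix _ _ hdx, ← h1]
        by_cases h2 : i.1 = 0
        · rw [hnn _ (by simp only [Prod.fst_add]; lia) _ hdx]; simp
        · have e : (i + (-1, 0)).1.toNat + 1 = i.1.toNat := by
            simp only [Prod.fst_add]; lia
          rw [e, hS _ _ (by simp only [Prod.fst_add]; lia) _ hdx]

end Resolution
end
end HopfTate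

/-! ### Resolutions of k: acyclicity of the mapping cone and the comparison theorem. -/

namespace HopfTate
noncomputable section
open EtaRing Cx

section graded

variable {ι X Z : Type*} [DecidableEq ι] [AddCommGroup X] [AddCommGroup Z]
  (gr : ι → AddSubgroup X) [Decomposition gr]

lemma gproj_mem (i : ι) (x : X) : gproj gr i x ∈ gr i := by
  induction x using gr_induction gr with
  | h0 => rw [map_zero]; exact zero_mem _
  | hadd x y hx hy => rw [map_add]; exact add_mem hx hy
  | hom j x hx =>
    by_cases h : j = i
    · subst h; rwa [gproj_same gr hx]
    · rw [gproj_ne gr hx h]; exact zero_mem _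

end graded

namespace Cx

variable {B : EtaRing.{u}} {X Y Z X' Y' : Cx B}

lemma map_gproj {f : X.X →+ Y.X} {g : ℤ × ℤ} (hf : ∀ i, ∀ x ∈ X.gr i, f x ∈ Y.gr (i + g))
    (i : ℤ × ℤ) (x : X.X) : f (gproj X.gr i x) = gproj Y.gr (i + g) (f x) := by
  induction x using gr_induction X.gr with
  | h0 => simp
  | hadd x y hx hy => simp only [map_add, hx, hy]
  | hom j x hx =>
    by_cases h : j = i
    · subst h; rw [gproj_same X.gr hx, gproj_same Y.gr (hf _ _ hx)]
    · rw [gproj_ne X.gr hx h, gproj_ne Y.gr (hf _ _ hx) (fun e => h (add_right_cancel e)), map_zero]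

lemma gproj_of_mem (X : Cx B) {g : ℤ × ℤ} {x : X.X} (hx : x ∈ X.gr g) : gproj X.gr g x = x :=
  gproj_same X.gr hx

lemma GrMor.gproj' (φ : GrMor X Y) (i : ℤ × ℤ) (x : X.X) :
    φ.f (gproj X.gr i x) = gproj Y.gr i (φ.f x) := by
  have := map_gproj (f := φ.f.toAddMonoidHom) (g := 0)
    (fun i x hx => by rw [add_zero]; exact φ.map_gr i x hx) i x
  rwa [add_zero] at this

/-- The trivial action of `Γ` on `k`. -/
instance unitModule : Module (Gam B)ᵐᵒᵖ B.k := (unit B).mod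

lemma unit_gr_zero {g : ℤ × ℤ} (hg : g.1 ≠ 0) {a : B.k} (ha : a ∈ (unit B).gr g) : a = 0 := by
  change a ∈ (if g.1 = 0 then B.gr g.2 else ⊥) at ha
  rwa [if_neg hg, AddSubgroup.mem_bot] at ha

lemma mem_unit {j : ℤ} {a : B.k} (ha : a ∈ B.gr j) : a ∈ (unit B).gr (0, j) := by
  change a ∈ (if (0 : ℤ) = 0 then B.gr j else ⊥)
  rwa [if_pos rfl]

/-- A chain map `q : Y → k` that makes `Y` a non-negative resolution of `k`. -/
structure IsRes (q : Mor Y (unit B)) : Prop where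
  nonneg : ∀ n l : ℤ, n < 0 → Y.gr (n, l) = ⊥
  surj : Function.Surjective q.f
  exact : ∀ x : Y.X, Y.d x = 0 → q.f x = 0 → ∃ y : Y.X, Y.d y = x

namespace IsRes

variable {q : Mor Y (unit B)}

lemma eq_zero (hq : IsRes q) {g : ℤ × ℤ} (hg : g.1 < 0) {y : Y.X} (hy : y ∈ Y.gr g) : y = 0 := by
  have := hq.nonneg g.1 g.2 hg
  rwa [this, AddSubgroup.mem_bot] at hy

/-- The homological degree 0 part of a preimage has its boundary in degree -1, where the complex
vanishes. -/
lemma exists_cycle (hq : IsRes q) (a : B.k) : ∃ z, Y.d z = 0 ∧ q.f z = a := by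
  induction a using gr_induction B.gr with
  | h0 => exact ⟨0, map_zero _, map_zero _⟩
  | hadd a b ha hb =>
    obtain ⟨z, hz, rfl⟩ := ha
    obtain ⟨w, hw, rfl⟩ := hb
    exact ⟨z + w, by rw [map_add, hz, hw, add_zero], map_add _ _ _⟩
  | hom j a ha =>
    obtain ⟨y, rfl⟩ := hq.surj a
    refine ⟨gproj Y.gr (0, j) y, hq.eq_zero ?_ (Y.d_mem _ _ (gproj_mem Y.gr (0, j) y)), ?_⟩
    · simp
    · rw [q.gproj', gproj_of_mem (unit B) (mem_unit ha)]

lemma cone_exact (hq : IsRes q) (w : (cone q).X) (hw : (cone q).d w = 0) :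
    ∃ v, (cone q).d v = w := by
  obtain ⟨y, a⟩ := w
  rw [cone_d] at hw
  have h1 : Y.d y = 0 := neg_eq_zero.1 (congrArg Prod.fst hw)
  have h2 : q.f y = 0 := (zero_add _).symm.trans (congrArg Prod.snd hw)
  obtain ⟨u, hu⟩ := hq.exact y h1 h2
  obtain ⟨z, hz, hz'⟩ := hq.exists_cycle (a + q.f u)
  -- The element -u gives the right first coordinate, as the cone negates the boundary; the cycle z
  -- repairs the second coordinate without disturbing the first.
  refine ⟨((z - u, 0) : Y.X × B.k), ?_⟩
  rw [cone_d, map_sub, map_sub, hz, hz', hu]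
  exact Prod.ext (by simp) ((zero_add _).trans (by simp))

end IsRes

/-- A homotopy raises the homological degree, so on a non-negative complex it lands in positive
degrees, where k is zero. This is the condition under which homotopies pass to mapping cones. -/
lemma IsRes.htpy_aug {p : Mor X (unit B)} (hp : IsRes p) (q : Mor Y (unit B)) {F G : Mor X Y}
    (H : Htpy F G) (x : X.X) : q.f (H.h x) = 0 := by
  induction x using gr_induction X.gr with
  | h0 => simp
  | hadd x y hx hy => simp only [map_add, hx, hy, add_zero]
  | hom g x hx =>
    by_cases hg : g.1 < 0
    · rw [hp.eq_zero hg hx]; simp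
    · exact unit_gr_zero (by simp only [Prod.fst_add]; lia) (q.map_gr _ _ (H.mem g x hx))

end Cx

namespace Resolution

variable {B : EtaRing.{u}} (P : Resolution B) {Y : Cx B} {q : Mor Y (unit B)}

lemma isRes : IsRes P.aug := ⟨P.nonneg, P.aug_surj, P.exact⟩

/-- The map (0, ε) from P to the cone of q is a chain map, hence null-homotopic. The first component
of a null-homotopy is a chain map to Y, and its second equation says that this map covers ε. -/
theorem exists_lift (hq : IsRes q) : ∃ φ : Mor P.P Y, ∀ x, q.f (φ.f x) = P.aug.f x := by
  obtain ⟨h, hg, hd⟩ := P.null_homotopic hq.cone_exact 0 1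
    (LinearMap.prod (0 : P.P.X →ₗ[(Gam B)ᵐᵒᵖ] Y.X) P.aug.f)
    (fun i x hx => by
      rw [add_zero]; exact ⟨zero_mem _, P.aug.map_gr _ _ hx⟩)
    (fun x => by
      change (((-Y.d 0, 0 + q.f 0) : Y.X × B.k)) = (1 : ℤ) • ((0, P.aug.f (P.P.d x)) : Y.X × B.k)
      rw [P.aug.map_d]
      change _ = (1 : ℤ) • ((0, 0) : Y.X × B.k)
      simp)
  -- The null-homotopy raises the homological degree, and k sits in degree 0.
  have h2 : ∀ x, (h x).2 = 0 := fun x => by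
    induction x using gr_induction P.P.gr with
    | h0 => rw [map_zero]; rfl
    | hadd x y hx hy => rw [map_add]; exact (congrArg₂ (· + ·) hx hy).trans (add_zero _)
    | hom g x hx =>
      by_cases h : g.1 < 0
      · rw [P.isRes.eq_zero h hx, map_zero]; rfl
      · exact unit_gr_zero (by simp only [Prod.fst_add]; simp; lia) (hg g x hx).2
  refine ⟨{ f := (LinearMap.fst _ _ _).comp h, map_gr := fun g x hx => ?_, map_d := fun x => ?_ },
    fun x => ?_⟩
  · have := (hg g x hx).1
    have e : g + (0 + (1, 0)) + (-1, 0) = g := by ext <;> simp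
    rwa [e] at this
  · have e : -Y.d (h x).1 + (1 : ℤ) • (h (P.P.d x)).1 = 0 := congrArg Prod.fst (hd x)
    rw [one_smul] at e
    exact (neg_add_eq_zero.1 e).symm
  · have e : 0 + q.f (h x).1 + (1 : ℤ) • (h (P.P.d x)).2 = P.aug.f x := congrArg Prod.snd (hd x)
    rwa [h2, smul_zero, add_zero, zero_add] at e

/-- The pair (F - G, 0) maps P to the cone of q with homological degree one, and it anticommutes
with the boundaries because the cone negates that of Y. It is null-homotopic with sign -1, and minus
the first component of the null-homotopy is the desired homotopy. -/
theorem exists_htpy (hq : IsRes q) (F G : Mor P.P Y) (h : ∀ x, q.f (F.f x) = q.f (G.f x)) :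
    Nonempty (Htpy F G) := by
  obtain ⟨h, hg, hd⟩ := P.null_homotopic hq.cone_exact (1, 0) (-1)
    (LinearMap.prod (F.f - G.f) (0 : P.P.X →ₗ[(Gam B)ᵐᵒᵖ] (unit B).X))
    (fun i x hx => by
      refine ⟨?_, zero_mem _⟩
      have e : i + (1, 0) + (-1, 0) = i := by ext <;> simp
      rw [e]
      exact (Y.gr i).sub_mem (F.map_gr _ _ hx) (G.map_gr _ _ hx))
    (fun x => by
      refine Prod.ext ?_ ?_
      · change -Y.d (F.f x - G.f x) = (-1 : ℤ) • (F.f (P.P.d x) - G.f (P.P.d x))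
        rw [map_sub, F.map_d, G.map_d]; simp
      · change 0 + q.f (F.f x - G.f x) = (-1 : ℤ) • 0
        rw [map_sub, h]; simp)
  refine ⟨{ h := -((LinearMap.fst _ _ _).comp h).toAddMonoidHom, ra := fun a x => ?_,
            sm := fun x => ?_, mem := fun g x hx => ?_, eq := fun x => ?_ }⟩
  · change -(h (P.P.ra a x)).1 = Y.ra a (-(h x).1)
    rw [lin_ra, map_neg]; rfl
  · change -(h (P.P.sm x)).1 = Y.sm (-(h x).1)
    rw [lin_sm, map_neg]; rfl
  · have := (hg g x hx).1
    have e : g + ((1, 0) + (1, 0)) + (-1, 0) = g + (1, 0) := by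
      ext <;> simp only [Prod.fst_add, Prod.snd_add] <;> ring
    rw [e] at this
    exact neg_mem this
  · have e : -Y.d (h x).1 + (-1 : ℤ) • (h (P.P.d x)).1 = F.f x - G.f x := congrArg Prod.fst (hd x)
    change F.f x - G.f x = Y.d (-(h x).1) + -(h (P.P.d x)).1
    rw [← e]; simp

end Resolution
end
end HopfTate

/-! ### Multiplication by s + nη in Γ. -/

namespace HopfTate
noncomputable section
open EtaRing Cx

variable {B : EtaRing.{u}}

/-- The Koszul sign disappears because -η = η, so η is strictly central. -/
lemma eta_comm (a : B.k) : B.eta * a = a * B.eta := by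
  rw [eta_mul]
  induction a using gr_induction B.gr with
  | h0 => simp
  | hadd x y hx hy => simp only [map_add, add_mul, hx, hy]
  | hom i x hx =>
    rw [sig_of_mem hx]
    rcases sg_cases i with h | h
    · rw [h, one_smul]
    · rw [h, neg_smul, one_smul, neg_mul, ← mul_neg, neg_eta]

namespace Gam

lemma mul_mem {i j : ℤ} {x y : Gam B} (hx : x ∈ gr B i) (hy : y ∈ gr B j) :
    x * y ∈ gr B (i + j) := by
  have h1 : ∀ {i j l : ℤ} {a b : B.k}, a ∈ B.gr i → b ∈ B.gr j → i + j = l → a * b ∈ B.gr l :=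
    fun ha hb e => e ▸ SetLike.GradedMul.mul_mem ha hb
  refine ⟨h1 hx.1 hy.1 rfl, add_mem (add_mem ?_ ?_) ?_⟩
  · exact h1 (sig_mem hx.1) hy.2 (by ring)
  · exact h1 hx.2 hy.1 (by ring)
  · exact h1 (h1 B.eta_mem (sig_mem hx.2) rfl) hy.2 (by ring)

/-- Left multiplication in `Γ`, a map of right modules. -/
def lmul (γ : Gam B) : Gam B →ₗ[(Gam B)ᵐᵒᵖ] Gam B where
  toFun x := γ * x
  map_add' := mul_add γ
  map_smul' δ x := (mul_assoc γ x δ.unop).symm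

@[simp] lemma zsmul_a (n : ℤ) (x : Gam B) : (n • x).a = n • x.a :=
  map_zsmul (AddMonoidHom.mk' (fun x : Gam B => x.a) fun _ _ => rfl) n x

@[simp] lemma zsmul_b (n : ℤ) (x : Gam B) : (n • x).b = n • x.b :=
  map_zsmul (AddMonoidHom.mk' (fun x : Gam B => x.b) fun _ _ => rfl) n x

@[simp] lemma neg_a (x : Gam B) : (-x).a = -x.a := rfl
@[simp] lemma neg_b (x : Gam B) : (-x).b = -x.b := rfl
variable (B) in
/-- The element `s + n η` of `Γ`. -/
def sEta (n : ℤ) : Gam B := s + n • ι B.eta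

lemma sEta_mem (n : ℤ) : sEta B n ∈ gr B 1 :=
  add_mem s_mem (zsmul_mem (ι_mem B.eta_mem) _)

/-- Here sη = ηs, so the product is s² + (2n+1)ηs + n(n+1)η². With s² = ηs both coefficients, 2n+2
and n(n+1), are even, and 2η = 0. This is why the differential must alternate between s and s + η.
-/
lemma sEta_mul_sEta (n : ℤ) : sEta B n * sEta B (n + 1) = 0 := by
  have h : (ι B.eta : Gam B) * s = s * ι B.eta := by rw [ι_mul_s, sig_eta]
  have h2 : (ι B.eta : Gam B) + ι B.eta = 0 := by rw [← map_add, B.two_eta, map_zero]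
  have h3 : (n * (n + 1)) • (ι B.eta : Gam B) = 0 := by
    obtain ⟨m, hm⟩ := Int.even_mul_succ_self n
    rw [hm, add_smul, ← smul_add, h2, smul_zero]
  have h4 : (n • ι B.eta) * (n + 1) • (ι B.eta : Gam B) = 0 := by
    rw [smul_mul_smul_comm, ← smul_mul_assoc, h3, zero_mul]
  have h5 : (s : Gam B) * s + (n + 1) • (s * ι B.eta) + n • (s * ι B.eta)
      = (n + 1) • (s * (ι B.eta + ι B.eta)) := by
    rw [s_mul_s, h, mul_add, smul_add]
    module
  rw [sEta, sEta, add_mul, mul_add, mul_add, h4, mul_smul_comm, smul_mul_assoc, h, add_zero, h5, h2,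
    mul_zero, smul_zero]

lemma sEta_mul_a (n : ℤ) (x : Gam B) : (sEta B n * x).a = n • (B.eta * x.a) := by
  simp only [sEta, mul_a, add_a, s_a, zsmul_a, ι_a, zero_add, smul_mul_assoc]

lemma two_eta_mul (a : B.k) : B.eta * a + B.eta * a = 0 := by
  rw [← add_mul, B.two_eta, zero_mul]

lemma sEta_mul_b (n : ℤ) (x : Gam B) : (sEta B n * x).b = x.a + (n + 1) • (B.eta * x.b) := by
  have : (n • (ι B.eta : Gam B)) * x = n • (ι B.eta * x) := smul_mul_assoc _ _ _
  rw [sEta, add_mul, this]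
  simp only [add_b, mul_b, zsmul_b, s_a, s_b, ι_a, ι_b]
  simp only [map_zero, zero_mul, one_mul, map_one, mul_one, zero_add, sig_eta, add_zero, mul_zero]
  module

end Gam

namespace Std

/-! ## The standard resolution -/

variable (B) in
/-- The part of bidegree `g` of the graded `Γ`-module that is free on generators of bidegree `(n, n)`
for `n ≥ 0`. -/
def gr (g : ℤ × ℤ) : AddSubgroup (ℕ →₀ Gam B) where
  carrier := {x | ∀ n : ℕ, ((n : ℤ) = g.1 → x n ∈ Gam.gr B (g.2 - g.1)) ∧ ((n : ℤ) ≠ g.1 → x n = 0)}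
  zero_mem' n := ⟨fun _ => zero_mem _, fun _ => rfl⟩
  add_mem' hx hy n := ⟨fun h => add_mem ((hx n).1 h) ((hy n).1 h), fun h => by
    rw [Finsupp.add_apply, (hx n).2 h, (hy n).2 h, add_zero]⟩
  neg_mem' hx n := ⟨fun h => neg_mem ((hx n).1 h), fun h => by
    rw [Finsupp.neg_apply, (hx n).2 h, neg_zero]⟩

lemma single_mem {n : ℕ} {l : ℤ} {x : Gam B} (hx : x ∈ Gam.gr B (l - n)) :
    Finsupp.single n x ∈ gr B (n, l) := by
  refine fun m => ⟨fun h => ?_, fun h => ?_⟩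
  · rw [Nat.cast_inj.1 h, Finsupp.single_eq_same]; exact hx
  · rw [Finsupp.single_eq_of_ne]; rintro rfl; exact h rfl

lemma gr_cases {g : ℤ × ℤ} {x : ℕ →₀ Gam B} (hx : x ∈ gr B g) :
    x = 0 ∨ ∃ (n : ℕ) (y : Gam B), g.1 = n ∧ y ∈ Gam.gr B (g.2 - n) ∧ x = Finsupp.single n y := by
  by_cases h : 0 ≤ g.1
  · right
    obtain ⟨n, hn⟩ := Int.eq_ofNat_of_zero_le h
    refine ⟨n, x n, hn, hn ▸ (hx n).1 hn.symm, ?_⟩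
    ext m : 1
    by_cases e : n = m
    · subst e; rw [Finsupp.single_eq_same]
    · rw [Finsupp.single_eq_of_ne (Ne.symm e), (hx m).2]
      rw [hn]; exact fun e' => e (Nat.cast_inj.1 e').symm
  · left
    ext m : 1
    rw [(hx m).2]
    · rfl
    · lia

lemma internal : IsInternal (gr B) := by
  refine isInternal_of_detect (W := fun _ => ℕ → B.k × B.k) ?_
    (fun g => { toFun := fun x n => if (n : ℤ) = g.1 then
                  (gproj B.gr (g.2 - g.1) (x n).a, gproj B.gr (g.2 - g.1 - 1) (x n).b) else 0
                map_zero' := by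
                  funext n
                  simp
                map_add' := fun x y => by
                  funext n
                  simp only [Pi.add_apply]
                  split_ifs <;> simp }) ?_ ?_
  · rw [eq_top_iff]
    intro x _
    induction x using Finsupp.induction_linear with
    | zero => exact zero_mem _
    | add x y hx hy => exact add_mem (hx trivial) (hy trivial)
    | single n y =>
      rw [Gam.eq_add y, Finsupp.single_add]
      refine add_mem ?_ ?_
      · induction y.a using gr_induction B.gr with
        | h0 => simp
        | hadd a b ha hb => rw [map_add, Finsupp.single_add]; exact add_mem ha hb
        | hom j a ha =>
          exact AddSubgroup.mem_iSup_of_mem ((n : ℤ), j + n)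
            (single_mem (Gam.ι_mem (by rwa [add_sub_cancel_right])))
      · induction y.b using gr_induction B.gr with
        | h0 => simp
        | hadd a b ha hb => rw [map_add, mul_add, Finsupp.single_add]; exact add_mem ha hb
        | hom j a ha =>
          refine AddSubgroup.mem_iSup_of_mem ((n : ℤ), 1 + j + n) (single_mem ?_)
          rw [add_sub_cancel_right]
          exact Gam.mul_mem Gam.s_mem (Gam.ι_mem ha)
  · rintro ⟨n, l⟩ ⟨n', l'⟩ h x hx
    funext m
    change (if (m : ℤ) = n then _ else _) = _
    split_ifs with e
    · by_cases e' : (m : ℤ) = n'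
      · have hl : l' ≠ l := fun hl => h (Prod.ext (e.symm.trans e') hl.symm)
        have := (hx m).1 e'
        change x m ∈ Gam.gr B (l' - n') at this
        rw [← e'] at this
        change (gproj B.gr (l - n) (x m).a, gproj B.gr (l - n - 1) (x m).b) = 0
        rw [gproj_ne B.gr this.1 (by lia), gproj_ne B.gr this.2 (by lia)]; rfl
      · rw [(hx m).2 e']; simp
    · rfl
  · rintro ⟨n, l⟩ x hx h0
    ext m : 1
    by_cases e : (m : ℤ) = n
    · have h1 := congrFun h0 m
      change (if (m : ℤ) = n then
        ((gproj B.gr (l - n) (x m).a, gproj B.gr (l - n - 1) (x m).b) : B.k × B.k) else _) = 0 at h1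
      have h2 : x m ∈ Gam.gr B (l - n) := (hx m).1 e
      rw [if_pos e, gproj_same B.gr h2.1, gproj_same B.gr h2.2] at h1
      exact Gam.ext (congrArg Prod.fst h1) (congrArg Prod.snd h1)
    · exact (hx m).2 e

variable (B) in
/-- The boundary of the standard resolution, `p_{n+1} ↦ p_n (s + n η)`. -/
def bd : (ℕ →₀ Gam B) →ₗ[(Gam B)ᵐᵒᵖ] (ℕ →₀ Gam B) :=
  Finsupp.lsum ℕ fun n => match n with
    | 0 => 0
    | n + 1 => (Finsupp.lsingle n).comp (Gam.lmul (Gam.sEta B n))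

lemma bd_zero (x : Gam B) : bd B (Finsupp.single 0 x) = 0 := by simp [bd]

lemma bd_succ (n : ℕ) (x : Gam B) :
    bd B (Finsupp.single (n + 1) x) = Finsupp.single n (Gam.sEta B n * x) := by
  simp [bd, Gam.lmul]

variable (B) in
/-- The standard resolution, free over `Γ` on generators `p_n` of bidegree `(n, n)`, `n ≥ 0`, with
boundary `p_{n+1} ↦ p_n (s + n η)`. -/
abbrev cx : Cx B where
  X := ℕ →₀ Gam B
  gr := gr B
  internal := internal
  smul_mem g j x γ hx hγ := by
    obtain rfl | ⟨n, y, hn, hy, rfl⟩ := gr_cases hx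
    · rw [smul_zero]; exact zero_mem _
    · obtain ⟨m, l⟩ := g
      obtain rfl : m = n := hn
      rw [Finsupp.smul_single, Prod.mk_add_mk, add_zero]
      refine single_mem ?_
      have := Gam.mul_mem hy hγ
      rwa [sub_add_eq_add_sub] at this
  d := bd B
  d_mem g x hx := by
    obtain rfl | ⟨n, y, hn, hy, rfl⟩ := gr_cases hx
    · rw [map_zero]; exact zero_mem _
    · obtain ⟨m, l⟩ := g
      obtain rfl : m = n := hn
      cases n with
      | zero => rw [bd_zero]; exact zero_mem _
      | succ n =>
        rw [bd_succ]
        have e : (((n + 1 : ℕ) : ℤ), l) + (-1, 0) = ((n : ℤ), l) := by ext <;> simp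
        rw [e]
        refine single_mem ?_
        have := Gam.mul_mem (Gam.sEta_mem n) hy
        have e2 : 1 + (l - ((n + 1 : ℕ) : ℤ)) = l - n := by push_cast; ring
        rwa [e2] at this
  d_d x := by
    induction x using Finsupp.induction_linear with
    | zero => simp
    | add x y hx hy => rw [map_add, map_add, hx, hy, add_zero]
    | single n y =>
      rcases n with _ | _ | n
      · rw [bd_zero, map_zero]
      · rw [bd_succ, bd_zero]
      · rw [bd_succ, bd_succ, ← mul_assoc]
        push_cast
        rw [Gam.sEta_mul_sEta, zero_mul, Finsupp.single_zero]

lemma ra_single (a : B.k) (n : ℕ) (x : Gam B) :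
    (cx B).ra a (Finsupp.single n x) = Finsupp.single n (x * Gam.ι a) :=
  Finsupp.smul_single _ _ _

lemma sm_single (n : ℕ) (x : Gam B) :
    (cx B).sm (Finsupp.single n x) = Finsupp.single n (x * Gam.s) :=
  Finsupp.smul_single _ _ _

variable (B) in
/-- The augmentation of the standard resolution. -/
def aug : Mor (cx B) (unit B) where
  f :=
    { toFun := fun x => (x 0).a
      map_add' := fun _ _ => rfl
      map_smul' := fun _ _ => rfl }
  map_gr g x hx := by
    obtain rfl | ⟨n, y, hn, hy, rfl⟩ := gr_cases hx
    · exact zero_mem _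
    · obtain ⟨m, l⟩ := g
      obtain rfl : m = n := hn
      rcases n with _ | n
      · have := hy.1
        rw [Nat.cast_zero, sub_zero] at this
        change ((Finsupp.single 0 y : ℕ →₀ Gam B) 0).a ∈ _
        rw [Finsupp.single_eq_same]
        exact mem_unit this
      · change ((Finsupp.single (n + 1) y : ℕ →₀ Gam B) 0).a ∈ _
        rw [Finsupp.single_eq_of_ne (Nat.succ_ne_zero n).symm]
        exact zero_mem _
  map_d x := by
    induction x using Finsupp.induction_linear with
    | zero => rfl
    | add x y hx hy => rw [map_add, map_add, hx, hy]; exact (add_zero _)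
    | single n y =>
      rcases n with _ | _ | n
      · change ((bd B (Finsupp.single 0 y)) 0).a = 0
        rw [bd_zero]; rfl
      · change ((bd B (Finsupp.single (0 + 1) y)) 0).a = 0
        rw [bd_succ, Finsupp.single_eq_same, Gam.sEta_mul_a, Nat.cast_zero, zero_smul]
      · change ((bd B (Finsupp.single (n + 1 + 1) y)) 0).a = 0
        rw [bd_succ]; simp

lemma aug_single_zero (x : Gam B) : (aug B).f (Finsupp.single 0 x) = x.a := by
  change ((Finsupp.single 0 x : ℕ →₀ Gam B) 0).a = x.a
  rw [Finsupp.single_eq_same]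

lemma aug_single_succ (n : ℕ) (x : Gam B) : (aug B).f (Finsupp.single (n + 1) x) = 0 := by
  change ((Finsupp.single (n + 1) x : ℕ →₀ Gam B) 0).a = 0
  simp

variable (B) in
/-- The `k`-linear contraction of the standard resolution, `p_n (a + s b) ↦ p_{n+1} b`. -/
def contr : (ℕ →₀ Gam B) →+ (ℕ →₀ Gam B) :=
  Finsupp.liftAddHom fun n => (Finsupp.singleAddHom (n + 1)).comp
    (AddMonoidHom.mk' (fun x : Gam B => Gam.ι x.b) fun x y => by
      rw [Gam.add_b, map_add])

lemma contr_single (n : ℕ) (x : Gam B) :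
    contr B (Finsupp.single n x) = Finsupp.single (n + 1) (Gam.ι x.b) := by simp [contr]

lemma contr_ra (a : B.k) (x : (cx B).X) : contr B ((cx B).ra a x) = (cx B).ra a (contr B x) := by
  induction x using Finsupp.induction_linear with
  | zero => simp
  | add x y hx hy => simp only [map_add, hx, hy]
  | single n y =>
    rw [ra_single, contr_single, contr_single, ra_single]
    congr 1
    apply Gam.ext <;> simp

lemma contr_mem {g : ℤ × ℤ} {x : (cx B).X} (hx : x ∈ (cx B).gr g) :
    contr B x ∈ (cx B).gr (g + (1, 0)) := by
  obtain rfl | ⟨n, y, hn, hy, rfl⟩ := gr_cases hx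
  · rw [map_zero]; exact zero_mem _
  · obtain ⟨m, l⟩ := g
    obtain rfl : m = n := hn
    rw [contr_single]
    refine single_mem (n := n + 1) (Gam.ι_mem ?_)
    have := hy.2
    have e : l - n - 1 = l + 0 - ((n + 1 : ℕ) : ℤ) := by push_cast; ring
    rwa [e] at this

/-- On p_n(a + sb) with n ≥ 1 the two composites contribute p_n(s + nη)b and p_n(a + nηb), and the
two terms in η cancel. For n = 0 there is no second contribution, and p_0 a is left over. -/
lemma bd_contr (x : (cx B).X) :
    bd B (contr B x) + contr B (bd B x) = x - Finsupp.single 0 (Gam.ι ((aug B).f x)) := by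
  induction x using Finsupp.induction_linear with
  | zero =>
    rw [map_zero, map_zero, map_zero, map_zero]
    change _ = 0 - Finsupp.single 0 (Gam.ι 0)
    simp
  | add x y hx hy =>
    have e : (Finsupp.single 0 (Gam.ι ((aug B).f (x + y))) : ℕ →₀ Gam B)
        = Finsupp.single 0 (Gam.ι ((aug B).f x)) + Finsupp.single 0 (Gam.ι ((aug B).f y)) := by
      rw [← Finsupp.single_add, map_add]
      exact congrArg _ (map_add Gam.ι _ _)
    rw [e]
    simp only [map_add]
    rw [add_sub_add_comm, ← hx, ← hy]; abel
  | single n y =>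
    rcases n with _ | n
    · rw [bd_zero, map_zero, add_zero, contr_single, bd_succ, aug_single_zero, ← Finsupp.single_sub]
      congr 1
      apply Gam.ext
      · rw [Gam.sEta_mul_a]; simp [sub_eq_add_neg]
      · rw [Gam.sEta_mul_b]; simp [sub_eq_add_neg]
    · rw [bd_succ, contr_single, contr_single, bd_succ, aug_single_succ]
      change _ = _ - Finsupp.single 0 (Gam.ι 0)
      rw [map_zero, Finsupp.single_zero, sub_zero, ← Finsupp.single_add]
      congr 1
      apply Gam.ext
      · rw [Gam.add_a, Gam.sEta_mul_a, Gam.ι_a, Gam.ι_a, Gam.sEta_mul_b]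
        push_cast
        have := Gam.two_eta_mul y.b
        rw [add_left_comm, ← smul_add, this, smul_zero, add_zero]
      · rw [Gam.add_b, Gam.sEta_mul_b]; simp

lemma isRes : IsRes (aug B) where
  nonneg n l hn := by
    rw [eq_bot_iff]
    intro x hx
    obtain rfl | ⟨m, y, hm, hy, rfl⟩ := gr_cases hx
    · exact zero_mem _
    · simp only at hm; lia
  surj a := ⟨Finsupp.single 0 (Gam.ι a), aug_single_zero _⟩
  exact x hx h0 := ⟨contr B x, by
    have := bd_contr x
    rw [h0] at this
    change bd B x = 0 at hx
    rw [hx, map_zero, add_zero] at this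
    rw [this]
    change x - Finsupp.single 0 (Gam.ι 0) = x
    simp⟩

/-! ### Maps out of the standard resolution -/

variable {Y : Cx B}

/-- The `Γ`-linear map with `p_n ↦ y n`. -/
def lin (y : ℕ → Y.X) : (cx B).X →ₗ[(Gam B)ᵐᵒᵖ] Y.X :=
  Finsupp.lsum ℕ fun n =>
    { toFun := fun x => op x • y n
      map_add' := fun x x' => by rw [op_add, add_smul]
      map_smul' := fun γ x => (mul_smul γ (op x) (y n)) }

lemma lin_single (y : ℕ → Y.X) (n : ℕ) (x : Gam B) :
    lin y (Finsupp.single n x) = op x • y n := by simp [lin]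

lemma lin_ext {f g : (cx B).X →ₗ[(Gam B)ᵐᵒᵖ] Y.X}
    (h : ∀ n, f (Finsupp.single n 1) = g (Finsupp.single n 1)) : f = g := by
  refine LinearMap.ext fun x => ?_
  induction x using Finsupp.induction_linear with
  | zero => simp
  | add x y hx hy => rw [map_add, map_add, hx, hy]
  | single n y =>
    have e : (Finsupp.single n y : ℕ →₀ Gam B) = op y • Finsupp.single n (1 : Gam B) := by
      rw [Finsupp.smul_single]; exact congrArg _ (one_mul y).symm
    rw [e, map_smul, map_smul, h]

lemma lin_mem {y : ℕ → Y.X} (hy : ∀ n : ℕ, y n ∈ Y.gr (n, n)) {g : ℤ × ℤ} {x : (cx B).X}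
    (hx : x ∈ (cx B).gr g) : lin y x ∈ Y.gr g := by
  obtain rfl | ⟨n, z, hn, hz, rfl⟩ := gr_cases hx
  · rw [map_zero]; exact zero_mem _
  · obtain ⟨m, l⟩ := g
    obtain rfl : m = n := hn
    rw [lin_single]
    have := Y.smul_mem _ _ _ _ (hy n) hz
    simpa using this

lemma sEta_smul (n : ℤ) (y : Y.X) :
    op (Gam.sEta B n) • y = Y.sm y + n • Y.ra B.eta y := by
  rw [Gam.sEta, op_add, add_smul, op_smul]
  congr 1
  rw [ra_def]
  induction n using Int.induction_on with
  | zero => simp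
  | succ n h => rw [add_smul, add_smul, add_smul, h, one_smul, one_smul]
  | pred n h => rw [sub_smul, sub_smul, sub_smul, h, one_smul, one_smul]

/-- The chain map with `p_n ↦ y n`. -/
def mor (y : ℕ → Y.X) (hy : ∀ n : ℕ, y n ∈ Y.gr (n, n)) (h0 : Y.d (y 0) = 0)
    (hd : ∀ n : ℕ, Y.d (y (n + 1)) = Y.sm (y n) + (n : ℤ) • Y.ra B.eta (y n)) : Mor (cx B) Y where
  f := lin y
  map_gr _ _ hx := lin_mem hy hx
  map_d x := by
    change ((lin y).comp (bd B)) x = (Y.d.comp (lin y)) x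
    congr 1
    refine lin_ext fun n => ?_
    rw [LinearMap.comp_apply, LinearMap.comp_apply, lin_single, op_one, one_smul]
    rcases n with _ | n
    · rw [bd_zero, map_zero, h0]
    · rw [bd_succ, lin_single, mul_one, sEta_smul, hd]

variable (B) in
/-- The standard resolution. -/
def res : Resolution B where
  P := cx B
  nonneg := isRes.nonneg
  aug := aug B
  aug_surj := isRes.surj
  exact := isRes.exact
  -- The module is free on homogeneous generators: preimages of their images are chosen and
  -- projected to the bidegree (n, n).
  proj A C g f hg := by
    have h : ∀ n : ℕ, ∃ y : A.X, y ∈ A.gr (n, n) ∧ g.f y = f.f (Finsupp.single n 1) := fun n => by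
      obtain ⟨y, hy⟩ := hg (f.f (Finsupp.single n 1))
      refine ⟨gproj A.gr (n, n) y, gproj_mem _ _ _, ?_⟩
      rw [g.gproj', hy, gproj_of_mem]
      refine f.map_gr _ _ (single_mem ?_)
      rw [sub_self]
      exact Gam.ι_mem (a := (1 : B.k)) SetLike.GradedOne.one_mem
    choose y hy hy' using h
    refine ⟨⟨lin y, fun _ _ hx => lin_mem hy hx⟩, fun x => ?_⟩
    change (g.f.comp (lin y)) x = f.f x
    congr 1
    refine lin_ext fun n => ?_
    rw [LinearMap.comp_apply, lin_single, op_one, one_smul, hy']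

end Std
end
end HopfTate

/-! ### The unit complex, tensor products of resolutions and the standard diagonal. -/

namespace HopfTate
noncomputable section
open EtaRing Cx

variable {B : EtaRing.{u}}

namespace Cx

variable {X Y X' Y' : Cx B}

lemma hom_induction (X : Cx B) {p : X.X → Prop} (h0 : p 0) (hom : ∀ g, ∀ x ∈ X.gr g, p x)
    (hadd : ∀ x y, p x → p y → p (x + y)) (x : X.X) : p x := gr_induction X.gr h0 hom hadd x

lemma unit_ra (a b : B.k) : (unit B).ra a b = b * a := rfl

lemma unit_sm (a : B.k) : (unit B).sm a = 0 := mul_zero a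

lemma unit_mem {g : ℤ × ℤ} {a : B.k} (ha : a ∈ (unit B).gr g) :
    a = 0 ∨ g.1 = 0 ∧ a ∈ B.gr g.2 := by
  by_cases h : g.1 = 0
  · right
    change a ∈ (if g.1 = 0 then B.gr g.2 else ⊥) at ha
    rw [if_pos h] at ha
    exact ⟨h, ha⟩
  · exact Or.inl (unit_gr_zero h ha)

lemma unit_kos (e : ℤ) {j : ℤ} {a : B.k} (ha : a ∈ B.gr j) : (unit B).kos e a = sg (e * j) • a := by
  rw [kos_of_mem e (mem_unit ha)]
  simp

lemma unit_kos_one (a : B.k) : (unit B).kos 1 a = B.sig a := by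
  induction a using gr_induction B.gr with
  | h0 => exact (map_zero ((unit B).kos 1)).trans (map_zero _).symm
  | hadd x y hx hy => exact (map_add ((unit B).kos 1) x y).trans (by rw [hx, hy, map_add])
  | hom i x hx => rw [unit_kos 1 hx, sig_of_mem hx, one_mul]

lemma unit_la (a b : B.k) : (unit B).la a b = a * b := by
  induction b using gr_induction B.gr with
  | h0 => rw [mul_zero]; exact map_zero _
  | hadd x y hx hy => rw [mul_add, ← hx, ← hy]; exact map_add _ _ _
  | hom j b hb =>
    induction a using gr_induction B.gr with
    | h0 => simp
    | hadd x y hx hy => rw [map_add, AddMonoidHom.add_apply, hx, hy, add_mul]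
    | hom i a ha =>
      rw [la_of_mem ha, unit_kos i hb, unit_ra, B.graded_comm i j a ha b hb, smul_mul_assoc]

lemma tm_la (a : B.k) (x : X.X) (y : Y.X) : tm (X.ra a x) y = tm x (Y.la a y) := by
  induction a using gr_induction B.gr with
  | h0 => simp
  | hadd a b h h' => simp only [map_add, AddMonoidHom.add_apply, h, h']
  | hom j a ha => rw [tm_ra ha, la_of_mem ha]

/-- The sign that a scalar usually picks up in passing the second factor is invisible on multiples
of η. -/
lemma tm_ra_eta (x : X.X) (y : Y.X) : tm (X.ra B.eta x) y = tm x (Y.ra B.eta y) := by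
  rw [tm_la]
  congr 1
  induction y using gr_induction Y.gr with
  | h0 => simp
  | hadd x y hx hy => simp only [map_add, hx, hy]
  | hom g y hy =>
    rw [la_of_mem B.eta_mem, kos_of_mem _ hy]
    rcases sg_cases (1 * tot g) with h | h
    · rw [h, one_smul]
    · rw [h, neg_smul, one_smul, map_neg, neg_ra_eta]

variable (B) in
/-- The multiplication `k ⊗ k → k`. -/
def unitMul : Mor (tensor (unit B) (unit B)) (unit B) :=
  Mor.ofAdd (X := tensor (unit B) (unit B))
    (tlift (X := unit B) (Y := unit B) (Z := B.k) AddMonoidHom.mul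
      (fun g h j x hx a ha y hy => by
        change x * a * y = sg (j * tot h) • (x * (y * a))
        obtain rfl | ⟨h1, h2⟩ := unit_mem hy
        · simp
        · rw [mul_assoc, B.graded_comm _ _ a ha y h2, mul_smul_comm, tot, h1, zero_add]))
    (fun a (z : TC (unit B) (unit B)) => by
      rw [tensor_ra]
      induction z using T_induction with
      | htm g h x hx y hy => exact (mul_assoc x y a).symm
      | hadd z w hz hw =>
        rw [map_add, map_add, map_add, hz, hw]; exact (map_add ((unit B).ra a) _ _).symm)
    (fun (z : TC (unit B) (unit B)) => by
      rw [tensor_sm]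
      induction z using T_induction with
      | htm g h x hx y hy =>
        rw [sT_tm, unit_sm, unit_sm]
        change tlift _ _ (tm (X := unit B) (Y := unit B) x (0 : (unit B).X)
          + tm (X := unit B) (Y := unit B) (0 : (unit B).X) _) = _
        rw [map_zero, map_zero, AddMonoidHom.zero_apply, add_zero, map_zero, unit_sm]
      | hadd z w hz hw =>
        rw [map_add, map_add, map_add, hz, hw]; exact (map_add ((unit B).sm) _ _).symm)
    (fun g z hz => grT_le (fun h h' e x hx y hy => by
      rw [← e]
      change x * y ∈ (unit B).gr (h + h')
      obtain rfl | ⟨h1, h2⟩ := unit_mem hx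
      · rw [zero_mul]; exact zero_mem _
      obtain rfl | ⟨h3, h4⟩ := unit_mem hy
      · rw [mul_zero]; exact zero_mem _
      have := mem_unit (SetLike.GradedMul.mul_mem h2 h4)
      have e : ((0 : ℤ), h.2 + h'.2) = h + h' := by
        refine Prod.ext ?_ rfl
        change 0 = h.1 + h'.1
        rw [h1, h3, add_zero]
      rwa [e] at this) z hz)
    (fun (z : TC (unit B) (unit B)) => by
      rw [tensor_d]
      induction z using T_induction with
      | htm g h x hx y hy =>
        rw [dT_tm]
        change tlift _ _ (tm (X := unit B) (Y := unit B) (0 : (unit B).X) y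
          + tm (X := unit B) (Y := unit B) _ (0 : (unit B).X)) = 0
        rw [map_zero, map_zero, AddMonoidHom.zero_apply, add_zero, map_zero]
      | hadd z w hz hw => rw [map_add, map_add, hz, hw]; exact add_zero _)

/-- The augmentation of a tensor product. -/
def augT (p : Mor X (unit B)) (q : Mor Y (unit B)) : Mor (tensor X Y) (unit B) :=
  (unitMul B).comp (Mor.tensor p q)

lemma augT_tm (p : Mor X (unit B)) (q : Mor Y (unit B)) (x : X.X) (y : Y.X) :
    (augT p q).f (tm x y : TC X Y) = (p.f x * q.f y : B.k) := rfl

lemma IsRes.tensor_nonneg {p : Mor X (unit B)} {q : Mor Y (unit B)} (hp : IsRes p) (hq : IsRes q)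
    (n l : ℤ) (hn : n < 0) : (tensor X Y).gr (n, l) = ⊥ := by
  rw [eq_bot_iff]
  change grT X Y (n, l) ≤ ⊥
  rw [grT, AddSubgroup.closure_le]
  rintro _ ⟨⟨a, b⟩, ⟨c, d⟩, h, x, hx, y, hy, rfl⟩
  have h1 : a + c = n := congrArg Prod.fst h
  by_cases ha : a < 0
  · rw [hp.eq_zero ha hx]; simp
  · rw [hq.eq_zero (g := (c, d)) (by change c < 0; lia) hy]; simp

end Cx

namespace Std

variable {Y : Cx B}

/-- The map `x ⊗ y ↦ ε(x) y`. -/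
def collapse : TC (cx B) Y →+ Y.X :=
  tlift (Y.la.comp (aug B).f.toAddMonoidHom) (fun g h j x hx a ha y hy => by
    change Y.la ((aug B).f ((cx B).ra a x)) y = sg (j * tot h) • Y.la ((aug B).f x) (Y.ra a y)
    rw [(aug B).ra', unit_ra, ← la_la, la_of_mem ha, kos_of_mem j hy, map_zsmul, map_zsmul])

lemma collapse_tm (x : (cx B).X) (y : Y.X) : collapse (tm x y) = Y.la ((aug B).f x) y := rfl

lemma collapse_d (z : TC (cx B) Y) : collapse (dT (cx B) Y z) = Y.d (collapse z) := by
  induction z using T_induction with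
  | htm g h x hx y hy =>
    rw [dT_tm, map_add, collapse_tm, collapse_tm, collapse_tm, (aug B).map_d, (aug B).kos',
      unit_kos_one, d_la]
    change Y.la 0 y + _ = _
    simp
  | hadd z w hz hw => simp only [map_add, hz, hw]

lemma aug_collapse (q : Mor Y (unit B)) (z : TC (cx B) Y) :
    q.f (collapse z) = (augT (aug B) q).f z := by
  induction z using T_induction with
  | htm g h x hx y hy =>
    rw [collapse_tm, q.la', unit_la, augT_tm]
  | hadd z w hz hw =>
    rw [map_add, map_add, hz, hw]
    exact (map_add (augT (aug B) q).f _ _).symm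

/-- The map `x ⊗ y ↦ κ(x) ⊗ y`, where `κ` is the contraction of the standard resolution. -/
def contrT : TC (cx B) Y →+ TC (cx B) Y :=
  tlift (AddMonoidHom.comp (tm (X := cx B) (Y := Y)) (contr B)) (fun g h j x hx a ha y hy => by
    change tm (contr B ((cx B).ra a x)) y = sg (j * tot h) • tm (X := cx B) (contr B x) (Y.ra a y)
    rw [contr_ra]
    exact tm_balanced _ h j _ (contr_mem hx) a ha y hy)

lemma contrT_tm (x : (cx B).X) (y : Y.X) : contrT (tm x y) = tm (X := cx B) (contr B x) y := rfl

variable (B) in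
/-- The generator of degree `0` of the standard resolution. -/
def p₀ : (cx B).X := Finsupp.single 0 1

lemma single_one_mem (n : ℕ) : (Finsupp.single n 1 : (cx B).X) ∈ (cx B).gr (n, n) := by
  refine single_mem ?_
  rw [sub_self]
  exact Gam.ι_mem (a := (1 : B.k)) SetLike.GradedOne.one_mem

lemma kos_single_one (e : ℤ) (n : ℕ) :
    (cx B).kos e (Finsupp.single n 1) = Finsupp.single n 1 := by
  rw [kos_of_mem e (single_one_mem n), tot_mk, mul_add, sg_add, sg_sq, one_smul]

lemma contr_kos (x : (cx B).X) : contr B ((cx B).kos 1 x) = -(cx B).kos 1 (contr B x) := by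
  induction x using (cx B).hom_induction with
  | h0 => simp
  | hadd x y hx hy => simp only [map_add, hx, hy, neg_add]
  | hom g x hx =>
    rw [kos_of_mem 1 hx, kos_of_mem 1 (contr_mem hx), map_zsmul, tot_add, mul_add, sg_add, ← neg_smul]
    simp

/-- Contracting the left factor alone contracts the tensor product onto p_0 ⊗ Y. The terms with d on
the right factor cancel because the contraction is odd. -/
lemma contrT_d (z : TC (cx B) Y) :
    dT (cx B) Y (contrT z) + contrT (dT (cx B) Y z) = z - tm (p₀ B) (collapse z) := by
  induction z using T_induction with
  | htm g h x hx y hy =>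
    have e : (Finsupp.single 0 (Gam.ι ((aug B).f x)) : ℕ →₀ Gam B)
        = (cx B).ra ((aug B).f x) (p₀ B) := by
      rw [p₀, ra_single, one_mul]
    rw [contrT_tm, dT_tm, dT_tm, map_add, contrT_tm, contrT_tm, contr_kos, map_neg,
      AddMonoidHom.neg_apply, collapse_tm, ← tm_la, ← e, add_add_add_comm, add_neg_cancel, add_zero,
      ← AddMonoidHom.add_apply, ← map_add]
    rw [← AddMonoidHom.sub_apply, ← map_sub]
    exact congrArg (fun u => tm (X := cx B) u y) (bd_contr x)
  | hadd z w hz hw =>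
    simp only [map_add]
    rw [add_sub_add_comm, ← hz, ← hw]; abel

/-- By `contrT_d` the tensor product is homotopy equivalent to Y over k, so exactness is inherited
from Y. The case of two standard resolutions allows the comparison theorem to be applied to
diagonals. -/
theorem isRes_tensor {q : Mor Y (unit B)} (hq : IsRes q) : IsRes (augT (aug B) q) where
  nonneg := isRes.tensor_nonneg hq
  surj a := by
    obtain ⟨y, rfl⟩ := hq.surj a
    refine ⟨(tm (p₀ B) y : TC (cx B) Y), ?_⟩
    rw [augT_tm, p₀, aug_single_zero, Gam.one_a]
    exact one_mul _
  exact z hz h0 := by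
    change dT (cx B) Y z = 0 at hz
    have h1 : Y.d (collapse z) = 0 := by rw [← collapse_d, hz, map_zero]
    obtain ⟨w, hw⟩ := hq.exact _ h1 ((aug_collapse q z).trans h0)
    -- The contraction exhibits z as a boundary up to p_0 ⊗ (collapse of z), and w bounds that
    -- collapse in Y.
    refine ⟨contrT z + tm (p₀ B) w, ?_⟩
    change dT (cx B) Y (contrT z + tm (p₀ B) w) = z
    have h2 := contrT_d z
    have h3 : (cx B).d (p₀ B) = 0 := bd_zero 1
    rw [hz, map_zero, add_zero] at h2
    rw [map_add, h2, dT_tm, h3, map_zero, AddMonoidHom.zero_apply, zero_add, p₀, kos_single_one, hw]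
    exact sub_add_cancel _ _

/-! ### The diagonal of the standard resolution -/

lemma d_single_one_zero : (cx B).d (Finsupp.single 0 1) = 0 := bd_zero 1

lemma d_single_one_succ (n : ℕ) : (cx B).d (Finsupp.single (n + 1) 1)
    = (cx B).sm (Finsupp.single n 1) + (n : ℤ) • (cx B).ra B.eta (Finsupp.single n 1) := by
  rw [← sEta_smul, Finsupp.smul_single]
  change bd B _ = _
  rw [bd_succ, mul_one]
  exact congrArg _ (one_mul _).symm

variable (B) in
/-- The element `∑ p_i ⊗ p_j`, the sum over `i + j = n`. -/
def diagEl (n : ℕ) : TC (cx B) (cx B) :=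
  ∑ ij ∈ Finset.HasAntidiagonal.antidiagonal n, tm (X := cx B) (Y := cx B) (Finsupp.single ij.1 1)
    (Finsupp.single ij.2 1)

/-- Differentiating either factor of the summands with i + j = n + 1 leaves p_i(s + iη) ⊗ p_j + p_i
⊗ p_j(s + jη) for i + j = n. As η passes through the tensor sign and the p_j are even, this is the
diagonal action of s + nη. -/
lemma diagEl_d (n : ℕ) : dT (cx B) (cx B) (diagEl B (n + 1))
    = sT (cx B) (cx B) (diagEl B n) + (n : ℤ) • rT (cx B) (cx B) B.eta (diagEl B n) := by
  have h1 : dT (cx B) (cx B) (diagEl B (n + 1))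
      = ∑ ij ∈ Finset.HasAntidiagonal.antidiagonal (n + 1), tm (X := cx B) (Y := cx B)
          ((cx B).d (Finsupp.single ij.1 1)) (Finsupp.single ij.2 1)
        + ∑ ij ∈ Finset.HasAntidiagonal.antidiagonal (n + 1), tm (X := cx B) (Y := cx B)
          (Finsupp.single ij.1 1) ((cx B).d (Finsupp.single ij.2 1)) := by
    rw [diagEl, map_sum, ← Finset.sum_add_distrib]
    refine Finset.sum_congr rfl fun ij _ => ?_
    rw [dT_tm, kos_single_one]
  rw [h1, Finset.Nat.sum_antidiagonal_succ, Finset.Nat.sum_antidiagonal_succ', d_single_one_zero,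
    map_zero, AddMonoidHom.zero_apply, map_zero, zero_add, zero_add, ← Finset.sum_add_distrib,
    diagEl, map_sum, map_sum, Finset.smul_sum, ← Finset.sum_add_distrib]
  refine Finset.sum_congr rfl fun ij hij => ?_
  rw [d_single_one_succ, d_single_one_succ, sT_tm, rT_tm, kos_single_one, tm_lin_left, tm_lin_right,
    tm_ra_eta, ← Finset.HasAntidiagonal.mem_antidiagonal.1 hij]
  push_cast
  module

variable (B) in
/-- The diagonal `p_n ↦ ∑ p_i ⊗ p_j` of the standard resolution. -/
def diag : Mor (cx B) (tensor (cx B) (cx B)) :=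
  mor (Y := tensor (cx B) (cx B)) (diagEl B)
    (fun n => AddSubgroup.sum_mem (K := grT (cx B) (cx B) (n, n)) fun ij hij => by
      have := tm_mem (single_one_mem (B := B) ij.1) (single_one_mem (B := B) ij.2)
      rw [← Finset.HasAntidiagonal.mem_antidiagonal.1 hij]
      push_cast
      exact this)
    (by
      change dT (cx B) (cx B) (diagEl B 0) = 0
      rw [diagEl, Finset.Nat.antidiagonal_zero, Finset.sum_singleton, dT_tm, d_single_one_zero]
      simp)
    (fun n => by
      rw [tensor_sm, tensor_ra]
      exact diagEl_d n)

lemma diag_single_one (n : ℕ) : (diag B).f (Finsupp.single n 1) = diagEl B n := by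
  change lin (Y := tensor (cx B) (cx B)) (diagEl B) (Finsupp.single n 1) = _
  rw [lin_single, op_one, one_smul]

lemma diag_covers (x : (cx B).X) : (Mor.tensor (aug B) (aug B)).f ((diag B).f x)
    = (tm (X := unit B) (Y := unit B) (1 : B.k) ((aug B).f x) : TC (unit B) (unit B)) := by
  -- The right-hand side is made into a Γ-linear map so that both sides need only be compared on
  -- generators; for n > 0 every summand of the diagonal contains some p_i with i > 0, which ε
  -- kills.
  let T : Mor (unit B) (tensor (unit B) (unit B)) :=
    Mor.ofAdd (X := unit B) (Y := tensor (unit B) (unit B))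
      (tm (X := unit B) (Y := unit B) (1 : B.k))
      (fun a x => by rw [tensor_ra, rT_tm])
      (fun x => by
        rw [tensor_sm, sT_tm, unit_sm, unit_sm]
        change (tm (X := unit B) (Y := unit B) (1 : B.k)) (0 : (unit B).X)
          = (tm (X := unit B) (Y := unit B) (1 : B.k)) (0 : (unit B).X)
          + tm (X := unit B) (Y := unit B) (0 : (unit B).X) _
        rw [map_zero, map_zero, AddMonoidHom.zero_apply, add_zero])
      (fun g x hx => by
        have := tm_mem (X := unit B) (Y := unit B)
          (mem_unit (SetLike.GradedOne.one_mem : (1 : B.k) ∈ B.gr 0)) hx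
        rwa [show ((0 : ℤ), (0 : ℤ)) + g = g from zero_add g] at this)
      (fun x => by
        rw [tensor_d, dT_tm]
        change (tm (X := unit B) (Y := unit B) (1 : B.k)) (0 : (unit B).X)
          = tm (X := unit B) (Y := unit B) (0 : (unit B).X) _
          + (tm (X := unit B) (Y := unit B) _) (0 : (unit B).X)
        rw [map_zero, map_zero, map_zero, AddMonoidHom.zero_apply, add_zero])
  change ((Mor.tensor (aug B) (aug B)).f.comp (diag B).f) x = (T.f.comp (aug B).f) x
  congr 1
  refine lin_ext fun n => ?_
  rw [LinearMap.comp_apply, LinearMap.comp_apply, diag_single_one]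
  change Mor.tmap (aug B) (aug B) (diagEl B n) = tm (X := unit B) (Y := unit B) (1 : B.k) _
  rw [diagEl, map_sum]
  rcases n with _ | n
  · rw [Finset.Nat.antidiagonal_zero, Finset.sum_singleton, Mor.tmap_tm, aug_single_zero, Gam.one_a]
  · rw [aug_single_succ, Finset.sum_eq_zero]
    · exact (map_zero (tm (X := unit B) (Y := unit B) (1 : (unit B).X))).symm
    · rintro ⟨i, j⟩ hij
      rw [Mor.tmap_tm]
      rcases i with _ | i
      · rcases j with _ | j
        · simp at hij
        · change tm _ ((aug B).f (Finsupp.single (j + 1) 1)) = 0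
          rw [aug_single_succ]
          exact (map_zero (tm (X := unit B) (Y := unit B) _))
      · change tm ((aug B).f (Finsupp.single (i + 1) 1)) _ = 0
        rw [aug_single_succ]
        exact DFunLike.congr_fun (map_zero (tm (X := unit B) (Y := unit B))) _

end Std
end
end HopfTate

/-! ### Evaluation of the two factors of the Tate complex. -/

namespace HopfTate
noncomputable section
open EtaRing Cx

variable {B : EtaRing.{u}}

namespace Cx

variable {X Y : Cx B}

/-- The map `x ⊗ y ↦ ℓ(x) y` given by a right `k`-linear functional `ℓ`. -/
def actBy (ℓ : X.X →+ B.k) (hℓ : ∀ a x, ℓ (X.ra a x) = ℓ x * a) : TC X Y →+ Y.X :=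
  tlift (Y.la.comp ℓ) (fun g h j x hx a ha y hy => by
    change Y.la (ℓ (X.ra a x)) y = sg (j * tot h) • Y.la (ℓ x) (Y.ra a y)
    rw [hℓ, ← la_la, la_of_mem ha, kos_of_mem j hy, map_zsmul, map_zsmul])

lemma actBy_tm (ℓ : X.X →+ B.k) (hℓ : ∀ a x, ℓ (X.ra a x) = ℓ x * a) (x : X.X) (y : Y.X) :
    actBy ℓ hℓ (tm x y) = Y.la (ℓ x) y := rfl

lemma zsmul_ra_eta (n : ℤ) (x : X.X) : -(n • X.ra B.eta x) = n • X.ra B.eta x := by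
  rw [← smul_neg, neg_ra_eta]

lemma sg_smul_ra_eta (e : ℤ) (x : X.X) : sg e • X.ra B.eta x = X.ra B.eta x := by
  rcases sg_cases e with h | h
  · rw [h, one_smul]
  · rw [h, neg_smul, one_smul, neg_ra_eta]

lemma ra_eta_kos (e : ℤ) (x : X.X) : X.ra B.eta (X.kos e x) = X.ra B.eta x := by
  induction x using X.hom_induction with
  | h0 => simp
  | hadd x y hx hy => simp only [map_add, hx, hy]
  | hom g x hx => rw [kos_of_mem e hx, map_zsmul, sg_smul_ra_eta]

variable (X) in
/-- The additive map given by `φ g` on the part of bidegree `g`. -/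
def lift {Z : Type*} [AddCommGroup Z] (φ : ∀ g, X.gr g →+ Z) : X.X →+ Z := glift X.gr φ

lemma lift_of_mem {Z : Type*} [AddCommGroup Z] (φ : ∀ g, X.gr g →+ Z) {g : ℤ × ℤ}
    {x : X.X} (hx : x ∈ X.gr g) : lift X φ x = φ g ⟨x, hx⟩ :=
  glift_of_mem X.gr φ hx

variable (X Y) in
/-- The additive map on the internal `Hom` given by `φ g` on the part of bidegree `g`. -/
def hlift {Z : Type*} [AddCommGroup Z] (φ : ∀ g, grH X Y g →+ Z) : homAll X Y →+ Z :=
  lift (ihom X Y) φ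

lemma hlift_of_mem {Z : Type*} [AddCommGroup Z] (φ : ∀ g, grH X Y g →+ Z) {g : ℤ × ℤ}
    {f : homAll X Y} (hf : f ∈ grH X Y g) : hlift X Y φ f = φ g ⟨f, hf⟩ :=
  lift_of_mem (X := ihom X Y) φ hf

lemma la_eta (x : X.X) : X.la B.eta x = X.ra B.eta x := by
  rw [la_of_mem B.eta_mem, ra_eta_kos]

end Cx

namespace GMod

variable (M : GMod B)

lemma eq_zero {g : ℤ × ℤ} (hg : g.1 ≠ 0) {m : M.X} (hm : m ∈ M.gr g) : m = 0 := by
  have := M.conc g.1 g.2 hg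
  rwa [this, AddSubgroup.mem_bot] at hm

lemma d_eq_zero (m : M.X) : M.d m = 0 := by
  induction m using M.toCx.hom_induction with
  | h0 => simp
  | hadd x y hx hy => rw [map_add, hx, hy, add_zero]
  | hom g m hm =>
    by_cases h : g.1 = 0
    · exact M.eq_zero (by simp only [Prod.fst_add]; lia) (M.d_mem _ _ hm)
    · rw [M.eq_zero h hm, map_zero]

end GMod

namespace Std

variable (B) in
/-- The mapping cone of the augmentation of the standard resolution. -/
abbrev tl : Cx B := cone (aug B)

/-- The Tate complex formed with the standard resolution. -/
abbrev hm (M : Cx B) : Cx B := tensor (tl B) (ihom (cx B) M)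

/-! ### The functional on the mapping cone -/

variable (B) in
/-- The sum of the coefficients of the elements `p_n s`. -/
def bsum : (ℕ →₀ Gam B) →+ B.k :=
  Finsupp.liftAddHom fun _ => AddMonoidHom.mk' (fun x : Gam B => x.b) Gam.add_b

@[simp] lemma bsum_single (n : ℕ) (x : Gam B) : bsum B (Finsupp.single n x) = x.b :=
  Finsupp.liftAddHom_apply_single _ _ _

variable (B) in
/-- The right `k`-linear functional on the mapping cone with `1 ↦ 1`, `p_n ↦ 0` and
`p_n s ↦ -1`. -/
def lam : (tl B).X →+ B.k := AddMonoidHom.mk' (fun x => x.2 - bsum B x.1) (fun x y => by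
  rw [Prod.fst_add, Prod.snd_add, map_add, add_sub_add_comm])

lemma lam_mk (x : ℕ →₀ Gam B) (a : B.k) : lam B ((x, a) : (ℕ →₀ Gam B) × B.k) = a - bsum B x := rfl

lemma tl_induction {p : (tl B).X → Prop} (h0 : p 0) (h1 : ∀ a : B.k, p ((0, a) : (ℕ →₀ Gam B) × B.k))
    (h2 : ∀ n (x : Gam B), p ((Finsupp.single n x, 0) : (ℕ →₀ Gam B) × B.k))
    (hadd : ∀ x y, p x → p y → p (x + y)) (x : (tl B).X) : p x := by
  have h3 (x : ℕ →₀ Gam B) : p ((x, 0) : (ℕ →₀ Gam B) × B.k) := by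
    induction x using Finsupp.induction_linear with
    | zero => exact h0
    | add x y hx hy =>
      have e : ((x + y, 0) : (ℕ →₀ Gam B) × B.k) = (x, 0) + (y, 0) := by simp
      rw [e]; exact hadd _ _ hx hy
    | single n x => exact h2 n x
  have e : x = ((x.1, 0) : (ℕ →₀ Gam B) × B.k) + (0, x.2) := by simp
  rw [e]
  exact hadd _ _ (h3 _) (h1 _)

lemma tl_ra (a : B.k) (x : ℕ →₀ Gam B) (b : B.k) : (tl B).ra a ((x, b) : (ℕ →₀ Gam B) × B.k)
    = (((cx B).ra a x, b * a) : (ℕ →₀ Gam B) × B.k) := rfl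

lemma tl_sm (x : ℕ →₀ Gam B) (b : B.k) : (tl B).sm ((x, b) : (ℕ →₀ Gam B) × B.k)
    = (((cx B).sm x, 0) : (ℕ →₀ Gam B) × B.k) := Prod.ext rfl (unit_sm b)

lemma tl_d (x : ℕ →₀ Gam B) (b : B.k) : (tl B).d ((x, b) : (ℕ →₀ Gam B) × B.k)
    = ((-bd B x, (aug B).f x) : (ℕ →₀ Gam B) × B.k) := Prod.ext rfl (zero_add _)

lemma lam_ra (a : B.k) (x : (tl B).X) : lam B ((tl B).ra a x) = lam B x * a := by
  induction x using tl_induction with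
  | h0 => simp
  | hadd x y hx hy => simp only [map_add, hx, hy, add_mul]
  | h1 b => rw [tl_ra, map_zero, lam_mk, lam_mk, map_zero, sub_zero, sub_zero]
  | h2 n x => rw [tl_ra, ra_single, lam_mk, lam_mk, bsum_single, bsum_single]; simp

lemma tl_cases {g : ℤ × ℤ} {x : (tl B).X} (hx : x ∈ (tl B).gr g) :
    ∃ y : ℕ →₀ Gam B, ∃ a : B.k, x = ((y, a) : (ℕ →₀ Gam B) × B.k) ∧
      (y = 0 ∨ ∃ (n : ℕ) (z : Gam B), g.1 = n + 1 ∧ z ∈ Gam.gr B (g.2 - n) ∧ y = Finsupp.single n z) ∧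
      (a = 0 ∨ g.1 = 0 ∧ a ∈ B.gr g.2) := by
  obtain ⟨y, a⟩ := x
  refine ⟨y, a, rfl, ?_, unit_mem hx.2⟩
  obtain h | ⟨n, z, h1, h2, h3⟩ := gr_cases hx.1
  · exact Or.inl h
  · refine Or.inr ⟨n, z, ?_, ?_, h3⟩
    · simp only [Prod.fst_add] at h1; lia
    · simpa using h2

lemma lam_mem {g : ℤ × ℤ} {x : (tl B).X} (hx : x ∈ (tl B).gr g) : lam B x ∈ B.gr (g.2 - g.1) := by
  obtain ⟨y, a, rfl, hy, ha⟩ := tl_cases hx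
  rw [lam_mk]
  refine sub_mem ?_ ?_
  · obtain rfl | ⟨h1, h2⟩ := ha
    · exact zero_mem _
    · rwa [h1, sub_zero]
  · obtain rfl | ⟨n, z, h1, h2, rfl⟩ := hy
    · rw [map_zero]; exact zero_mem _
    · rw [bsum_single, h1]
      have := h2.2
      rwa [sub_sub] at this

/-- On p_n(a + sb) the left side is a + nηb. For n = 0 the term a comes from the augmentation and
λ(1) = 1, for n > 0 from the boundary in P; the values 1 and -1 of λ on 1 and on p_n s are chosen so
that the two cases agree. -/
lemma lam_d {g : ℤ × ℤ} {x : (tl B).X} (hx : x ∈ (tl B).gr g) :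
    lam B ((tl B).d x) = -B.sig (lam B ((tl B).sm x)) + g.1 • (B.eta * lam B x) := by
  obtain ⟨y, a, rfl, hy, ha⟩ := tl_cases hx
  have ha' : g.1 • (B.eta * a) = 0 := by
    obtain rfl | ⟨h1, h2⟩ := ha
    · simp
    · rw [h1, zero_smul]
  rw [tl_d, tl_sm, lam_mk, lam_mk, lam_mk, mul_sub, smul_sub, ha']
  obtain rfl | ⟨n, z, h1, h2, rfl⟩ := hy
  · have h3 : (aug B).f 0 = 0 := map_zero _
    rw [h3]
    simp
  · rw [sm_single, bsum_single, bsum_single, h1]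
    have e : (z * Gam.s).b = B.sig z.a + B.eta * B.sig z.b := by simp
    rw [e, zero_sub, zero_sub, map_neg, map_neg B.sig, map_add B.sig, sig_sig, map_mul, sig_sig, sig_eta, neg_neg]
    rcases n with _ | n
    · rw [bd_zero, aug_single_zero, map_zero]
      simp
    · rw [bd_succ, aug_single_succ, bsum_single, Gam.sEta_mul_b]
      have h4 : (2 : ℤ) • (B.eta * z.b) = 0 := by rw [two_smul, Gam.two_eta_mul]
      push_cast
      have h5 : z.a + B.eta * z.b + -(((n : ℤ) + 1 + 1) • (B.eta * z.b))
          = 0 - -(z.a + ((n : ℤ) + 1) • (B.eta * z.b)) - ((n : ℤ) + 1) • (2 : ℤ) • (B.eta * z.b) := by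
        module
      rw [h5, h4, smul_zero, sub_zero]

lemma lam_kos {g : ℤ × ℤ} {x : (tl B).X} (hx : x ∈ (tl B).gr g) :
    lam B ((tl B).kos 1 x) = sg (tot g) • lam B x := by
  rw [kos_of_mem 1 hx, one_mul, map_zsmul]

/-! ### Evaluation at the generators -/

variable (B) in
/-- The generators of the standard resolution, indexed by the integers. -/
def pz (n : ℤ) : (cx B).X := if 0 ≤ n then Finsupp.single n.toNat 1 else 0

lemma pz_natCast (n : ℕ) : pz B n = Finsupp.single n 1 := by simp [pz]

lemma pz_neg {n : ℤ} (hn : n < 0) : pz B n = 0 := if_neg (by lia)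

lemma pz_mem (n : ℤ) : pz B n ∈ (cx B).gr (n, n) := by
  by_cases h : 0 ≤ n
  · lift n to ℕ using h
    rw [pz_natCast]; exact single_one_mem n
  · rw [pz_neg (by lia)]; exact zero_mem _

lemma kos_pz (e n : ℤ) : (cx B).kos e (pz B n) = pz B n := by
  rw [kos_of_mem e (pz_mem n), tot_mk, mul_add, sg_add, sg_sq, one_smul]

lemma d_pz (n : ℤ) : (cx B).d (pz B (n + 1))
    = (cx B).sm (pz B n) + n • (cx B).ra B.eta (pz B n) := by
  by_cases h : 0 ≤ n
  · lift n to ℕ using h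
    rw [← Nat.cast_succ, pz_natCast, pz_natCast]; exact d_single_one_succ n
  · rw [pz_neg (n := n) (by lia), map_zero, map_zero, smul_zero, add_zero]
    by_cases h2 : n = -1
    · rw [h2]; exact d_single_one_zero
    · rw [pz_neg (by lia), map_zero]

variable {M : Cx B}

/-- Evaluation of `f` of homological degree `-n` at the generator `p_n`. -/
def ev : homAll (cx B) M →+ M.X :=
  hlift (cx B) M (fun g => (AddMonoidHom.eval (pz B (-g.1))).comp
    ((homAll (cx B) M).subtype.comp (grH (cx B) M g).subtype))

lemma ev_of_mem {g : ℤ × ℤ} {f : homAll (cx B) M} (hf : f ∈ grH (cx B) M g) :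
    ev f = f.1 (pz B (-g.1)) := hlift_of_mem _ hf

lemma ev_mem {g : ℤ × ℤ} {f : homAll (cx B) M} (hf : f ∈ grH (cx B) M g) :
    ev f ∈ M.gr (0, g.2 - g.1) := by
  rw [ev_of_mem hf]
  have := hf.2 _ _ (pz_mem (-g.1))
  have e : g + (-g.1, -g.1) = (0, g.2 - g.1) := by ext <;> simp [sub_eq_add_neg]
  rwa [e] at this

/-- The total degree of p_n is even, so a cochain and its value at the generator have the same
parity. -/
lemma ev_kos (e : ℤ) (f : homAll (cx B) M) : ev ((ihom (cx B) M).kos e f) = M.kos e (ev f) := by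
  induction f using H_induction with
  | hom g f hf =>
    rw [kos_of_mem (X := ihom (cx B) M) e hf, kos_of_mem e (ev_mem hf)]
    rw [map_zsmul]
    congr 1
    rw [tot_zero_mk, tot, mul_add, mul_sub, sg_add, sg_sub, mul_comm]
  | hadd f f' h h' => simp only [map_add, h, h']

lemma ev_ra (a : B.k) (f : homAll (cx B) M) : ev (rH (cx B) M a f) = M.ra a (ev f) := by
  induction f using H_induction with
  | hadd f f' h h' => simp only [map_add, h, h']
  | hom g f hf =>
    induction a using gr_induction B.gr with
    | h0 => simp
    | hadd a b h h' => simp only [map_add, AddMonoidHom.add_apply, h, h']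
    | hom j a ha =>
      rw [ev_of_mem (rH_grH hf ha), ev_of_mem hf, rH_apply, la_of_mem ha, kos_pz, map_ra f.2]
      simp

lemma ev_la (a : B.k) (f : homAll (cx B) M) : ev ((ihom (cx B) M).la a f) = M.la a (ev f) := by
  induction a using gr_induction B.gr with
  | h0 => simp
  | hadd a b h h' => simp only [map_add, AddMonoidHom.add_apply, h, h']
  | hom j a ha => rw [la_of_mem (X := ihom (cx B) M) ha, la_of_mem ha, ihom_ra, ev_ra, ev_kos]

lemma ev_sm {g : ℤ × ℤ} {f : homAll (cx B) M} (hf : f ∈ grH (cx B) M g) :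
    ev (sH (cx B) M f) = M.sm (ev f) - f.1 ((cx B).sm (pz B (-g.1))) := by
  rw [ev_of_mem (sH_grH hf), ev_of_mem hf, sH_apply, kos_pz]
  simp

/-- As M has no boundary, that of f is f ∘ d up to sign, and d(p_{n+1}) = p_n(s + nη) with n = -g.1.
The signs on multiples of η do not matter. -/
lemma ev_d (M : GMod B) {g : ℤ × ℤ} {f : homAll (cx B) M.toCx} (hf : f ∈ grH (cx B) M.toCx g) :
    ev (dH (cx B) M.toCx f)
      = -(sg (tot g) • f.1 ((cx B).sm (pz B (-g.1)))) + g.1 • M.ra B.eta (ev f) := by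
  have e : -(g + (-1, 0)).1 = -g.1 + 1 := by simp only [Prod.fst_add]; ring
  rw [ev_of_mem (dH_grH hf), ev_of_mem hf, dH_apply, M.d_eq_zero, kos_grH hf, e, d_pz, map_add,
    map_zsmul, map_ra f.2, zero_sub, smul_add, neg_add, one_mul, smul_comm, sg_smul_ra_eta]
  simp

end Std
end
end HopfTate

/-! ### The operators s + cη on M and the comparison map. -/

namespace HopfTate
noncomputable section
open EtaRing Cx

variable {B : EtaRing.{u}}

namespace GMod

variable (M : GMod B)

/-- Only the parity of c matters, since 2η = 0; this reconciles the two-case form of the answer with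
the uniform operator s + cη. -/
lemma mulS_even {c : ℤ} (hc : Even c) : M.mulS c = M.mulS 0 := by
  obtain ⟨k, rfl⟩ := hc
  refine AddMonoidHom.ext fun m => ?_
  have h : M.ra B.eta m + M.ra B.eta m = 0 := by
    rw [← AddMonoidHom.add_apply, ← map_add, B.two_eta, map_zero, AddMonoidHom.zero_apply]
  rw [mulS_apply, mulS_apply, ← two_mul, mul_comm, mul_smul, two_smul, h, smul_zero, zero_smul]

lemma mulS_odd {c : ℤ} (hc : Odd c) : M.mulS c = M.mulS 1 := by
  have h := M.mulS_even (hc.sub_odd odd_one)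
  refine AddMonoidHom.ext fun m => ?_
  have h1 := DFunLike.congr_fun h m
  rw [mulS_apply, mulS_apply, zero_smul, add_zero, sub_smul] at h1
  rw [mulS_apply, mulS_apply]
  rw [add_eq_left, sub_eq_zero] at h1
  rw [h1]

lemma mulS_add_two (c : ℤ) : M.mulS (c + 2) = M.mulS c := by
  rcases Int.even_or_odd c with h | h
  · rw [M.mulS_even h, M.mulS_even (h.add even_two)]
  · rw [M.mulS_odd h, M.mulS_odd (h.add_even even_two)]

lemma mem_ansZ {c : ℤ} {m : M.X} : m ∈ M.ansZ c ↔ M.mulS c m = 0 := by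
  rw [ansZ]
  split_ifs with h
  · rw [M.mulS_even h]; rfl
  · rw [M.mulS_odd (Int.not_even_iff_odd.1 h)]; rfl

lemma mem_ansB {c : ℤ} {m : M.X} : m ∈ M.ansB c ↔ ∃ n, M.mulS (c - 1) n = m := by
  rw [ansB]
  split_ifs with h
  · rw [M.mulS_odd (h.sub_odd odd_one)]; rfl
  · rw [M.mulS_even ((Int.not_even_iff_odd.1 h).sub_odd odd_one)]; rfl

/-- The map to `ker(s + c η)/im(s + (c - 1) η)` induced by a right `k`-linear map. -/
def homologyMap {X : Cx B} (c : ℤ) (F : X.X →+ M.X) (hra : ∀ a x, F (X.ra a x) = M.ra a (F x))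
    (hz : ∀ z ∈ X.cyc (-c), M.mulS c (F z) = 0)
    (hb : ∀ w, X.sm w = 0 → w ∈ X.deg (-c + 1) → ∃ m, M.mulS (c - 1) m = F (X.d w)) :
    X.Hinv (-c) →ₗ[B.kᵐᵒᵖ] M.ans c :=
  Submodule.mapQ _ _ (LinearMap.restrict
      ({ F with map_smul' := fun a x => hra (unop a) x } : X.X →ₗ[B.kᵐᵒᵖ] M.X)
      (p := X.cyc (-c)) (q := M.ansZ c) (fun _ h => M.mem_ansZ.2 (hz _ h))) (by
    rintro ⟨z, hz⟩ ⟨w, ⟨hw1, hw2⟩, hw⟩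
    obtain ⟨m, hm⟩ := hb w (mem_inv.1 hw1) hw2
    exact M.mem_ansB.2 ⟨m, hm.trans (congrArg F hw)⟩)

end GMod

namespace Std

/-! ### The comparison map `hm(M) → M` -/

section

variable {M : Cx B}

variable (M) in
/-- The map `x ⊗ f ↦ lam(x) ev(f)`. -/
def R : (hm M).X →+ M.X := ev.comp (actBy (Y := ihom (cx B) M) (lam B) lam_ra)

lemma R_tm (x : (tl B).X) (f : homAll (cx B) M) :
    R M (tm (Y := ihom (cx B) M) x f : TC (tl B) (ihom (cx B) M)) = M.la (lam B x) (ev f) :=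
  ev_la _ _

lemma R_ra (a : B.k) (z : (hm M).X) : R M ((hm M).ra a z) = M.ra a (R M z) := by
  rw [tensor_ra]
  induction z using T_induction (X := tl B) (Y := ihom (cx B) M) with
  | htm g h x hx f hf => rw [rT_tm, ihom_ra, R_tm, R_tm, ev_ra, la_ra]
  | hadd z w hz hw => simp only [map_add, hz, hw]

lemma R_mem {g : ℤ × ℤ} {z : (hm M).X} (hz : z ∈ (hm M).gr g) : R M z ∈ M.gr (0, g.2 - g.1) := by
  refine grT_le (X := tl B) (Y := ihom (cx B) M) (f := R M) (fun h h' e x hx f hf => ?_) z hz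
  rw [R_tm, la_of_mem (lam_mem hx)]
  have := ra_mem (kos_mem (h.2 - h.1) (ev_mem hf)) (lam_mem hx)
  have e2 : ((0, h'.2 - h'.1) + (0, h.2 - h.1) : ℤ × ℤ) = (0, g.2 - g.1) := by
    rw [← e]; ext <;> simp only [Prod.fst_add, Prod.snd_add] <;> ring
  rwa [e2] at this

lemma R_kos (e : ℤ) (z : (hm M).X) : R M ((hm M).kos e z) = M.kos e (R M z) := by
  induction z using (hm M).hom_induction with
  | h0 => simp
  | hadd z w hz hw => simp only [map_add, hz, hw]
  | hom g z hz =>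
    rw [kos_of_mem (X := hm M) e hz, kos_of_mem e (R_mem hz), map_zsmul]
    congr 1
    rw [tot_zero_mk, tot, mul_add, mul_sub, sg_add, sg_sub, mul_comm]

end

section

variable (M : GMod B)

/-- For z = x ⊗ f, the terms with λ(xs) and with f(p_n s) occur in R(dz) and R(zs) alike, up to the
common sign. What remains is s acting on ev(f) and multiples of η; the multiples contributed by λ
and by ev are the homological degrees of x and of f, which add up to that of z. -/
lemma R_d_of_mem {g : ℤ × ℤ} {z : (hm M.toCx).X} (hz : z ∈ (hm M.toCx).gr g) :
    R M.toCx ((hm M.toCx).d z)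
      = sg (tot g) • (R M.toCx ((hm M.toCx).sm z) - M.mulS (-g.1) (R M.toCx z)) := by
  rw [tensor_d, tensor_sm]
  refine tm_gr_induction (X := tl B) (Y := ihom (cx B) M.toCx) (p := fun z =>
    R M.toCx (dT _ _ z) = sg (tot g) • (R M.toCx (sT _ _ z) - M.mulS (-g.1) (R M.toCx z)))
    (by simp) (fun h h' e x hx f hf => ?_) (fun z w hz hw => ?_) (fun z hz => ?_) hz
  · rw [dT_tm, sT_tm, map_add, map_add, R_tm, R_tm, R_tm, R_tm, R_tm, ihom_d, ihom_sm, lam_kos hx,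
      ev_d M hf, ev_sm hf, lam_d hx, ev_kos, sig_of_mem (lam_mem (sm_mem hx)),
      M.mulS_apply, sm_la, ← e]
    have e1 : sg ((h + (0, 1)).2 - (h + (0, 1)).1) = -sg (tot h) := by
      have : (h + (0, 1)).2 - (h + (0, 1)).1 = tot h + 1 - (h.1 + h.1) := by
        simp only [Prod.fst_add, Prod.snd_add, tot]; ring
      rw [this, sg_sub, sg_add, sg_add, sg_sq, sg_one]; ring
    have e2 : sg (1 * tot (0, h'.2 - h'.1)) = sg (tot h') := by
      rw [one_mul, tot_zero_mk, tot, sg_sub, sg_add, mul_comm]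
    rw [e1, kos_of_mem 1 (ev_mem hf), e2]
    simp only [map_add, map_sub, map_neg, map_zsmul, AddMonoidHom.add_apply, AddMonoidHom.neg_apply,
      AddMonoidHom.zsmul_apply, la_ra, ← la_la, la_eta, tot_add, sg_add, smul_add, smul_sub, smul_neg,
      neg_smul, Prod.fst_add]
    have e3 (k n : ℤ) (u : M.X) : sg k • n • M.ra B.eta u = n • M.ra B.eta u := by
      rw [smul_comm, sg_smul_ra_eta]
    simp only [mul_smul, add_smul, smul_add, e3, sg_smul_ra_eta]
    rcases sg_cases (tot h) with h1 | h1 <;> rcases sg_cases (tot h') with h2 | h2 <;>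
      simp only [h1, h2] <;> module
  · simp only [map_add, hz, hw]; module
  · simp only [map_neg, hz]; module

lemma R_d {n : ℤ} {z : (hm M.toCx).X} (hz : z ∈ (hm M.toCx).deg n) :
    R M.toCx ((hm M.toCx).d z) = R M.toCx ((hm M.toCx).sm ((hm M.toCx).kos 1 z))
      - M.mulS (-n) (R M.toCx ((hm M.toCx).kos 1 z)) := by
  refine deg_induction (X := hm M.toCx) (p := fun z => R M.toCx ((hm M.toCx).d z)
    = R M.toCx ((hm M.toCx).sm ((hm M.toCx).kos 1 z))
      - M.mulS (-n) (R M.toCx ((hm M.toCx).kos 1 z))) (fun l z hz => ?_) (fun z w hz hw => ?_) hz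
  · rw [R_d_of_mem M hz, kos_of_mem (X := hm M.toCx) 1 hz, one_mul]
    simp only [map_zsmul]
    rw [smul_sub]
  · simp only [map_add, hz, hw]; abel

/-- On invariants the term R(zs) drops out, so R intertwines the boundary with s + cη up to a sign
and the sign operator. -/
lemma R_d_of_inv {n : ℤ} {z : (hm M.toCx).X} (hz : z ∈ (hm M.toCx).deg n)
    (hs : (hm M.toCx).sm z = 0) :
    R M.toCx ((hm M.toCx).d z) = -M.mulS (-n) (R M.toCx ((hm M.toCx).kos 1 z)) := by
  rw [R_d M hz, kos_inv (X := hm M.toCx) hs, map_zero, zero_sub]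

lemma mulS_R {c : ℤ} {z : (hm M.toCx).X} (hz : z ∈ (hm M.toCx).cyc (-c)) :
    M.mulS c (R M.toCx z) = 0 := by
  obtain ⟨⟨h1, h2⟩, h3⟩ := mem_cyc.1 hz
  -- Applied to z with its sign operator, so that the sign operator in the formula is undone and
  -- R(z) itself appears.
  have h := R_d_of_inv M (kos_deg (X := hm M.toCx) (e := 1) h2) (kos_inv (X := hm M.toCx) h1)
  rw [kos_kos, neg_neg] at h
  have h4 := kos_d (X := hm M.toCx) 1 z
  rw [h3, map_zero, sg_one, neg_smul, one_smul, eq_comm, neg_eq_zero] at h4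
  rw [h4, map_zero, eq_comm, neg_eq_zero] at h
  exact h

/-- The comparison map on homology. -/
def RH (c : ℤ) : (hm M.toCx).Hinv (-c) →ₗ[B.kᵐᵒᵖ] M.ans c :=
  M.homologyMap (X := hm M.toCx) c (R M.toCx) R_ra (fun _ hz => mulS_R M hz) (fun w hw1 hw2 => by
    -- The chain w has homological degree -c + 1 = -(c - 1), so the formula involves s + (c - 1)η.
    refine ⟨-R M.toCx ((hm M.toCx).kos 1 w), ?_⟩
    rw [R_d_of_inv M hw2 hw1, neg_add, neg_neg, map_neg]
    rfl)

lemma RH_Hcls (c : ℤ) (z : (hm M.toCx).cyc (-c)) : RH M c ((hm M.toCx).Hcls (-c) z)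
    = M.ansCls c ⟨R M.toCx z.1, M.mem_ansZ.2 (mulS_R M z.2)⟩ := rfl

end

end Std
end
end HopfTate

/-! ### Explicit chains: surjectivity of the comparison map. -/

namespace HopfTate
noncomputable section
open EtaRing Cx

variable {B : EtaRing.{u}}

namespace Cx

variable {X : Cx B}

variable (X) in
/-- Multiplication by `s + η`. -/
def nm : X.X →+ X.X := X.sm + X.ra B.eta

lemma nm_apply (x : X.X) : X.nm x = X.sm x + X.ra B.eta x := rfl

lemma ra_eta_add (x : X.X) : X.ra B.eta x + X.ra B.eta x = 0 := by
  rw [← AddMonoidHom.add_apply, ← map_add, B.two_eta, map_zero, AddMonoidHom.zero_apply]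

/-- Both composites of s and s + η vanish, since s² = ηs and 2η = 0. Hence s + η produces invariants
and kills multiples of s. -/
lemma sm_nm (x : X.X) : X.sm (X.nm x) = 0 := by
  rw [nm_apply, map_add, sm_sm, sm_ra, sig_eta, ra_eta_add]

lemma nm_sm (x : X.X) : X.nm (X.sm x) = 0 := by
  rw [nm_apply, sm_sm, ra_eta_add]

lemma d_nm (x : X.X) : X.d (X.nm x) = X.nm (X.d x) := by
  rw [nm_apply, nm_apply, map_add, d_sm, d_ra]

lemma nm_mem {g : ℤ × ℤ} {x : X.X} (hx : x ∈ X.gr g) : X.nm x ∈ X.gr (g + (0, 1)) :=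
  add_mem (sm_mem hx) (ra_mem hx B.eta_mem)

end Cx

lemma GMod.mulS_kos (M : GMod B) (c : ℤ) (m : M.X) :
    M.mulS c (M.kos 1 m) = -M.kos 1 (M.mulS c m) := by
  rw [M.mulS_apply, M.mulS_apply, map_add, kos_sm, map_zsmul, kos_ra 1 B.eta_mem]
  simp only [sg_one, neg_smul, one_smul, mul_one, smul_neg, neg_add, neg_neg]

namespace Std

lemma cx_ra_apply (a : B.k) (x : ℕ →₀ Gam B) (n : ℕ) : (cx B).ra a x n = x n * Gam.ι a := rfl

lemma cx_sm_apply (x : ℕ →₀ Gam B) (n : ℕ) : (cx B).sm x n = x n * Gam.s := rfl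

lemma cx_d_apply (x : ℕ →₀ Gam B) (n : ℕ) : (cx B).d x n = Gam.sEta B n * x (n + 1) := by
  change bd B x n = _
  induction x using Finsupp.induction_linear with
  | zero => simp
  | add x y hx hy => rw [map_add, Finsupp.add_apply, Finsupp.add_apply, hx, hy, mul_add]
  | single m y =>
    rcases m with _ | m
    · simp [bd_zero]
    · rw [bd_succ]
      by_cases h : m = n
      · subst h; simp
      · rw [Finsupp.single_eq_of_ne (Ne.symm h), Finsupp.single_eq_of_ne (by lia), mul_zero]

variable (M : GMod B)

/-! ### Cochains given by an element of the module -/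

variable {M} in
lemma homAll_of_gr {F : M.X →+ ((cx B).X →+ M.X)} (k : ℤ)
    (hF : ∀ l, ∀ m ∈ M.gr (0, l), F m ∈ homDeg (cx B) M.toCx (k, l + k)) (m : M.X) :
    F m ∈ homAll (cx B) M.toCx := by
  induction m using M.toCx.hom_induction with
  | h0 => rw [map_zero]; exact zero_mem _
  | hadd x y hx hy => rw [map_add]; exact add_mem hx hy
  | hom g m hm =>
    obtain ⟨n, l⟩ := g
    by_cases h : n = 0
    · subst h; exact homDeg_le _ (hF l m hm)
    · rw [M.eq_zero h hm, map_zero]; exact zero_mem _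

lemma genHom_mem (n : ℕ) (l : ℤ) (m : M.X) (hm : m ∈ M.gr (0, l)) :
    ((AddMonoidHom.mk' (fun m => AddMonoidHom.mk' (fun x : (cx B).X => op (x n) • m)
      (fun x y => by rw [Finsupp.add_apply, op_add, add_smul]))
      (fun m m' => AddMonoidHom.ext fun x => smul_add _ _ _) : M.X →+ ((cx B).X →+ M.X))) m
      ∈ homDeg (cx B) M.toCx (-n, l + -n) := by
  refine ⟨fun a x => ?_, fun h x hx => ?_⟩
  · change op ((cx B).ra a x n) • m = M.ra a (op (x n) • m)
    rw [cx_ra_apply, ra_def, op_mul, mul_smul]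
  · change op (x n) • m ∈ _
    by_cases e : (n : ℤ) = h.1
    · have := M.smul_mem (0, l) _ m (x n) hm ((hx n).1 e)
      have e2 : ((0, l) + (0, h.2 - h.1) : ℤ × ℤ) = (-(n : ℤ), l + -(n : ℤ)) + h := by
        ext <;> simp only [Prod.fst_add, Prod.snd_add, e] <;> ring
      rwa [e2] at this
    · rw [(hx n).2 e, op_zero, zero_smul]; exact zero_mem _

/-- The `Γ`-linear map with `p_n ↦ m` that vanishes on the other generators. -/
def genHom (n : ℕ) : M.X →+ homAll (cx B) M.toCx :=
  AddMonoidHom.codRestrict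
    (AddMonoidHom.mk' (fun m => AddMonoidHom.mk' (fun x : (cx B).X => op (x n) • m)
      (fun x y => by rw [Finsupp.add_apply, op_add, add_smul]))
      (fun m m' => AddMonoidHom.ext fun x => smul_add _ _ _))
    (homAll (cx B) M.toCx) (homAll_of_gr (-n) (genHom_mem M n))

lemma genHom_apply (n : ℕ) (m : M.X) (x : (cx B).X) : (genHom M n m).1 x = op (x n) • m := rfl

lemma genHom_grH (n : ℕ) {l : ℤ} {m : M.X} (hm : m ∈ M.gr (0, l)) :
    genHom M n m ∈ grH (cx B) M.toCx (-n, l + -n) := genHom_mem M n l m hm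

/-- The conjugate action measures the failure of Γ-linearity, so Γ-linear maps are invariant. -/
lemma genHom_sm (n : ℕ) (m : M.X) : sH (cx B) M.toCx (genHom M n m) = 0 := by
  refine H_ext fun x => ?_
  rw [sH_apply, genHom_apply, genHom_apply, cx_sm_apply, op_mul, mul_smul]
  exact sub_self _

lemma ev_genHom (n : ℕ) (m : M.X) : ev (genHom M n m) = m := by
  induction m using M.toCx.hom_induction with
  | h0 => simp
  | hadd x y hx hy => rw [map_add, map_add, hx, hy]
  | hom g m hm =>
    obtain ⟨k, l⟩ := g
    by_cases h : k = 0
    · subst h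
      rw [ev_of_mem (genHom_grH M n hm), genHom_apply, neg_neg, pz_natCast, Finsupp.single_eq_same,
        op_one, one_smul]
    · rw [M.eq_zero h hm, map_zero, map_zero]

/-- Only the coefficient of p_n in dy matters, and it is (s + nη) times that of p_{n+1} in y; thus
the map sees m(s + nη), which is zero. -/
lemma genHom_d (n : ℕ) {m : M.X} (hm : M.mulS n m = 0) : dH (cx B) M.toCx (genHom M n m) = 0 := by
  have h (y : (cx B).X) : (genHom M n m).1 ((cx B).d y) = 0 := by
    rw [genHom_apply, cx_d_apply, op_mul, mul_smul, sEta_smul]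
    exact (congrArg _ hm).trans (smul_zero _)
  refine H_ext fun x => ?_
  rw [dH_apply, M.d_eq_zero, kos_d, map_zsmul, h, smul_zero, map_zero, sub_zero]
  rfl

lemma augHom_mem (l : ℤ) (m : M.X) (hm : m ∈ M.gr (0, l)) :
    (AddMonoidHom.mk' (fun m => (M.ra.flip m).comp (aug B).f.toAddMonoidHom)
      (fun m m' => AddMonoidHom.ext fun x => map_add (M.ra ((aug B).f x)) m m') :
      M.X →+ ((cx B).X →+ M.X)) m ∈ homDeg (cx B) M.toCx (0, l) := by
  refine ⟨fun a x => ?_, fun h x hx => ?_⟩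
  · change M.ra ((aug B).f ((cx B).ra a x)) m = M.ra a (M.ra ((aug B).f x) m)
    rw [(aug B).ra', unit_ra, ra_ra]
  · change M.ra ((aug B).f x) m ∈ _
    obtain h0 | ⟨h1, h2⟩ := unit_mem ((aug B).map_gr _ _ hx)
    · rw [h0, map_zero]; exact zero_mem _
    · have := ra_mem hm h2
      have e2 : ((0, l) + (0, h.2) : ℤ × ℤ) = ((0 : ℤ), l) + h :=
        Prod.ext (by simp only [Prod.fst_add, h1]) rfl
      rwa [e2] at this

/-- The map `x ↦ m ε(x)`. -/
def augHom : M.X →+ homAll (cx B) M.toCx :=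
  AddMonoidHom.codRestrict
    (AddMonoidHom.mk' (fun m => (M.ra.flip m).comp (aug B).f.toAddMonoidHom)
      (fun m m' => AddMonoidHom.ext fun x => map_add (M.ra ((aug B).f x)) m m'))
    (homAll (cx B) M.toCx)
    (homAll_of_gr 0 (fun l m hm => by rw [add_zero]; exact augHom_mem M l m hm))

lemma augHom_apply (m : M.X) (x : (cx B).X) : (augHom M m).1 x = M.ra ((aug B).f x) m := rfl

lemma augHom_grH {l : ℤ} {m : M.X} (hm : m ∈ M.gr (0, l)) :
    augHom M m ∈ grH (cx B) M.toCx (0, l) := augHom_mem M l m hm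

lemma augHom_sm (m : M.X) : sH (cx B) M.toCx (augHom M m) = augHom M (M.sm m) := by
  refine H_ext fun x => ?_
  rw [sH_apply, augHom_apply, augHom_apply, augHom_apply, (aug B).sm', unit_sm, (aug B).kos',
    unit_kos_one, sm_ra, sig_sig, map_zero]
  exact sub_zero _

lemma augHom_ra (a : B.k) (m : M.X) : rH (cx B) M.toCx a (augHom M m) = augHom M (M.ra a m) := by
  refine H_ext fun x => ?_
  rw [rH_apply, augHom_apply, augHom_apply, (aug B).la', unit_la, ra_ra]

lemma augHom_d (m : M.X) : dH (cx B) M.toCx (augHom M m) = 0 := by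
  refine H_ext fun x => ?_
  have h (y : (cx B).X) : (augHom M m).1 ((cx B).d y) = 0 := by
    rw [augHom_apply, (aug B).map_d]
    exact DFunLike.congr_fun (map_zero M.ra) m
  rw [dH_apply, M.d_eq_zero, kos_d, map_zsmul, h, smul_zero, map_zero, sub_zero]
  rfl

lemma kos_augHom (e : ℤ) (m : M.X) :
    (ihom (cx B) M.toCx).kos e (augHom M m) = augHom M (M.kos e m) := by
  induction m using M.toCx.hom_induction with
  | h0 => simp
  | hadd x y hx hy => simp only [map_add, hx, hy]
  | hom g m hm =>
    obtain ⟨k, l⟩ := g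
    by_cases h : k = 0
    · subst h
      rw [kos_of_mem (X := ihom (cx B) M.toCx) e (augHom_grH M hm), kos_of_mem e hm, map_zsmul]
    · rw [M.eq_zero h hm]; simp

lemma ev_augHom (m : M.X) : ev (augHom M m) = m := by
  induction m using M.toCx.hom_induction with
  | h0 => simp
  | hadd x y hx hy => rw [map_add, map_add, hx, hy]
  | hom g m hm =>
    obtain ⟨k, l⟩ := g
    by_cases h : k = 0
    · subst h
      rw [ev_of_mem (augHom_grH M hm), augHom_apply, neg_zero, ← Nat.cast_zero, pz_natCast,
        aug_single_zero, Gam.one_a, ra_one]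
    · rw [M.eq_zero h hm, map_zero, map_zero]

/-! ### The chains `t^c m` -/

/-- The generator `p_n` of the mapping cone. -/
def pt (n : ℕ) : (tl B).X := ((Finsupp.single n 1, 0) : (ℕ →₀ Gam B) × B.k)

/-- The element `1` of the mapping cone. -/
def one : (tl B).X := ((0, 1) : (ℕ →₀ Gam B) × B.k)

lemma pt_mem (n : ℕ) : pt n ∈ (tl B).gr (n + 1, n) := by
  refine ⟨?_, zero_mem _⟩
  have := single_one_mem (B := B) n
  have e : (((n : ℤ) + 1, (n : ℤ)) + (-1, 0) : ℤ × ℤ) = ((n : ℤ), (n : ℤ)) := by ext <;> simp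
  change _ ∈ (cx B).gr (((n : ℤ) + 1, (n : ℤ)) + (-1, 0) : ℤ × ℤ)
  rwa [e]

lemma one_mem : one ∈ (tl B).gr (0, 0) :=
  ⟨zero_mem _, mem_unit (SetLike.GradedOne.one_mem : (1 : B.k) ∈ B.gr 0)⟩

lemma lam_pt (n : ℕ) : lam B (pt n) = 0 := by
  rw [pt, lam_mk, bsum_single, Gam.one_b, sub_zero]

lemma lam_sm_pt (n : ℕ) : lam B ((tl B).sm (pt n)) = -1 := by
  rw [pt, tl_sm, sm_single, lam_mk, bsum_single]
  simp

lemma lam_one : lam B one = 1 := by rw [one, lam_mk, map_zero, sub_zero]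

lemma one_sm : (tl B).sm one = 0 := by rw [one, tl_sm, map_zero]; rfl

lemma one_d : (tl B).d one = 0 := by
  rw [one, tl_d, map_zero, map_zero, neg_zero]; rfl

lemma pt_d_zero : (tl B).d (pt 0) = one := by
  rw [pt, one, tl_d, bd_zero, aug_single_zero, neg_zero, Gam.one_a]

lemma pt_d_succ (n : ℕ) : (tl B).d (pt (n + 1))
    = -((tl B).sm (pt n) + (n : ℤ) • (tl B).ra B.eta (pt n)) := by
  have h := d_single_one_succ (B := B) n
  change bd B _ = _ at h
  rw [pt, tl_d, pt, tl_sm, tl_ra, h, aug_single_succ, zero_mul]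
  refine Prod.ext ?_ ?_
  · rfl
  · change (0 : B.k) = -(0 + (n : ℤ) • 0)
    rw [smul_zero, add_zero, neg_zero]

lemma kos_one (e : ℤ) : (tl B).kos e one = one := by
  rw [kos_of_mem e one_mem, tot_mk, add_zero, mul_zero, sg_zero, one_smul]

/-- The element `x ⊗ f` of the Tate complex. -/
def el {M : Cx B} : (tl B).X →+ homAll (cx B) M →+ (hm M).X := tm (X := tl B) (Y := ihom (cx B) M)

lemma el_mem {M : Cx B} {g h : ℤ × ℤ} {x : (tl B).X} {f : homAll (cx B) M} (hx : x ∈ (tl B).gr g)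
    (hf : f ∈ grH (cx B) M h) : el x f ∈ (hm M).gr (g + h) :=
  tm_mem (X := tl B) (Y := ihom (cx B) M) hx hf

lemma el_sm {M : Cx B} (x : (tl B).X) (f : homAll (cx B) M) :
    (hm M).sm (el x f) = el x (sH (cx B) M f) + el ((tl B).sm x) ((ihom (cx B) M).kos 1 f) := by
  rw [tensor_sm, el, sT_tm, ihom_sm]

lemma el_d {M : Cx B} (x : (tl B).X) (f : homAll (cx B) M) :
    (hm M).d (el x f) = el ((tl B).d x) f + el ((tl B).kos 1 x) (dH (cx B) M f) := by
  rw [tensor_d, el, dT_tm, ihom_d]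

lemma el_ra {M : Cx B} (a : B.k) (x : (tl B).X) (f : homAll (cx B) M) :
    (hm M).ra a (el x f) = el x (rH (cx B) M a f) := by
  rw [tensor_ra, el, rT_tm, ihom_ra]

lemma R_el {M : Cx B} (x : (tl B).X) (f : homAll (cx B) M) :
    R M (el x f) = M.la (lam B x) (ev f) := R_tm x f

/-- Of the terms of (p_n ⊗ f)(s + η) only p_n s ⊗ f survives, as λ vanishes on p_n. -/
lemma R_nm_pt {M : Cx B} (n : ℕ) (f : homAll (cx B) M) :
    R M ((hm M).nm (el (pt n) f)) = -M.kos 1 (ev f) := by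
  rw [nm_apply, map_add, R_ra, el_sm, map_add, R_el, R_el, R_el, lam_pt, lam_sm_pt, map_neg,
    AddMonoidHom.neg_apply, la_one, ev_kos]
  simp

/-- The representatives of t^n m for n ≥ 0: 1 is an invariant cycle of the cone, so 1 ⊗ f inherits
invariance and the cycle condition from the cochain f. -/
lemma el_one_genHom (n : ℕ) (m : M.X) : (hm M.toCx).sm (el one (genHom M n m)) = 0 ∧
    el one (genHom M n m) ∈ (hm M.toCx).deg (-n) ∧ R M.toCx (el one (genHom M n m)) = m ∧
    (M.mulS n m = 0 → (hm M.toCx).d (el one (genHom M n m)) = 0) ∧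
    ∀ l, m ∈ M.gr (0, l) → el one (genHom M n m) ∈ (hm M.toCx).gr (-n, l - n) := by
  have h (l : ℤ) (m : M.X) (hm : m ∈ M.gr (0, l)) :
      el one (genHom M n m) ∈ (Std.hm M.toCx).gr (-n, l - n) := by
    have := el_mem one_mem (genHom_grH M n hm)
    have e : ((0, 0) + (-(n : ℤ), l + -(n : ℤ)) : ℤ × ℤ) = (-(n : ℤ), l - n) := by
      ext <;> simp [sub_eq_add_neg]
    rwa [e] at this
  refine ⟨?_, ?_, ?_, fun hm => ?_, fun l => h l m⟩
  · rw [el_sm, genHom_sm, one_sm]; simp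
  · induction m using M.toCx.hom_induction with
    | h0 => simp
    | hadd x y hx hy => rw [map_add, map_add]; exact add_mem hx hy
    | hom g m hm =>
      obtain ⟨k, l⟩ := g
      by_cases hk : k = 0
      · subst hk; exact mem_deg (X := Std.hm M.toCx) (h l m hm)
      · rw [M.eq_zero hk hm]; simp
  · rw [R_el, lam_one, la_one, ev_genHom]
  · rw [el_d, one_d, genHom_d M n hm]; simp

/-- The representatives of t^c m for c = -(n+1) < 0. Multiplication by s + η forces invariance. If m
is a cycle, the boundary of p_n ⊗ mε is annihilated by s + η: for n > 0 it is a multiple of s, and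
for n = 0 it is 1 ⊗ mε with m(s + η) = 0. -/
lemma exists_of_neg (n : ℕ) (m : M.X) : ∃ z : (hm M.toCx).X, (hm M.toCx).sm z = 0 ∧
    z ∈ (hm M.toCx).deg (n + 1) ∧ R M.toCx z = m ∧ (M.mulS (n + 1) m = 0 → (hm M.toCx).d z = 0) ∧
    ∀ l, m ∈ M.gr (0, l) → z ∈ (hm M.toCx).gr (n + 1, l + (n + 1)) := by
  have h (l : ℤ) (m : M.X) (hm : m ∈ M.gr (0, l)) : (Std.hm M.toCx).nm (-el (pt n) (augHom M m))
      ∈ (Std.hm M.toCx).gr (n + 1, l + (n + 1)) := by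
    have := nm_mem (X := Std.hm M.toCx) (neg_mem
      (el_mem (pt_mem n) (augHom_grH M hm)))
    have e : (((n : ℤ) + 1, (n : ℤ)) + (0, l) + (0, 1) : ℤ × ℤ) = ((n : ℤ) + 1, l + (n + 1)) := by
      ext <;> simp only [Prod.fst_add, Prod.snd_add] <;> ring
    rwa [e] at this
  -- The minus sign and the sign operator on m cancel those in `R_nm_pt`.
  refine ⟨(Std.hm M.toCx).nm (-el (pt n) (augHom M (M.kos 1 m))), sm_nm (X := Std.hm M.toCx) _, ?_, ?_,
    fun hm => ?_, fun l hm => h l _ (kos_mem 1 hm)⟩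
  · generalize M.kos 1 m = m
    induction m using M.toCx.hom_induction with
    | h0 => simp
    | hadd x y hx hy => rw [map_add, map_add, neg_add, map_add]; exact add_mem hx hy
    | hom g m hm =>
      obtain ⟨k, l⟩ := g
      by_cases hk : k = 0
      · subst hk; exact mem_deg (X := Std.hm M.toCx) (h l m hm)
      · rw [M.eq_zero hk hm]; simp
  · rw [map_neg, map_neg, R_nm_pt, ev_augHom, kos_kos, neg_neg]
  · have hm' : M.mulS (n + 1) (M.kos 1 m) = 0 := by rw [M.mulS_kos, hm, map_zero, neg_zero]
    generalize M.kos 1 m = m at hm'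
    rw [d_nm (X := Std.hm M.toCx), map_neg, el_d, augHom_d, map_zero, add_zero, map_neg,
      neg_eq_zero]
    rcases n with _ | n
    · rw [Nat.cast_zero, zero_add, M.mulS_apply, one_smul] at hm'
      rw [pt_d_zero, nm_apply, el_sm, one_sm, el_ra, augHom_sm, augHom_ra, map_zero,
        AddMonoidHom.zero_apply, add_zero, ← map_add, ← map_add, hm', map_zero, map_zero]
    -- The chain (p_n ⊗ m'ε)s, where m' is m with its sign operator, consists of p_n s ⊗ mε and p_n
    -- ⊗ (m's)ε. By the cycle condition the second term is a multiple of η that turns the sum into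
    -- -d(p_{n+1}) ⊗ mε.
    · have h1 := el_sm (pt n) (augHom M (M.kos 1 m))
      rw [augHom_sm, kos_augHom, kos_kos] at h1
      have h2 : el (pt n) (augHom M (M.sm (M.kos 1 m)))
          + (n : ℤ) • el ((tl B).ra B.eta (pt n)) (augHom M m) = 0 := by
        have h3 : el ((tl B).ra B.eta (pt n)) (augHom M m)
            = el (pt n) (augHom M (M.ra B.eta (M.kos 1 m))) := by
          rw [ra_eta_kos, ← augHom_ra, ← ihom_ra]
          exact tm_ra_eta (X := tl B) (Y := ihom (cx B) M.toCx) _ _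
        have h4 : M.mulS n (M.kos 1 m) = 0 := by
          have h5 : ((n + 1 : ℕ) : ℤ) + 1 = n + 2 := by push_cast; ring
          rw [h5, M.mulS_add_two] at hm'
          rw [M.mulS_kos, hm', map_zero, neg_zero]
        rw [h3, ← map_zsmul, ← map_zsmul, ← map_add, ← map_add, ← M.mulS_apply, h4, map_zero,
          map_zero]
      have h6 : (n : ℤ) • el ((tl B).ra B.eta (pt n)) (augHom M m)
          = -((n : ℤ) • el ((tl B).ra B.eta (pt n)) (augHom M m)) := by
        have h8 : el ((tl B).ra B.eta (pt n)) (augHom M m)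
            = -el ((tl B).ra B.eta (pt n)) (augHom M m) := by
          conv_lhs => rw [← neg_ra_eta (X := tl B) (pt n), map_neg, AddMonoidHom.neg_apply]
        rw [← smul_neg, ← h8]
      have h7 : el ((tl B).d (pt (n + 1))) (augHom M m)
          = -(Std.hm M.toCx).sm (el (pt n) (augHom M (M.kos 1 m))) := by
        rw [h1, pt_d_succ, map_neg, map_add, map_zsmul, AddMonoidHom.neg_apply,
          AddMonoidHom.add_apply, AddMonoidHom.zsmul_apply, h6, eq_neg_of_add_eq_zero_left h2]
        abel
      rw [h7, map_neg, nm_sm (X := Std.hm M.toCx), neg_zero]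

/-- The comparison map on homology is surjective. -/
lemma exists_chain (c : ℤ) (m : M.X) : ∃ z : (hm M.toCx).X, (hm M.toCx).sm z = 0 ∧
    z ∈ (hm M.toCx).deg (-c) ∧ R M.toCx z = m ∧ (M.mulS c m = 0 → (hm M.toCx).d z = 0) ∧
    ∀ l, m ∈ M.gr (0, l) → z ∈ (hm M.toCx).gr (-c, l - c) := by
  rcases lt_or_ge c 0 with h | h
  -- The cone shifts p_n to homological degree n + 1, so p_0 already serves c = -1.
  · obtain ⟨n, rfl⟩ : ∃ n : ℕ, c = -(n + 1) := ⟨(-c - 1).toNat, by lia⟩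
    have := exists_of_neg M n m
    have e : M.mulS (-((n : ℤ) + 1)) = M.mulS (n + 1) := by
      refine AddMonoidHom.ext fun m => ?_
      rw [M.mulS_apply, M.mulS_apply, neg_smul, zsmul_ra_eta]
    rw [neg_neg, e]
    simpa only [sub_neg_eq_add] using this
  · lift c to ℕ using h
    exact ⟨_, el_one_genHom M c m⟩

end Std
end
end HopfTate

/-! ### Coordinates on the Tate complex and contractions, towards injectivity. -/

namespace HopfTate
noncomputable section
open EtaRing Cx

variable {B : EtaRing.{u}}

namespace Cx

variable {X Y : Cx B}

lemma sm_deg {n : ℤ} {x : X.X} (hx : x ∈ X.deg n) : X.sm x ∈ X.deg n := by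
  refine deg_induction (p := fun x => X.sm x ∈ X.deg n) (fun l x hx => ?_) (fun x y h h' => ?_) hx
  · have := sm_mem hx
    rw [Prod.mk_add_mk, add_zero] at this
    exact mem_deg this
  · rw [map_add]; exact add_mem h h'

lemma ra_deg {n : ℤ} (a : B.k) {x : X.X} (hx : x ∈ X.deg n) : X.ra a x ∈ X.deg n :=
  (X.deg n).smul_mem (op a) hx

lemma nm_deg {n : ℤ} {x : X.X} (hx : x ∈ X.deg n) : X.nm x ∈ X.deg n :=
  add_mem (sm_deg hx) (ra_deg _ hx)

lemma d_deg {n : ℤ} {x : X.X} (hx : x ∈ X.deg (n + 1)) : X.d x ∈ X.deg n := by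
  refine deg_induction (p := fun x => X.d x ∈ X.deg n) (fun l x hx => ?_) (fun x y h h' => ?_) hx
  · have := X.d_mem _ _ hx
    rw [Prod.mk_add_mk, add_zero, add_neg_cancel_right] at this
    exact mem_deg this
  · rw [map_add]; exact add_mem h h'

lemma actBy_ra (ℓ : X.X →+ B.k) (hℓ : ∀ a x, ℓ (X.ra a x) = ℓ x * a) (a : B.k) (z : TC X Y) :
    actBy ℓ hℓ (rT X Y a z) = Y.ra a (actBy ℓ hℓ z) := by
  induction z using T_induction with
  | htm g h x hx y hy => rw [rT_tm, actBy_tm, actBy_tm, la_ra]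
  | hadd z w hz hw => simp only [map_add, hz, hw]

lemma actBy_deg (ℓ : X.X →+ B.k) (hℓ : ∀ a x, ℓ (X.ra a x) = ℓ x * a) {k n : ℤ}
    (hk : ∀ g, ∀ x ∈ X.gr g, ℓ x = 0 ∨ g.1 = k ∧ ∃ j, ℓ x ∈ B.gr j) {z : TC X Y}
    (hz : z ∈ (tensor X Y).deg n) : actBy ℓ hℓ z ∈ Y.deg (n - k) := by
  refine deg_induction (X := tensor X Y) (p := fun z => actBy ℓ hℓ z ∈ Y.deg (n - k))
    (fun l z hz => ?_) (fun x y h h' => ?_) hz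
  · refine grT_le (S := (Y.deg (n - k)).toAddSubgroup) (fun h h' e x hx y hy => ?_) z hz
    change actBy ℓ hℓ (tm x y) ∈ Y.deg (n - k)
    rw [actBy_tm]
    obtain h0 | ⟨h1, j, h2⟩ := hk h x hx
    · rw [h0, map_zero]; exact zero_mem _
    · rw [la_of_mem h2]
      refine ra_deg _ (kos_deg ?_)
      have e1 := congrArg Prod.fst e
      rw [Prod.fst_add, h1] at e1
      have e2 : n - k = h'.1 := by change k + h'.1 = n at e1; rw [← e1]; ring
      rw [e2]
      exact mem_deg hy
  · rw [map_add]; exact add_mem h h'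

lemma la_sig_kos (a : B.k) (x : X.X) : X.la (B.sig a) (X.kos 1 x) = X.kos 1 (X.la a x) := by
  rw [← kos_kos 1 (X.la _ _), kos_la_sig, kos_kos]

end Cx

namespace Std

/-! ### Coordinates on the tensor product with the mapping cone -/

variable {Y : Cx B}

variable (B) in
/-- The coefficient of `p_n`. -/
def fA (n : ℕ) : (tl B).X →+ B.k := AddMonoidHom.mk' (fun x => (x.1 n).a) (fun _ _ => rfl)

variable (B) in
/-- The coefficient of `p_n s`. -/
def fB (n : ℕ) : (tl B).X →+ B.k := AddMonoidHom.mk' (fun x => (x.1 n).b) (fun _ _ => rfl)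

variable (B) in
/-- The coefficient of `1`. -/
def fY : (tl B).X →+ B.k := AddMonoidHom.mk' (fun x => x.2) (fun _ _ => rfl)

lemma fA_apply (n : ℕ) (x : (tl B).X) : fA B n x = (x.1 n).a := rfl
lemma fB_apply (n : ℕ) (x : (tl B).X) : fB B n x = (x.1 n).b := rfl
lemma tl_ra_fst (a : B.k) (x : (tl B).X) (n : ℕ) : ((tl B).ra a x).1 n = x.1 n * Gam.ι a := rfl
lemma tl_sm_fst (x : (tl B).X) (n : ℕ) : ((tl B).sm x).1 n = x.1 n * Gam.s := rfl
lemma tl_d_fst (x : (tl B).X) (n : ℕ) :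
    ((tl B).d x).1 n = -(Gam.sEta B n * x.1 (n + 1)) := by
  rw [← cx_d_apply]; rfl

lemma fA_ra (n : ℕ) (a : B.k) (x : (tl B).X) : fA B n ((tl B).ra a x) = fA B n x * a := by
  rw [fA_apply, fA_apply, tl_ra_fst]; rfl

lemma fB_ra (n : ℕ) (a : B.k) (x : (tl B).X) : fB B n ((tl B).ra a x) = fB B n x * a := by
  rw [fB_apply, fB_apply, tl_ra_fst]; simp

lemma fY_ra (a : B.k) (x : (tl B).X) : fY B ((tl B).ra a x) = fY B x * a := rfl

/-- The coordinate of `p_n`. -/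
def cA (n : ℕ) : TC (tl B) Y →+ Y.X := actBy (fA B n) (fA_ra n)
/-- The coordinate of `p_n s`. -/
def cB (n : ℕ) : TC (tl B) Y →+ Y.X := actBy (fB B n) (fB_ra n)
/-- The coordinate of `1`. -/
def cY : TC (tl B) Y →+ Y.X := actBy (fY B) fY_ra

lemma cA_tm (n : ℕ) (x : (tl B).X) (y : Y.X) : cA n (tm x y) = Y.la (x.1 n).a y := rfl
lemma cB_tm (n : ℕ) (x : (tl B).X) (y : Y.X) : cB n (tm x y) = Y.la (x.1 n).b y := rfl
lemma cY_tm (x : (tl B).X) (y : Y.X) : cY (tm x y) = Y.la x.2 y := rfl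

/-- A coefficient of p_n s in zs arises from p_n acted on by s, from s acting on the other factor,
and from p_n s² = p_n sη. -/
lemma cB_sm (n : ℕ) (z : TC (tl B) Y) :
    cB n (sT (tl B) Y z) = Y.sm (cB n z) + Y.kos 1 (cA n z) + Y.ra B.eta (cB n z) := by
  induction z using T_induction with
  | hadd z w hz hw => simp only [map_add, hz, hw]; abel
  | htm g h x hx y hy =>
    have e : (x.1 n * Gam.s).b = B.sig (x.1 n).a + B.eta * B.sig (x.1 n).b := by simp
    rw [sT_tm, map_add, cB_tm, cB_tm, cB_tm, cA_tm, tl_sm_fst, e, map_add, AddMonoidHom.add_apply,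
      ← la_la, la_sig_kos, la_sig_kos, la_eta, ra_eta_kos, sm_la, add_assoc]

lemma cY_sm (z : TC (tl B) Y) : cY (sT (tl B) Y z) = Y.sm (cY z) := by
  induction z using T_induction with
  | hadd z w hz hw => simp only [map_add, hz, hw]
  | htm g h x hx y hy =>
    have e : ((tl B).sm x).2 = 0 := unit_sm x.2
    rw [sT_tm, map_add, cY_tm, cY_tm, cY_tm, e, map_zero, sm_la, AddMonoidHom.zero_apply, add_zero]

lemma fB_deg (n : ℕ) (g : ℤ × ℤ) (x : (tl B).X) (hx : x ∈ (tl B).gr g) :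
    fB B n x = 0 ∨ g.1 = n + 1 ∧ fB B n x ∈ B.gr (g.2 - n - 1) := by
  have h := hx.1 n
  by_cases e : (n : ℤ) = (g + (-1, 0)).1
  · right
    rw [Prod.fst_add] at e
    have e2 : g.1 = n + 1 := by rw [e]; ring
    refine ⟨e2, ?_⟩
    have h2 := (h.1 (by rw [Prod.fst_add]; exact e)).2
    simp only [Prod.fst_add, Prod.snd_add, e2] at h2
    have e3 : g.2 + 0 - ((n : ℤ) + 1 + -1) - 1 = g.2 - n - 1 := by ring
    rwa [e3] at h2
  · left
    rw [fB_apply, h.2 e]; rfl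

/-- The boundary of p_{n+1} in the cone contributes -p_n s, and that of p_{n+1}s contributes -(n+1)
p_n sη. Thus the coordinate at p_n s of dz involves only coordinates of index n and n + 1. -/
lemma cB_d (n : ℕ) (z : TC (tl B) Y) : cB n (dT (tl B) Y z)
    = Y.d (cB n z) - (cA (n + 1) z + ((n : ℤ) + 1) • Y.ra B.eta (cB (n + 1) z)) := by
  induction z using T_induction with
  | hadd z w hz hw => simp only [map_add, hz, hw, smul_add]; abel
  | htm g h x hx y hy =>
    -- The element p_n s of the cone has even total degree 2n + 2, so its coefficient has the parity
    -- of x.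
    have e : fB B n ((tl B).kos 1 x) = B.sig (fB B n x) := by
      rw [kos_of_mem 1 hx, map_zsmul]
      obtain h0 | ⟨h1, h2⟩ := fB_deg n g x hx
      · rw [h0, map_zero, smul_zero]
      · rw [sig_of_mem h2, tot, h1]
        congr 1
        have : g.2 - (n : ℤ) - 1 = 1 * ((n + 1) + g.2) - (((n : ℤ) + 1) + (n + 1)) := by ring
        rw [this, sg_sub, sg_add ((n : ℤ) + 1) (n + 1), sg_sq, mul_one]
    have e' : (((tl B).kos 1 x).1 n).b = B.sig (x.1 n).b := e
    rw [dT_tm, map_add, cB_tm, cB_tm, cB_tm, cA_tm, cB_tm, e', tl_d_fst, Gam.neg_b, Gam.sEta_mul_b,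
      d_la, map_neg, map_add, map_zsmul, AddMonoidHom.neg_apply, AddMonoidHom.add_apply,
      AddMonoidHom.zsmul_apply, ← la_la, la_eta]
    abel

lemma cB_deg (n : ℕ) {k : ℤ} {z : TC (tl B) Y} (hz : z ∈ (tensor (tl B) Y).deg k) :
    cB n z ∈ Y.deg (k - (n + 1)) :=
  actBy_deg _ _ (fun g x hx => (fB_deg n g x hx).imp_right fun h => ⟨h.1, _, h.2⟩) hz

lemma cY_deg {k : ℤ} {z : TC (tl B) Y} (hz : z ∈ (tensor (tl B) Y).deg k) : cY z ∈ Y.deg k := by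
  have := actBy_deg (Y := Y) (fY B) fY_ra (k := 0) (fun g x hx => (unit_mem hx.2).imp_right
    fun h => ⟨h.1, _, h.2⟩) hz
  rwa [sub_zero] at this

/-- A consequence of the freeness of the cone over k on 1, p_n and p_n s. The expansion is asserted
for every N' ≥ N so that those of two summands can be added with a common range. -/
lemma exists_coord (z : TC (tl B) Y) : ∃ N, ∀ N' ≥ N, (∀ n ≥ N', cA n z = 0 ∧ cB n z = 0) ∧
    z = tm one (cY z) + ∑ n ∈ Finset.range N',
      (tm (pt n) (cA n z) + tm ((tl B).sm (pt n)) (cB n z)) := by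
  have hadd (z w : TC (tl B) Y)
      (hz : ∃ N, ∀ N' ≥ N, (∀ n ≥ N', cA n z = 0 ∧ cB n z = 0) ∧
        z = tm one (cY z) + ∑ n ∈ Finset.range N',
          (tm (pt n) (cA n z) + tm ((tl B).sm (pt n)) (cB n z)))
      (hw : ∃ N, ∀ N' ≥ N, (∀ n ≥ N', cA n w = 0 ∧ cB n w = 0) ∧
        w = tm one (cY w) + ∑ n ∈ Finset.range N',
          (tm (pt n) (cA n w) + tm ((tl B).sm (pt n)) (cB n w))) :
      ∃ N, ∀ N' ≥ N, (∀ n ≥ N', cA n (z + w) = 0 ∧ cB n (z + w) = 0) ∧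
        z + w = tm one (cY (z + w)) + ∑ n ∈ Finset.range N',
          (tm (pt n) (cA n (z + w)) + tm ((tl B).sm (pt n)) (cB n (z + w))) := by
    obtain ⟨N, hN⟩ := hz
    obtain ⟨L, hL⟩ := hw
    refine ⟨max N L, fun N' hN' => ?_⟩
    obtain ⟨h1, h2⟩ := hN N' (le_of_max_le_left hN')
    obtain ⟨h3, h4⟩ := hL N' (le_of_max_le_right hN')
    refine ⟨fun n hn => ?_, ?_⟩
    · rw [map_add, map_add, (h1 n hn).1, (h1 n hn).2, (h3 n hn).1, (h3 n hn).2, add_zero]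
      exact ⟨rfl, rfl⟩
    · conv_lhs => rw [h2, h4]
      simp only [map_add, Finset.sum_add_distrib]
      abel
  induction z using T_induction with
  | hadd z w hz hw => exact hadd z w hz hw
  | htm g h x hx y hy =>
    clear hx
    induction x using tl_induction with
    | h0 => exact ⟨0, fun N' _ => by simp⟩
    | h1 a =>
      refine ⟨0, fun N' _ => ?_⟩
      have hA (n : ℕ) : cA n (tm ((0, a) : (ℕ →₀ Gam B) × B.k) y : TC (tl B) Y) = 0 := by
        rw [cA_tm]; exact DFunLike.congr_fun (map_zero Y.la) y
      have hB (n : ℕ) : cB n (tm ((0, a) : (ℕ →₀ Gam B) × B.k) y : TC (tl B) Y) = 0 := by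
        rw [cB_tm]; exact DFunLike.congr_fun (map_zero Y.la) y
      refine ⟨fun n _ => ⟨hA n, hB n⟩, ?_⟩
      have e : ((0, a) : (ℕ →₀ Gam B) × B.k) = (tl B).ra a one := by
        rw [one, tl_ra, map_zero, one_mul]
      have h3 : tm one (cY (tm ((0, a) : (ℕ →₀ Gam B) × B.k) y : TC (tl B) Y))
          = (tm ((0, a) : (ℕ →₀ Gam B) × B.k) y : TC (tl B) Y) := by
        rw [e, tm_la, cY_tm, one, la_one]
      simp only [hA, hB, map_zero, add_zero, Finset.sum_const_zero]
      exact h3.symm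
    | h2 m x =>
      have hA (n : ℕ) (hn : n ≠ m) :
          cA n (tm ((Finsupp.single m x, 0) : (ℕ →₀ Gam B) × B.k) y : TC (tl B) Y) = 0 := by
        rw [cA_tm, Finsupp.single_eq_of_ne hn]; exact DFunLike.congr_fun (map_zero Y.la) y
      have hB (n : ℕ) (hn : n ≠ m) :
          cB n (tm ((Finsupp.single m x, 0) : (ℕ →₀ Gam B) × B.k) y : TC (tl B) Y) = 0 := by
        rw [cB_tm, Finsupp.single_eq_of_ne hn]; exact DFunLike.congr_fun (map_zero Y.la) y
      have hY : cY (tm ((Finsupp.single m x, 0) : (ℕ →₀ Gam B) × B.k) y : TC (tl B) Y) = 0 := by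
        rw [cY_tm]; exact DFunLike.congr_fun (map_zero Y.la) y
      refine ⟨m + 1, fun N' hN' => ⟨fun n hn => ⟨hA n (by lia), hB n (by lia)⟩, ?_⟩⟩
      rw [hY, map_zero, zero_add, Finset.sum_eq_single m]
      · rw [cA_tm, cB_tm, ← tm_la, ← tm_la, ← AddMonoidHom.add_apply, ← map_add]
        congr 2
        rw [pt, tl_sm, tl_ra, tl_ra, sm_single, ra_single, ra_single]
        refine Prod.ext ?_ ?_
        · change Finsupp.single m x = Finsupp.single m _ + Finsupp.single m _
          rw [← Finsupp.single_add, one_mul, one_mul]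
          simp only [Finsupp.single_eq_same]
          rw [← Gam.eq_add]
        · simp
      · intro n _ hn
        rw [hA n hn, hB n hn, map_zero, map_zero, add_zero]
      · intro h
        exact absurd (Finset.mem_range.2 (by lia)) h
    | hadd x x' h h' =>
      rw [map_add, AddMonoidHom.add_apply]
      exact hadd _ _ h h'

lemma eq_sum_coord (z : TC (tl B) Y) {N : ℕ} (hA : ∀ n ≥ N, cA n z = 0) (hB : ∀ n ≥ N, cB n z = 0) :
    z = tm one (cY z) + ∑ n ∈ Finset.range N,
      (tm (pt n) (cA n z) + tm ((tl B).sm (pt n)) (cB n z)) := by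
  obtain ⟨L, hL⟩ := exists_coord z
  refine (hL (max N L) (le_max_right _ _)).2.trans ?_
  congr 1
  refine (Finset.sum_subset (Finset.range_mono (le_max_left N L)) fun n _ hn => ?_).symm
  rw [Finset.mem_range, not_lt] at hn
  rw [hA n hn, hB n hn, map_zero, map_zero, add_zero]

/-! ### The contraction of the cochains -/

variable {M : Cx B}

lemma contr_comp_mem {g : ℤ × ℤ} {f : (cx B).X →+ M.X} (hf : f ∈ homDeg (cx B) M g) :
    ((M.kos 1).comp (f.comp ((cx B).kos 1))).comp (contr B) ∈ homDeg (cx B) M (g + (1, 0)) := by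
  refine ⟨fun a x => ?_, fun h x hx => ?_⟩
  · simp only [AddMonoidHom.comp_apply, kos_map_kos 1 hf, map_zsmul]
    rw [contr_ra, hf.1]
  · simp only [AddMonoidHom.comp_apply, kos_map_kos 1 hf]
    rw [add_assoc, add_comm (1, 0) h]
    exact zsmul_mem (hf.2 _ _ (contr_mem hx)) _

variable (M) in
/-- The contraction of the cochain complex induced by that of the standard resolution. -/
def contrH : homAll (cx B) M →+ homAll (cx B) M :=
  hres ((AddMonoidHom.compHom.flip (contr B)).comp ((AddMonoidHom.compHom (M.kos 1)).comp
    (AddMonoidHom.compHom.flip ((cx B).kos 1)))) (fun _ _ hf => homDeg_le _ (contr_comp_mem hf))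

lemma contrH_apply (f : homAll (cx B) M) (x : (cx B).X) :
    (contrH M f).1 x = M.kos 1 (f.1 ((cx B).kos 1 (contr B x))) := rfl

lemma contrH_grH {g : ℤ × ℤ} {f : homAll (cx B) M} (hf : f ∈ grH (cx B) M g) :
    contrH M f ∈ grH (cx B) M (g + (1, 0)) := contr_comp_mem hf

lemma contr_pz (n : ℤ) : contr B (pz B n) = 0 := by
  by_cases h : 0 ≤ n
  · lift n to ℕ using h
    rw [pz_natCast, contr_single, Gam.one_b, map_zero, Finsupp.single_zero]
  · rw [pz_neg (by lia), map_zero]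

lemma ev_contrH (f : homAll (cx B) M) : ev (contrH M f) = 0 := by
  induction f using H_induction with
  | hadd f f' h h' => rw [map_add, map_add, h, h', add_zero]
  | hom g f hf => rw [ev_of_mem (contrH_grH hf), contrH_apply, contr_pz, map_zero, map_zero, map_zero]

lemma contrH_deg {k : ℤ} {f : homAll (cx B) M} (hf : f ∈ (ihom (cx B) M).deg k) :
    contrH M f ∈ (ihom (cx B) M).deg (k + 1) := by
  refine deg_induction (X := ihom (cx B) M) (p := fun f => contrH M f ∈ (ihom (cx B) M).deg (k + 1))
    (fun l f hf => ?_) (fun f f' h h' => ?_) hf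
  · have := contrH_grH hf
    rw [Prod.mk_add_mk, add_zero] at this
    exact mem_deg (X := ihom (cx B) M) this
  · exact (map_add (contrH M) f f').symm ▸ add_mem h h'

variable {M : GMod B}

/-- Composing f with `bd_contr` gives f ∘ (dκ + κd) = f - f(p_0)ε, up to the place of the scalar.
Here f ∘ d = 0 on the image of κ and f(p_0) = 0, so f = f ∘ κd; the definition of `contrH` absorbs
the sign. -/
lemma d_contrH (f : homAll (cx B) M.toCx) (hd : dH (cx B) M.toCx f = 0)
    (h0 : f.1 (pz B 0) = 0) : dH (cx B) M.toCx (contrH M.toCx f) = f := by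
  refine H_ext fun x => ?_
  have h1 := DFunLike.congr_fun (congrArg Subtype.val hd) ((cx B).kos 1 (contr B x))
  rw [dH_apply, M.d_eq_zero, zero_sub, kos_d, kos_kos, map_zsmul] at h1
  have h2 : f.1 ((cx B).d (contr B x)) = 0 := by
    have h3 := congrArg (M.kos 1) h1
    rw [map_neg, kos_kos, sg_one, neg_smul, one_smul, neg_neg] at h3
    exact h3.trans (map_zero _)
  have h4 : (cx B).kos 1 (contr B ((cx B).kos 1 ((cx B).d x))) = -contr B ((cx B).d x) := by
    rw [contr_kos, map_neg, kos_kos]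
  rw [dH_apply, M.d_eq_zero, zero_sub, contrH_apply, h4, map_neg, map_neg, map_neg, kos_kos, neg_neg]
  have h5 := congrArg f.1 (bd_contr x)
  have h6 : (Finsupp.single 0 (Gam.ι ((aug B).f x)) : ℕ →₀ Gam B)
      = (cx B).ra ((aug B).f x) (pz B 0) := by
    rw [show pz B 0 = Finsupp.single 0 1 from pz_natCast 0, ra_single, one_mul]
  have h7 : f.1 (bd B (contr B x)) + f.1 (contr B (bd B x)) = f.1 x := by
    rw [← map_add, h5, h6, map_sub, map_ra f.2, h0, map_zero, sub_zero]
  rw [show f.1 (bd B (contr B x)) = 0 from h2, zero_add] at h7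
  exact h7

lemma apply_of_deg {k : ℤ} {f : homAll (cx B) M.toCx} (hf : f ∈ (ihom (cx B) M.toCx).deg k)
    {n : ℤ} (hn : n ≠ -k) : f.1 (pz B n) = 0 := by
  refine deg_induction (X := ihom (cx B) M.toCx) (p := fun f => f.1 (pz B n) = 0)
    (fun l f hf => ?_) (fun f f' h h' => ?_) hf
  · exact M.eq_zero (by simp only [Prod.fst_add]; lia) (grH_map hf (pz_mem n))
  · change f.1 (pz B n) + f'.1 (pz B n) = 0
    rw [h, h', add_zero]

lemma ev_of_deg {k : ℤ} {f : homAll (cx B) M.toCx} (hf : f ∈ (ihom (cx B) M.toCx).deg k) :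
    ev f = f.1 (pz B (-k)) := by
  refine deg_induction (X := ihom (cx B) M.toCx) (p := fun f => ev f = f.1 (pz B (-k)))
    (fun l f hf => ev_of_mem hf) (fun f f' h h' => ?_) hf
  exact (map_add ev f f').trans (congrArg₂ (· + ·) h h')

/-- Invariance means Γ-linearity, so f is determined by its values at the p_n; those with n ≠ -k lie
in nonzero homological degrees of M and vanish. -/
lemma eq_zero_of_ev {k : ℤ} {f : homAll (cx B) M.toCx} (hf : f ∈ (ihom (cx B) M.toCx).deg k)
    (hs : sH (cx B) M.toCx f = 0) (he : ev f = 0) : f = 0 := by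
  have h1 (x : (cx B).X) : f.1 ((cx B).sm x) = M.sm (f.1 x) := by
    have := DFunLike.congr_fun (congrArg Subtype.val hs) ((cx B).kos 1 x)
    rw [sH_apply, kos_kos] at this
    exact (sub_eq_zero.1 this).symm
  have h2 (n : ℕ) : f.1 (Finsupp.single n 1) = 0 := by
    rw [← pz_natCast]
    by_cases h : (n : ℤ) = -k
    · rw [h, ← ev_of_deg hf, he]
    · exact apply_of_deg hf h
  refine H_ext fun x => ?_
  change f.1 x = 0
  induction x using Finsupp.induction_linear with
  | zero => exact map_zero f.1
  | add x y hx hy => exact (map_add f.1 x y).trans (by rw [hx, hy, add_zero])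
  | single n γ =>
    have e : (Finsupp.single n γ : ℕ →₀ Gam B)
        = (cx B).ra γ.a (Finsupp.single n 1) + (cx B).ra γ.b ((cx B).sm (Finsupp.single n 1)) := by
      rw [← smul_eq, Finsupp.smul_single, op_smul_eq_mul, one_mul]
    rw [e, map_add, map_ra f.2, map_ra f.2, h1, h2, map_zero, map_zero, map_zero, add_zero]

end Std
end
end HopfTate

/-! ### Bijectivity of the comparison map. -/

namespace HopfTate
noncomputable section
open EtaRing Cx

variable {B : EtaRing.{u}}

namespace Std

section

variable {M : Cx B}

/-- The coordinate of `p_n` on the Tate complex. -/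
def hA (n : ℕ) : (hm M).X →+ homAll (cx B) M := cA (Y := ihom (cx B) M) n
/-- The coordinate of `p_n s` on the Tate complex. -/
def hB (n : ℕ) : (hm M).X →+ homAll (cx B) M := cB (Y := ihom (cx B) M) n
/-- The coordinate of `1` on the Tate complex. -/
def hY : (hm M).X →+ homAll (cx B) M := cY (Y := ihom (cx B) M)

lemma hB_sm (n : ℕ) (z : (hm M).X) : hB n ((hm M).sm z)
    = sH (cx B) M (hB n z) + (ihom (cx B) M).kos 1 (hA n z) + rH (cx B) M B.eta (hB n z) := by
  rw [← ihom_sm, ← ihom_ra, tensor_sm]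
  exact cB_sm (Y := ihom (cx B) M) n z

lemma hB_ra (n : ℕ) (a : B.k) (z : (hm M).X) :
    hB n ((hm M).ra a z) = rH (cx B) M a (hB n z) := by
  rw [← ihom_ra, tensor_ra]
  exact actBy_ra (Y := ihom (cx B) M) (fB B n) (fB_ra n) _ _

lemma hY_sm (z : (hm M).X) : hY ((hm M).sm z) = sH (cx B) M (hY z) := by
  rw [← ihom_sm, tensor_sm]
  exact cY_sm (Y := ihom (cx B) M) z

lemma hB_d (n : ℕ) (z : (hm M).X) : hB n ((hm M).d z)
    = dH (cx B) M (hB n z) - (hA (n + 1) z + ((n : ℤ) + 1) • rH (cx B) M B.eta (hB (n + 1) z)) := by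
  rw [← ihom_d, ← ihom_ra, tensor_d]
  exact cB_d (Y := ihom (cx B) M) n z

lemma hB_deg (n : ℕ) {k : ℤ} {z : (hm M).X} (hz : z ∈ (hm M).deg k) :
    hB n z ∈ (ihom (cx B) M).deg (k - (n + 1)) := cB_deg (Y := ihom (cx B) M) n hz

lemma hY_deg {k : ℤ} {z : (hm M).X} (hz : z ∈ (hm M).deg k) : hY z ∈ (ihom (cx B) M).deg k :=
  cY_deg (Y := ihom (cx B) M) hz

lemma exists_bound (z : (hm M).X) : ∃ N, ∀ n ≥ N, hB n z = 0 := by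
  obtain ⟨N, hN⟩ := exists_coord (Y := ihom (cx B) M) z
  exact ⟨N, fun n hn => ((hN N le_rfl).1 n hn).2⟩

/-- By the coordinate of zs = 0 at p_n s, the coordinate at p_n of an invariant chain is determined
by the one at p_n s. -/
lemma hA_eq_zero {z : (hm M).X} (hs : (hm M).sm z = 0) {n : ℕ} (hB0 : hB n z = 0) :
    hA n z = 0 := by
  have h := hB_sm n z
  rw [hs, hB0, map_zero, map_zero, map_zero, zero_add, add_zero] at h
  have h1 := kos_kos (X := ihom (cx B) M) 1 (hA n z)
  rw [← h, map_zero] at h1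
  exact h1.symm

lemma eq_el_one {z : (hm M).X} (hA0 : ∀ n, hA n z = 0) (hB0 : ∀ n, hB n z = 0) :
    z = el one (hY z) := by
  have h := eq_sum_coord (Y := ihom (cx B) M) (N := 0) z (fun n _ => hA0 n) (fun n _ => hB0 n)
  rw [Finset.sum_range_zero, add_zero] at h
  exact h

lemma R_el_pt (n : ℕ) (f g : homAll (cx B) M) :
    R M (el (pt n) f + el ((tl B).sm (pt n)) g) = -ev g := by
  rw [map_add, R_el, R_el, lam_pt, lam_sm_pt, map_zero, map_neg, AddMonoidHom.neg_apply, la_one]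
  exact zero_add _

lemma R_eq_sub_sum {z : (hm M).X} (N : ℕ) (hA0 : ∀ n ≥ N, hA n z = 0) (hB0 : ∀ n ≥ N, hB n z = 0) :
    R M z = ev (hY z) + ∑ n ∈ Finset.range N, -ev (hB n z) := by
  have h : z = el one (hY z) + ∑ n ∈ Finset.range N,
      (el (pt n) (hA n z) + el ((tl B).sm (pt n)) (hB n z)) :=
    eq_sum_coord (Y := ihom (cx B) M) (N := N) z hA0 hB0
  refine (congrArg (R M) h).trans ?_
  rw [map_add, map_sum, R_el, lam_one, la_one]
  exact congrArg _ (Finset.sum_congr rfl fun n _ => R_el_pt n _ _)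

lemma hB_el_pt (n N : ℕ) (f : homAll (cx B) M) : hB n (el (pt N) f) = 0 := by
  change (ihom (cx B) M).la ((Finsupp.single N (1 : Gam B) : ℕ →₀ Gam B) n).b f = 0
  have : ((Finsupp.single N (1 : Gam B) : ℕ →₀ Gam B) n).b = 0 := by
    rw [Finsupp.single_apply]; split_ifs <;> rfl
  rw [this, map_zero]; rfl

lemma hA_el_pt (n N : ℕ) (f : homAll (cx B) M) :
    hA n (el (pt N) f) = if n = N then f else 0 := by
  change (ihom (cx B) M).la ((Finsupp.single N (1 : Gam B) : ℕ →₀ Gam B) n).a f = _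
  by_cases h : n = N
  · rw [h, Finsupp.single_eq_same, if_pos rfl, Gam.one_a, la_one]
  · rw [Finsupp.single_eq_of_ne h, if_neg h, Gam.zero_a, map_zero]; rfl

/-- These are invariant chains with a prescribed coordinate f at a single p_N s; they serve to
remove the coordinates of a cycle one at a time. -/
lemma hB_nm_el_pt (n N : ℕ) (f : homAll (cx B) M) :
    hB n ((hm M).nm (el (pt N) ((ihom (cx B) M).kos 1 f))) = if n = N then f else 0 := by
  have e : hB n ((hm M).nm (el (pt N) ((ihom (cx B) M).kos 1 f)))
      = hB n ((hm M).sm (el (pt N) ((ihom (cx B) M).kos 1 f)))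
        + hB n ((hm M).ra B.eta (el (pt N) ((ihom (cx B) M).kos 1 f))) := map_add _ _ _
  rw [e, hB_sm, hB_ra, hB_el_pt, hA_el_pt, map_zero, map_zero, zero_add, add_zero, add_zero]
  split_ifs
  · exact kos_kos (X := ihom (cx B) M) 1 f
  · exact map_zero ((ihom (cx B) M).kos 1)

end

variable (M : GMod B)

/-- In degree N + 1 the coordinates at 1 and at p_n s with n < N are cochains of positive
homological degree, which have no generator to be evaluated at. -/
lemma R_eq_neg_ev {k : ℤ} {z : (hm M.toCx).X} (hz : z ∈ (hm M.toCx).deg k) {N : ℕ} (hk : k = N + 1)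
    (hA0 : ∀ n ≥ N + 1, hA n z = 0) (hB0 : ∀ n ≥ N + 1, hB n z = 0) :
    R M.toCx z = -ev (hB N z) := by
  have h0 {j : ℤ} {f : homAll (cx B) M.toCx} (hf : f ∈ (ihom (cx B) M.toCx).deg j) (hj : 0 < j) :
      ev f = 0 := by
    rw [ev_of_deg hf, pz_neg (by omega), map_zero]
  rw [R_eq_sub_sum (N + 1) hA0 hB0, h0 (hY_deg hz) (by omega), zero_add, Finset.sum_eq_single N]
  · intro n hn hnN
    rw [Finset.mem_range] at hn
    rw [h0 (hB_deg n hz) (by omega), neg_zero]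
  · intro hN
    exact absurd (Finset.mem_range.2 (by omega)) hN

/-- Induction on a bound N for the indices of the coordinates at p_n s. With none left, z = 1 ⊗ f
with f Γ-linear and R(z) = ev(f) = 0, so z = 0. Otherwise the top coordinate is a cocycle, and the
chain with its contraction at p_N s has a boundary with the same top coordinate. -/
lemma exists_boundary (N : ℕ) {k : ℤ} (z : (hm M.toCx).X) (hs : (hm M.toCx).sm z = 0)
    (hk : z ∈ (hm M.toCx).deg k) (hd : (hm M.toCx).d z = 0) (hR : R M.toCx z = 0)
    (hB0 : ∀ n ≥ N, hB n z = 0) :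
    ∃ w, ((hm M.toCx).sm w = 0 ∧ w ∈ (hm M.toCx).deg (k + 1)) ∧ (hm M.toCx).d w = z := by
  induction N generalizing z with
  | zero =>
    have h := eq_el_one (fun n => hA_eq_zero hs (hB0 n n.zero_le)) (fun n => hB0 n n.zero_le)
    have h1 : hY z = 0 := by
      refine eq_zero_of_ev (hY_deg hk) ?_ ?_
      · rw [← hY_sm, hs, map_zero]
      · have h2 := congrArg (R M.toCx) h
        rw [hR, R_el, lam_one, la_one] at h2
        exact h2.symm
    refine ⟨0, ⟨map_zero _, zero_mem _⟩, ?_⟩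
    rw [h, h1, map_zero, map_zero]
  | succ N ih =>
    have hA0 : ∀ n ≥ N + 1, hA n z = 0 := fun n hn => hA_eq_zero hs (hB0 n hn)
    have hgk := hB_deg N hk
    have hgd := hB_d N z
    rw [hd, map_zero, hA0 (N + 1) le_rfl, hB0 (N + 1) le_rfl, map_zero, smul_zero, add_zero,
      sub_zero] at hgd
    -- The only obstruction to contracting a cocycle is its value at p_0. It vanishes for degree
    -- reasons except when the top coordinate has degree 0, that is k = N + 1; then it is -R(z).
    have hg0 : (hB N z).1 (pz B 0) = 0 := by
      by_cases h : k = N + 1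
      · have h1 := R_eq_neg_ev M hk h hA0 hB0
        rw [hR, ev_of_deg hgk, h, sub_self, neg_zero] at h1
        exact neg_eq_zero.1 h1.symm
      · exact apply_of_deg hgk (by omega)
    have hgh := d_contrH (hB N z) hgd.symm hg0
    have hfk := contrH_deg hgk
    have hfe := ev_contrH (hB N z)
    generalize contrH M.toCx (hB N z) = f at hgh hfk hfe
    have hws := sm_nm (X := hm M.toCx) (el (pt N) ((ihom (cx B) M.toCx).kos 1 f))
    have hwk : (hm M.toCx).nm (el (pt N) ((ihom (cx B) M.toCx).kos 1 f)) ∈ (hm M.toCx).deg (k + 1) :=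
      nm_deg (X := hm M.toCx) (tm_deg (X := tl B) (Y := ihom (cx B) M.toCx)
        (m := (N : ℤ) + 1) (n := k - (N + 1) + 1) (by ring) (mem_deg (pt_mem N))
        (kos_deg (X := ihom (cx B) M.toCx) hfk))
    have hwR : R M.toCx ((hm M.toCx).nm (el (pt N) ((ihom (cx B) M.toCx).kos 1 f))) = 0 := by
      rw [R_nm_pt, ev_kos, kos_kos, hfe, neg_zero]
    have hwB := fun n => hB_nm_el_pt (M := M.toCx) n N f
    generalize (hm M.toCx).nm (el (pt N) ((ihom (cx B) M.toCx).kos 1 f)) = w at hws hwk hwR hwB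
    -- The coordinates of w of index n + 1 > N vanish, so only the boundary of the coordinate of
    -- index n contributes.
    have hwd (n : ℕ) (hn : n ≥ N) : hB n ((hm M.toCx).d w) = if n = N then hB N z else 0 := by
      have e1 : hB (n + 1) w = 0 := by rw [hwB, if_neg (by omega)]
      rw [hB_d, e1, hA_eq_zero hws e1, map_zero, smul_zero, add_zero, sub_zero, hwB]
      split_ifs
      · exact hgh
      · exact map_zero _
    -- The contraction has value zero at generators, so R(w) = 0; hence subtracting dw preserves the
    -- condition R = 0 needed for the induction.
    have hRd : R M.toCx ((hm M.toCx).d w) = 0 := by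
      rw [R_d_of_inv M hwk hws, R_kos, hwR, map_zero, map_zero, neg_zero]
    obtain ⟨v, ⟨hv1, hv2⟩, hv⟩ := ih (z - (hm M.toCx).d w)
      (by rw [map_sub, ← d_sm (X := hm M.toCx), hs, hws, map_zero, sub_zero])
      (sub_mem hk (d_deg (X := hm M.toCx) hwk))
      (by rw [map_sub, hd, d_d, sub_zero])
      (by rw [map_sub, hR, hRd, sub_zero])
      (fun n hn => by
        rw [map_sub, hwd n hn]
        split_ifs with h
        · rw [h, sub_self]
        · rw [hB0 n (by omega), sub_zero])
    refine ⟨v + w, ⟨by rw [map_add, hv1, hws, add_zero], add_mem hv2 hwk⟩, ?_⟩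
    rw [map_add, hv, sub_add_cancel]

theorem RH_injective (c : ℤ) : Function.Injective (RH M c) := by
  rw [injective_iff_map_eq_zero]
  intro x hx
  obtain ⟨⟨z, hz⟩, rfl⟩ := Hcls_surjective _ x
  obtain ⟨m, hm⟩ := M.mem_ansB.1 ((Submodule.Quotient.mk_eq_zero
    ((M.ansB c).submoduleOf (M.ansZ c))).1 hx)
  obtain ⟨⟨h1, h2⟩, h3⟩ := mem_cyc.1 hz
  -- R(z) is only known to be m(s + (c - 1)η). This invariant chain is chosen, signs included, so
  -- that R(dw) = R(z); then z - dw is killed by R on the nose.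
  obtain ⟨w, hw1, hw2, hw3, -⟩ := exists_chain M (c - 1) (-M.kos 1 m)
  have hw : R M.toCx ((Std.hm M.toCx).d w) = R M.toCx z := by
    rw [R_d_of_inv M hw2 hw1, R_kos, hw3, map_neg, kos_kos, map_neg, neg_neg, neg_neg]
    exact hm
  have e : -(c - 1) = -c + 1 := by ring
  rw [e] at hw2
  obtain ⟨N, hN⟩ := exists_bound (z - (Std.hm M.toCx).d w)
  obtain ⟨v, ⟨hv1, hv2⟩, hv⟩ := exists_boundary M N (k := -c) (z - (Std.hm M.toCx).d w)
    (by rw [map_sub, ← d_sm (X := Std.hm M.toCx), h1, hw1, map_zero, sub_zero])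
    (sub_mem h2 (d_deg (X := Std.hm M.toCx) hw2))
    (by rw [map_sub, h3, d_d, sub_zero])
    (by rw [map_sub, hw, sub_self])
    hN
  refine (Submodule.Quotient.mk_eq_zero _).2 ?_
  change z ∈ (Std.hm M.toCx).bdry (-c)
  refine mem_bdry.2 ⟨v + w, ⟨by rw [map_add, hv1, hw1, add_zero], add_mem hv2 hw2⟩, ?_⟩
  rw [map_add, hv, sub_add_cancel]

lemma exists_cyc (c : ℤ) {m : M.X} (hm : m ∈ M.ansZ c) : ∃ z : (Std.hm M.toCx).X,
    ∃ hz : z ∈ (Std.hm M.toCx).cyc (-c), R M.toCx z = m ∧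
      (∀ l, m ∈ M.gr (0, l) → z ∈ (Std.hm M.toCx).gr (-c, l - c)) ∧
      RH M c ((Std.hm M.toCx).Hcls (-c) ⟨z, hz⟩) = M.ansCls c ⟨m, hm⟩ := by
  obtain ⟨z, h1, h2, h3, h4, h5⟩ := exists_chain M c m
  have hz : z ∈ (Std.hm M.toCx).cyc (-c) := mem_cyc.2 ⟨⟨h1, h2⟩, h4 (M.mem_ansZ.1 hm)⟩
  refine ⟨z, hz, h3, h5, ?_⟩
  rw [RH_Hcls]
  congr 1
  exact Subtype.ext h3

theorem RH_surjective (c : ℤ) : Function.Surjective (RH M c) := by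
  intro x
  obtain ⟨⟨m, hm⟩, rfl⟩ := Submodule.mkQ_surjective _ x
  obtain ⟨z, hz, -, -, h⟩ := exists_cyc M c hm
  exact ⟨_, h⟩

end Std
end
end HopfTate

/-! ### Independence of the resolution, and naturality. -/

namespace HopfTate
noncomputable section
open EtaRing Cx

variable {B : EtaRing.{u}}

namespace Cx

variable {X Y Z : Cx B}

/-- The homotopy is used twice: once on the cone and once on the internal Hom, each time with the
other factor fixed. -/
lemma Hmap_coneMap_tensor {p : Mor X (unit B)} (F : Mor X X) (hF : ∀ x, p.f (F.f x) = p.f x)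
    (H : Htpy F (Mor.id X)) (hH : ∀ x, p.f (H.h x) = 0) (n : ℤ)
    (x : (tensor (cone p) (ihom X Z)).Hinv n) :
    Hmap (Mor.tensor (coneMap F hF) (Mor.ihom F (Mor.id Z))) n x = x := by
  have h1 := ((H.cone hF (fun _ => rfl) hH).tensorRight (Mor.ihom F (Mor.id Z))).Hmap_eq n
  have h2 := ((H.ihom Z).tensorLeft
    (coneMap (p := p) (q := p) (Mor.id X) (fun _ => rfl))).Hmap_eq n
  have h3 : Mor.tensor (coneMap (p := p) (q := p) (Mor.id X) (fun _ => rfl))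
      (Mor.ihom (Mor.id X) (Mor.id Z)) = Mor.id (tensor (cone p) (ihom X Z)) := by
    refine Mor.ext_f fun z => ?_
    induction z using T_induction (X := cone p) (Y := ihom X Z) with
    | htm g h x hx y hy => rfl
    | hadd z w hz hw => rw [map_add, map_add, hz, hw]
  rw [h1, h2, h3, Hmap_id]

end Cx

namespace Resolution

variable (P : Resolution B)

/-- A comparison map to the standard resolution. -/
def toStd : Mor P.P (Std.cx B) := (P.exists_lift Std.isRes).choose

lemma toStd_aug (x : P.P.X) : (Std.aug B).f (P.toStd.f x) = P.aug.f x :=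
  (P.exists_lift Std.isRes).choose_spec x

/-- A comparison map from the standard resolution. -/
def fromStd : Mor (Std.cx B) P.P := ((Std.res B).exists_lift P.isRes).choose

lemma fromStd_aug (x : (Std.cx B).X) : P.aug.f (P.fromStd.f x) = (Std.aug B).f x :=
  ((Std.res B).exists_lift P.isRes).choose_spec x

lemma toStd_fromStd_aug (x : (Std.cx B).X) :
    (Std.aug B).f ((P.toStd.comp P.fromStd).f x) = (Std.aug B).f x :=
  (P.toStd_aug _).trans (P.fromStd_aug x)

lemma fromStd_toStd_aug (x : P.P.X) :
    P.aug.f ((P.fromStd.comp P.toStd).f x) = P.aug.f x :=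
  (P.fromStd_aug _).trans (P.toStd_aug x)

lemma exists_htpy_std : Nonempty (Htpy (P.toStd.comp P.fromStd) (Mor.id (Std.cx B))) :=
  (Std.res B).exists_htpy Std.isRes _ _ P.toStd_fromStd_aug

lemma exists_htpy_self : Nonempty (Htpy (P.fromStd.comp P.toStd) (Mor.id P.P)) :=
  P.exists_htpy P.isRes _ _ P.fromStd_toStd_aug

/-- The induced map of mapping cones to that of the standard resolution. -/
def toTl : Mor P.tilde (Std.tl B) := coneMap P.toStd P.toStd_aug

/-- The induced map of mapping cones from that of the standard resolution. -/
def fromTl : Mor (Std.tl B) P.tilde := coneMap P.fromStd P.fromStd_aug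

/-- The comparison of Tate complexes to the one formed with the standard resolution. -/
def toHm (M : Cx B) : Mor (P.hm M) (Std.hm M) :=
  Mor.tensor P.toTl (Mor.ihom P.fromStd (Mor.id M))

/-- The comparison of Tate complexes from the one formed with the standard resolution. -/
def fromHm (M : Cx B) : Mor (Std.hm M) (P.hm M) :=
  Mor.tensor P.fromTl (Mor.ihom P.toStd (Mor.id M))

lemma Hmap_toHm_fromHm (M : Cx B) (n : ℤ) (x : (Std.hm M).Hinv n) :
    Hmap (P.toHm M) n (Hmap (P.fromHm M) n x) = x := by
  obtain ⟨H⟩ := P.exists_htpy_std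
  have e : (P.toHm M).comp (P.fromHm M) = Mor.tensor (coneMap (P.toStd.comp P.fromStd)
      P.toStd_fromStd_aug) (Mor.ihom (P.toStd.comp P.fromStd) (Mor.id M)) := by
    refine Mor.ext_f fun z => ?_
    induction z using T_induction (X := Std.tl B) (Y := ihom (Std.cx B) M) with
    | htm g h x hx y hy => rfl
    | hadd z w hz hw => rw [map_add, map_add, hz, hw]
  rw [← Hmap_comp, e]
  exact Hmap_coneMap_tensor _ _ H (Std.isRes.htpy_aug _ H) n x

lemma Hmap_fromHm_toHm (M : Cx B) (n : ℤ) (x : (P.hm M).Hinv n) :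
    Hmap (P.fromHm M) n (Hmap (P.toHm M) n x) = x := by
  obtain ⟨H⟩ := P.exists_htpy_self
  have e : (P.fromHm M).comp (P.toHm M) = Mor.tensor (coneMap (P.fromStd.comp P.toStd)
      P.fromStd_toStd_aug) (Mor.ihom (P.fromStd.comp P.toStd) (Mor.id M)) := by
    refine Mor.ext_f fun z => ?_
    induction z using T_induction (X := P.tilde) (Y := ihom P.P M) with
    | htm g h x hx y hy => rfl
    | hadd z w hz hw => rw [map_add, map_add, hz, hw]
  rw [← Hmap_comp, e]
  exact Hmap_coneMap_tensor _ _ H (P.isRes.htpy_aug _ H) n x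

lemma toHm_hmMap {M L : Cx B} (μ : Mor M L) (z : (P.hm M).X) :
    (P.toHm L).f ((P.hmMap μ).f z)
      = (Mor.tensor (Mor.id (Std.tl B)) (Mor.ihom (Mor.id (Std.cx B)) μ)).f ((P.toHm M).f z) := by
  induction z using T_induction (X := P.tilde) (Y := ihom P.P M) with
  | htm g h x hx y hy => rfl
  | hadd z w hz hw => rw [map_add, map_add, map_add, map_add, hz, hw]

end Resolution

namespace Std

lemma ev_hmap {M L : Cx B} (μ : Mor M L) (f : homAll (cx B) M) :
    ev (Mor.hmap (Mor.id (cx B)) μ f) = μ.f (ev f) := by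
  induction f using H_induction with
  | hadd f f' h h' => simp only [map_add, h, h']
  | hom g f hf =>
    have h : Mor.hmap (Mor.id (cx B)) μ f ∈ grH (cx B) L g :=
      (Mor.ihom (Mor.id (cx B)) μ).map_gr g f hf
    rw [ev_of_mem hf, ev_of_mem h]
    rfl

lemma R_hmMap {M L : Cx B} (μ : Mor M L) (z : (hm M).X) :
    R L ((Mor.tensor (Mor.id (tl B)) (Mor.ihom (Mor.id (cx B)) μ)).f z) = μ.f (R M z) := by
  induction z using T_induction (X := tl B) (Y := ihom (cx B) M) with
  | htm g h x hx y hy =>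
    rw [R_tm, μ.la', ← ev_hmap]
    exact R_tm (M := L) x (Mor.hmap (Mor.id (cx B)) μ y)
  | hadd z w hz hw => rw [map_add, map_add, map_add, map_add, hz, hw]

end Std

namespace GMod

variable (M L : GMod B) (P : Resolution B)

/-- The comparison map from Tate cohomology. -/
def fromTate (c : ℤ) : M.tateExt P c →ₗ[B.kᵐᵒᵖ] M.ans c :=
  (Std.RH M c).comp (Hmap (P.toHm M.toCx) (-c))

lemma fromTate_bijective (c : ℤ) : Function.Bijective (M.fromTate P c) := by
  constructor
  · intro x y h
    have h1 := Std.RH_injective M c h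
    rw [← P.Hmap_fromHm_toHm M.toCx (-c) x, h1, P.Hmap_fromHm_toHm]
  · intro y
    obtain ⟨x, rfl⟩ := Std.RH_surjective M c y
    exact ⟨Hmap (P.fromHm M.toCx) (-c) x,
      congrArg (Std.RH M c) (P.Hmap_toHm_fromHm M.toCx (-c) x)⟩

/-- The isomorphism from `ker(s)/im(s + η)` or `ker(s + η)/im(s)` to Tate cohomology. -/
def toTate (c : ℤ) : M.ans c ≃ₗ[B.kᵐᵒᵖ] M.tateExt P c :=
  (LinearEquiv.ofBijective (M.fromTate P c) (M.fromTate_bijective P c)).symm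

variable {M P} in
lemma toTate_eq_iff {c : ℤ} {x : M.ans c} {y : M.tateExt P c} :
    M.toTate P c x = y ↔ x = M.fromTate P c y := by
  rw [toTate, LinearEquiv.symm_apply_eq]; rfl

lemma fromTate_Hcls (c : ℤ) (z : (P.hm M.toCx).cyc (-c)) :
    M.fromTate P c ((P.hm M.toCx).Hcls (-c) z) = M.ansCls c ⟨Std.R M.toCx ((P.toHm M.toCx).f z.1),
      M.mem_ansZ.2 (Std.mulS_R M ((P.toHm M.toCx).map_cyc (-c) z.2))⟩ := rfl

variable {M L}

lemma ansCls_eq_iff {c : ℤ} {m n : M.ansZ c} :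
    M.ansCls c m = M.ansCls c n ↔ ∃ x, M.mulS (c - 1) x = m.1 - n.1 :=
  (Submodule.Quotient.eq _).trans M.mem_ansB

lemma Hom.mulS (φ : M.Hom L) (c : ℤ) (m : M.X) : φ.f (M.mulS c m) = L.mulS c (φ.f m) := by
  rw [mulS_apply, mulS_apply, map_add, map_zsmul, φ.sm', φ.ra']

lemma Hom.mem_ansZ (φ : M.Hom L) {c : ℤ} {m : M.X} (hm : m ∈ M.ansZ c) : φ.f m ∈ L.ansZ c := by
  rw [GMod.mem_ansZ] at hm ⊢
  rw [← Hom.mulS, hm, map_zero]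

lemma Hom.ansCls_eq (φ : M.Hom L) {c : ℤ} {m n : M.ansZ c} (h : M.ansCls c m = M.ansCls c n) :
    L.ansCls c ⟨φ.f m.1, Hom.mem_ansZ φ m.2⟩ = L.ansCls c ⟨φ.f n.1, Hom.mem_ansZ φ n.2⟩ := by
  obtain ⟨x, hx⟩ := ansCls_eq_iff.1 h
  exact ansCls_eq_iff.2 ⟨φ.f x, by rw [← Hom.mulS, hx, map_sub]⟩

/-- R and the comparison of Tate complexes commute with maps of coefficients at chain level, so the
inverse isomorphism is natural too. -/
theorem tateMap_toTate (φ : M.Hom L) (c : ℤ) (m : M.X) (hm : m ∈ M.ansZ c) :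
    tateMap P c φ (M.toTate P c (M.ansCls c ⟨m, hm⟩))
      = L.toTate P c (L.ansCls c ⟨φ.f m, Hom.mem_ansZ φ hm⟩) := by
  rw [eq_comm, toTate_eq_iff]
  obtain ⟨y, hy⟩ := Hcls_surjective _ (M.toTate P c (M.ansCls c ⟨m, hm⟩))
  have h := toTate_eq_iff.1 hy.symm
  rw [← hy, fromTate_Hcls] at *
  refine (Hom.ansCls_eq φ h).trans ?_
  have e : tateMap P c φ ((P.hm M.toCx).Hcls (-c) y)
      = (P.hm L.toCx).Hcls (-c) ⟨(P.hmMap φ).f y.1, (P.hmMap φ).map_cyc (-c) y.2⟩ := rfl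
  rw [e, fromTate_Hcls]
  congr 1
  refine Subtype.ext ?_
  change φ.f (Std.R M.toCx _) = Std.R L.toCx _
  rw [P.toHm_hmMap, Std.R_hmMap]

/-- The class `t^c m` is represented by the image of a chain formed with the standard resolution. -/
lemma exists_toTate_eq (c : ℤ) {m : M.X} (hm : m ∈ M.ansZ c) : ∃ z : (Std.hm M.toCx).X,
    ∃ hz : z ∈ (Std.hm M.toCx).cyc (-c), Std.R M.toCx z = m ∧
      (∀ l, m ∈ M.gr (0, l) → z ∈ (Std.hm M.toCx).gr (-c, l - c)) ∧
      M.toTate P c (M.ansCls c ⟨m, hm⟩) = Hmap (P.fromHm M.toCx) (-c)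
        ((Std.hm M.toCx).Hcls (-c) ⟨z, hz⟩) := by
  obtain ⟨z, hz, h1, h2, h3⟩ := Std.exists_cyc M c hm
  refine ⟨z, hz, h1, h2, ?_⟩
  rw [toTate_eq_iff, fromTate, LinearMap.comp_apply, P.Hmap_toHm_fromHm, h3]

end GMod

end
end HopfTate

/-! ### The cup product with the standard diagonal. -/

namespace HopfTate
noncomputable section
open EtaRing Cx

variable {B : EtaRing.{u}}

namespace Cx

/-- The pairing of Tate complexes formed with arbitrary maps `Φ` and `Ψ`. -/
def gpair {T P : Cx B} (Φ : Mor (tensor T T) T) (Ψ : Mor P (tensor P P)) (M N : Cx B) :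
    Mor (tensor (tensor T (ihom P M)) (tensor T (ihom P N))) (tensor T (ihom P (tensor M N))) :=
  ((Mor.tensor Φ (Mor.ihom Ψ (Mor.id (tensor M N)))).comp
    (Mor.tensor (Mor.id (tensor T T)) (alpha P M P N))).comp
    (mid T (ihom P M) T (ihom P N))

lemma gpair_tm {T P : Cx B} (Φ : Mor (tensor T T) T) (Ψ : Mor P (tensor P P)) (M N : Cx B)
    (x : T.X) {e h : ℤ × ℤ} {f : homAll P M} (hf : f ∈ grH P M e) {y : T.X} (hy : y ∈ T.gr h)
    (g : homAll P N) :
    (gpair Φ Ψ M N).f (tm4 (X := T) (Z := ihom P M) (Y := T) (W := ihom P N) x f y g)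
      = sg (tot e * tot h) • (tm (Y := ihom P (tensor M N)) (Φ.f (tm x y : TC T T))
          (Mor.hmap Ψ (Mor.id (tensor M N)) (alH f g)) : TC T (ihom P (tensor M N))) := by
  have h1 : (mid T (ihom P M) T (ihom P N)).f
      (tm4 (X := T) (Z := ihom P M) (Y := T) (W := ihom P N) x f y g)
      = sg (tot e * tot h) • tm4 (X := T) (Z := T) (Y := ihom P M) (W := ihom P N) x y f g :=
    midT_tm4 (X := T) (Y := ihom P M) (Z := T) (W := ihom P N) x hf hy g
  change (Mor.tensor Φ (Mor.ihom Ψ (Mor.id (tensor M N)))).f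
    ((Mor.tensor (Mor.id (tensor T T)) (alpha P M P N)).f ((mid T (ihom P M) T (ihom P N)).f _)) = _
  rw [h1, map_zsmul, map_zsmul]
  rfl

/-- Homotopic maps `Ψ` induce the same pairing in homology. -/
lemma Hmap_gpair_eq {T P : Cx B} (Φ : Mor (tensor T T) T) {Ψ Ψ' : Mor P (tensor P P)}
    (H : Htpy Ψ Ψ') (M N : Cx B) (n : ℤ) : Hmap (gpair Φ Ψ M N) n = Hmap (gpair Φ Ψ' M N) n := by
  refine LinearMap.ext fun x => ?_
  rw [gpair, gpair, Hmap_comp, Hmap_comp, Hmap_comp, Hmap_comp,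
    ((H.ihom (tensor M N)).tensorLeft Φ).Hmap_eq n]

end Cx

namespace Std

/-! ### Products of cochains -/

variable {M N : GMod B}

/-- At p_n with n = -(e.1 + e'.1) the diagonal gives ∑ p_i ⊗ p_j, and only i = -e.1, j = -e'.1
contributes, as f and g vanish on all other generators. No sign occurs because p_i is even. If -e.1
or -e'.1 is negative, both sides are zero. -/
lemma ev_alH {e e' : ℤ × ℤ} {f : homAll (cx B) M.toCx} (hf : f ∈ grH (cx B) M.toCx e)
    {g : homAll (cx B) N.toCx} (hg : g ∈ grH (cx B) N.toCx e') :
    ev (Mor.hmap (diag B) (Mor.id (Cx.tensor M.toCx N.toCx)) (alH f g))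
      = (tm (ev f) (ev g) : TC M.toCx N.toCx) := by
  have h1 : Mor.hmap (diag B) (Mor.id (Cx.tensor M.toCx N.toCx)) (alH f g)
      ∈ grH (cx B) (Cx.tensor M.toCx N.toCx) (e + e') :=
    (Mor.ihom (diag B) (Mor.id _)).map_gr _ _ (alH_grH hf hg)
  have h2 (i j : ℕ) : (alH f g).1 (tm (Finsupp.single i 1) (Finsupp.single j 1) : TC (cx B) (cx B))
      = (tm (f.1 (pz B i)) (g.1 (pz B j)) : TC M.toCx N.toCx) := by
    rw [alH_tm f hg (single_one_mem i), tot_mk, add_mul, sg_add, sg_sq, one_smul, pz_natCast,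
      pz_natCast]
  have h3 (i : ℤ) (hi : i ≠ -e.1) : f.1 (pz B i) = 0 :=
    apply_of_deg (mem_deg (X := ihom (cx B) M.toCx) (n := e.1) (l := e.2) hf) hi
  have h4 (i : ℤ) (hi : i ≠ -e'.1) : g.1 (pz B i) = 0 :=
    apply_of_deg (mem_deg (X := ihom (cx B) N.toCx) (n := e'.1) (l := e'.2) hg) hi
  rw [ev_of_mem h1, ev_of_mem hf, ev_of_mem hg]
  change (alH f g).1 ((diag B).f (pz B (-(e + e').1))) = _
  rw [Prod.fst_add]
  by_cases hn : 0 ≤ -(e.1 + e'.1)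
  · obtain ⟨n, hn⟩ := Int.eq_ofNat_of_zero_le hn
    rw [hn, pz_natCast, diag_single_one, diagEl, map_sum]
    simp only [h2]
    by_cases he : 0 ≤ -e.1 ∧ 0 ≤ -e'.1
    · obtain ⟨i, hi⟩ := Int.eq_ofNat_of_zero_le he.1
      obtain ⟨j, hj⟩ := Int.eq_ofNat_of_zero_le he.2
      rw [Finset.sum_eq_single (i, j), hi, hj]
      · rintro ⟨i', j'⟩ - h
        by_cases h5 : (i' : ℤ) = -e.1
        · have h6 : (j' : ℤ) ≠ -e'.1 := by
            intro h6
            exact h (by rw [Prod.mk.injEq]; omega)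
          rw [h4 _ h6, map_zero]
        · rw [h3 _ h5, map_zero, AddMonoidHom.zero_apply]
      · intro h
        exact absurd (Finset.HasAntidiagonal.mem_antidiagonal.2 (by simp only; omega)) h
    · rw [Finset.sum_eq_zero]
      · rcases not_and_or.1 he with h | h
        · rw [pz_neg (B := B) (n := -e.1) (by omega), map_zero, map_zero, AddMonoidHom.zero_apply]
        · rw [pz_neg (B := B) (n := -e'.1) (by omega), map_zero, map_zero]
      · rintro ⟨i', j'⟩ -
        rcases not_and_or.1 he with h | h
        · rw [h3 _ (by omega), map_zero, AddMonoidHom.zero_apply]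
        · rw [h4 _ (by omega), map_zero]
  · rw [pz_neg (B := B) (n := -(e.1 + e'.1)) (by omega), map_zero, map_zero]
    by_cases h : -e.1 < 0
    · rw [pz_neg h, map_zero, map_zero, AddMonoidHom.zero_apply]
    · rw [pz_neg (B := B) (n := -e'.1) (by omega), map_zero, map_zero]

/-! ### The pairing formed with the standard diagonal -/

variable (Φ : Mor (Cx.tensor (tl B) (tl B)) (tl B))

/-- The map `(z, w) ↦ R(z · w)`, where `z · w` is the product of the chains `z` and `w`. -/
def prodR (M N : Cx B) : (hm M).X →+ (hm N).X →+ (Cx.tensor M N).X :=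
  (tm (X := hm M) (Y := hm N)).compr₂
    ((R (Cx.tensor M N)).comp (gpair Φ (diag B) M N).f.toAddMonoidHom)

lemma prodR_apply (M N : Cx B) (z : (hm M).X) (w : (hm N).X) : prodR Φ M N z w
    = R (Cx.tensor M N) ((gpair Φ (diag B) M N).f (tm (X := hm M) (Y := hm N) z w)) := rfl

lemma prodR_el {e e' h : ℤ × ℤ} (x : (tl B).X) {f : homAll (cx B) M.toCx}
    (hf : f ∈ grH (cx B) M.toCx e) {y : (tl B).X} (hy : y ∈ (tl B).gr h)
    {g : homAll (cx B) N.toCx} (hg : g ∈ grH (cx B) N.toCx e') :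
    prodR Φ M.toCx N.toCx (el x f) (el y g) = sg (tot e * tot h) •
      (Cx.tensor M.toCx N.toCx).la (lam B (Φ.f (tm (X := tl B) (Y := tl B) x y)))
        (tm (ev f) (ev g) : TC M.toCx N.toCx) := by
  rw [← ev_alH hf hg, ← R_el]
  exact (congrArg (R _) (gpair_tm Φ (diag B) M.toCx N.toCx x hf hy g)).trans (map_zsmul _ _ _)

lemma la_tm {X Y : Cx B} {j : ℤ} {a : B.k} (ha : a ∈ B.gr j) {g : ℤ × ℤ} {x : X.X}
    (hx : x ∈ X.gr g) (y : Y.X) : (Cx.tensor X Y).la a (tm x y : TC X Y)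
      = sg (j * tot g) • (tm x (Y.la a y) : TC X Y) := by
  induction y using Y.hom_induction with
  | h0 => simp
  | hadd y y' h h' => simp only [map_add, h, h', smul_add]
  | hom h y hy =>
    rw [la_of_mem (X := Cx.tensor X Y) ha, kos_of_mem (X := Cx.tensor X Y) j (tm_mem hx hy),
      map_zsmul, tensor_ra, rT_tm, la_of_mem ha, kos_of_mem j hy, map_zsmul, map_zsmul, smul_smul,
      ← sg_add, tot_add, mul_add]

lemma el_induction {p : (hm M.toCx).X → Prop}
    (hel : ∀ g h, ∀ x ∈ (tl B).gr g, ∀ f ∈ grH (cx B) M.toCx h, p (el x f))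
    (hadd : ∀ z w, p z → p w → p (z + w)) (z : (hm M.toCx).X) : p z :=
  T_induction (X := tl B) (Y := ihom (cx B) M.toCx) (p := p) hel hadd z

/-- Left multiplication by 1 ⊗ f involves Φ only through χ = Φ(1 ⊗ -). The sign of the interchange
of f and y cancels the one of moving λ(χ y) past ev(f). -/
lemma prodR_one {χ : Mor (tl B) (tl B)}
    (hχ : ∀ y, Φ.f (tm (X := tl B) (Y := tl B) one y) = χ.f y) (f : homAll (cx B) M.toCx)
    (z : (hm N.toCx).X) : prodR Φ M.toCx N.toCx (el one f) z = (tm (ev f)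
      (R N.toCx ((Mor.tensor χ (Mor.id (ihom (cx B) N.toCx))).f z)) : TC M.toCx N.toCx) := by
  induction f using H_induction with
  | hadd f f' h h' =>
    simp only [map_add, AddMonoidHom.add_apply, h, h']
  | hom e f hf =>
    induction z using el_induction with
    | hadd z w hz hw => simp only [map_add, hz, hw]
    | hel h e' y hy g hg =>
      rw [prodR_el Φ one hf hy hg, hχ, la_tm (lam_mem (χ.map_gr h y hy)) (ev_mem hf), smul_smul,
        ← sg_add]
      have h1 : (Mor.tensor χ (Mor.id (ihom (cx B) N.toCx))).f (el y g) = el (χ.f y) g := rfl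
      -- Modulo 2 a difference of degrees is their sum, so the two summands of the exponent agree.
      have h2 : sg (tot e * tot h + (h.2 - h.1) * tot (0, e.2 - e.1)) = 1 := by
        rw [tot_zero_mk, tot, tot, show (e.1 + e.2) * (h.1 + h.2) + (h.2 - h.1) * (e.2 - e.1)
          = (e.1 * h.1 + e.2 * h.2) + (e.1 * h.1 + e.2 * h.2) by ring, sg_add, sg_sq]
      rw [h1, R_el, h2, one_smul]

end Std

namespace GMod

variable (M N : GMod B)

/-- This is the Leibniz rule of M[t, t⁻¹]: the diagonal action distributes s over the factors, and
the multiples of η add up because η passes through the tensor sign. -/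
lemma mulS_tmul (a b : ℤ) (m : M.X) (n : N.X) : (M.tensor N).mulS (a + b) (M.tmul N m n)
    = M.tmul N m (N.mulS b n) + M.tmul N (M.mulS a m) (N.kos 1 n) := by
  have h : (tm (M.ra B.eta m) (N.kos 1 n) : TC M.toCx N.toCx) = tm m (N.ra B.eta n) := by
    rw [tm_ra_eta, ra_eta_kos]
  rw [mulS_apply, mulS_apply, mulS_apply, tmul, tmul, tmul]
  rw [tensor_sm, tensor_ra, sT_tm, rT_tm, map_add, map_zsmul, map_add, map_zsmul,
    AddMonoidHom.add_apply, AddMonoidHom.zsmul_apply, h]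
  module

lemma tmul_mem_ansZ {a b : ℤ} {m : M.X} (hm : m ∈ M.ansZ a) {n : N.X} (hn : n ∈ N.ansZ b) :
    M.tmul N m n ∈ (M.tensor N).ansZ (a + b) := by
  rw [mem_ansZ] at *
  rw [mulS_tmul, hm, hn, tmul, tmul, map_zero, map_zero, AddMonoidHom.zero_apply, add_zero]

end GMod

namespace Std

variable {M N : GMod B} (Φ : Mor (Cx.tensor (tl B) (tl B)) (tl B))

/-- For a cycle z, dw · z is the boundary of the invariant chain w · z, and R carries boundaries of
invariant chains into the image of s + (c₁ + c₂ - 1)η. So the first factor may be changed within its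
homology class. -/
lemma R_cross {c₁ c₂ : ℤ} {w : (hm M.toCx).X} (hs : (hm M.toCx).sm w = 0)
    (hw : w ∈ (hm M.toCx).deg (-c₁ + 1)) {z : (hm N.toCx).X} (hz : z ∈ (hm N.toCx).cyc (-c₂)) :
    ∃ x, (M.tensor N).mulS (c₁ + c₂ - 1) x = prodR Φ M.toCx N.toCx ((hm M.toCx).d w) z := by
  obtain ⟨⟨h1, h2⟩, h3⟩ := mem_cyc.1 hz
  let G := gpair Φ (diag B) M.toCx N.toCx
  let u : (Cx.tensor (hm M.toCx) (hm N.toCx)).X := tm (X := hm M.toCx) (Y := hm N.toCx) w z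
  have hu : (Cx.tensor (hm M.toCx) (hm N.toCx)).d u
      = tm (X := hm M.toCx) (Y := hm N.toCx) ((hm M.toCx).d w) z := by
    change dT _ _ u = _
    rw [dT_tm, h3, map_zero, add_zero]
  have h4 := R_d_of_inv (M.tensor N) (n := -(c₁ + c₂ - 1))
    (G.map_deg (tm_deg (X := hm M.toCx) (Y := hm N.toCx) (by ring) hw h2))
    (mem_inv.1 (G.map_inv (tm_inv (X := hm M.toCx) (Y := hm N.toCx) hs h1)))
  rw [neg_neg] at h4
  refine ⟨_, (map_neg _ _).trans (h4.symm.trans ?_)⟩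
  rw [prodR_apply, ← hu]
  exact congrArg _ (G.map_d u).symm

/-- Since the comparison map is injective, z is homologous to 1 ⊗ f with f the Γ-linear map p_n ↦
R(z). For this representative the product is R(z) ⊗ R(χ w), where χ is homotopic to the identity. -/
lemma exists_prodR_of_nonneg {χ : Mor (tl B) (tl B)}
    (hχ : ∀ y, Φ.f (tm (X := tl B) (Y := tl B) one y) = χ.f y) (H : Htpy χ (Mor.id (tl B)))
    (n : ℕ) {c : ℤ} {z : (hm M.toCx).X} (hz : z ∈ (hm M.toCx).cyc (-n)) {w : (hm N.toCx).X}
    (hw : w ∈ (hm N.toCx).cyc (-c)) : ∃ x, (M.tensor N).mulS (n + c - 1) x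
      = prodR Φ M.toCx N.toCx z w - M.tmul N (R M.toCx z) (R N.toCx w) := by
  have hm := mulS_R M hz
  have hy : el one (genHom M n (R M.toCx z)) ∈ (Std.hm M.toCx).cyc (-n) := by
    obtain ⟨h1, h2, -, h3, -⟩ := el_one_genHom M n (R M.toCx z)
    exact mem_cyc.2 ⟨⟨h1, h2⟩, h3 hm⟩
  have h1 : (Std.hm M.toCx).Hcls (-n) ⟨z, hz⟩ = (Std.hm M.toCx).Hcls (-n) ⟨_, hy⟩ := by
    refine RH_injective M n ?_
    rw [RH_Hcls, RH_Hcls]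
    congr 2
    rw [R_el, lam_one, la_one, ev_genHom]
  obtain ⟨u, ⟨hu1, hu2⟩, hu⟩ := mem_bdry.1 (Hcls_eq.1 h1)
  obtain ⟨x1, hx1⟩ := R_cross Φ hu1 hu2 hw
  let G := Mor.tensor χ (Mor.id (ihom (cx B) N.toCx))
  have h2 : (Std.hm N.toCx).Hcls (-c) ⟨G.f w, G.map_cyc _ hw⟩ = (Std.hm N.toCx).Hcls (-c) ⟨w, hw⟩ := by
    have h3 := DFunLike.congr_fun ((H.tensorRight (Mor.id (ihom (cx B) N.toCx))).Hmap_eq (-c))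
      ((Std.hm N.toCx).Hcls (-c) ⟨w, hw⟩)
    refine h3.trans ?_
    have e : Mor.tensor (Mor.id (tl B)) (Mor.id (ihom (cx B) N.toCx)) = Mor.id (Std.hm N.toCx) := by
      refine Mor.ext_f fun z => ?_
      induction z using T_induction (X := tl B) (Y := ihom (cx B) N.toCx) with
      | htm g h x hx y hy => rfl
      | hadd z w hz hw => rw [map_add, map_add, hz, hw]
    rw [e, Hmap_id]
  have h4 := congrArg (RH N c) h2
  rw [RH_Hcls, RH_Hcls, GMod.ansCls_eq_iff] at h4
  obtain ⟨x2, hx2⟩ := h4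
  -- One correction for replacing z by 1 ⊗ f, one for replacing χ w by w. The second is a boundary
  -- by the Leibniz rule, as R(z) is killed by s + nη.
  refine ⟨x1 + M.tmul N (R M.toCx z) x2, ?_⟩
  have h5 := M.mulS_tmul N n (c - 1) (R M.toCx z) x2
  rw [hm, hx2, ← add_sub_assoc] at h5
  have h6 : M.tmul N 0 (N.kos 1 x2) = 0 := DFunLike.congr_fun (map_zero tm) _
  have h7 : M.tmul N (R M.toCx z) (R N.toCx (G.f w) - R N.toCx w)
      = M.tmul N (R M.toCx z) (R N.toCx (G.f w)) - M.tmul N (R M.toCx z) (R N.toCx w) :=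
    map_sub _ _ _
  have h8 := prodR_one Φ hχ (genHom M n (R M.toCx z)) w
  rw [ev_genHom] at h8
  change _ = M.tmul N (R M.toCx z) (R N.toCx (G.f w)) at h8
  rw [map_add, hx1, h5, h6, h7, hu, ← h8, map_sub, AddMonoidHom.sub_apply]
  abel

end Std
end
end HopfTate

namespace HopfTate
noncomputable section
open EtaRing Cx

variable {B : EtaRing.{u}}

namespace Std

/-! ### Periodicity -/

variable (B) in
/-- The `Γ`-linear map `p_n ↦ p_{n - 2k}`. -/
def per (k : ℕ) : (cx B).X →ₗ[(Gam B)ᵐᵒᵖ] (cx B).X :=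
  lin (Y := cx B) fun n => pz B (n - (k + k))

lemma per_pz (k : ℕ) (n : ℤ) : per B k (pz B n) = pz B (n - (k + k)) := by
  by_cases h : 0 ≤ n
  · lift n to ℕ using h
    rw [per, pz_natCast, lin_single, op_one, one_smul]
  · rw [pz_neg (by omega), pz_neg (by omega), map_zero]

lemma per_mem (k : ℕ) {g : ℤ × ℤ} {x : (cx B).X} (hx : x ∈ (cx B).gr g) :
    per B k x ∈ (cx B).gr (g + (-(k + k : ℤ), -(k + k : ℤ))) := by
  obtain rfl | ⟨n, z, hn, hz, rfl⟩ := gr_cases hx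
  · rw [map_zero]; exact zero_mem _
  · obtain ⟨m, l⟩ := g
    obtain rfl : m = n := hn
    rw [per, lin_single]
    have := (cx B).smul_mem _ _ _ _ (pz_mem ((n : ℤ) - (k + k))) hz
    have e : (((n : ℤ) - (k + k), (n : ℤ) - (k + k)) + (0, l - n) : ℤ × ℤ)
        = ((n : ℤ), l) + (-(k + k : ℤ), -(k + k : ℤ)) := by
      ext <;> simp only [Prod.fst_add, Prod.snd_add] <;> ring
    rwa [e] at this

lemma sg_tot_per (e : ℤ) (k : ℕ) (g : ℤ × ℤ) :
    sg (e * tot (g + (-(k + k : ℤ), -(k + k : ℤ)))) = sg (e * tot g) := by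
  rw [tot_add, mul_add, sg_add, tot_mk (-(k + k : ℤ)), mul_add e (-(k + k : ℤ)), sg_add, sg_sq, mul_one]

lemma per_kos (k : ℕ) (e : ℤ) (x : (cx B).X) :
    per B k ((cx B).kos e x) = (cx B).kos e (per B k x) := by
  induction x using (cx B).hom_induction with
  | h0 => simp
  | hadd x y hx hy => simp only [map_add, hx, hy]
  | hom g x hx => rw [kos_of_mem e hx, kos_of_mem e (per_mem k hx), sg_tot_per, map_zsmul]

lemma per_ra (k : ℕ) (a : B.k) (x : (cx B).X) :
    per B k ((cx B).ra a x) = (cx B).ra a (per B k x) := (per B k).map_smul _ _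

lemma per_sm (k : ℕ) (x : (cx B).X) :
    per B k ((cx B).sm x) = (cx B).sm (per B k x) := (per B k).map_smul _ _

lemma per_la (k : ℕ) (a : B.k) (x : (cx B).X) :
    per B k ((cx B).la a x) = (cx B).la a (per B k x) := by
  induction a using gr_induction B.gr with
  | h0 => simp
  | hadd a b h h' => simp only [map_add, AddMonoidHom.add_apply, h, h']
  | hom j a ha => rw [la_of_mem ha, la_of_mem ha, per_ra, per_kos]

/-- Shifting the index by 2k replaces s + nη by s + (n - 2k)η, which is the same because 2η = 0. -/
lemma per_d (k : ℕ) (x : (cx B).X) : per B k ((cx B).d x) = (cx B).d (per B k x) := by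
  change ((per B k).comp (bd B)) x = ((cx B).d.comp (per B k)) x
  congr 1
  refine lin_ext fun n => ?_
  rw [LinearMap.comp_apply, LinearMap.comp_apply, per, lin_single, op_one, one_smul]
  rcases n with _ | n
  · rw [bd_zero, map_zero]
    -- The boundary of p_{-2k} is a multiple of p_{-2k-1}, which is zero by convention.
    have h := d_pz (B := B) ((0 : ℕ) - (k + k) - 1)
    rw [sub_add_cancel, pz_neg (n := (0 : ℕ) - (k + k : ℤ) - 1) (by omega)] at h
    rw [h]
    simp
  · have h := d_pz (B := B) ((n : ℤ) - (k + k))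
    rw [sub_add_eq_add_sub, ← Nat.cast_succ] at h
    have h2 : ((k : ℤ) + k) • (cx B).ra B.eta (pz B ((n : ℤ) - (k + k))) = 0 := by
      rw [add_smul, ← smul_add, ra_eta_add, smul_zero]
    rw [bd_succ, lin_single, mul_one, sEta_smul, h, sub_smul, h2, sub_zero]

section

variable {M : Cx B}

lemma comp_per_mem (k : ℕ) {g : ℤ × ℤ} {f : (cx B).X →+ M.X} (hf : f ∈ homDeg (cx B) M g) :
    f.comp (per B k).toAddMonoidHom ∈ homDeg (cx B) M (g + (-(k + k : ℤ), -(k + k : ℤ))) := by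
  refine ⟨fun a x => ?_, fun h x hx => ?_⟩
  · exact (congrArg f (per_ra k a x)).trans (hf.1 a _)
  · have := hf.2 _ _ (per_mem k hx)
    rwa [add_comm h, ← add_assoc] at this

variable (M) in
/-- Composition with `p_n ↦ p_{n - 2k}`. -/
def perH (k : ℕ) : homAll (cx B) M →+ homAll (cx B) M :=
  hres (AddMonoidHom.compHom.flip (per B k).toAddMonoidHom)
    (fun _ _ hf => homDeg_le _ (comp_per_mem k hf))

lemma perH_apply (k : ℕ) (f : homAll (cx B) M) (x : (cx B).X) :
    (perH M k f).1 x = f.1 (per B k x) := rfl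

lemma perH_grH (k : ℕ) {g : ℤ × ℤ} {f : homAll (cx B) M} (hf : f ∈ grH (cx B) M g) :
    perH M k f ∈ grH (cx B) M (g + (-(k + k : ℤ), -(k + k : ℤ))) := comp_per_mem k hf

lemma perH_ra (k : ℕ) (a : B.k) (f : homAll (cx B) M) :
    perH M k (rH (cx B) M a f) = rH (cx B) M a (perH M k f) :=
  H_ext fun x => by rw [perH_apply, rH_apply, rH_apply, perH_apply, per_la]

lemma perH_sm (k : ℕ) (f : homAll (cx B) M) :
    perH M k (sH (cx B) M f) = sH (cx B) M (perH M k f) :=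
  H_ext fun x => by
    rw [perH_apply, sH_apply, sH_apply, perH_apply, perH_apply, per_sm, per_kos]

lemma perH_d (k : ℕ) (f : homAll (cx B) M) :
    perH M k (dH (cx B) M f) = dH (cx B) M (perH M k f) :=
  H_ext fun x => by
    rw [perH_apply, dH_apply, dH_apply, perH_apply, perH_apply, per_kos, per_d]

lemma perH_kos (k : ℕ) (e : ℤ) (f : homAll (cx B) M) :
    perH M k ((ihom (cx B) M).kos e f) = (ihom (cx B) M).kos e (perH M k f) := by
  induction f using H_induction with
  | hadd f f' h h' => simp only [map_add, h, h']
  | hom g f hf =>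
    rw [kos_of_mem (X := ihom (cx B) M) e hf,
      kos_of_mem (X := ihom (cx B) M) e (perH_grH k hf), sg_tot_per, map_zsmul]

lemma ev_perH (k : ℕ) (f : homAll (cx B) M) : ev (perH M k f) = ev f := by
  induction f using H_induction with
  | hadd f f' h h' => simp only [map_add, h, h']
  | hom g f hf =>
    rw [ev_of_mem hf, ev_of_mem (perH_grH k hf), perH_apply, per_pz, Prod.fst_add]
    congr 2
    ring

variable (M) in
/-- The endomorphism of the Tate complex induced by `p_n ↦ p_{n - 2k}`. -/
def perHm (k : ℕ) : (hm M).X →+ (hm M).X :=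
  tlift (X := tl B) (Y := ihom (cx B) M) (el.compl₂ (perH M k)) (fun g h j x hx a ha f hf => by
    simp only [AddMonoidHom.compl₂_apply]
    rw [ihom_ra, perH_ra, ← ihom_ra, ← sg_tot_per j k h]
    exact tm_balanced (X := tl B) (Y := ihom (cx B) M) g _ j x hx a ha _ (perH_grH k hf))

lemma perHm_el (k : ℕ) (x : (tl B).X) (f : homAll (cx B) M) :
    perHm M k (el x f) = el x (perH M k f) := rfl

lemma perHm_deg (k : ℕ) {n : ℤ} {z : (hm M).X} (hz : z ∈ (hm M).deg n) :
    perHm M k z ∈ (hm M).deg (n + -(k + k)) := by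
  refine map_deg_shift (X := hm M) (Y := hm M) (h := perHm M k) (fun g z hz => ?_) hz
  refine ⟨g.2 + -(k + k), grT_le (X := tl B) (Y := ihom (cx B) M) (f := perHm M k)
    (S := (hm M).gr (g + (-(k + k : ℤ), -(k + k : ℤ)))) (fun h h' e x hx f hf => ?_) z hz⟩
  have := el_mem hx (perH_grH k hf)
  rwa [← add_assoc, e] at this

end

section

variable {M N : GMod B}

lemma perHm_sm (k : ℕ) (z : (hm M.toCx).X) :
    perHm M.toCx k ((hm M.toCx).sm z) = (hm M.toCx).sm (perHm M.toCx k z) := by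
  induction z using el_induction with
  | hadd z w hz hw => simp only [map_add, hz, hw]
  | hel g h x hx f hf =>
    rw [el_sm, map_add, perHm_el, perHm_el, perHm_el, el_sm, perH_sm, perH_kos]

lemma perHm_d (k : ℕ) (z : (hm M.toCx).X) :
    perHm M.toCx k ((hm M.toCx).d z) = (hm M.toCx).d (perHm M.toCx k z) := by
  induction z using el_induction with
  | hadd z w hz hw => simp only [map_add, hz, hw]
  | hel g h x hx f hf =>
    rw [el_d, map_add, perHm_el, perHm_el, perHm_el, el_d, perH_d]

lemma R_perHm (k : ℕ) (z : (hm M.toCx).X) : R M.toCx (perHm M.toCx k z) = R M.toCx z := by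
  induction z using el_induction with
  | hadd z w hz hw => simp only [map_add, hz, hw]
  | hel g h x hx f hf => rw [perHm_el, R_el, R_el, ev_perH]

variable (Φ : Mor (Cx.tensor (tl B) (tl B)) (tl B))

/-- The shift acts on the cochain factor only. After R, a product depends on that factor through its
value at the generator, which the shift preserves, and through the parity of its degree, which an
even shift preserves as well. -/
lemma prodR_perHm (k : ℕ) (z : (hm M.toCx).X) (w : (hm N.toCx).X) :
    prodR Φ M.toCx N.toCx (perHm M.toCx k z) w = prodR Φ M.toCx N.toCx z w := by
  induction z using el_induction with
  | hadd z z' hz hz' => simp only [map_add, AddMonoidHom.add_apply, hz, hz']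
  | hel g e x hx f hf =>
    induction w using el_induction with
    | hadd w w' hw hw' => simp only [map_add, hw, hw']
    | hel h e' y hy f' hf' =>
      rw [perHm_el, prodR_el Φ x (perH_grH k hf) hy hf', prodR_el Φ x hf hy hf', ev_perH, mul_comm,
        sg_tot_per, mul_comm]

lemma perHm_cyc (k : ℕ) {n m : ℤ} (h : m = n + -(k + k)) {z : (hm M.toCx).X}
    (hz : z ∈ (hm M.toCx).cyc n) : perHm M.toCx k z ∈ (hm M.toCx).cyc m := by
  rw [mem_cyc] at hz ⊢
  refine ⟨⟨?_, h ▸ perHm_deg k hz.1.2⟩, ?_⟩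
  · rw [← perHm_sm, hz.1.1, map_zero]
  · rw [← perHm_d, hz.2, map_zero]

/-- The product of chains corresponds to the tensor product of elements. -/
theorem exists_prodR {χ : Mor (tl B) (tl B)}
    (hχ : ∀ y, Φ.f (tm (X := tl B) (Y := tl B) one y) = χ.f y) (H : Htpy χ (Mor.id (tl B)))
    {c₁ c₂ : ℤ} {z : (hm M.toCx).X} (hz : z ∈ (hm M.toCx).cyc (-c₁)) {w : (hm N.toCx).X}
    (hw : w ∈ (hm N.toCx).cyc (-c₂)) : ∃ x, (M.tensor N).mulS (c₁ + c₂ - 1) x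
      = prodR Φ M.toCx N.toCx z w - M.tmul N (R M.toCx z) (R N.toCx w) := by
  -- A shift by 2|c₁| makes the first degree non-negative; since only parity matters for s + cη,
  -- nothing changes on the side of M ⊗ N.
  obtain ⟨k, n, hn⟩ : ∃ k n : ℕ, c₁ + (k + k) = n := ⟨c₁.natAbs, (c₁ + (c₁.natAbs + c₁.natAbs)).toNat,
    by omega⟩
  have h1 := exists_prodR_of_nonneg Φ hχ H n (perHm_cyc k (by rw [← hn, neg_add]) hz) hw
  rw [prodR_perHm, R_perHm] at h1
  have h2 : (M.tensor N).mulS (n + c₂ - 1) = (M.tensor N).mulS (c₁ + c₂ - 1) := by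
    have e : (n : ℤ) + c₂ - 1 = c₁ + c₂ - 1 + (k + k) := by rw [← hn]; ring
    rw [e]
    rcases Int.even_or_odd (c₁ + c₂ - 1) with h | h
    · rw [GMod.mulS_even _ h, GMod.mulS_even _ (h.add ⟨k, rfl⟩)]
    · rw [GMod.mulS_odd _ h, GMod.mulS_odd _ (h.add_even ⟨k, rfl⟩)]
  rwa [h2] at h1

end

end Std
end
end HopfTate

/-! ### The cup product for an arbitrary resolution. -/

namespace HopfTate
noncomputable section
open EtaRing Cx

variable {B : EtaRing.{u}}

lemma Cx.alH_hmap {X X' Y Y' M N : Cx B} (φ : Mor X Y) (ψ : Mor X' Y') (f : homAll Y M)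
    (g : homAll Y' N) : alH (Mor.hmap φ (Mor.id M) f) (Mor.hmap ψ (Mor.id N) g)
      = Mor.hmap (Mor.tensor φ ψ) (Mor.id (tensor M N)) (alH f g) := by
  induction g using H_induction with
  | hadd g g' h h' => simp only [map_add, h, h']
  | hom e g hg =>
    refine HT_ext fun i i' x hx x' hx' => ?_
    have hg' : Mor.hmap ψ (Mor.id N) g ∈ grH X' N e := (Mor.ihom ψ (Mor.id N)).map_gr e g hg
    rw [alH_tm _ hg' hx, Mor.hmap_apply]
    exact (alH_tm f hg (φ.map_gr _ _ hx) (ψ.f x')).symm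

namespace Resolution

variable {P : Resolution B} (Ψ : P.Diagonal) (Φ : P.FoldExt)

/-- The diagonal of the standard resolution obtained from one of `P`. -/
def stdDiag : Mor (Std.cx B) (tensor (Std.cx B) (Std.cx B)) :=
  (Mor.tensor P.toStd P.toStd).comp (Ψ.map.comp P.fromStd)

/-- The product on the mapping cone of the standard resolution obtained from one for `P`. -/
def stdFold : Mor (tensor (Std.tl B) (Std.tl B)) (Std.tl B) :=
  P.toTl.comp (Φ.map.comp (Mor.tensor P.fromTl P.fromTl))

/-- Both maps cover the identity of k, and their target is a resolution, so the comparison theorem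
applies. -/
lemma exists_htpy_stdDiag : Nonempty (Htpy (stdDiag Ψ) (Std.diag B)) := by
  refine (Std.res B).exists_htpy (Std.isRes_tensor Std.isRes) _ _ fun x => ?_
  have h (u : TC P.P P.P) : (Mor.tensor (Std.aug B) (Std.aug B)).f
      ((Mor.tensor P.toStd P.toStd).f u) = (Mor.tensor P.aug P.aug).f u := by
    induction u using T_induction with
    | hadd z w hz hw => simp only [map_add, hz, hw]
    | htm g h x hx y hy =>
      exact congrArg₂ (fun a b => tm (X := unit B) (Y := unit B) a b) (P.toStd_aug x) (P.toStd_aug y)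
  have h1 := (h (Ψ.map.f (P.fromStd.f x))).trans (Ψ.covers (P.fromStd.f x))
  have h2 := congrArg (fun a => tm (X := unit B) (Y := unit B) (1 : B.k) a) (P.fromStd_aug x)
  exact congrArg (unitMul B).f (h1.trans (h2.trans (Std.diag_covers x).symm))

lemma fromTl_one : P.fromTl.f Std.one = P.incl 1 := Prod.ext (map_zero P.fromStd.f) rfl

/-- The transported product need not be unital; multiplication by 1 becomes a round trip of
comparison maps, which is homotopic to the identity by `exists_htpy_tl`. -/
lemma stdFold_one (y : (Std.tl B).X) :
    (stdFold Φ).f (tm (X := Std.tl B) (Y := Std.tl B) Std.one y)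
      = (P.toTl.comp P.fromTl).f y := by
  change P.toTl.f (Φ.map.f (tm (X := P.tilde) (Y := P.tilde) (P.fromTl.f Std.one) (P.fromTl.f y))) = _
  rw [fromTl_one, Φ.left]
  rfl

variable (P) in
lemma exists_htpy_tl : Nonempty (Htpy (P.toTl.comp P.fromTl) (Mor.id (Std.tl B))) := by
  obtain ⟨H⟩ := P.exists_htpy_std
  exact ⟨H.cone P.toStd_fromStd_aug (fun _ => rfl) (Std.isRes.htpy_aug _ H)⟩

/-- This holds at chain level: moving both factors to P, multiplying there and moving back is the
pairing built from the transported Ψ and Φ. -/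
lemma toHm_pairing (M N : Cx B) (u : TC (Std.hm M) (Std.hm N)) :
    (P.toHm (tensor M N)).f ((pairing Ψ Φ M N).f ((Mor.tensor (P.fromHm M) (P.fromHm N)).f u))
      = (gpair (stdFold Φ) (stdDiag Ψ) M N).f u := by
  induction u using T4_induction (X := Std.tl B) (Y := ihom (Std.cx B) M) (Z := Std.tl B)
    (W := ihom (Std.cx B) N) with
  | hadd z w hz hw => simp only [map_add, hz, hw]
  | htm i e h e' x hx f hf y hy g hg =>
    rw [gpair_tm (stdFold Φ) (stdDiag Ψ) M N x hf hy g]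
    have hf' : Mor.hmap P.toStd (Mor.id M) f ∈ grH P.P M e :=
      (Mor.ihom P.toStd (Mor.id M)).map_gr e f hf
    have h1 := gpair_tm Φ.map Ψ.map M N (P.fromTl.f x) hf' (P.fromTl.map_gr h y hy)
      (Mor.hmap P.toStd (Mor.id N) g)
    have h2 : Mor.hmap P.fromStd (Mor.id (tensor M N)) (Mor.hmap Ψ.map (Mor.id (tensor M N))
        (alH (Mor.hmap P.toStd (Mor.id M) f) (Mor.hmap P.toStd (Mor.id N) g)))
        = Mor.hmap (stdDiag Ψ) (Mor.id (tensor M N)) (alH f g) := by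
      rw [alH_hmap]
      exact H_ext fun _ => rfl
    have h3 (a : P.tilde.X) (F : homAll P.P (tensor M N)) : (P.toHm (tensor M N)).f
        (tm (X := P.tilde) (Y := ihom P.P (tensor M N)) a F)
        = tm (X := Std.tl B) (Y := ihom (Std.cx B) (tensor M N)) (P.toTl.f a)
          (Mor.hmap P.fromStd (Mor.id (tensor M N)) F) := rfl
    have h4 : (pairing Ψ Φ M N).f ((Mor.tensor (P.fromHm M) (P.fromHm N)).f
        (tm4 (X := Std.tl B) (Y := Std.tl B) (Z := ihom (Std.cx B) M) (W := ihom (Std.cx B) N)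
          x f y g)) = _ := h1
    rw [h4, map_zsmul, h3, h2]
    rfl

end Resolution

namespace GMod

variable {M N : GMod B} {P : Resolution B}

/-- The product is transported to the standard resolution, the transported diagonal is replaced by
the standard one up to homotopy, and `exists_prodR` computes the result modulo the image of s + (c₁
+ c₂ - 1)η. -/
theorem cup_toTate (Ψ : P.Diagonal) (Φ : P.FoldExt) (c₁ c₂ : ℤ) {m : M.X} (hm : m ∈ M.ansZ c₁)
    {n : N.X} (hn : n ∈ N.ansZ c₂) :
    M.cup N Ψ Φ c₁ c₂ (M.toTate P c₁ (M.ansCls c₁ ⟨m, hm⟩)) (N.toTate P c₂ (N.ansCls c₂ ⟨n, hn⟩))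
      = (M.tensor N).toTate P (c₁ + c₂)
        ((M.tensor N).ansCls (c₁ + c₂) ⟨M.tmul N m n, M.tmul_mem_ansZ N hm hn⟩) := by
  obtain ⟨z, hz, rfl, -, h1⟩ := M.exists_toTate_eq (P := P) c₁ hm
  obtain ⟨w, hw, rfl, -, h2⟩ := N.exists_toTate_eq (P := P) c₂ hn
  rw [h1, h2, eq_comm, toTate_eq_iff]
  obtain ⟨H⟩ := Resolution.exists_htpy_stdDiag Ψ
  obtain ⟨H'⟩ := P.exists_htpy_tl
  have hc : -c₁ + -c₂ = -(c₁ + c₂) := by ring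
  let u : (Cx.tensor (Std.hm M.toCx) (Std.hm N.toCx)).cyc (-(c₁ + c₂)) :=
    crossCyc hc ⟨z, hz⟩ ⟨w, hw⟩
  have h3 : Hmap (P.toHm (M.tensor N).toCx) (-(c₁ + c₂)) (M.cup N Ψ Φ c₁ c₂
      (Hmap (P.fromHm M.toCx) (-c₁) ((Std.hm M.toCx).Hcls (-c₁) ⟨z, hz⟩))
      (Hmap (P.fromHm N.toCx) (-c₂) ((Std.hm N.toCx).Hcls (-c₂) ⟨w, hw⟩)))
      = Hmap (gpair (Resolution.stdFold Φ) (Resolution.stdDiag Ψ) M.toCx N.toCx) (-(c₁ + c₂))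
        ((Cx.tensor (Std.hm M.toCx) (Std.hm N.toCx)).Hcls (-(c₁ + c₂)) u) :=
    congrArg ((Std.hm (M.tensor N).toCx).Hcls (-(c₁ + c₂)))
      (Subtype.ext (Resolution.toHm_pairing Ψ Φ M.toCx N.toCx u.1))
  obtain ⟨x, hx⟩ := Std.exists_prodR (Resolution.stdFold Φ) (Resolution.stdFold_one Φ) H' hz hw
  rw [fromTate, LinearMap.comp_apply, h3, Hmap_gpair_eq _ H, Hmap_Hcls, Std.RH_Hcls, eq_comm,
    ansCls_eq_iff]
  exact ⟨x, hx⟩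

end GMod

end
end HopfTate

/-! ### An explicit unital product on the standard mapping cone. -/

namespace HopfTate
noncomputable section
open EtaRing Cx

variable {B : EtaRing.{u}}

namespace Gam

/-! ### The multiplication on the mapping cone of the standard resolution -/

lemma eta_left_comm (a b : B.k) : a * (B.eta * b) = B.eta * (a * b) := by
  rw [← mul_assoc, ← eta_comm, mul_assoc]

lemma neg_eta_mul (a : B.k) : -(B.eta * a) = B.eta * a := by rw [← neg_mul, neg_eta]

lemma two_zsmul_eta_mul (a : B.k) : (2 : ℤ) • (B.eta * a) = 0 := by rw [two_smul, two_eta_mul]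

lemma neg_zsmul_eta_mul (n : ℤ) (a : B.k) : -(n • (B.eta * a)) = n • (B.eta * a) := by
  rw [← smul_neg, neg_eta_mul]

lemma eta_mul_sig (a : B.k) : B.eta * B.sig a = B.eta * a := by
  rw [eta_mul, sig_sig, eta_comm]

lemma eta_mul_sig_mul (a b : B.k) : B.eta * (B.sig a * b) = B.eta * (a * b) := by
  rw [← mul_assoc, eta_mul_sig, mul_assoc]

lemma eta_mul_mul_sig (a b : B.k) : B.eta * (a * B.sig b) = B.eta * (a * b) := by
  rw [← eta_mul_sig, map_mul, sig_sig, eta_mul_sig_mul]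

variable (B) in
/-- The biadditive map `Γ × Γ → Γ` of degree `-1` given by
`(α + s β, γ + s δ) ↦ -(σ(β) γ + α δ + η β δ) - s β δ`. -/
def fold : Gam B →+ Gam B →+ Gam B :=
  AddMonoidHom.mk' (fun x => AddMonoidHom.mk'
      (fun y => ⟨-(B.sig x.b * y.a + x.a * y.b + B.eta * (x.b * y.b)), -(x.b * y.b)⟩)
      (fun y z => by
        apply Gam.ext
        · simp only [add_a, add_b, mul_add]; abel
        · simp only [add_b, mul_add]; abel))
    (fun x y => by
      refine AddMonoidHom.ext fun z => ?_
      apply Gam.ext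
      · simp only [AddMonoidHom.mk'_apply, AddMonoidHom.add_apply, add_a, add_b, map_add, mul_add,
          add_mul]; abel
      · simp only [AddMonoidHom.mk'_apply, AddMonoidHom.add_apply, add_b, add_mul]; abel)

lemma fold_a (x y : Gam B) :
    (fold B x y).a = -(B.sig x.b * y.a + x.a * y.b + B.eta * (x.b * y.b)) := rfl

lemma fold_b (x y : Gam B) : (fold B x y).b = -(x.b * y.b) := rfl

variable (B) in
/-- The map `a + s b ↦ -σ(a) + s σ(b)`. -/
def kap : Gam B →+ Gam B := AddMonoidHom.mk' (fun x => ⟨-B.sig x.a, B.sig x.b⟩) (fun x y => by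
  apply Gam.ext
  · simp only [add_a, map_add]; abel
  · simp only [add_b, map_add])

lemma kap_a (x : Gam B) : (kap B x).a = -B.sig x.a := rfl

lemma kap_b (x : Gam B) : (kap B x).b = B.sig x.b := rfl

lemma kap_of_mem {j : ℤ} {x : Gam B} (hx : x ∈ gr B j) : kap B x = -(sg j • x) := by
  apply Gam.ext
  · rw [kap_a, neg_a, zsmul_a, sig_of_mem hx.1]
  · rw [kap_b, neg_b, zsmul_b, sig_of_mem hx.2, sg_sub, sg_one, mul_neg, mul_one, neg_smul]

lemma fold_ι_left (c : B.k) (x y : Gam B) :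
    fold B (x * ι c) y = fold B x (ι (B.sig c) * y) := by
  apply Gam.ext
  · simp [fold_a, mul_assoc]
  · simp [fold_b, mul_assoc]

lemma fold_ι_right (c : B.k) (x y : Gam B) : fold B x (y * ι c) = fold B x y * ι c := by
  apply Gam.ext
  · simp [fold_a, mul_assoc, add_mul]
  · simp [fold_b, mul_assoc]

/-- Linearity of the product over s for the diagonal action, with `kap` as the sign of the second
factor inside the cone. Only terms in 2η obstruct it. -/
lemma fold_s (x y : Gam B) :
    fold B x (y * s) + fold B (x * s) (kap B y) = fold B x y * s := by
  apply Gam.ext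
  · simp only [fold_a, add_a, mul_a, mul_b, s_a, s_b, mul_zero, mul_one, add_zero, zero_add,
      kap_a, kap_b, map_add, map_mul, sig_sig, sig_eta, mul_add, add_mul, mul_neg, mul_assoc,
      eta_left_comm, neg_add, neg_eta_mul, zero_mul, neg_neg, eta_mul_sig, eta_mul_sig_mul,
      eta_mul_mul_sig]
    abel_nf
    simp only [two_zsmul_eta_mul, add_zero]
  · simp only [fold_a, fold_b, add_b, mul_b, s_a, s_b, mul_zero, mul_one, add_zero,
      kap_b, map_add, map_mul, sig_sig, sig_eta, mul_add, add_mul, mul_assoc, eta_left_comm, neg_add,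
      neg_eta_mul, map_neg, mul_neg, eta_mul_sig, eta_mul_sig_mul, eta_mul_mul_sig]
    abel

/-- The Leibniz rule in terms of coefficients. The boundary of p_i x involves s + (i - 1)η, and the
product sits at p_{i+j+1}, whose boundary involves s + (i + j)η; the common sign of the cone is left
out. -/
lemma fold_sEta (i j : ℤ) (x y : Gam B) :
    fold B (sEta B (i - 1) * x) y + fold B (kap B x) (sEta B (j - 1) * y)
      = sEta B (i + j) * fold B x y := by
  apply Gam.ext
  · simp only [fold_a, add_a, sEta_mul_a, sEta_mul_b, kap_a, kap_b, map_add, map_mul,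
      sig_sig, sig_eta, mul_add, add_mul, mul_neg, mul_assoc, smul_mul_assoc, mul_smul_comm,
      map_zsmul, eta_left_comm, neg_add, neg_eta_mul, neg_neg, neg_mul, sub_add_cancel,
      smul_add, add_smul, sub_smul, one_smul, eta_mul_sig, eta_mul_sig_mul, sub_mul,
      mul_sub, neg_zsmul_eta_mul, neg_sub]
    abel_nf
    simp only [two_zsmul_eta_mul, zero_add, neg_one_smul, neg_zsmul_eta_mul]
  · simp only [fold_a, fold_b, add_b, sEta_mul_b, kap_b, mul_add, add_mul, mul_neg, mul_assoc,
      smul_mul_assoc, mul_smul_comm, eta_left_comm, neg_add, neg_eta_mul, sub_add_cancel, add_smul,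
      one_smul, eta_mul_sig_mul, neg_zsmul_eta_mul]
    abel_nf
    simp only [two_zsmul_eta_mul, add_zero]

/-- The index -1 belongs to the boundary of p_0 x, which is ε(x) instead of a multiple of some
p_{-1}. The formal expression agrees with the action of ε(x) up to the sign of the cone, so the
Leibniz rule needs no separate case for i = 0. -/
lemma fold_sEta_left (x y : Gam B) : fold B (sEta B (-1) * x) y = -(ι (B.sig x.a) * y) := by
  apply Gam.ext
  · rw [fold_a, sEta_mul_a, sEta_mul_b]
    simp only [neg_a, mul_a, ι_a, neg_add_cancel, zero_smul, add_zero, neg_one_smul, neg_eta_mul,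
      mul_assoc, neg_add]
    rw [add_assoc, two_eta_mul, add_zero]
  · rw [fold_b, sEta_mul_b]
    simp only [neg_b, mul_b, ι_a, ι_b, neg_add_cancel, zero_smul, add_zero, sig_sig, zero_mul,
      map_zero, mul_zero]

lemma fold_sEta_right (x y : Gam B) : fold B x (sEta B (-1) * y) = -(x * ι y.a) := by
  apply Gam.ext
  · rw [fold_a, sEta_mul_a, sEta_mul_b]
    simp only [neg_a, mul_a, ι_a, neg_add_cancel, zero_smul, add_zero, neg_one_smul, neg_eta_mul,
      eta_left_comm, eta_mul_sig_mul, neg_add]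
    rw [add_right_comm, two_eta_mul, zero_add]
  · rw [fold_b, sEta_mul_b]
    simp only [neg_b, mul_b, ι_a, ι_b, neg_add_cancel, zero_smul, add_zero, mul_zero, zero_add]

lemma hom_induction {p : Gam B → Prop} (hom : ∀ j, ∀ x ∈ gr B j, p x)
    (hadd : ∀ x y, p x → p y → p (x + y)) (x : Gam B) : p x := by
  rw [eq_add x]
  refine hadd _ _ ?_ ?_
  · induction x.a using gr_induction B.gr with
    | h0 => exact hom 0 _ (by rw [map_zero]; exact zero_mem _)
    | hadd a b ha hb => rw [map_add]; exact hadd _ _ ha hb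
    | hom j a ha => exact hom j _ (ι_mem ha)
  · induction x.b using gr_induction B.gr with
    | h0 => exact hom 0 _ (by rw [map_zero, mul_zero]; exact zero_mem _)
    | hadd a b ha hb => rw [map_add, mul_add]; exact hadd _ _ ha hb
    | hom j a ha => exact hom (1 + j) _ (mul_mem s_mem (ι_mem ha))

lemma ι_sig_mul {i j : ℤ} {a : B.k} (ha : a ∈ B.gr i) {x : Gam B} (hx : x ∈ gr B j) :
    ι (B.sig a) * x = sg (i * (j + 1)) • (x * ι a) := by
  apply Gam.ext
  · rw [mul_a, ι_a, zsmul_a, mul_a, ι_a, sig_of_mem ha, smul_mul_assoc, B.graded_comm i j a ha _ hx.1,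
      smul_smul, ← sg_add, mul_add, mul_one, add_comm]
  · rw [zsmul_b, mul_b, mul_b, ι_a, ι_a, ι_b, sig_sig, map_zero, B.graded_comm i _ a ha _ hx.2]
    have e : sg (i * (j - 1)) = sg (i * (j + 1)) := by
      rw [mul_sub, mul_add, sg_sub, sg_add]
    simp only [zero_mul, mul_zero, add_zero, zero_add, e, ι_b]

lemma fold_mem {i j : ℤ} {x y : Gam B} (hx : x ∈ gr B i) (hy : y ∈ gr B j) :
    fold B x y ∈ gr B (i + j - 1) := by
  have h : ∀ {i j l : ℤ} {a b : B.k}, a ∈ B.gr i → b ∈ B.gr j → i + j = l → a * b ∈ B.gr l :=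
    fun ha hb e => e ▸ SetLike.GradedMul.mul_mem ha hb
  refine ⟨neg_mem (add_mem (add_mem ?_ ?_) ?_), neg_mem ?_⟩
  · exact h (sig_mem hx.2) hy.1 (by ring)
  · exact h hx.1 hy.2 (by ring)
  · exact h B.eta_mem (h hx.2 hy.2 rfl) (by ring)
  · exact h hx.2 hy.2 (by ring)

end Gam

namespace Std

lemma single_mem_tl (n : ℕ) {j : ℤ} {x : Gam B} (hx : x ∈ Gam.gr B j) :
    ((Finsupp.single n x, 0) : (ℕ →₀ Gam B) × B.k) ∈ (tl B).gr (n + 1, j + n) := by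
  refine ⟨?_, zero_mem _⟩
  change _ ∈ (cx B).gr (((n : ℤ) + 1, j + n) + (-1, 0) : ℤ × ℤ)
  have e : (((n : ℤ) + 1, j + n) + (-1, 0) : ℤ × ℤ) = ((n : ℤ), j + n) := by ext <;> simp
  rw [e]
  exact single_mem (by rwa [add_sub_cancel_right])

lemma pair_add (x y : ℕ →₀ Gam B) :
    ((x + y, 0) : (ℕ →₀ Gam B) × B.k) = ((x, 0) : (ℕ →₀ Gam B) × B.k) + (y, 0) :=
  Prod.ext rfl (add_zero 0).symm

lemma pair_zsmul (n : ℤ) (x : ℕ →₀ Gam B) :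
    ((n • x, 0) : (ℕ →₀ Gam B) × B.k) = n • ((x, 0) : (ℕ →₀ Gam B) × B.k) :=
  Prod.ext rfl (smul_zero n).symm

lemma tl_kos_single (e : ℤ) (n : ℕ) {j : ℤ} {x : Gam B} (hx : x ∈ Gam.gr B j) :
    (tl B).kos e ((Finsupp.single n x, 0) : (ℕ →₀ Gam B) × B.k)
      = sg (e * (j + 1)) • ((Finsupp.single n x, 0) : (ℕ →₀ Gam B) × B.k) := by
  rw [kos_of_mem e (single_mem_tl n hx)]
  congr 1
  rw [tot_mk, show e * ((n : ℤ) + 1 + (j + n)) = e * n + e * n + e * (j + 1) by ring, sg_add, sg_add,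
    sg_sq, one_mul]

lemma tl_kos (n : ℕ) (x : Gam B) : (tl B).kos 1 ((Finsupp.single n x, 0) : (ℕ →₀ Gam B) × B.k)
    = ((Finsupp.single n (Gam.kap B x), 0) : (ℕ →₀ Gam B) × B.k) := by
  induction x using Gam.hom_induction with
  | hadd x y hx hy =>
    rw [map_add, Finsupp.single_add, Finsupp.single_add, pair_add, pair_add, ← hx, ← hy]
    exact map_add _ _ _
  | hom j x hx =>
    rw [tl_kos_single 1 n hx, Gam.kap_of_mem hx, one_mul, sg_add, sg_one, mul_neg_one, neg_smul,
      Finsupp.single_neg, ← Finsupp.smul_single, ← pair_zsmul]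
    exact Prod.ext rfl neg_zero

lemma tl_kos_unit (a : B.k) : (tl B).kos 1 ((0, a) : (ℕ →₀ Gam B) × B.k)
    = ((0, B.sig a) : (ℕ →₀ Gam B) × B.k) := by
  have e (x : B.k) : ((0, x) : (ℕ →₀ Gam B) × B.k) = (tl B).ra x one := by
    rw [one, tl_ra, map_zero, one_mul]
  rw [e, e]
  induction a using gr_induction B.gr with
  | h0 => simp
  | hadd a b h h' => simp only [map_add, AddMonoidHom.add_apply, h, h']
  | hom j a ha =>
    rw [kos_ra 1 ha, kos_one, sig_of_mem ha, one_mul, map_zsmul, AddMonoidHom.zsmul_apply]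

/-- In the cone p_n has odd total degree 2n + 1, so a scalar passing it from the left is changed by
the grading involution. -/
lemma tl_la (a : B.k) (n : ℕ) (x : Gam B) :
    (tl B).la a ((Finsupp.single n x, 0) : (ℕ →₀ Gam B) × B.k)
      = ((Finsupp.single n (Gam.ι (B.sig a) * x), 0) : (ℕ →₀ Gam B) × B.k) := by
  induction x using Gam.hom_induction with
  | hadd x y hx hy =>
    rw [mul_add, Finsupp.single_add, Finsupp.single_add, pair_add, pair_add, ← hx, ← hy]
    exact map_add _ _ _
  | hom j x hx =>
    induction a using gr_induction B.gr with
    | h0 => simp; rfl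
    | hadd a b h h' =>
      rw [map_add, AddMonoidHom.add_apply, h, h', ← pair_add, ← Finsupp.single_add, ← add_mul,
        ← map_add, ← map_add]
    | hom i a ha =>
      rw [la_of_mem ha, tl_kos_single i n hx, map_zsmul, tl_ra, zero_mul, ra_single, ← pair_zsmul,
        Finsupp.smul_single, Gam.ι_sig_mul ha hx]

lemma tl_la_unit (a b : B.k) : (tl B).la a ((0, b) : (ℕ →₀ Gam B) × B.k)
    = ((0, a * b) : (ℕ →₀ Gam B) × B.k) := by
  have e (x : B.k) : ((0, x) : (ℕ →₀ Gam B) × B.k) = (tl B).ra x one := by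
    rw [one, tl_ra, map_zero, one_mul]
  rw [e, e, la_ra, ← ra_ra]
  congr 1
  induction a using gr_induction B.gr with
  | h0 => simp
  | hadd a b h h' => simp only [map_add, AddMonoidHom.add_apply, h, h']
  | hom j a ha => rw [la_of_mem ha, kos_one]

lemma tl_sm_unit (a : B.k) : (tl B).sm ((0, a) : (ℕ →₀ Gam B) × B.k) = 0 := by
  rw [tl_sm, map_zero]; rfl

lemma tl_d_unit (a : B.k) : (tl B).d ((0, a) : (ℕ →₀ Gam B) × B.k) = 0 := by
  rw [tl_d, map_zero, map_zero, neg_zero]; rfl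

variable (B) in
/-- The biadditive map with `(p_i x, p_j y) ↦ p_{i+j+1} (x ⋆ y)`, where `⋆` is `Gam.fold`. -/
def foldP : (ℕ →₀ Gam B) →+ (ℕ →₀ Gam B) →+ (ℕ →₀ Gam B) :=
  Finsupp.liftAddHom fun i => AddMonoidHom.flip (Finsupp.liftAddHom fun j =>
    AddMonoidHom.flip ((Gam.fold B).compr₂ (Finsupp.singleAddHom (i + j + 1))))

lemma foldP_single (i j : ℕ) (x y : Gam B) :
    foldP B (Finsupp.single i x) (Finsupp.single j y)
      = Finsupp.single (i + j + 1) (Gam.fold B x y) := by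
  simp [foldP]

variable (B) in
/-- The product on the mapping cone of the standard resolution. -/
def foldB : (tl B).X →+ (tl B).X →+ (tl B).X :=
  AddMonoidHom.mk' (fun X => AddMonoidHom.mk' (fun Y => (((foldP B X.1 Y.1, 0) : (ℕ →₀ Gam B) × B.k)
      + (tl B).la X.2 Y + (tl B).ra Y.2 ((X.1, 0) : (ℕ →₀ Gam B) × B.k)))
    (fun Y Z => by
      rw [Prod.fst_add, Prod.snd_add, map_add, map_add, map_add, AddMonoidHom.add_apply, pair_add]
      abel))
    (fun X Y => AddMonoidHom.ext fun Z => by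
      change ((foldP B (X.1 + Y.1) Z.1, 0) : (ℕ →₀ Gam B) × B.k) + (tl B).la (X.2 + Y.2) Z
          + (tl B).ra Z.2 ((X.1 + Y.1, 0) : (ℕ →₀ Gam B) × B.k)
        = (((foldP B X.1 Z.1, 0) : (ℕ →₀ Gam B) × B.k) + (tl B).la X.2 Z
          + (tl B).ra Z.2 ((X.1, 0) : (ℕ →₀ Gam B) × B.k))
        + (((foldP B Y.1 Z.1, 0) : (ℕ →₀ Gam B) × B.k) + (tl B).la Y.2 Z
          + (tl B).ra Z.2 ((Y.1, 0) : (ℕ →₀ Gam B) × B.k))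
      rw [map_add, map_add, AddMonoidHom.add_apply, AddMonoidHom.add_apply, pair_add, pair_add]
      rw [show (tl B).ra Z.2 (((X.1, 0) : (ℕ →₀ Gam B) × B.k) + (Y.1, 0)) = _ from map_add _ _ _]
      abel)

lemma foldB_apply (X Y : (tl B).X) : foldB B X Y = ((foldP B X.1 Y.1, 0) : (ℕ →₀ Gam B) × B.k)
      + (tl B).la X.2 Y + (tl B).ra Y.2 ((X.1, 0) : (ℕ →₀ Gam B) × B.k) := rfl

lemma foldB_unit_left (a : B.k) (Y : (tl B).X) :
    foldB B ((0, a) : (ℕ →₀ Gam B) × B.k) Y = (tl B).la a Y := by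
  rw [foldB_apply, map_zero, AddMonoidHom.zero_apply]
  change 0 + (tl B).la a Y + (tl B).ra Y.2 0 = _
  rw [map_zero, zero_add, add_zero]

lemma foldB_unit_right (X : (tl B).X) (b : B.k) :
    foldB B X ((0, b) : (ℕ →₀ Gam B) × B.k) = (tl B).ra b X := by
  rw [foldB_apply, map_zero, tl_la_unit]
  change 0 + ((0, X.2 * b) : (ℕ →₀ Gam B) × B.k) + (tl B).ra b ((X.1, 0) : (ℕ →₀ Gam B) × B.k) = _
  rw [tl_ra, zero_mul, zero_add]
  exact Prod.ext (zero_add _) (add_zero _)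

lemma foldB_single (i j : ℕ) (x y : Gam B) :
    foldB B ((Finsupp.single i x, 0) : (ℕ →₀ Gam B) × B.k) ((Finsupp.single j y, 0) : (ℕ →₀ Gam B) × B.k)
      = ((Finsupp.single (i + j + 1) (Gam.fold B x y), 0) : (ℕ →₀ Gam B) × B.k) := by
  rw [foldB_apply, foldP_single, map_zero, map_zero, AddMonoidHom.zero_apply,
    AddMonoidHom.zero_apply, add_zero, add_zero]

lemma foldB_induction {p : (tl B).X → (tl B).X → Prop}
    (h1 : ∀ a Y, p ((0, a) : (ℕ →₀ Gam B) × B.k) Y)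
    (h2 : ∀ X b, p X ((0, b) : (ℕ →₀ Gam B) × B.k))
    (h3 : ∀ i j (x y : Gam B), p ((Finsupp.single i x, 0) : (ℕ →₀ Gam B) × B.k)
      ((Finsupp.single j y, 0) : (ℕ →₀ Gam B) × B.k))
    (hadd : ∀ X X' Y, p X Y → p X' Y → p (X + X') Y)
    (hadd' : ∀ X Y Y', p X Y → p X Y' → p X (Y + Y')) (X Y : (tl B).X) : p X Y := by
  induction X using tl_induction with
  | h0 => exact h1 0 Y
  | h1 a => exact h1 a Y
  | hadd X X' h h' => exact hadd _ _ _ h h'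
  | h2 i x =>
    induction Y using tl_induction with
    | h0 => exact h2 _ 0
    | h1 b => exact h2 _ b
    | hadd Y Y' h h' => exact hadd' _ _ _ h h'
    | h2 j y => exact h3 i j x y

lemma foldB_ra_left (a : B.k) (X Y : (tl B).X) :
    foldB B ((tl B).ra a X) Y = foldB B X ((tl B).la a Y) := by
  refine foldB_induction (p := fun X Y => foldB B ((tl B).ra a X) Y = foldB B X ((tl B).la a Y))
    (fun b Y => ?_) (fun X b => ?_) (fun i j x y => ?_) (fun X X' Y h h' => ?_)
    (fun X Y Y' h h' => ?_) X Y
  · rw [tl_ra, map_zero, foldB_unit_left, foldB_unit_left, la_la]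
  · rw [foldB_unit_right, tl_la_unit, foldB_unit_right, ra_ra]
  · rw [tl_ra, zero_mul, ra_single, tl_la, foldB_single, foldB_single, Gam.fold_ι_left]
  · simp only [map_add, AddMonoidHom.add_apply, h, h']
  · simp only [map_add, h, h']

lemma foldB_ra (a : B.k) (X Y : (tl B).X) :
    foldB B X ((tl B).ra a Y) = (tl B).ra a (foldB B X Y) := by
  refine foldB_induction (p := fun X Y => foldB B X ((tl B).ra a Y) = (tl B).ra a (foldB B X Y))
    (fun b Y => ?_) (fun X b => ?_) (fun i j x y => ?_) (fun X X' Y h h' => ?_)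
    (fun X Y Y' h h' => ?_) X Y
  · rw [foldB_unit_left, foldB_unit_left, la_ra]
  · rw [foldB_unit_right, tl_ra, map_zero, foldB_unit_right, ra_ra]
  · rw [tl_ra, zero_mul, ra_single, foldB_single, foldB_single, Gam.fold_ι_right, tl_ra, zero_mul,
      ra_single]
  · simp only [map_add, AddMonoidHom.add_apply, h, h']
  · simp only [map_add, h, h']

lemma foldB_sm (X Y : (tl B).X) : foldB B X ((tl B).sm Y) + foldB B ((tl B).sm X) ((tl B).kos 1 Y)
    = (tl B).sm (foldB B X Y) := by
  refine foldB_induction (p := fun X Y => foldB B X ((tl B).sm Y)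
      + foldB B ((tl B).sm X) ((tl B).kos 1 Y) = (tl B).sm (foldB B X Y))
    (fun b Y => ?_) (fun X b => ?_) (fun i j x y => ?_) (fun X X' Y h h' => ?_)
    (fun X Y Y' h h' => ?_) X Y
  · rw [foldB_unit_left, foldB_unit_left, tl_sm_unit, map_zero, AddMonoidHom.zero_apply, add_zero,
      sm_la]
  · rw [foldB_unit_right, tl_sm_unit, tl_kos_unit, foldB_unit_right, sm_ra, map_zero, zero_add]
  · rw [tl_sm, tl_sm, sm_single, sm_single, tl_kos, foldB_single, foldB_single, foldB_single, tl_sm,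
      sm_single, ← Gam.fold_s, Finsupp.single_add]
    exact Prod.ext rfl (add_zero _)
  · simp only [map_add, AddMonoidHom.add_apply] at *
    rw [← h, ← h']; abel
  · simp only [map_add] at *
    rw [← h, ← h']; abel

lemma foldB_d_left (i j : ℕ) (x y : Gam B) :
    foldB B ((tl B).d ((Finsupp.single i x, 0) : (ℕ →₀ Gam B) × B.k))
        ((Finsupp.single j y, 0) : (ℕ →₀ Gam B) × B.k)
      = ((-Finsupp.single (i + j) (Gam.fold B (Gam.sEta B (i - 1) * x) y), 0) :
        (ℕ →₀ Gam B) × B.k) := by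
  rw [tl_d]
  rcases i with _ | i
  · rw [bd_zero, neg_zero, aug_single_zero, foldB_unit_left, tl_la, Nat.cast_zero, zero_sub,
      Gam.fold_sEta_left, Finsupp.single_neg, neg_neg, zero_add]
  · rw [bd_succ, ← Finsupp.single_neg, aug_single_succ, foldB_single, Nat.cast_succ,
      add_sub_cancel_right, map_neg, AddMonoidHom.neg_apply, Finsupp.single_neg, add_right_comm]

lemma foldB_d_right (i j : ℕ) (x y : Gam B) :
    foldB B ((Finsupp.single i x, 0) : (ℕ →₀ Gam B) × B.k)
        ((tl B).d ((Finsupp.single j y, 0) : (ℕ →₀ Gam B) × B.k))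
      = ((-Finsupp.single (i + j) (Gam.fold B x (Gam.sEta B (j - 1) * y)), 0) :
        (ℕ →₀ Gam B) × B.k) := by
  rw [tl_d]
  rcases j with _ | j
  · rw [bd_zero, neg_zero, aug_single_zero, foldB_unit_right, tl_ra, zero_mul, ra_single,
      Nat.cast_zero, zero_sub, Gam.fold_sEta_right, Finsupp.single_neg, neg_neg, add_zero]
  · rw [bd_succ, ← Finsupp.single_neg, aug_single_succ, foldB_single, Nat.cast_succ,
      add_sub_cancel_right, map_neg, Finsupp.single_neg, add_assoc]

/-- If one factor lies in k, this says that the boundary is compatible with scalars; otherwise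
`foldB_d_left` and `foldB_d_right` reduce it to `Gam.fold_sEta`, uniformly in the indices. -/
lemma foldB_d (X Y : (tl B).X) : foldB B ((tl B).d X) Y + foldB B ((tl B).kos 1 X) ((tl B).d Y)
    = (tl B).d (foldB B X Y) := by
  refine foldB_induction (p := fun X Y => foldB B ((tl B).d X) Y
      + foldB B ((tl B).kos 1 X) ((tl B).d Y) = (tl B).d (foldB B X Y))
    (fun b Y => ?_) (fun X b => ?_) (fun i j x y => ?_) (fun X X' Y h h' => ?_)
    (fun X Y Y' h h' => ?_) X Y
  · rw [foldB_unit_left, tl_d_unit, tl_kos_unit, foldB_unit_left, d_la, map_zero,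
      AddMonoidHom.zero_apply, zero_add]
  · rw [foldB_unit_right, foldB_unit_right, tl_d_unit, map_zero, d_ra, add_zero]
  · rw [foldB_d_left, tl_kos, foldB_d_right, foldB_single, tl_d, aug_single_succ, bd_succ, ← pair_add,
      ← neg_add, ← Finsupp.single_add, Gam.fold_sEta, Nat.cast_add]
  · simp only [map_add, AddMonoidHom.add_apply] at *
    rw [← h, ← h']; abel
  · simp only [map_add] at *
    rw [← h, ← h']; abel

end Std
end
end HopfTate

/-! ### Existence of Ψ and Φ for every resolution. -/

namespace HopfTate
noncomputable section
open EtaRing Cx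

variable {B : EtaRing.{u}}

namespace Cx

variable {X Y Z : Cx B}

lemma balanced_of_ra (b : X.X →+ Y.X →+ Z.X)
    (hb : ∀ a x y, b (X.ra a x) y = b x (Y.la a y)) : Balanced b := by
  intro g h j x _ a ha y hy
  rw [hb, la_of_mem ha, kos_of_mem j hy, map_zsmul, map_zsmul]

/-- The chain map on a tensor product that corresponds to a suitable biadditive map. -/
def Mor.ofBiadd (b : X.X →+ Y.X →+ Z.X) (hb : ∀ a x y, b (X.ra a x) y = b x (Y.la a y))
    (hr : ∀ a x y, b x (Y.ra a y) = Z.ra a (b x y))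
    (hs : ∀ x y, b x (Y.sm y) + b (X.sm x) (Y.kos 1 y) = Z.sm (b x y))
    (hg : ∀ g h, ∀ x ∈ X.gr g, ∀ y ∈ Y.gr h, b x y ∈ Z.gr (g + h))
    (hd : ∀ x y, b (X.d x) y + b (X.kos 1 x) (Y.d y) = Z.d (b x y)) : Mor (Cx.tensor X Y) Z :=
  Mor.ofAdd (X := Cx.tensor X Y) (Y := Z) (tlift b (balanced_of_ra b hb))
    (fun a (z : TC X Y) => by
      rw [tensor_ra]
      induction z using T_induction with
      | htm g h x hx y hy => exact hr a x y
      | hadd z w hz hw => simp only [map_add, hz, hw])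
    (fun (z : TC X Y) => by
      rw [tensor_sm]
      induction z using T_induction with
      | htm g h x hx y hy => exact hs x y
      | hadd z w hz hw => simp only [map_add, hz, hw])
    (fun g z hz => grT_le (fun h h' e x hx y hy => by
      rw [← e]; exact hg h h' x hx y hy) z hz)
    (fun (z : TC X Y) => by
      rw [tensor_d]
      induction z using T_induction with
      | htm g h x hx y hy => exact hd x y
      | hadd z w hz hw => simp only [map_add, hz, hw])

/-- The chain map `F - (∂h + h∂)` for a `Γ`-linear map `h` of homological degree `1`. -/
def Mor.subBdry (F : Mor X Y) (h : X.X →+ Y.X) (hr : ∀ a x, h (X.ra a x) = Y.ra a (h x))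
    (hs : ∀ x, h (X.sm x) = Y.sm (h x)) (hg : ∀ g, ∀ x ∈ X.gr g, h x ∈ Y.gr (g + (1, 0))) :
    Mor X Y :=
  Mor.ofAdd (F.f.toAddMonoidHom
      - (Y.d.toAddMonoidHom.comp h + h.comp X.d.toAddMonoidHom))
    (fun a x => by
      change F.f (X.ra a x) - (Y.d (h (X.ra a x)) + h (X.d (X.ra a x)))
        = Y.ra a (F.f x - (Y.d (h x) + h (X.d x)))
      rw [F.ra', hr, d_ra, d_ra, hr, map_sub, map_add])
    (fun x => by
      change F.f (X.sm x) - (Y.d (h (X.sm x)) + h (X.d (X.sm x)))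
        = Y.sm (F.f x - (Y.d (h x) + h (X.d x)))
      rw [F.sm', hs, d_sm, d_sm, hs, map_sub, map_add])
    (fun g x hx => sub_mem (F.map_gr g x hx) (add_mem
      (show Y.d (h x) ∈ _ by
        simpa only [add_assoc, Prod.mk_add_mk, add_neg_cancel, add_zero, Prod.mk_zero_zero]
          using Y.d_mem _ _ (hg g x hx))
      (show h (X.d x) ∈ _ by
        simpa only [add_assoc, Prod.mk_add_mk, neg_add_cancel, add_zero, Prod.mk_zero_zero]
          using hg _ _ (X.d_mem g x hx))))
    (fun x => by
      change F.f (X.d x) - (Y.d (h (X.d x)) + h (X.d (X.d x)))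
        = Y.d (F.f x - (Y.d (h x) + h (X.d x)))
      rw [F.map_d, d_d, map_sub, map_add, d_d, map_zero, add_zero, zero_add])

lemma la_unit_mem {a : B.k} {g h : ℤ × ℤ} (ha : a ∈ (unit B).gr g) {y : Y.X} (hy : y ∈ Y.gr h) :
    Y.la a y ∈ Y.gr (g + h) := by
  obtain rfl | ⟨h1, h2⟩ := unit_mem ha
  · rw [map_zero]; exact zero_mem _
  · rw [la_of_mem h2, show g + h = h + (0, g.2) by ext <;> simp [h1, add_comm]]
    exact ra_mem (kos_mem _ hy) h2

lemma ra_unit_mem {a : B.k} {g h : ℤ × ℤ} (ha : a ∈ (unit B).gr h) {x : X.X} (hx : x ∈ X.gr g) :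
    X.ra a x ∈ X.gr (g + h) := by
  obtain rfl | ⟨h1, h2⟩ := unit_mem ha
  · rw [map_zero]; exact zero_mem _
  · rw [show g + h = g + (0, h.2) by ext <;> simp [h1]]
    exact ra_mem hx h2

/-- The inclusion of the target of `p` into the mapping cone of `p`. -/
def coneIncl (p : Mor X Z) : Mor Z (cone p) where
  f := LinearMap.inr _ _ _
  map_gr _ _ hx := ⟨zero_mem _, hx⟩
  map_d x := Prod.ext (by simp) (by simp)

/-- The projection from the mapping cone of `p` to the target of `p`. -/
def coneSnd (p : Mor X Z) : GrMor (cone p) Z where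
  f := LinearMap.snd _ _ _
  map_gr _ _ hx := hx.2

end Cx

namespace Std

lemma foldB_mem {g h : ℤ × ℤ} {X Y : (tl B).X} (hX : X ∈ (tl B).gr g) (hY : Y ∈ (tl B).gr h) :
    foldB B X Y ∈ (tl B).gr (g + h) := by
  have hX1 : ((X.1, 0) : (ℕ →₀ Gam B) × B.k) ∈ (tl B).gr g := ⟨hX.1, zero_mem _⟩
  obtain ⟨x, a, rfl, hx, ha⟩ := tl_cases hX
  obtain ⟨y, b, rfl, hy, hb⟩ := tl_cases hY
  rw [foldB_apply]
  refine add_mem (add_mem ?_ (la_unit_mem hX.2 hY)) (ra_unit_mem hY.2 hX1)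
  change ((foldP B x y, 0) : (ℕ →₀ Gam B) × B.k) ∈ _
  obtain rfl | ⟨i, z, h1, h2, rfl⟩ := hx
  · rw [map_zero, AddMonoidHom.zero_apply]; exact zero_mem _
  obtain rfl | ⟨j, w, h3, h4, rfl⟩ := hy
  · rw [map_zero]; exact zero_mem _
  rw [foldP_single]
  convert single_mem_tl (i + j + 1) (Gam.fold_mem h2 h4) using 2
  ext
  · simp only [Prod.fst_add, h1, h3]; push_cast; ring
  · simp only [Prod.snd_add]; push_cast; ring

variable (B) in
/-- The product on the mapping cone of the standard resolution, as a chain map. -/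
def foldMor : Mor (tensor (tl B) (tl B)) (tl B) :=
  Mor.ofBiadd (foldB B) foldB_ra_left foldB_ra foldB_sm (fun _ _ _ hX _ hY => foldB_mem hX hY)
    foldB_d

end Std

namespace Resolution

variable (P : Resolution B)

theorem nonempty_diagonal : Nonempty P.Diagonal := by
  refine ⟨(Mor.tensor P.fromStd P.fromStd).comp ((Std.diag B).comp P.toStd), fun x => ?_⟩
  have h (u : TC (Std.cx B) (Std.cx B)) : (Mor.tensor P.aug P.aug).f
      ((Mor.tensor P.fromStd P.fromStd).f u) = (Mor.tensor (Std.aug B) (Std.aug B)).f u := by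
    induction u using T_induction with
    | hadd z w hz hw => simp only [map_add, hz, hw]
    | htm g h x hx y hy =>
      exact congrArg₂ (fun a b => tm (X := unit B) (Y := unit B) a b) (P.fromStd_aug x)
        (P.fromStd_aug y)
  have h2 := congrArg (fun a => tm (X := unit B) (Y := unit B) (1 : B.k) a) (P.toStd_aug x)
  exact (h _).trans ((Std.diag_covers (P.toStd.f x)).trans h2)

variable {P}

lemma tilde_sm_snd (x : P.tilde.X) : (P.tilde.sm x).2 = 0 := unit_sm x.2

lemma tilde_kos_snd (x : P.tilde.X) : (P.tilde.kos 1 x).2 = B.sig x.2 :=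
  ((coneSnd P.aug).kos' 1 x).trans (unit_kos_one x.2)

lemma tilde_ra_snd (a : B.k) (x : P.tilde.X) : (P.tilde.ra a x).2 = x.2 * a := rfl

lemma tilde_la_snd (a : B.k) (x : P.tilde.X) : (P.tilde.la a x).2 = a * x.2 :=
  ((coneSnd P.aug).la' a x).trans (unit_la a x.2)

lemma toTl_incl (a : B.k) : P.toTl.f (P.incl a) = ((0, a) : (ℕ →₀ Gam B) × B.k) :=
  Prod.ext (map_zero P.toStd.f) rfl

/-- The pairing of the mapping cone with itself induced by the product on the mapping cone of the
standard resolution. -/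
def preFold (P : Resolution B) : Mor (tensor P.tilde P.tilde) P.tilde :=
  P.fromTl.comp ((Std.foldMor B).comp (Mor.tensor P.toTl P.toTl))

lemma preFold_left (x : P.tilde.X) :
    (preFold P).f (tm (X := P.tilde) (Y := P.tilde) (P.incl 1) x)
      = (P.fromTl.comp P.toTl).f x := by
  change P.fromTl.f (Std.foldB B (P.toTl.f (P.incl 1)) (P.toTl.f x)) = _
  rw [toTl_incl, Std.foldB_unit_left, la_one]
  rfl

lemma preFold_right (x : P.tilde.X) :
    (preFold P).f (tm (X := P.tilde) (Y := P.tilde) x (P.incl 1))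
      = (P.fromTl.comp P.toTl).f x := by
  change P.fromTl.f (Std.foldB B (P.toTl.f x) (P.toTl.f (P.incl 1))) = _
  rw [toTl_incl, Std.foldB_unit_right, ra_one]
  rfl

/-- The null homotopy which corrects `preFold` to an extension of the fold map. -/
def foldHtpyB {F G : Mor P.tilde P.tilde} (H : Htpy F G) :
    P.tilde.X →+ P.tilde.X →+ P.tilde.X :=
  AddMonoidHom.mk' (fun x => AddMonoidHom.mk' (fun y => H.h (P.tilde.la x.2 y) + P.tilde.ra y.2 (H.h x))
      (fun y z => by
        rw [map_add, map_add, Prod.snd_add, map_add, AddMonoidHom.add_apply]; abel))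
    (fun x y => AddMonoidHom.ext fun z => by
      change H.h (P.tilde.la (x.2 + y.2) z) + P.tilde.ra z.2 (H.h (x + y))
        = (H.h (P.tilde.la x.2 z) + P.tilde.ra z.2 (H.h x))
          + (H.h (P.tilde.la y.2 z) + P.tilde.ra z.2 (H.h y))
      rw [map_add, map_add, map_add, AddMonoidHom.add_apply, map_add]; abel)

section

variable {F G : Mor P.tilde P.tilde} (H : Htpy F G)

lemma foldHtpyB_apply (x y : P.tilde.X) :
    foldHtpyB H x y = H.h (P.tilde.la x.2 y) + P.tilde.ra y.2 (H.h x) := rfl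

lemma foldHtpyB_ra_left (a : B.k) (x y : P.tilde.X) :
    foldHtpyB H (P.tilde.ra a x) y = foldHtpyB H x (P.tilde.la a y) := by
  rw [foldHtpyB_apply, foldHtpyB_apply, tilde_ra_snd, tilde_la_snd, la_la, H.ra, ra_ra]

/-- The map of degree one on the tensor product which corresponds to `foldHtpyB`. -/
def foldHtpy : TC P.tilde P.tilde →+ P.tilde.X :=
  tlift (foldHtpyB H) (balanced_of_ra _ (foldHtpyB_ra_left H))

lemma foldHtpy_tm (x y : P.tilde.X) :
    foldHtpy H (tm x y) = H.h (P.tilde.la x.2 y) + P.tilde.ra y.2 (H.h x) := rfl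

/-- The chain map `preFold` corrected by a homotopy. -/
def corrFold : Mor (tensor P.tilde P.tilde) P.tilde :=
  (preFold P).subBdry (foldHtpy H)
    (fun a (z : TC P.tilde P.tilde) => by
      rw [tensor_ra]
      induction z using T_induction with
      | htm g h x hx y hy =>
        rw [rT_tm, foldHtpy_tm, foldHtpy_tm, la_ra, H.ra, tilde_ra_snd, ← ra_ra, map_add]
      | hadd z w hz hw => simp only [map_add, hz, hw])
    (fun (z : TC P.tilde P.tilde) => by
      rw [tensor_sm]
      induction z using T_induction with
      | htm g h x hx y hy =>
        rw [sT_tm, map_add, foldHtpy_tm, foldHtpy_tm, foldHtpy_tm, tilde_sm_snd, tilde_sm_snd,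
          tilde_kos_snd, ← sm_la, H.sm, H.sm, map_add, sm_ra, map_zero, map_zero,
          AddMonoidHom.zero_apply, AddMonoidHom.zero_apply, map_zero, add_zero, zero_add]
      | hadd z w hz hw => simp only [map_add, hz, hw])
    (fun g z hz => grT_le (fun h h' e x hx y hy => by
      rw [← e]
      refine add_mem ?_ ?_
      · exact H.mem _ _ (la_unit_mem hx.2 hy)
      · rw [add_right_comm]; exact ra_unit_mem hy.2 (H.mem _ _ hx)) z hz)

lemma corrFold_tm (x y : P.tilde.X) :
    (corrFold H).f (tm (X := P.tilde) (Y := P.tilde) x y)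
      = (preFold P).f (tm (X := P.tilde) (Y := P.tilde) x y)
        - (P.tilde.d (foldHtpy H (tm x y))
          + (foldHtpy H (tm (P.tilde.d x) y) + foldHtpy H (tm (P.tilde.kos 1 x) (P.tilde.d y)))) :=
  rfl

end

variable (P) in
-- The transported product restricts on 1 ⊗ P̃ and on P̃ ⊗ 1 to a round trip of comparison maps,
-- which differs from the identity by dH + Hd. With π the projection of P̃ to k, the map x ⊗ y ↦
-- H(π(x)y) + H(x)π(y) restricts to H on both, because H vanishes on k. Subtracting its boundary
-- gives the fold map exactly. For this π has to be Γ-linear, not a chain map.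
theorem nonempty_foldExt : Nonempty P.FoldExt := by
  obtain ⟨h⟩ := P.exists_htpy_self
  let H := h.cone P.fromStd_toStd_aug (fun _ => rfl) (P.isRes.htpy_aug _ h)
  -- The homotopy induced on a cone is zero on the summand k; otherwise the two terms of the
  -- correction would interfere on 1 ⊗ x and x ⊗ 1.
  have hH (a : B.k) : H.h (P.incl a) = 0 := Prod.ext (by simp [H, incl, Htpy.cone]) rfl
  have hd (a : B.k) : P.tilde.d (P.incl a) = 0 :=
    ((coneIncl P.aug).map_d a).symm.trans (map_zero _)
  have hk : P.tilde.kos 1 (P.incl 1) = P.incl 1 :=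
    ((coneIncl P.aug).kos' 1 (1 : B.k)).symm.trans
      (congrArg P.incl ((unit_kos_one 1).trans (map_one _)))
  have hl (a : B.k) : P.tilde.la a (P.incl 1) = P.incl a :=
    ((coneIncl P.aug).la' a (1 : B.k)).symm.trans
      (congrArg P.incl ((unit_la a 1).trans (mul_one a)))
  have e (x : P.tilde.X) : (P.fromTl.comp P.toTl).f x - x
      = P.tilde.d (H.h x) + H.h (P.tilde.d x) := H.eq x
  have h1 : (P.incl 1).2 = 1 := rfl
  refine ⟨⟨corrFold H, fun x => ?_, fun x => ?_⟩⟩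
  · have h2 : foldHtpy H (tm 0 x) = 0 := by rw [map_zero, AddMonoidHom.zero_apply, map_zero]
    rw [corrFold_tm, preFold_left, hd, hk, h2, foldHtpy_tm, foldHtpy_tm, hH, h1, la_one, la_one,
      map_zero, map_zero, add_zero, add_zero, zero_add, ← e, sub_sub_cancel]
  · rw [corrFold_tm, preFold_right, hd, map_zero, map_zero, add_zero, foldHtpy_tm, foldHtpy_tm, h1,
      ra_one, ra_one, hl, hl, hH, hH, zero_add, zero_add, ← e, sub_sub_cancel]

end Resolution
end
end HopfTate

/-! ### The homology of M[t, t⁻¹] and the pairings. -/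

namespace HopfTate
noncomputable section
open EtaRing Cx

variable {B : EtaRing.{u}}

namespace GMod

variable {M N L : GMod B} {P : Resolution B}

lemma single_mem_lauZ {c : ℤ} {m : M.X} : Finsupp.single c m ∈ M.lauZ c ↔ m ∈ M.ansZ c := by
  rw [GMod.mem_ansZ]
  constructor
  · rintro ⟨-, h⟩
    rwa [lauD_single, Finsupp.single_eq_zero] at h
  · intro h
    exact ⟨⟨m, rfl⟩, by rw [lauD_single, h, Finsupp.single_zero]⟩

lemma eq_single_of_mem_lauZ {c : ℤ} {x : M.Laurent} (hx : x ∈ M.lauZ c) :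
    Finsupp.single c (x c) = x := by
  obtain ⟨⟨_, rfl⟩, -⟩ := hx
  rw [Finsupp.single_eq_same]

variable (M) in
/-- The correspondence of the cycles in `t^c M` with `ker(s)` or `ker(s + η)`. -/
def lauZEquiv (c : ℤ) : M.lauZ c ≃ₗ[B.kᵐᵒᵖ] M.ansZ c where
  toFun x := ⟨x.1 c, single_mem_lauZ.1 ((eq_single_of_mem_lauZ x.2).symm ▸ x.2)⟩
  invFun m := ⟨Finsupp.single c m.1, single_mem_lauZ.2 m.2⟩
  map_add' _ _ := rfl
  map_smul' _ _ := rfl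
  left_inv x := Subtype.ext (eq_single_of_mem_lauZ x.2)
  right_inv _ := Subtype.ext Finsupp.single_eq_same

/-- Boundaries in t^c M come from t^(c-1) M, where the differential is s + (c - 1)η; up to parity
this is the operator whose image is divided out in degree c. -/
lemma lauB_map (c : ℤ) : ((M.lauB c).submoduleOf (M.lauZ c)).map (M.lauZEquiv c).toLinearMap
    = (M.ansB c).submoduleOf (M.ansZ c) := by
  ext m
  constructor
  · rintro ⟨x, ⟨y, hy⟩, rfl⟩
    refine M.mem_ansB.2 ⟨y, ?_⟩
    rw [lauD_single, sub_add_cancel] at hy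
    exact Finsupp.single_eq_same.symm.trans (DFunLike.congr_fun hy c)
  · intro hm
    obtain ⟨y, hy⟩ := M.mem_ansB.1 hm
    refine ⟨(M.lauZEquiv c).symm m, ⟨y, ?_⟩, (M.lauZEquiv c).apply_symm_apply m⟩
    rw [lauD_single, sub_add_cancel, hy]
    rfl

variable (M P) in
/-- The isomorphism from the homology of `M[t, t⁻¹]` to Tate cohomology. -/
def lauTate (c : ℤ) : M.lauH c ≃ₗ[B.kᵐᵒᵖ] M.tateExt P c :=
  (Submodule.Quotient.equiv _ _ (M.lauZEquiv c) (lauB_map c)).trans (M.toTate P c)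

lemma lauTate_lauCls (c : ℤ) {m : M.X} (hm : m ∈ M.ansZ c) :
    M.lauTate P c (M.lauCls c ⟨Finsupp.single c m, single_mem_lauZ.2 hm⟩)
      = M.toTate P c (M.ansCls c ⟨m, hm⟩) := by
  change M.toTate P c (M.ansCls c ((M.lauZEquiv c) _)) = _
  congr 2
  exact Subtype.ext Finsupp.single_eq_same

lemma exists_cyc_toTate (c l : ℤ) {m : M.X} (hm : m ∈ M.ansZ c) (hl : m ∈ M.gr (0, l)) :
    ∃ (z : (P.hm M.toCx).X) (hz : z ∈ (P.hm M.toCx).cyc (-c)),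
      z ∈ (P.hm M.toCx).gr (-c, l - c) ∧
      M.toTate P c (M.ansCls c ⟨m, hm⟩) = (P.hm M.toCx).Hcls (-c) ⟨z, hz⟩ := by
  obtain ⟨z, hz, -, h1, h2⟩ := M.exists_toTate_eq (P := P) c hm
  exact ⟨(P.fromHm M.toCx).f z, (P.fromHm M.toCx).map_cyc (-c) hz,
    (P.fromHm M.toCx).map_gr _ _ (h1 l hl), h2⟩

/-- A cycle in one homological degree is a single monomial, so the cup product formula followed by
naturality in the coefficients gives the claim. -/
theorem lauTate_pairing (Ψ : P.Diagonal) (Φ : P.FoldExt) (μ : (M.tensor N).Hom L) (c₁ c₂ : ℤ)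
    (x : M.Laurent) (hx : x ∈ M.lauZ c₁) (y : N.Laurent) (hy : y ∈ N.lauZ c₂) :
    ∃ h : lauPair μ x y ∈ L.lauZ (c₁ + c₂),
      tateMap P (c₁ + c₂) μ
          (M.cup N Ψ Φ c₁ c₂ (M.lauTate P c₁ (M.lauCls c₁ ⟨x, hx⟩))
            (N.lauTate P c₂ (N.lauCls c₂ ⟨y, hy⟩)))
        = L.lauTate P (c₁ + c₂) (L.lauCls (c₁ + c₂) ⟨lauPair μ x y, h⟩) := by
  obtain ⟨m, rfl⟩ := hx.1
  obtain ⟨n, rfl⟩ := hy.1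
  have hm := single_mem_lauZ.1 hx
  have hn := single_mem_lauZ.1 hy
  have h := Hom.mem_ansZ μ (M.tmul_mem_ansZ N hm hn)
  simp only [lauPair_single]
  refine ⟨single_mem_lauZ.2 h, ?_⟩
  rw [lauTate_lauCls c₁ hm, lauTate_lauCls c₂ hn, cup_toTate Ψ Φ c₁ c₂ hm hn, tateMap_toTate,
    lauTate_lauCls]

end GMod
end
end HopfTate

theorem mainTheorem8 (B : EtaRing.{u}) :
    -- resolutions `P` exist, and each of them has maps `Ψ` and `Φ` as used for the cup product
    Nonempty (Resolution.{u} B) ∧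
    ∀ P : Resolution.{u} B, Nonempty P.Diagonal ∧ Nonempty P.FoldExt ∧
    ∃ (t : ∀ (M : GMod.{u} B) (c : ℤ), M.ans c ≃ₗ[B.kᵐᵒᵖ] M.tateExt P c)
      (τ : ∀ (M : GMod.{u} B) (c : ℤ), M.lauH c ≃ₗ[B.kᵐᵒᵖ] M.tateExt P c),
      -- `t^c m` has homological degree `-c` and internal degree `|m| - c`
      (∀ (M : GMod.{u} B) (c l : ℤ) (m : M.X) (hm : m ∈ M.ansZ c), m ∈ M.gr (0, l) →
        ∃ (z : (P.hm M.toCx).X) (hz : z ∈ (P.hm M.toCx).cyc (-c)),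
          z ∈ (P.hm M.toCx).gr (-c, l - c) ∧
          t M c (M.ansCls c ⟨m, hm⟩) = (P.hm M.toCx).Hcls (-c) ⟨z, hz⟩) ∧
      -- `t^c m` is natural in the module
      (∀ (M L : GMod.{u} B) (φ : M.Hom L) (c : ℤ) (m : M.X) (hm : m ∈ M.ansZ c),
        ∃ h : φ.f m ∈ L.ansZ c,
          GMod.tateMap P c φ (t M c (M.ansCls c ⟨m, hm⟩)) = t L c (L.ansCls c ⟨φ.f m, h⟩)) ∧
      -- the cup product is `(t^c₁ m) ⌣ (t^c₂ n) = t^(c₁ + c₂) (m ⊗ n)`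
      (∀ (Ψ : P.Diagonal) (Φ : P.FoldExt) (M N : GMod.{u} B) (c₁ c₂ : ℤ)
        (m : M.X) (hm : m ∈ M.ansZ c₁) (n : N.X) (hn : n ∈ N.ansZ c₂),
        ∃ h : M.tmul N m n ∈ (M.tensor N).ansZ (c₁ + c₂),
          M.cup N Ψ Φ c₁ c₂ (t M c₁ (M.ansCls c₁ ⟨m, hm⟩)) (t N c₂ (N.ansCls c₂ ⟨n, hn⟩))
            = t (M.tensor N) (c₁ + c₂) ((M.tensor N).ansCls (c₁ + c₂) ⟨M.tmul N m n, h⟩)) ∧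
      -- the homology class of the cycle `t^c m` of `M[t, t⁻¹]` corresponds to `t^c m`
      (∀ (M : GMod.{u} B) (c : ℤ) (m : M.X) (hm : m ∈ M.ansZ c),
        ∃ h : Finsupp.single c m ∈ M.lauZ c,
          τ M c (M.lauCls c ⟨Finsupp.single c m, h⟩) = t M c (M.ansCls c ⟨m, hm⟩)) ∧
      -- a pairing `μ : M ⊗ N → L` induces the obvious pairing on the homology of `M[t, t⁻¹]`
      (∀ (Ψ : P.Diagonal) (Φ : P.FoldExt) (M N L : GMod.{u} B) (μ : (M.tensor N).Hom L)
        (c₁ c₂ : ℤ) (x : M.Laurent) (hx : x ∈ M.lauZ c₁) (y : N.Laurent) (hy : y ∈ N.lauZ c₂),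
        ∃ h : GMod.lauPair μ x y ∈ L.lauZ (c₁ + c₂),
          GMod.tateMap P (c₁ + c₂) μ
              (M.cup N Ψ Φ c₁ c₂ (τ M c₁ (M.lauCls c₁ ⟨x, hx⟩)) (τ N c₂ (N.lauCls c₂ ⟨y, hy⟩)))
            = τ L (c₁ + c₂) (L.lauCls (c₁ + c₂) ⟨GMod.lauPair μ x y, h⟩)) := by
  refine ⟨⟨Std.res B⟩, fun P => ⟨P.nonempty_diagonal, P.nonempty_foldExt,
    fun M c => M.toTate P c, fun M c => M.lauTate P c, fun M c l m hm hl => ?_, ?_, ?_, ?_, ?_⟩⟩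
  · exact GMod.exists_cyc_toTate c l hm hl
  · exact fun M L φ c m hm => ⟨GMod.Hom.mem_ansZ φ hm, GMod.tateMap_toTate P φ c m hm⟩
  · exact fun Ψ Φ M N c₁ c₂ m hm n hn =>
      ⟨M.tmul_mem_ansZ N hm hn, GMod.cup_toTate Ψ Φ c₁ c₂ hm hn⟩
  · exact fun M c m hm => ⟨GMod.single_mem_lauZ.2 hm, GMod.lauTate_lauCls c hm⟩
  · exact fun Ψ Φ M N L μ c₁ c₂ x hx y hy => GMod.lauTate_pairing Ψ Φ μ c₁ c₂ x hx y hy
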